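/- Let $d\ge 1$, $r\ge 0$ and $J=(-\infty,0)$. Fix a smooth radial $\varphi:\mathbb{R}^d\to[0,1]$ supported in $\{\frac34\le|\xi|\le\frac83\}$ with $\sum_{j\in\mathbb{Z}}\varphi(2^{-j}\xi)=1$ for $\xi\neq0$, and put $\dot\Delta_j=\varphi(2^{-j}D)$, $\|u\|_{\dot B^s_{\infty,1}}=\sum_{j\in\mathbb{Z}}2^{js}\|\dot\Delta_j u\|_{L^\infty}$ and $\|u\|_{\widetilde L^1(J;\dot B^s_{\infty,1})}=\sum_{j}2^{js}\|\dot\Delta_ju\|_{L^1(J;L^\infty)}$; the space $\dot B^s_{\infty,1}$ consists of the tempered distributions on $\mathbb{R}^d$ modulo polynomials for which the norm is finite. Elements $u$ of $\dot B^1_{\infty,1}$ are identified with $C^1$ functions, modulo constants, through $u=\sum_j(\dot\Delta_ju-\dot\Delta_ju(0))$. For real-valued $\eta,f\in\dot B^1_{\infty,1}$ let $H(x,z)=e^{z|D|}\eta(x)$, $z<0$, and, for $v:\mathbb{R}^d\times J\to\mathbb{R}$, $$Q_a[v]=\nabla_xH\cdot\nabla_xv-\frac{|\nabla_xH|^2-|D|H}{1+|D|H}\,\partial_zv,\qquad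 Q_b[v]=|D|^{-1}\nabla_x\cdot\big(\nabla_xH\,\partial_zv-|D|H\,\nabla_xv\big),$$ $$w[v](\cdot,z)=\int_{-\infty}^ze^{-(z-\tau)|D|}|D|\big(Q_b[v]-Q_a[v]\big)(\cdot,\tau)\,d\tau,$$ $$\mathcal{T}[v](\cdot,z)=e^{z|D|}f+\int_0^ze^{(z-z')|D|}\big(w[v]+Q_a[v]\big)(\cdot,z')\,dz'.$$ Let $\mathcal{V}_*$ be the space of functions $v$ on $\mathbb{R}^d\times J$, modulo constants, such that $|D|v$ and $\partial_zv$ belong to $L^\infty(J;L^\infty)\cap\widetilde L^1(J;\dot B^1_{\infty,1})$; here $v(\cdot,z)$ is, up to a constant, the $C^1$ representative (given above) of its class modulo polynomials. Such $v$ are Lipschitz. If $\mathcal{T}$ has a unique fixed point $v\in\mathcal{V}_*$, the Dirichlet–Neumann operator of the domain $\{y<\eta(x)\}$ is defined by $$G^-(\eta)f=|D|f+\int_{-\infty}^0e^{\tau|D|}|D|\big(Q_b[v]-Q_a[v]\big)(\cdot,\tau)\,d\tau .$$ Then there exist constants $c_*>0$ and $C>0$, depending only on $d$ and $r$ (and on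 the fixed function $\varphi$), such that for all real-valued $\eta,f\in\dot B^1_{\infty,1}\cap\dot B^{1+r}_{\infty,1}$ with $\||D|\eta\|_{\dot B^0_{\infty,1}}<c_*$ the following holds: $\mathcal{T}$ has a unique fixed point in $\mathcal{V}_*$, so that $G^-(\eta)f$ is well defined; $G^-(\eta)f$ is a bounded continuous function; and $$\|G^-(\eta)f\|_{\dot B^r_{\infty,1}}\le C\,\||D|f\|_{\dot B^r_{\infty,1}}+C\,\||D|\eta\|_{\dot B^r_{\infty,1}}\,\||D|f\|_{\dot B^0_{\infty,1}} .$$ -/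

import Mathlib

open scoped SchwartzMap FourierTransform ContDiff ENNReal

noncomputable section

namespace DirichletNeumann

/-- Euclidean space of dimension `d`. -/
abbrev E (d : ℕ) := EuclideanSpace ℝ (Fin d)

/-! ### Littlewood-Paley blocks and homogeneous Fourier multipliers -/

/-- A homogeneous dyadic partition of unity: a smooth radial function with values in `[0, 1]`,
supported in the annulus `3/4 ≤ |ξ| ≤ 8/3`, with `∑_{j ∈ ℤ} φ (2^{-j} ξ) = 1` for `ξ ≠ 0`. -/
structure LittlewoodPaley (d : ℕ) where
  toFun : E d → ℝ
  smooth : ContDiff ℝ ∞ toFun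
  nonneg : ∀ ξ, 0 ≤ toFun ξ
  le_one : ∀ ξ, toFun ξ ≤ 1
  radial : ∀ ξ ξ', ‖ξ‖ = ‖ξ'‖ → toFun ξ = toFun ξ'
  support : ∀ ξ, toFun ξ ≠ 0 → 3 / 4 ≤ ‖ξ‖ ∧ ‖ξ‖ ≤ 8 / 3
  hasSum_one : ∀ ξ, ξ ≠ 0 → HasSum (fun j : ℤ => toFun ((2 : ℝ) ^ (-j) • ξ)) 1

/-- A Fourier symbol `m(ξ)` that is smooth away from the origin; `m(D)` is the corresponding
Fourier multiplier for the convention `D = -i∇`. -/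
structure Symbol (d : ℕ) where
  toFun : E d → ℂ
  smooth : ContDiffOn ℝ ∞ toFun {0}ᶜ

namespace Symbol

variable {d : ℕ}

/-- Composition of Fourier multipliers. -/
instance : Mul (Symbol d) := ⟨fun m n => ⟨fun ξ => m.toFun ξ * n.toFun ξ, m.smooth.mul n.smooth⟩⟩

/-- The identity. -/
instance : One (Symbol d) := ⟨⟨fun _ => 1, contDiffOn_const⟩⟩

theorem contDiffOn_ofReal_norm : ContDiffOn ℝ ∞ (fun ξ : E d => ((‖ξ‖ : ℝ) : ℂ)) {0}ᶜ := by
  intro ξ hξ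
  exact (Complex.ofRealCLM.contDiff.contDiffAt.comp ξ
    (contDiffAt_norm ℝ (by simpa using hξ))).contDiffWithinAt

/-- `|D|`. -/
def absD : Symbol d := ⟨fun ξ => ((‖ξ‖ : ℝ) : ℂ), contDiffOn_ofReal_norm⟩

/-- `e^{t|D|}` (used for `t ≤ 0`). -/
def expD (t : ℝ) : Symbol d :=
  ⟨fun ξ => Complex.exp ((t : ℂ) * ((‖ξ‖ : ℝ) : ℂ)),
    (contDiffOn_const.mul contDiffOn_ofReal_norm).cexp⟩

/-- `e^{t|D|} - 1` (used for `t ≤ 0`). -/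
def expDSubOne (t : ℝ) : Symbol d :=
  ⟨fun ξ => (expD t).toFun ξ - 1, (expD t).smooth.sub contDiffOn_const⟩

/-- The `k`-th component of `ℛ = |D|⁻¹∇`, with symbol `i ξ_k / |ξ|`. -/
def riesz (k : Fin d) : Symbol d :=
  ⟨fun ξ => Complex.I * ((ξ k : ℝ) : ℂ) * (((‖ξ‖ : ℝ) : ℂ))⁻¹, by
    refine ContDiffOn.mul ?_ (contDiffOn_ofReal_norm.inv fun ξ hξ => by simpa using hξ)
    refine contDiffOn_const.mul (ContDiff.contDiffOn ?_)
    exact Complex.ofRealCLM.contDiff.comp (EuclideanSpace.proj (𝕜 := ℝ) k).contDiff⟩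

end Symbol

variable {d : ℕ} (φ : LittlewoodPaley d)

/-- The function `ξ ↦ e^{2πi x·ξ} m(2πξ) φ(2^{-j} 2πξ)`. The factors `2π` translate between
Mathlib's Fourier transform `∫ e^{-2πi x·ξ} u(x) dx` and the convention `D = -i∇`. -/
def blockSymbol (m : Symbol d) (j : ℤ) (x ξ : E d) : ℂ :=
  Complex.exp (((2 * Real.pi * inner ℝ x ξ : ℝ) : ℂ) * Complex.I) *
    m.toFun ((2 * Real.pi) • ξ) * ((φ.toFun ((2 : ℝ) ^ (-j) • (2 * Real.pi) • ξ) : ℝ) : ℂ)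

theorem blockSymbol_ne_zero {m : Symbol d} {j : ℤ} {x ξ : E d} (h : blockSymbol φ m j x ξ ≠ 0) :
    3 / 4 ≤ (2 : ℝ) ^ (-j) * (2 * Real.pi) * ‖ξ‖ ∧
      (2 : ℝ) ^ (-j) * (2 * Real.pi) * ‖ξ‖ ≤ 8 / 3 := by
  have h1 : φ.toFun ((2 : ℝ) ^ (-j) • (2 * Real.pi) • ξ) ≠ 0 := by
    intro h0
    exact h (by rw [blockSymbol, h0, Complex.ofReal_zero, mul_zero])
  have h2 := φ.support _ h1
  have hpi := Real.pi_pos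
  have hj : (0 : ℝ) < (2 : ℝ) ^ (-j) := by positivity
  rwa [norm_smul, norm_smul, Real.norm_of_nonneg hj.le,
    Real.norm_of_nonneg (by positivity : (0 : ℝ) ≤ 2 * Real.pi), ← mul_assoc] at h2

theorem hasCompactSupport_blockSymbol (m : Symbol d) (j : ℤ) (x : E d) :
    HasCompactSupport (blockSymbol φ m j x) := by
  have hc : (0 : ℝ) < (2 : ℝ) ^ (-j) * (2 * Real.pi) := by
    have := Real.pi_pos
    positivity
  refine HasCompactSupport.intro
    (isCompact_closedBall (0 : E d) (8 / 3 / ((2 : ℝ) ^ (-j) * (2 * Real.pi)))) ?_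
  intro ξ hξ
  by_contra h
  apply hξ
  rw [mem_closedBall_zero_iff, le_div_iff₀ hc, mul_comm]
  exact (blockSymbol_ne_zero φ h).2

theorem contDiff_blockSymbol (m : Symbol d) (j : ℤ) (x : E d) :
    ContDiff ℝ ∞ (blockSymbol φ m j x) := by
  have hpi := Real.pi_pos
  rw [contDiff_iff_contDiffAt]
  intro ξ
  by_cases hξ : ξ = 0
  · have hc : (0 : ℝ) < (2 : ℝ) ^ (-j) * (2 * Real.pi) := by positivity
    have : blockSymbol φ m j x =ᶠ[nhds ξ] fun _ => 0 := by
      filter_upwards [Metric.ball_mem_nhds ξ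
        (show (0 : ℝ) < 3 / 4 / ((2 : ℝ) ^ (-j) * (2 * Real.pi)) by positivity)] with ζ hζ
      by_contra h
      have h1 := (blockSymbol_ne_zero φ h).1
      rw [hξ, mem_ball_zero_iff, lt_div_iff₀ hc, mul_comm] at hζ
      linarith
    exact contDiffAt_const.congr_of_eventuallyEq this
  · have h2 : (2 * Real.pi) • ξ ≠ 0 := smul_ne_zero (by positivity) hξ
    have hm : ContDiffAt ℝ ∞ m.toFun ((2 * Real.pi) • ξ) :=
      m.smooth.contDiffAt (isOpen_compl_singleton.mem_nhds h2)
    refine ContDiffAt.mul (ContDiffAt.mul ?_ ?_) ?_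
    · refine (ContDiffAt.mul ?_ contDiffAt_const).cexp
      exact Complex.ofRealCLM.contDiff.contDiffAt.comp ξ
        (contDiffAt_const.mul (contDiffAt_const.inner ℝ contDiffAt_id))
    · exact hm.comp ξ (contDiff_const_smul (2 * Real.pi)).contDiffAt
    · exact Complex.ofRealCLM.contDiff.contDiffAt.comp ξ (φ.smooth.contDiffAt.comp ξ
        ((contDiff_const_smul _).comp (contDiff_const_smul _)).contDiffAt)

/-- The Schwartz function `y ↦ K(x - y)`, where `K` is the convolution kernel of `m(D) Δ̇_j`. -/
def blockTest (m : Symbol d) (j : ℤ) (x : E d) : 𝓢(E d, ℂ) :=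
  𝓕 ((hasCompactSupport_blockSymbol φ m j x).toSchwartzMap (contDiff_blockSymbol φ m j x))

/-- The value at `x` of `m(D) Δ̇_j u`, that is `⟨u, K(x - ·)⟩`. Here `u` is given through its action
on Schwartz functions: `⇑u` for a tempered distribution, `pair g` for a function `g`. -/
def block (m : Symbol d) (j : ℤ) (u : 𝓢(E d, ℂ) → ℂ) (x : E d) : ℂ := u (blockTest φ m j x)

/-- The action of a real function (bounded, or of linear growth) on Schwartz functions. -/
def pair (g : E d → ℝ) (ψ : 𝓢(E d, ℂ)) : ℂ := ∫ y, ψ y * ((g y : ℝ) : ℂ)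

/-- The norm of `m(D) u` in the homogeneous Besov space `Ḃ^s_{∞,1}`, which is
`∑_j 2^{js} sup |m(D) Δ̇_j u|` (the blocks are continuous, so the supremum is the `L^∞` norm).
It does not see polynomials: it is a function of the class of `u` modulo polynomials. -/
def besovNorm (m : Symbol d) (s : ℝ) (u : 𝓢(E d, ℂ) → ℂ) : ℝ≥0∞ :=
  ∑' j : ℤ, ENNReal.ofReal ((2 : ℝ) ^ ((j : ℝ) * s)) * ⨆ x, ‖block φ m j u x‖ₑ

/-- The Chemin-Lerner norm of `m(D_x) u` in `L̃¹(J; Ḃ^s_{∞,1})`, `J = (-∞, 0)`. -/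
def cheminLernerNorm (m : Symbol d) (s : ℝ) (u : E d → ℝ → ℝ) : ℝ≥0∞ :=
  ∑' j : ℤ, ENNReal.ofReal ((2 : ℝ) ^ ((j : ℝ) * s)) *
    ∫⁻ z in Set.Iio (0 : ℝ), ⨆ x, ‖block φ m j (pair fun y => u y z) x‖ₑ

/-- The tempered distribution `u` is real-valued: `u(ψ̄)` is the conjugate of `u(ψ)`. -/
def IsRealValued (u : 𝓢'(E d, ℂ)) : Prop :=
  ∀ ψ χ : 𝓢(E d, ℂ), (∀ x, χ x = star (ψ x)) → u χ = star (u ψ)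

/-- The function `∑_j (Δ̇_j u - Δ̇_j u(0))`: for a class in `Ḃ¹_{∞,1}` modulo polynomials, this is
its representative as a `C¹` function with gradient `∑_j ∇Δ̇_j u`, normalized to vanish at `0`. -/
def realization (u : 𝓢(E d, ℂ) → ℂ) (x : E d) : ℝ :=
  ∑' j : ℤ, (block φ 1 j u x - block φ 1 j u 0).re

/-- `m(D) g = ∑_j m(D) Δ̇_j g`, for a multiplier `m` that does not charge the zero frequency. -/
def mult (m : Symbol d) (g : E d → ℝ) (x : E d) : ℝ := ∑' j : ℤ, (block φ m j (pair g) x).re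

/-- `e^{t|D|} g`, `t ≤ 0`, for an actual function `g` (not only a class modulo polynomials), written
as `g + (e^{t|D|} - 1) g`; in particular `e^{t|D|} 1 = 1`. -/
def poisson (t : ℝ) (g : E d → ℝ) (x : E d) : ℝ := g x + mult φ (Symbol.expDSubOne t) g x

/-! ### The operator `𝒯` and the Dirichlet-Neumann operator -/

section Operators

variable (η f : 𝓢(E d, ℂ) → ℂ) (v : E d → ℝ → ℝ)

/-- `H(·, z) = e^{z|D|} η`. -/
def H (x : E d) (z : ℝ) : ℝ := poisson φ z (realization φ η) x

/-- `∇ₓH`. -/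
def gradH (x : E d) (z : ℝ) : E d := gradient (fun y => H φ η y z) x

/-- `|D|H`. -/
def absDH (x : E d) (z : ℝ) : ℝ := mult φ Symbol.absD (fun y => H φ η y z) x

/-- `∇ₓv`. -/
def gradX (x : E d) (z : ℝ) : E d := gradient (fun y => v y z) x

/-- `∂_z v`. -/
def dz (x : E d) (z : ℝ) : ℝ := deriv (v x) z

/-- `Q_a[v] = ∇ₓH · ∇ₓv - (|∇ₓH|² - |D|H) / (1 + |D|H) ∂_z v`. -/
def Qa (x : E d) (z : ℝ) : ℝ :=
  inner ℝ (gradH φ η x z) (gradX v x z) -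
    (‖gradH φ η x z‖ ^ 2 - absDH φ η x z) / (1 + absDH φ η x z) * dz v x z

/-- The vector field `∇ₓH ∂_z v - |D|H ∇ₓv`; `Q_b[v] = ℛ · (∇ₓH ∂_z v - |D|H ∇ₓv)`. -/
def B (x : E d) (z : ℝ) : E d := dz v x z • gradH φ η x z - absDH φ η x z • gradX v x z

/-- `m(D) Q_b[v](·, z) = ∑_k m(D) ℛ_k B_k(·, z)`. Only `m(D) = |D|e^{t|D|}` is used, for which this
is a bounded function, while `Q_b[v]` itself is only defined modulo constants. -/
def multQb (m : Symbol d) (x : E d) (z : ℝ) : ℝ :=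
  ∑ k : Fin d, mult φ (m * Symbol.riesz k) (fun y => B φ η v y z k) x

/-- `w(·, z) = ∫_{-∞}^z e^{-(z-τ)|D|} |D| (Q_b[v] - Q_a[v])(·, τ) dτ`. -/
def w (x : E d) (z : ℝ) : ℝ :=
  ∫ τ in Set.Iio z, (multQb φ η v (Symbol.absD * Symbol.expD (-(z - τ))) x τ -
    mult φ (Symbol.absD * Symbol.expD (-(z - τ))) (fun y => Qa φ η v y τ) x)

/-- `𝒯[v](·, z) = e^{z|D|} f + ∫_0^z e^{(z-z')|D|} (w + Q_a[v])(·, z') dz'`, for `z < 0`. -/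
def T (x : E d) (z : ℝ) : ℝ :=
  poisson φ z (realization φ f) x +
    ∫ z' in (0 : ℝ)..z, poisson φ (z - z') (fun y => w φ η v y z' + Qa φ η v y z') x

/-- The space `𝒱_*` of the functions `v` on `ℝ^d × J`, `J = (-∞, 0)`, such that `|D|v` and `∂_z v`
belong to `L^∞(J; L^∞) ∩ L̃¹(J; Ḃ¹_{∞,1})`. The values `v x z` with `z ≥ 0` play no role.
Since `|D|v` is not affected by polynomials in `x`, the functions `v(·, z)` are required to be
the realizations, up to an additive constant, of their classes modulo polynomials; then `v` has zero
norm exactly if it is constant. The two Chemin-Lerner bounds control `|D|v` in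
`L̃^∞(J; Ḃ^0_{∞,1})`, so `∇ₓv` is bounded, and together with `∂_z v ∈ L^∞` this says that `v` is
Lipschitz. -/
structure MemV : Prop where
  lipschitz : ∃ M : ℝ, ∀ (x y : E d) (z t : ℝ), z < 0 → t < 0 →
    |v x z - v y t| ≤ M * (‖x - y‖ + |z - t|)
  realized : ∀ (x : E d) (z : ℝ), z < 0 →
    v x z - v 0 z = realization φ (pair fun y => v y z) x
  absD_bounded : ∃ M : ℝ, ∀ (x : E d) (z : ℝ), z < 0 →
    |mult φ Symbol.absD (fun y => v y z) x| ≤ M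
  absD_besov : cheminLernerNorm φ Symbol.absD 1 v < ⊤
  dz_besov : cheminLernerNorm φ 1 1 (dz v) < ⊤

/-- `v ∈ 𝒱_*` is a fixed point of `𝒯`, modulo constants. -/
structure IsFixedPoint : Prop where
  mem : MemV φ v
  fixed : ∃ k : ℝ, ∀ (x : E d) (z : ℝ), z < 0 → v x z = T φ η f v x z + k

/-- `|D| f = ∑_j |D| Δ̇_j f`. -/
def absDf (x : E d) : ℝ := ∑' j : ℤ, (block φ Symbol.absD j f x).re

open Classical in
/-- The Dirichlet-Neumann operator of the domain below the graph of `η`: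
`G⁻(η) f = |D| f + ∫_{-∞}^0 e^{τ|D|} |D| (Q_b[v] - Q_a[v])(·, τ) dτ`, where `v` is the fixed point
of `𝒯` in `𝒱_*`; it is set to `0` if there is none. -/
def G (x : E d) : ℝ :=
  if h : ∃ v : E d → ℝ → ℝ, IsFixedPoint φ η f v then absDf φ f x + w φ η h.choose x 0 else 0

end Operators

end DirichletNeumann

end

/-! The fixed point problem is linear in v: the coefficients ∇ₓH, |D|H and (|∇ₓH|² - |D|H)/(1 +
|D|H) depend on η only. Both e^{z|D|}f and the Duhamel integral solve ∂_z u = |D|u + source, so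
differentiating v = 𝒯[v] gives an equation y = Y + L y for the pair y = (∇ₓv, ∂_z v). Here Y is the
gradient of e^{z|D|}f, and every term of the linear map L carries a coefficient, so L is small when
η is small. The equation is solved by contraction in the Banach space `Sp φ W` of bounded functions
g with ∑_j W_j ‖Δ̇_j g‖_{L¹(J;L^∞)} finite, for weights W_j ≥ 2^j.

Three estimates carry the contraction. `exists_spNorm_mul_le`: the space is an algebra, because
Δ̇_k(gf) only sees blocks of g or f of index at least k - 2; this also yields the quotient, as the
solution of a linear equation (`exists_isCoeff`). `exists_spNorm_timeOp_le`: the map g ↦ ∫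
e^{-|z-τ||D|} m(D) g(τ) dτ, with m of order one, is bounded, because on the j-th block the kernel is
dominated by 2^j e^{-2^j|z-τ|/4}, whose integral in time does not depend on j.
`exists_spNorm_heat_le`: for the same reason e^{z|D|}|D|u lies in the space when |D|u is in the
corresponding Besov space.

For uniqueness in 𝒱_* one shows that the gradient of an arbitrary element of 𝒱_* has a
representative in the space with weight 2^j. The blocks of |D|v are integrable on a half-line of
infinite length, hence small at suitable times, and their variation in z is controlled by ∂_z v
(`exists_sn_absD_le`). After removing a null set of times the contraction applies to the difference
of two solutions (`eq_primitive_of_isFixedPoint`).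

The tame estimate comes from the weights W_j = 2^j + δ 2^{j(1+r)}, whose constants do not depend on
δ (`isWeight_weight`). Let a₀, a be the norms of |D|η in Ḃ⁰ and Ḃʳ, and b₀, b those of |D|f. As long
as a₀ + δa is small, the solution satisfies δ ‖w(·,0)‖_{Ḃʳ} ≲ (a₀ + δa)(b₀ + δb). The choice δ ≈ 1/a
makes the first factor comparable to δa and to 1, so the right side is at most a constant times δ(a
b₀ + b), and dividing by δ gives the claim (`exists_balance`). -/

open MeasureTheory Filter
open scoped Topology

/-! ### Convolution operators with Schwartz symbols. -/

noncomputable section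

namespace DirichletNeumann

variable {d : ℕ}

/-! ### Convolution operators with Schwartz symbols -/

/-- The real part of the convolution kernel of the Fourier multiplier with Schwartz symbol `a`. -/
def ker (a : 𝓢(E d, ℂ)) (x : E d) : ℝ := (𝓕⁻ a x).re

/-- Symbols whose convolution kernel is real. -/
def Herm (a : 𝓢(E d, ℂ)) : Prop := ∀ ξ, a (-ξ) = star (a ξ)

/-- The product of Schwartz symbols. -/
def mulS (a b : 𝓢(E d, ℂ)) : 𝓢(E d, ℂ) := SchwartzMap.pairing (ContinuousLinearMap.mul ℂ ℂ) a b

/-- The symbol `2πi ⟨ξ, v⟩ a(ξ)` of the derivative in the direction `v`. -/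
def dirS (v : E d) (a : 𝓢(E d, ℂ)) : 𝓢(E d, ℂ) :=
  (2 * (Real.pi : ℂ) * Complex.I) • SchwartzMap.smulLeftCLM ℂ (fun x : E d => inner ℝ x v) a

/-- The real convolution operator with kernel `ker a`. -/
def cv (a : 𝓢(E d, ℂ)) (g : E d → ℝ) (x : E d) : ℝ := ∫ y, ker a (x - y) * g y

/-- The `L¹` norm of the convolution kernel. -/
def kerNorm (a : 𝓢(E d, ℂ)) : ℝ := ∫ y, |ker a y|

@[simp] theorem mulS_apply (a b : 𝓢(E d, ℂ)) (ξ : E d) : mulS a b ξ = a ξ * b ξ := by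
  simp [mulS]

@[simp] theorem dirS_apply (v : E d) (a : 𝓢(E d, ℂ)) (ξ : E d) :
    dirS v a ξ = 2 * (Real.pi : ℂ) * Complex.I * (inner ℝ ξ v : ℝ) * a ξ := by
  have hg : (fun x : E d => inner ℝ x v).HasTemperateGrowth := by fun_prop
  simp [dirS, SchwartzMap.smulLeftCLM_apply_apply hg, mul_assoc]

theorem Herm.mulS {a b : 𝓢(E d, ℂ)} (ha : Herm a) (hb : Herm b) : Herm (mulS a b) := fun ξ => by
  simp [ha ξ, hb ξ]

/-- Conjugating the inverse Fourier integral and substituting -ξ for ξ reproduces it when the symbol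
is Hermitian. Taking real parts in `ker` therefore loses nothing for the symbols of real operators.
-/
theorem ofReal_ker {a : 𝓢(E d, ℂ)} (ha : Herm a) (x : E d) : ((ker a x : ℝ) : ℂ) = 𝓕⁻ a x := by
  rw [ker]
  apply Complex.conj_eq_iff_re.mp
  rw [SchwartzMap.fourierInv_coe, Real.fourierInv_eq', ← integral_conj]
  rw [← integral_neg_eq_self]
  refine integral_congr_ae (Eventually.of_forall fun ξ => ?_)
  simp only [smul_eq_mul, map_mul, ha ξ, ← Complex.exp_conj, inner_neg_left]
  congr 1
  · congr 1
    simp [Complex.conj_ofNat]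
  · simp

theorem ker_add (a b : 𝓢(E d, ℂ)) (x : E d) : ker (a + b) x = ker a x + ker b x := by
  simp [ker, FourierTransform.fourierInv_add]

theorem ker_smul (c : ℝ) (a : 𝓢(E d, ℂ)) (x : E d) : ker ((c : ℂ) • a) x = c * ker a x := by
  rw [ker, FourierTransform.fourierInv_smul]
  simp [ker]

theorem ker_zero (x : E d) : ker (0 : 𝓢(E d, ℂ)) x = 0 := by
  have := ker_smul 0 (0 : 𝓢(E d, ℂ)) x
  simpa using this

theorem ker_sum {ι : Type*} (s : Finset ι) (a : ι → 𝓢(E d, ℂ)) (x : E d) :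
    ker (∑ i ∈ s, a i) x = ∑ i ∈ s, ker (a i) x := by
  classical
  induction s using Finset.induction_on with
  | empty => simp [ker_zero]
  | insert i s hi ih => rw [Finset.sum_insert hi, Finset.sum_insert hi, ker_add, ih]

theorem continuous_ker (a : 𝓢(E d, ℂ)) : Continuous (ker a) :=
  Complex.continuous_re.comp (𝓕⁻ a).continuous

theorem ker_decay (a : 𝓢(E d, ℂ)) (k : ℕ) : ∃ C, 0 < C ∧ ∀ x, |ker a x| * (1 + ‖x‖) ^ k ≤ C := by
  set C := 2 ^ k * ((Finset.Iic (k, 0)).sup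
    fun m => SchwartzMap.seminorm ℝ (E := E d) (F := ℂ) m.1 m.2) (𝓕⁻ a) with hC
  refine ⟨max C 1, by positivity, fun x => le_max_of_le_left ?_⟩
  have := SchwartzMap.one_add_le_sup_seminorm_apply (𝕜 := ℝ) (m := (k, 0)) le_rfl le_rfl (𝓕⁻ a) x
  rw [norm_iteratedFDeriv_zero] at this
  refine le_trans ?_ this
  rw [mul_comm]
  gcongr
  exact Complex.abs_re_le_norm _

theorem integrable_ker_mul_pow (a : 𝓢(E d, ℂ)) (k : ℕ) :
    Integrable fun x => |ker a x| * (1 + ‖x‖) ^ k := by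
  obtain ⟨C, hC, h⟩ := ker_decay a (k + (d + 1))
  have hi : Integrable fun x : E d => C * (1 + ‖x‖) ^ (-((d : ℝ) + 1)) :=
    (integrable_one_add_norm (by simp)).const_mul C
  refine hi.mono' ((continuous_ker a).abs.mul (by fun_prop)).aestronglyMeasurable
    (Eventually.of_forall fun x => ?_)
  have hx : 0 < 1 + ‖x‖ := by positivity
  rw [Real.norm_of_nonneg (by positivity), Real.rpow_neg hx.le, ← div_eq_mul_inv,
    le_div_iff₀ (by positivity)]
  have : (1 + ‖x‖) ^ ((d : ℝ) + 1) = (1 + ‖x‖) ^ (d + 1) := by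
    rw [← Real.rpow_natCast]; push_cast; rfl
  rw [this, mul_assoc, ← pow_add]
  exact h x

theorem integrable_ker (a : 𝓢(E d, ℂ)) : Integrable (ker a) := by
  refine (integrable_norm_iff (continuous_ker a).aestronglyMeasurable).mp ?_
  simpa using integrable_ker_mul_pow a 0

theorem kerNorm_nonneg (a : 𝓢(E d, ℂ)) : 0 ≤ kerNorm a := integral_nonneg fun _ => abs_nonneg _

theorem integral_ker (a : 𝓢(E d, ℂ)) : ∫ y, ker a y = (a 0).re := by
  have h1 : ∫ y, (𝓕⁻ a) y = a 0 := by
    have := congrArg (fun f : 𝓢(E d, ℂ) => f 0) (FourierTransform.fourier_fourierInv_eq (E := 𝓢(E d, ℂ)) (F := 𝓢(E d, ℂ)) a)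
    rw [← this]
    rw [SchwartzMap.fourier_coe, Real.fourier_eq']
    simp
  rw [← h1]
  exact integral_re (𝕜 := ℂ) (𝓕⁻ a).integrable

theorem ker_conv {a b : 𝓢(E d, ℂ)} (ha : Herm a) (hb : Herm b) (x : E d) :
    ∫ y, ker a (x - y) * ker b y = ker (mulS a b) x := by
  have h2 : SchwartzMap.convolution (ContinuousLinearMap.mul ℂ ℂ) (𝓕⁻ a) (𝓕⁻ b) =
      𝓕⁻ (mulS a b) := by
    simp [SchwartzMap.convolution, mulS]
  have h3 := SchwartzMap.convolution_apply (ContinuousLinearMap.mul ℂ ℂ) (𝓕⁻ a) (𝓕⁻ b) x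
  rw [h2, convolution_def] at h3
  apply Complex.ofReal_injective
  rw [ofReal_ker (ha.mulS hb), h3, ← integral_complex_ofReal,
    ← integral_sub_left_eq_self _ _ x]
  refine integral_congr_ae (Eventually.of_forall fun y => ?_)
  simp [ofReal_ker ha, ofReal_ker hb]

/-! ### Functions of linear growth -/

/-- Measurable functions of at most linear growth. -/
def LinGrowth (g : E d → ℝ) : Prop := Measurable g ∧ ∃ C, 0 ≤ C ∧ ∀ x, |g x| ≤ C * (1 + ‖x‖)

theorem LinGrowth.of_bounded {g : E d → ℝ} (hg : Measurable g) {M : ℝ} (hM : ∀ x, |g x| ≤ M) :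
    LinGrowth g :=
  ⟨hg, M, (abs_nonneg _).trans (hM 0), fun x => (hM x).trans
    (le_mul_of_one_le_right ((abs_nonneg _).trans (hM 0)) (by simp))⟩

theorem LinGrowth.add {g h : E d → ℝ} (hg : LinGrowth g) (hh : LinGrowth h) :
    LinGrowth (fun x => g x + h x) := by
  obtain ⟨m1, C1, h1, b1⟩ := hg
  obtain ⟨m2, C2, h2, b2⟩ := hh
  refine ⟨m1.add m2, C1 + C2, by positivity, fun x => (abs_add_le _ _).trans ?_⟩
  rw [add_mul]
  exact add_le_add (b1 x) (b2 x)

theorem one_add_norm_le_mul (x y : E d) : 1 + ‖y‖ ≤ (1 + ‖x‖) * (1 + ‖x - y‖) := by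
  have h : ‖y‖ ≤ ‖x‖ + ‖x - y‖ := by
    simpa using norm_sub_le x (x - y)
  nlinarith [norm_nonneg x, norm_nonneg (x - y), mul_nonneg (norm_nonneg x) (norm_nonneg (x - y))]

theorem LinGrowth.integrable {g : E d → ℝ} (hg : LinGrowth g) (a : 𝓢(E d, ℂ)) (x : E d) :
    Integrable fun y => ker a (x - y) * g y := by
  obtain ⟨hm, C, hC, hb⟩ := hg
  have h1 := ((integrable_ker_mul_pow a 1).comp_sub_left x).const_mul (C * (1 + ‖x‖))
  refine h1.mono' (((continuous_ker a).comp (continuous_const.sub continuous_id)).measurable.mul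
    hm).aestronglyMeasurable (Eventually.of_forall fun y => ?_)
  rw [Real.norm_eq_abs, abs_mul, pow_one]
  calc |ker a (x - y)| * |g y| ≤ |ker a (x - y)| * (C * ((1 + ‖x‖) * (1 + ‖x - y‖))) := by
        gcongr
        exact (hb y).trans (by gcongr; exact one_add_norm_le_mul x y)
    _ = _ := by ring

theorem cv_eq_integral (a : 𝓢(E d, ℂ)) (g : E d → ℝ) (x : E d) :
    cv a g x = ∫ y, ker a y * g (x - y) := by
  rw [cv, ← integral_sub_left_eq_self _ _ x]
  simp

theorem cv_add {a : 𝓢(E d, ℂ)} {g h : E d → ℝ} (hg : LinGrowth g) (hh : LinGrowth h) (x : E d) :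
    cv a (fun y => g y + h y) x = cv a g x + cv a h x := by
  rw [cv, cv, cv, ← integral_add (hg.integrable a x) (hh.integrable a x)]
  simp only [mul_add]

theorem cv_sub {a : 𝓢(E d, ℂ)} {g h : E d → ℝ} (hg : LinGrowth g) (hh : LinGrowth h) (x : E d) :
    cv a (fun y => g y - h y) x = cv a g x - cv a h x := by
  rw [cv, cv, cv, ← integral_sub (hg.integrable a x) (hh.integrable a x)]
  simp only [mul_sub]

theorem cv_const_mul (a : 𝓢(E d, ℂ)) (c : ℝ) (g : E d → ℝ) (x : E d) :
    cv a (fun y => c * g y) x = c * cv a g x := by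
  rw [cv, cv, ← integral_const_mul]
  congr 1
  ext y
  ring

theorem cv_const (a : 𝓢(E d, ℂ)) (c : ℝ) (x : E d) :
    cv a (fun _ => c) x = (a 0).re * c := by
  rw [cv_eq_integral, integral_mul_const, integral_ker]

theorem cv_sum {ι : Type*} {s : Finset ι} {g : ι → E d → ℝ} (hg : ∀ i ∈ s, LinGrowth (g i))
    (a : 𝓢(E d, ℂ)) (x : E d) :
    cv a (fun y => ∑ i ∈ s, g i y) x = ∑ i ∈ s, cv a (g i) x := by
  simp only [cv, Finset.mul_sum]
  exact integral_finsetSum _ fun i hi => (hg i hi).integrable a x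

theorem cv_add_symbol {a b : 𝓢(E d, ℂ)} {g : E d → ℝ} (hg : LinGrowth g) (x : E d) :
    cv (a + b) g x = cv a g x + cv b g x := by
  rw [cv, cv, cv, ← integral_add (hg.integrable a x) (hg.integrable b x)]
  simp only [ker_add, add_mul]

theorem cv_sum_symbol {ι : Type*} (s : Finset ι) (a : ι → 𝓢(E d, ℂ)) {g : E d → ℝ}
    (hg : LinGrowth g) (x : E d) :
    cv (∑ i ∈ s, a i) g x = ∑ i ∈ s, cv (a i) g x := by
  simp only [cv, ker_sum, Finset.sum_mul]
  exact integral_finsetSum _ fun i _ => hg.integrable (a i) x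

theorem cv_zero_symbol (g : E d → ℝ) (x : E d) : cv 0 g x = 0 := by
  simp [cv, ker_zero]

theorem abs_cv_le {a : 𝓢(E d, ℂ)} {g : E d → ℝ} {M : ℝ} (hM : ∀ x, |g x| ≤ M) (x : E d) :
    |cv a g x| ≤ kerNorm a * M := by
  rw [cv_eq_integral, ← Real.norm_eq_abs]
  refine (norm_integral_le_of_norm_le ((integrable_ker a).abs.mul_const M)
    (Eventually.of_forall fun y => ?_)).trans (integral_mul_const _ _).le
  rw [Real.norm_eq_abs, abs_mul]
  gcongr
  exact hM _

/-- This is the Fubini hypothesis behind the composition rule `cv_cv`. Linear growth is allowed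
because 1 + ‖z‖ ≤ (1 + ‖x‖)(1 + ‖x - y‖)(1 + ‖y - z‖) and each of the last two weights is absorbed
by the decay of one kernel. -/
theorem integrable_prod_ker {g : E d → ℝ} (hg : LinGrowth g) (a b : 𝓢(E d, ℂ)) (x : E d) :
    Integrable (fun p : E d × E d => ker a (x - p.1) * (ker b (p.1 - p.2) * g p.2))
      (volume.prod volume) := by
  obtain ⟨hm, C, hC, hb⟩ := hg
  set A : E d → ℝ := fun y => |ker a y| * (1 + ‖y‖) ^ 1
  set B : E d → ℝ := fun y => |ker b y| * (1 + ‖y‖) ^ 1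
  have hA : Integrable A := integrable_ker_mul_pow a 1
  have hB : Integrable B := integrable_ker_mul_pow b 1
  have hcA : Continuous A := (continuous_ker a).abs.mul (by fun_prop)
  have hcB : Continuous B := (continuous_ker b).abs.mul (by fun_prop)
  have hka := continuous_ker a
  have hkb := continuous_ker b
  have hAB : Integrable (fun p : E d × E d => C * (1 + ‖x‖) * (A (x - p.1) * B (p.1 - p.2)))
      (volume.prod volume) := by
    refine Integrable.const_mul ?_ _
    refine (integrable_prod_iff (Continuous.aestronglyMeasurable (by fun_prop))).mpr ⟨?_, ?_⟩
    · exact Eventually.of_forall fun y => (hB.comp_sub_left y).const_mul (A (x - y))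
    · have : ∀ y, ∫ z, ‖A (x - y) * B (y - z)‖ = A (x - y) * ∫ z, B z := by
        intro y
        rw [← integral_sub_left_eq_self B _ y, ← integral_const_mul]
        congr 1
        ext z
        exact Real.norm_of_nonneg (by positivity)
      simp only [this]
      exact (hA.comp_sub_left x).mul_const _
  refine hAB.mono' ?_ (Eventually.of_forall fun p => ?_)
  · refine Measurable.aestronglyMeasurable ?_
    exact (hka.comp (continuous_const.sub continuous_fst)).measurable.mul
      ((hkb.comp (continuous_fst.sub continuous_snd)).measurable.mul (hm.comp measurable_snd))
  · rw [Real.norm_eq_abs, abs_mul, abs_mul]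
    have h1 : |g p.2| ≤ C * ((1 + ‖x‖) * (1 + ‖x - p.1‖) * (1 + ‖p.1 - p.2‖)) := by
      refine (hb _).trans ?_
      gcongr
      refine (one_add_norm_le_mul p.1 p.2).trans ?_
      gcongr
      exact one_add_norm_le_mul x p.1
    calc _ ≤ |ker a (x - p.1)| * (|ker b (p.1 - p.2)| *
          (C * ((1 + ‖x‖) * (1 + ‖x - p.1‖) * (1 + ‖p.1 - p.2‖)))) := by gcongr
      _ = _ := by simp only [A, B, pow_one]; ring

theorem cv_cv {a b : 𝓢(E d, ℂ)} (ha : Herm a) (hb : Herm b) {g : E d → ℝ} (hg : LinGrowth g)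
    (x : E d) : cv a (cv b g) x = cv (mulS a b) g x := by
  have h1 : cv a (cv b g) x = ∫ y, ∫ z, ker a (x - y) * (ker b (y - z) * g z) := by
    simp only [cv, integral_const_mul]
  rw [h1, integral_integral_swap (integrable_prod_ker hg a b x), cv]
  refine integral_congr_ae (Eventually.of_forall fun z => ?_)
  change ∫ y, ker a (x - y) * (ker b (y - z) * g z) = ker (mulS a b) (x - z) * g z
  rw [← ker_conv ha hb, ← integral_mul_const,
    ← integral_sub_right_eq_self (fun y => ker a (x - z - y) * ker b y * g z) z]
  simp [mul_assoc]

theorem cv_symbol_congr {a b : 𝓢(E d, ℂ)} (h : ∀ ξ, a ξ = b ξ) (g : E d → ℝ) (x : E d) :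
    cv a g x = cv b g x := by
  rw [show a = b from SchwartzMap.ext h]

theorem cv_cv_comm {a b : 𝓢(E d, ℂ)} (ha : Herm a) (hb : Herm b) {g : E d → ℝ} (hg : LinGrowth g)
    (x : E d) : cv a (cv b g) x = cv b (cv a g) x := by
  rw [cv_cv ha hb hg, cv_cv hb ha hg]
  exact cv_symbol_congr (fun ξ => by simp [mul_comm]) _ _

theorem cv_cv_eq_zero {a b : 𝓢(E d, ℂ)} (ha : Herm a) (hb : Herm b) {g : E d → ℝ}
    (hg : LinGrowth g) (h : ∀ ξ, a ξ * b ξ = 0) (x : E d) : cv a (cv b g) x = 0 := by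
  rw [cv_cv ha hb hg, cv_symbol_congr (b := 0) (fun ξ => by simp [h]), cv_zero_symbol]

/-! ### Derivatives -/

theorem hasFDerivAt_ker (a : 𝓢(E d, ℂ)) (x : E d) :
    HasFDerivAt (ker a) (Complex.reCLM.comp (fderiv ℝ (⇑(𝓕⁻ a : 𝓢(E d, ℂ))) x)) x :=
  Complex.reCLM.hasFDerivAt.comp x (𝓕⁻ a : 𝓢(E d, ℂ)).differentiableAt.hasFDerivAt

theorem fderiv_ker_apply (a : 𝓢(E d, ℂ)) (x v : E d) :
    fderiv ℝ (ker a) x v = ker (dirS v a) x := by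
  rw [(hasFDerivAt_ker a x).fderiv, ker, dirS, ← SchwartzMap.lineDerivOp_fourierInv_eq,
    SchwartzMap.lineDerivOp_apply, (𝓕⁻ a : 𝓢(E d, ℂ)).differentiableAt.lineDeriv_eq_fderiv]
  rfl

theorem fderiv_ker_decay (a : 𝓢(E d, ℂ)) (k : ℕ) :
    ∃ C, 0 < C ∧ ∀ x, ‖fderiv ℝ (ker a) x‖ * (1 + ‖x‖) ^ k ≤ C := by
  set C := 2 ^ k * ((Finset.Iic (k, 1)).sup
    fun m => SchwartzMap.seminorm ℝ (E := E d) (F := ℂ) m.1 m.2) (𝓕⁻ a) with hC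
  refine ⟨max C 1, by positivity, fun x => le_max_of_le_left ?_⟩
  have := SchwartzMap.one_add_le_sup_seminorm_apply (𝕜 := ℝ) (m := (k, 1)) le_rfl le_rfl (𝓕⁻ a) x
  refine le_trans ?_ this
  rw [mul_comm, (hasFDerivAt_ker a x).fderiv, norm_iteratedFDeriv_one]
  gcongr
  refine (ContinuousLinearMap.opNorm_comp_le _ _).trans ?_
  rw [Complex.reCLM_norm, one_mul]

/-- The function g is only bounded and measurable, so the derivative falls on the kernel. The
derivative of a kernel is again a kernel, with symbol multiplied by 2πi⟨ξ, e_k⟩, which keeps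
gradients inside the calculus of symbols. -/
theorem hasFDerivAt_cv (a : 𝓢(E d, ℂ)) {g : E d → ℝ} (hg : Measurable g) {M : ℝ}
    (hM : ∀ x, |g x| ≤ M) (x : E d) :
    HasFDerivAt (cv a g) (∑ k : Fin d, cv (dirS (EuclideanSpace.single k 1) a) g x •
      (EuclideanSpace.proj k : E d →L[ℝ] ℝ)) x := by
  have hl := LinGrowth.of_bounded hg hM
  have hM0 : 0 ≤ M := (abs_nonneg _).trans (hM 0)
  obtain ⟨C, hC, hdec⟩ := fderiv_ker_decay a (d + 1)
  set F' : E d → E d → E d →L[ℝ] ℝ := fun x y => g y • fderiv ℝ (ker a) (x - y)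
  have hcf : Continuous (fderiv ℝ (ker a)) := by
    have : fderiv ℝ (ker a) = fun x => Complex.reCLM.comp (fderiv ℝ (⇑(𝓕⁻ a : 𝓢(E d, ℂ))) x) :=
      funext fun x => (hasFDerivAt_ker a x).fderiv
    rw [this]
    exact (((𝓕⁻ a : 𝓢(E d, ℂ)).smooth 1).continuous_fderiv (by simp)).const_clm_comp _
  have hbi : Integrable fun y : E d => M * (C * 2 ^ (d + 1) * (1 + ‖x - y‖) ^ (-((d : ℝ) + 1))) :=
    (((integrable_one_add_norm (by simp)).const_mul _).comp_sub_left x).const_mul M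
  have hbound : ∀ y, ∀ x' ∈ Metric.ball x 1,
      ‖F' x' y‖ ≤ M * (C * 2 ^ (d + 1) * (1 + ‖x - y‖) ^ (-((d : ℝ) + 1))) := by
    intro y x' hx'
    simp only [F', norm_smul, Real.norm_eq_abs]
    gcongr
    · exact hM y
    have hx : 0 < 1 + ‖x - y‖ := by positivity
    rw [Real.rpow_neg hx.le, ← div_eq_mul_inv, le_div_iff₀ (by positivity)]
    have : (1 + ‖x - y‖) ^ ((d : ℝ) + 1) = (1 + ‖x - y‖) ^ (d + 1) := by
      rw [← Real.rpow_natCast]; push_cast; rfl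
    rw [this]
    -- The dominating function must not depend on x'. Moving x' inside the unit ball costs a factor
    -- 2 in the weight, hence 2^(d+1) in the bound.
    have h2 : 1 + ‖x - y‖ ≤ 2 * (1 + ‖x' - y‖) := by
      have h3 : ‖x - y‖ ≤ ‖x' - y‖ + ‖x' - x‖ := by
        have := norm_sub_le (x' - y) (x' - x)
        simpa using this
      have h4 : ‖x' - x‖ < 1 := by simpa [dist_eq_norm] using hx'
      linarith [norm_nonneg (x' - y)]
    calc _ ≤ ‖fderiv ℝ (ker a) (x' - y)‖ * (2 * (1 + ‖x' - y‖)) ^ (d + 1) := by gcongr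
      _ = (‖fderiv ℝ (ker a) (x' - y)‖ * (1 + ‖x' - y‖) ^ (d + 1)) * 2 ^ (d + 1) := by
        rw [mul_pow]; ring
      _ ≤ _ := by gcongr; exact hdec _
  have key := hasFDerivAt_integral_of_dominated_of_fderiv_le (μ := volume) (𝕜 := ℝ)
    (F := fun x y => ker a (x - y) * g y) (F' := F') (x₀ := x) (Metric.ball_mem_nhds x one_pos)
    (Eventually.of_forall fun x' => (hl.integrable a x').aestronglyMeasurable)
    (hl.integrable a x) ?_ (Eventually.of_forall hbound) hbi ?_
  · suffices heq : (∑ k : Fin d, cv (dirS (EuclideanSpace.single k 1) a) g x •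
        (EuclideanSpace.proj k : E d →L[ℝ] ℝ)) = ∫ y, F' x y by rw [heq]; exact key
    refine ContinuousLinearMap.ext fun v => ?_
    have hF'i : Integrable (F' x) := hbi.mono' (by
      exact (hg.aestronglyMeasurable.smul
        (hcf.comp (continuous_const.sub continuous_id)).aestronglyMeasurable))
      (Eventually.of_forall fun y => hbound y x (Metric.mem_ball_self one_pos))
    rw [ContinuousLinearMap.integral_apply hF'i]
    have hv : ∀ y, F' x y v = ∑ k : Fin d, (ker (dirS (EuclideanSpace.single k 1) a) (x - y) * g y) * v k := by
      intro y
      simp only [F', smul_apply, smul_eq_mul]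
      have hv : v = ∑ k : Fin d, v k • (EuclideanSpace.single k (1 : ℝ) : E d) := by
        ext i; simp [Pi.single_apply]
      conv_lhs => rw [hv, map_sum, Finset.mul_sum]
      refine Finset.sum_congr rfl fun k _ => ?_
      rw [map_smul, fderiv_ker_apply, smul_eq_mul]
      ring
    simp only [hv]
    rw [integral_finsetSum _ fun k _ => ((hl.integrable _ x).mul_const _)]
    simp only [integral_mul_const]
    simp [cv]
  · exact (hg.aestronglyMeasurable.smul
        (hcf.comp (continuous_const.sub continuous_id)).aestronglyMeasurable)
  · refine Eventually.of_forall fun y x' _ => ?_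
    have h := ((hasFDerivAt_ker a (x' - y)).differentiableAt.hasFDerivAt.comp x'
      ((hasFDerivAt_id x').sub_const y)).mul_const (g y)
    simpa [F'] using h

attribute [irreducible] ker

end DirichletNeumann

end

/-! ### Dyadic blocks: kernel bounds that are uniform in the frequency and in time. -/

noncomputable section

namespace DirichletNeumann

variable {d : ℕ}

/-! ### Dilations and bounds for kernels -/

/-- The dilated symbol `ξ ↦ a (c ξ)`. -/
def dilS (c : ℝ) (hc : c ≠ 0) (a : 𝓢(E d, ℂ)) : 𝓢(E d, ℂ) :=
  SchwartzMap.compCLMOfContinuousLinearEquiv ℂ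
    (LinearEquiv.smulOfNeZero ℝ (E d) c hc).toContinuousLinearEquiv a

@[simp] theorem dilS_apply (c : ℝ) (hc : c ≠ 0) (a : 𝓢(E d, ℂ)) (ξ : E d) :
    dilS c hc a ξ = a (c • ξ) := rfl

theorem ker_eq_integral (a : 𝓢(E d, ℂ)) (x : E d) :
    ker a x = (∫ ξ, Complex.exp (((2 * Real.pi * inner ℝ ξ x : ℝ) : ℂ) * Complex.I) * a ξ).re := by
  rw [ker, SchwartzMap.fourierInv_coe, Real.fourierInv_eq']
  rfl

theorem ker_dilS {c : ℝ} (hc : 0 < c) (a : 𝓢(E d, ℂ)) (x : E d) :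
    ker (dilS c hc.ne' a) x = (c ^ d)⁻¹ * ker a (c⁻¹ • x) := by
  have h := Measure.integral_comp_smul (volume : Measure (E d)) (fun ξ : E d =>
    Complex.exp (((2 * Real.pi * inner ℝ ξ (c⁻¹ • x) : ℝ) : ℂ) * Complex.I) * a ξ) c
  rw [ker_eq_integral, ker_eq_integral]
  have h2 : ∀ ξ : E d, inner ℝ (c • ξ) (c⁻¹ • x) = inner ℝ ξ x := by
    intro ξ
    rw [inner_smul_left, inner_smul_right]
    simp [hc.ne']
  simp only [h2] at h
  simp only [dilS_apply]
  rw [h, Complex.smul_re, abs_of_nonneg (by positivity), smul_eq_mul]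
  simp

/-- Dilating a symbol rescales its kernel without changing the mass, so bounds for the block j
reduce to the block 0. -/
theorem kerNorm_dilS {c : ℝ} (hc : 0 < c) (a : 𝓢(E d, ℂ)) :
    kerNorm (dilS c hc.ne' a) = kerNorm a := by
  simp only [kerNorm, ker_dilS hc, abs_mul]
  rw [integral_const_mul, Measure.integral_comp_smul volume (fun y => |ker a y|), inv_pow, inv_inv,
    finrank_euclideanSpace, Fintype.card_fin, abs_of_nonneg (by positivity),
    abs_of_nonneg (by positivity), smul_eq_mul, ← mul_assoc, inv_mul_cancel₀ (by positivity),
    one_mul]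

theorem kerNorm_smul (c : ℝ) (a : 𝓢(E d, ℂ)) : kerNorm ((c : ℂ) • a) = |c| * kerNorm a := by
  simp only [kerNorm, ker_smul, abs_mul, integral_const_mul]

/-- The inverse Fourier transform followed by the embedding into L¹ is continuous on Schwartz
functions, hence bounded by finitely many seminorms. Bounds for kernels thus reduce to bounds for
derivatives of symbols. -/
theorem exists_kerNorm_le_seminorm (d : ℕ) : ∃ (s : Finset (ℕ × ℕ)) (C : ℝ), 0 ≤ C ∧
    ∀ a : 𝓢(E d, ℂ), kerNorm a ≤ C * (s.sup (schwartzSeminormFamily ℝ (E d) ℂ)) a := by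
  let L : 𝓢(E d, ℂ) →L[ℝ] Lp ℂ 1 (volume : Measure (E d)) :=
    (SchwartzMap.toLpCLM ℝ ℂ 1 volume).comp (FourierTransform.fourierInvCLM ℝ 𝓢(E d, ℂ))
  obtain ⟨s, C, -, h⟩ := Seminorm.bound_of_continuous (schwartz_withSeminorms ℝ (E d) ℂ)
    ((normSeminorm ℝ _).comp L.toLinearMap) (continuous_norm.comp L.continuous)
  refine ⟨s, C, C.2, fun a => ?_⟩
  refine le_trans ?_ (h a)
  have h1 : ((normSeminorm ℝ _).comp L.toLinearMap) a = ∫ x, ‖(𝓕⁻ a : 𝓢(E d, ℂ)) x‖ := by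
    rw [← SchwartzMap.norm_toLp_one]
    rfl
  rw [h1]
  exact integral_mono (integrable_ker a).abs (𝓕⁻ a : 𝓢(E d, ℂ)).integrable.norm
    fun x => by simp only [ker]; exact Complex.abs_re_le_norm _

/-! ### The symbols of the Littlewood-Paley blocks -/

theorem Symbol.ext' {m n : Symbol d} (h : ∀ ξ, m.toFun ξ = n.toFun ξ) : m = n := by
  cases m; cases n
  congr
  exact funext h

@[simp] theorem Symbol.mul_toFun (m n : Symbol d) (ξ : E d) :
    (m * n).toFun ξ = m.toFun ξ * n.toFun ξ := rfl

@[simp] theorem Symbol.one_toFun (ξ : E d) : (1 : Symbol d).toFun ξ = 1 := rfl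

theorem Symbol.mul_one' (m : Symbol d) : m * 1 = m := Symbol.ext' fun ξ => by simp

theorem Symbol.one_mul' (m : Symbol d) : 1 * m = m := Symbol.ext' fun ξ => by simp

theorem Symbol.mul_comm' (m n : Symbol d) : m * n = n * m := Symbol.ext' fun ξ => by simp [mul_comm]

/-- Symbols of real operators. -/
def Symbol.IsReal (m : Symbol d) : Prop := ∀ ξ, m.toFun (-ξ) = star (m.toFun ξ)

/-- Symbols that are homogeneous of degree `α` for dyadic dilations. -/
def Symbol.IsHom (m : Symbol d) (α : ℤ) : Prop :=
  ∀ (j : ℤ) (ξ : E d), m.toFun ((2 : ℝ) ^ j • ξ) = (((2 : ℝ) ^ (j * α) : ℝ) : ℂ) * m.toFun ξ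

theorem Symbol.IsReal.mul {m n : Symbol d} (hm : m.IsReal) (hn : n.IsReal) : (m * n).IsReal :=
  fun ξ => by simp [hm ξ, hn ξ]

theorem Symbol.IsReal.one : (1 : Symbol d).IsReal := fun ξ => by simp

theorem Symbol.IsReal.absD : (Symbol.absD : Symbol d).IsReal := fun ξ => by simp [Symbol.absD]

theorem Symbol.IsReal.expD (t : ℝ) : (Symbol.expD t : Symbol d).IsReal := fun ξ => by
  simp [Symbol.expD, ← Complex.exp_conj]

theorem Symbol.IsReal.expDSubOne (t : ℝ) : (Symbol.expDSubOne t : Symbol d).IsReal := fun ξ => by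
  simp only [Symbol.expDSubOne, star_sub, star_one]
  rw [Symbol.IsReal.expD t ξ]

theorem Symbol.IsReal.riesz (k : Fin d) : (Symbol.riesz k : Symbol d).IsReal := fun ξ => by
  simp [Symbol.riesz]

theorem Symbol.IsHom.mul {m n : Symbol d} {α β : ℤ} (hm : m.IsHom α) (hn : n.IsHom β) :
    (m * n).IsHom (α + β) := fun j ξ => by
  simp only [Symbol.mul_toFun, hm j ξ, hn j ξ, mul_add, zpow_add₀ (two_ne_zero (α := ℝ))]
  push_cast
  ring

theorem Symbol.IsHom.one : (1 : Symbol d).IsHom 0 := fun j ξ => by simp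

theorem Symbol.IsHom.absD : (Symbol.absD : Symbol d).IsHom 1 := fun j ξ => by
  simp [Symbol.absD, norm_smul]

theorem Symbol.IsHom.riesz (k : Fin d) : (Symbol.riesz k : Symbol d).IsHom 0 := fun j ξ => by
  have h2 : ((2 : ℂ) ^ j) ≠ 0 := zpow_ne_zero _ two_ne_zero
  simp only [Symbol.riesz, norm_smul, norm_zpow, Real.norm_ofNat]
  simp
  field_simp

variable (φ : LittlewoodPaley d)

/-- The symbol `m(2πξ) φ(2^{-j} 2πξ)` of `m(D) Δ̇_j`. -/
def sig (m : Symbol d) (j : ℤ) : 𝓢(E d, ℂ) :=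
  (hasCompactSupport_blockSymbol φ m j 0).toSchwartzMap (contDiff_blockSymbol φ m j 0)

/-- The dyadic cut-off `φ(2^{-j} 2πξ)`. -/
def phi (j : ℤ) (ξ : E d) : ℝ := φ.toFun ((2 : ℝ) ^ (-j) • (2 * Real.pi) • ξ)

theorem sig_apply (m : Symbol d) (j : ℤ) (ξ : E d) :
    sig φ m j ξ = m.toFun ((2 * Real.pi) • ξ) * (phi φ j ξ : ℝ) := by
  change blockSymbol φ m j 0 ξ = _
  simp [blockSymbol, phi]

theorem hasCompactSupport_sig (m : Symbol d) (j : ℤ) : HasCompactSupport (sig φ m j) :=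
  hasCompactSupport_blockSymbol φ m j 0

theorem herm_sig {m : Symbol d} (hm : m.IsReal) (j : ℤ) : Herm (sig φ m j) := fun ξ => by
  have h : phi φ j (-ξ) = phi φ j ξ := φ.radial _ _ (by simp)
  rw [sig_apply, sig_apply, h, smul_neg, hm]
  simp

theorem blockTest_apply (m : Symbol d) (j : ℤ) (x y : E d) :
    blockTest φ m j x y = 𝓕⁻ (sig φ m j) (x - y) := by
  rw [blockTest, SchwartzMap.fourier_coe, SchwartzMap.fourierInv_coe, Real.fourier_eq',
    Real.fourierInv_eq']
  refine integral_congr_ae (Eventually.of_forall fun ξ => ?_)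
  simp only [smul_eq_mul]
  rw [sig_apply]
  change _ * blockSymbol φ m j x ξ = _
  rw [blockSymbol, ← mul_assoc, ← mul_assoc, ← Complex.exp_add, ← mul_assoc]
  congr 4
  rw [← add_mul, inner_sub_right, real_inner_comm x]
  push_cast
  ring

/-- The definitions through pairings with Schwartz functions are replaced by real convolutions here;
later estimates are stated for `cv`. -/
theorem block_pair {m : Symbol d} (hm : m.IsReal) (j : ℤ) (g : E d → ℝ) (x : E d) :
    block φ m j (pair g) x = ((cv (sig φ m j) g x : ℝ) : ℂ) := by
  rw [block, pair, cv, ← integral_complex_ofReal]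
  congr 1
  ext y
  rw [blockTest_apply, ← ofReal_ker (herm_sig φ hm j)]
  simp

theorem mult_eq {m : Symbol d} (hm : m.IsReal) (g : E d → ℝ) (x : E d) :
    mult φ m g x = ∑' j : ℤ, cv (sig φ m j) g x := by
  simp [mult, block_pair φ hm]

theorem phi_support {j : ℤ} {ξ : E d} (h : phi φ j ξ ≠ 0) :
    3 / 4 * (2 : ℝ) ^ j ≤ 2 * Real.pi * ‖ξ‖ ∧ 2 * Real.pi * ‖ξ‖ ≤ 8 / 3 * (2 : ℝ) ^ j := by
  have h2 := φ.support _ h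
  have hpi := Real.pi_pos
  have hj : (0 : ℝ) < (2 : ℝ) ^ j := by positivity
  rw [norm_smul, norm_smul, Real.norm_of_nonneg (by positivity),
    Real.norm_of_nonneg (by positivity : (0 : ℝ) ≤ 2 * Real.pi), zpow_neg, inv_mul_eq_div,
    le_div_iff₀ hj, div_le_iff₀ hj] at h2
  exact h2

/-- The annuli of indices i and i + 2 are disjoint, since (8/3) 2^i < (3/4) 2^{i+2} = 3 · 2^i. -/
theorem phi_mul_eq_zero {i j : ℤ} (h : 1 < |i - j|) (ξ : E d) : phi φ i ξ * phi φ j ξ = 0 := by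
  wlog hij : i < j generalizing i j
  · rw [mul_comm]
    refine this (by rwa [abs_sub_comm]) (lt_of_le_of_ne (not_lt.mp hij) ?_)
    rintro rfl
    simp at h
  by_contra hne
  obtain ⟨h1, h2⟩ := mul_ne_zero_iff.mp hne
  have a1 := (phi_support φ h1).2
  have a2 := (phi_support φ h2).1
  have hj : j = (j - (i + 2)) + 2 + i := by ring
  have h3 : i + 2 ≤ j := by
    rw [abs_sub_comm, abs_of_pos (by lia)] at h
    lia
  have h4 : (2 : ℝ) ^ (i + 2) ≤ (2 : ℝ) ^ j := zpow_le_zpow_right₀ (by norm_num) h3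
  rw [zpow_add₀ (by norm_num)] at h4
  have h5 : (0 : ℝ) < (2 : ℝ) ^ i := by positivity
  norm_num at h4
  linarith

theorem hasSum_phi {ξ : E d} (hξ : ξ ≠ 0) : HasSum (fun j : ℤ => phi φ j ξ) 1 :=
  φ.hasSum_one _ (smul_ne_zero (by have := Real.pi_pos; positivity) hξ)

theorem phi_zero (j : ℤ) : phi φ j 0 = 0 := by
  by_contra h
  have h1 := (phi_support φ h).1
  have hj : (0 : ℝ) < (2 : ℝ) ^ j := by positivity
  simp at h1
  linarith

theorem sum_phi_mul (j : ℤ) (ξ : E d) :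
    (∑ i ∈ Finset.Icc (j - 1) (j + 1), phi φ i ξ) * phi φ j ξ = phi φ j ξ := by
  by_cases h : phi φ j ξ = 0
  · simp [h]
  have hξ : ξ ≠ 0 := by
    rintro rfl
    exact h (phi_zero φ j)
  have h1 : HasSum (fun i : ℤ => phi φ i ξ) (∑ i ∈ Finset.Icc (j - 1) (j + 1), phi φ i ξ) := by
    refine hasSum_sum_of_ne_finset_zero fun i hi => ?_
    have := phi_mul_eq_zero φ (i := i) (j := j) (by
      rw [Finset.mem_Icc] at hi
      rw [lt_abs]
      lia) ξ
    exact (mul_eq_zero.mp this).resolve_right h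
  rw [h1.unique (hasSum_phi φ hξ), one_mul]

/-- On the support of the j-th cut-off the three neighbouring cut-offs sum to 1. Hence a multiplier
restricted to the block j factors through the block of the other multiplier; this lets an operator
be estimated by its kernel applied to an already localized, bounded function. -/
theorem sig_mul_eq_sum (m n : Symbol d) (j : ℤ) :
    sig φ (m * n) j = ∑ i ∈ Finset.Icc (j - 1) (j + 1), mulS (sig φ m i) (sig φ n j) := by
  ext ξ
  rw [sum_apply]
  simp only [mulS_apply, sig_apply, Symbol.mul_toFun]
  rw [← Finset.sum_mul, ← Finset.mul_sum]
  have h : ((phi φ j ξ : ℝ) : ℂ) = (∑ i ∈ Finset.Icc (j - 1) (j + 1), ((phi φ i ξ : ℝ) : ℂ)) *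
      ((phi φ j ξ : ℝ) : ℂ) := by exact_mod_cast (sum_phi_mul φ j ξ).symm
  linear_combination m.toFun ((2 * Real.pi) • ξ) * n.toFun ((2 * Real.pi) • ξ) * h

theorem cv_sig_mul {m n : Symbol d} (hm : m.IsReal) (hn : n.IsReal) (j : ℤ) {g : E d → ℝ}
    (hg : LinGrowth g) (x : E d) : cv (sig φ (m * n) j) g x =
      ∑ i ∈ Finset.Icc (j - 1) (j + 1), cv (sig φ m i) (cv (sig φ n j) g) x := by
  rw [sig_mul_eq_sum, cv_sum_symbol _ _ hg]
  exact Finset.sum_congr rfl fun i _ => (cv_cv (herm_sig φ hm i) (herm_sig φ hn j) hg x).symm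

theorem cv_sig_eq_sum {m : Symbol d} (hm : m.IsReal) (j : ℤ) {g : E d → ℝ} (hg : LinGrowth g)
    (x : E d) : cv (sig φ m j) g x =
      ∑ i ∈ Finset.Icc (j - 1) (j + 1), cv (sig φ m i) (cv (sig φ 1 j) g) x := by
  simpa only [Symbol.mul_one'] using cv_sig_mul φ hm .one j hg x

theorem sig_mul_eq_zero (m n : Symbol d) {i j : ℤ} (h : 1 < |i - j|) (ξ : E d) :
    sig φ m i ξ * sig φ n j ξ = 0 := by
  have := phi_mul_eq_zero φ h ξ
  rw [sig_apply, sig_apply]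
  have h2 : ((phi φ i ξ : ℝ) : ℂ) * (phi φ j ξ : ℝ) = 0 := by exact_mod_cast this
  linear_combination m.toFun ((2 * Real.pi) • ξ) * n.toFun ((2 * Real.pi) • ξ) * h2

theorem sig_zero (m : Symbol d) (j : ℤ) : sig φ m j 0 = 0 := by
  rw [sig_apply, phi_zero]
  simp

theorem sig_mul_expD (m : Symbol d) (t : ℝ) (j : ℤ) (ξ : E d) :
    sig φ (m * Symbol.expD t) j ξ = Real.exp (t * ‖(2 * Real.pi) • ξ‖) • sig φ m j ξ := by
  rw [sig_apply, sig_apply]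
  simp only [Symbol.mul_toFun, Symbol.expD]
  rw [Complex.real_smul]
  push_cast
  ring

/-- Scaling turns time t at frequency 2^j into time 2^j t at frequency 1; this is the source of the
decay e^{2^j t/2} in the kernel bound. -/
theorem sig_eq_dilS {m : Symbol d} {α : ℤ} (hm : m.IsHom α) (t : ℝ) (j : ℤ) :
    sig φ (m * Symbol.expD t) j = (((2 : ℝ) ^ (j * α) : ℝ) : ℂ) •
      dilS ((2 : ℝ) ^ (-j)) (by positivity) (sig φ (m * Symbol.expD ((2 : ℝ) ^ j * t)) 0) := by
  ext ξ
  have h1 : (2 * Real.pi) • ξ = (2 : ℝ) ^ j • (2 * Real.pi) • (2 : ℝ) ^ (-j) • ξ := by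
    rw [smul_comm _ ((2 : ℝ) ^ (-j)), smul_smul ((2 : ℝ) ^ j), ← zpow_add₀ (by norm_num)]
    simp
  have h2 : phi φ 0 ((2 : ℝ) ^ (-j) • ξ) = phi φ j ξ := by
    simp only [phi]
    rw [smul_comm _ ((2 : ℝ) ^ (-j))]
    simp
  have h3 : ‖(2 * Real.pi) • ξ‖ = (2 : ℝ) ^ j * ‖(2 * Real.pi) • (2 : ℝ) ^ (-j) • ξ‖ := by
    conv_lhs => rw [h1]
    rw [norm_smul, Real.norm_of_nonneg (by positivity)]
  rw [smul_apply, dilS_apply, sig_mul_expD, sig_mul_expD, sig_apply, sig_apply, h2, h3]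
  conv_lhs => rw [h1, hm]
  simp only [smul_eq_mul, Complex.real_smul]
  rw [show t * ((2 : ℝ) ^ j * ‖(2 * Real.pi) • (2 : ℝ) ^ (-j) • ξ‖) =
    2 ^ j * t * ‖(2 * Real.pi) • (2 : ℝ) ^ (-j) • ξ‖ by ring]
  ring

/-- On the support of the block 0 the phase |2πξ| is smooth and at least 3/4. The chain and Leibniz
rules give polynomial factors in t times e^{3t/4}, and the polynomial factors are paid for with part
of the exponential. Derivatives are taken within the complement of the origin, where the norm is
smooth. -/
theorem exists_seminorm_sig_expD_le (m : Symbol d) (k n : ℕ) : ∃ C, 0 ≤ C ∧ ∀ t ≤ 0,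
    SchwartzMap.seminorm ℝ k n (sig φ (m * Symbol.expD t) 0) ≤ C * Real.exp (t / 2) := by
  set G := sig φ m 0 with hG
  have hpi := Real.pi_pos
  have hGc : HasCompactSupport G := hasCompactSupport_sig φ m 0
  set K := tsupport G with hK
  have hKc : IsCompact K := hGc
  set f : E d → ℝ := fun ξ => ‖(2 * Real.pi) • ξ‖ with hf
  have hKf : ∀ ξ ∈ K, 3 / 4 ≤ f ξ := by
    have hcl : IsClosed {ξ : E d | 3 / 4 ≤ f ξ} :=
      isClosed_le continuous_const (by fun_prop)
    have hsub : Function.support G ⊆ {ξ : E d | 3 / 4 ≤ f ξ} := by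
      intro ξ hξ
      have h0 : phi φ 0 ξ ≠ 0 := by
        intro h0
        apply hξ
        rw [hG, sig_apply, h0]
        simp
      have := (phi_support φ h0).1
      simpa [hf, norm_smul, abs_of_pos hpi] using this
    exact fun ξ hξ => closure_minimal hsub hcl hξ
  have hs : IsOpen ({0}ᶜ : Set (E d)) := isOpen_compl_singleton
  have hK0 : K ⊆ {0}ᶜ := by
    rintro ξ hξ rfl
    have := hKf _ hξ
    simp [hf] at this
    linarith
  have hfs : ContDiffOn ℝ ∞ f {0}ᶜ := by
    intro ξ hξ
    refine ((contDiffAt_norm ℝ (smul_ne_zero (by positivity) hξ)).comp ξ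
      (contDiff_const_smul (2 * Real.pi)).contDiffAt).contDiffWithinAt
  have hGs : ContDiffOn ℝ ∞ G {0}ᶜ := (G.smooth ⊤).contDiffOn
  have hD : ∃ D : ℝ, 1 ≤ D ∧ ∀ i ≤ n, ∀ ξ ∈ K,
      ‖iteratedFDerivWithin ℝ i f {0}ᶜ ξ‖ ≤ D ∧ ‖iteratedFDerivWithin ℝ i G {0}ᶜ ξ‖ ≤ D := by
    have h1 : ∀ i : ℕ, ∃ D : ℝ, ∀ ξ ∈ K,
        ‖iteratedFDerivWithin ℝ i f {0}ᶜ ξ‖ ≤ D ∧ ‖iteratedFDerivWithin ℝ i G {0}ᶜ ξ‖ ≤ D := by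
      intro i
      obtain ⟨D1, h1⟩ := hKc.exists_bound_of_continuousOn
        ((hfs.continuousOn_iteratedFDerivWithin (m := i) (by exact_mod_cast le_top)
          hs.uniqueDiffOn).mono hK0)
      obtain ⟨D2, h2⟩ := hKc.exists_bound_of_continuousOn
        ((hGs.continuousOn_iteratedFDerivWithin (m := i) (by exact_mod_cast le_top)
          hs.uniqueDiffOn).mono hK0)
      exact ⟨max D1 D2, fun ξ hξ => ⟨(h1 ξ hξ).trans (le_max_left _ _),
        (h2 ξ hξ).trans (le_max_right _ _)⟩⟩
    choose D hD using h1
    refine ⟨1 + ∑ i ∈ Finset.range (n + 1), |D i|, by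
      simp only [le_add_iff_nonneg_right]; positivity, fun i hi ξ hξ => ?_⟩
    have : D i ≤ 1 + ∑ i ∈ Finset.range (n + 1), |D i| := by
      have := Finset.single_le_sum (f := fun i => |D i|) (fun i _ => abs_nonneg _)
        (Finset.mem_range.mpr (Nat.lt_succ_of_le hi))
      linarith [le_abs_self (D i)]
    exact ⟨(hD i ξ hξ).1.trans this, (hD i ξ hξ).2.trans this⟩
  obtain ⟨D, hD1, hD⟩ := hD
  obtain ⟨R, hR⟩ := hKc.isBounded.exists_norm_le
  have hD0 : 0 ≤ D := by linarith
  refine ⟨|R| ^ k * ∑ i ∈ Finset.range (n + 1),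
    (n.choose i) * (i.factorial * (n.factorial * 4 ^ n) * D ^ i) * D, by positivity,
    fun t ht => ?_⟩
  refine SchwartzMap.seminorm_le_bound ℝ k n _ (by positivity) fun ξ => ?_
  have hfun : (sig φ (m * Symbol.expD t) 0 : E d → ℂ) =
      fun ξ => (fun s => Real.exp (t * s)) (f ξ) • G ξ := by
    ext ξ
    rw [sig_mul_expD]
  rw [hfun]
  by_cases hξ : ξ ∈ K
  swap
  · have h0 : (fun ξ => (fun s => Real.exp (t * s)) (f ξ) • G ξ) =ᶠ[𝓝 ξ] 0 := by
      filter_upwards [notMem_tsupport_iff_eventuallyEq.mp hξ] with ζ hζ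
      rw [hζ]
      simp
    rw [(h0.iteratedFDeriv ℝ n).eq_of_nhds, Pi.zero_def, iteratedFDeriv_fun_zero]
    simp
    positivity
  rw [mul_assoc]
  gcongr
  · exact (hR ξ hξ).trans (le_abs_self R)
  rw [← iteratedFDerivWithin_of_isOpen n hs (hK0 hξ)]
  have hexp : ContDiff ℝ ∞ fun s : ℝ => Real.exp (t * s) := by fun_prop
  refine (norm_iteratedFDerivWithin_smul_le (N := ∞) (hexp.comp_contDiffOn hfs) hGs
    hs.uniqueDiffOn (hK0 hξ) (by exact_mod_cast le_top)).trans ?_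
  rw [Finset.sum_mul]
  refine Finset.sum_le_sum fun i hi => ?_
  have hin : i ≤ n := Nat.lt_succ_iff.mp (Finset.mem_range.mp hi)
  have hcomp : ‖iteratedFDerivWithin ℝ i ((fun s => Real.exp (t * s)) ∘ f) {0}ᶜ ξ‖ ≤
      i.factorial * ((n.factorial * 4 ^ n) * Real.exp (t / 2)) * D ^ i := by
    refine norm_iteratedFDerivWithin_comp_le (N := ∞) hexp.contDiffOn hfs
      (by exact_mod_cast le_top) uniqueDiffOn_univ hs.uniqueDiffOn (Set.mapsTo_univ _ _) (hK0 hξ)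
      ?_ ?_
    · intro l hl
      rw [iteratedFDerivWithin_univ, norm_iteratedFDeriv_eq_norm_iteratedDeriv,
        iteratedDeriv_exp_const_mul]
      simp only [norm_mul, norm_pow, Real.norm_eq_abs, Real.abs_exp]
      -- The l-th derivative of s ↦ e^{ts} produces |t|^l ≤ 4^l l! e^{|t|/4}. Of the available decay
      -- e^{3t/4} this consumes e^{t/4} and leaves e^{t/2}.
      have h1 := Real.pow_div_factorial_le_exp (|t| / 4) (by positivity) l
      rw [div_pow, div_div, div_le_iff₀ (by positivity), abs_of_nonpos ht] at h1
      rw [abs_of_nonpos ht]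
      have h2 : Real.exp (t * f ξ) ≤ Real.exp (3 * t / 4) := by
        apply Real.exp_le_exp.mpr
        nlinarith [hKf ξ hξ]
      calc (-t) ^ l * Real.exp (t * f ξ)
          ≤ (Real.exp (-t / 4) * (4 ^ l * l.factorial)) * Real.exp (3 * t / 4) := by
            gcongr
        _ = (4 ^ l * l.factorial) * Real.exp (t / 2) := by
            rw [mul_right_comm, ← Real.exp_add]
            rw [show -t / 4 + 3 * t / 4 = t / 2 by ring]
            ring
        _ ≤ (4 ^ n * n.factorial) * Real.exp (t / 2) := by
            have hln := hl.trans hin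
            gcongr
            norm_num
        _ = _ := by ring
    · intro l hl1 hl
      exact ((hD l (hl.trans hin) ξ hξ).1).trans (le_self_pow₀ hD1 (by lia))
  refine (mul_le_mul_of_nonneg_right (mul_le_mul_of_nonneg_left hcomp (by positivity))
    (norm_nonneg _)).trans ?_
  calc _ ≤ (n.choose i : ℝ) * (i.factorial * ((n.factorial * 4 ^ n) * Real.exp (t / 2)) * D ^ i)
        * D := by
        gcongr
        exact (hD (n - i) (Nat.sub_le _ _) ξ hξ).2
    _ = _ := by ring

attribute [irreducible] sig

/-- The kernel of `m(D) e^{t|D|} Δ̇_j`, with `m` homogeneous of degree `α`, has `L¹` norm at most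
`C 2^{jα} e^{t 2^j / 2}`. -/
theorem exists_kerNorm_sig_le {m : Symbol d} {α : ℤ} (hm : m.IsHom α) : ∃ C, 0 < C ∧
    ∀ t ≤ 0, ∀ j : ℤ, kerNorm (sig φ (m * Symbol.expD t) j) ≤
      C * (2 : ℝ) ^ (j * α) * Real.exp ((2 : ℝ) ^ j * t / 2) := by
  obtain ⟨s, C, hC, h⟩ := exists_kerNorm_le_seminorm d
  choose B hB0 hB using fun p : ℕ × ℕ => exists_seminorm_sig_expD_le φ m p.1 p.2
  refine ⟨C * (∑ p ∈ s, B p) + 1, by have := Finset.sum_nonneg (s := s) fun p _ => hB0 p; positivity,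
    fun t ht j => ?_⟩
  have hj : (0 : ℝ) < 2 ^ j := by positivity
  rw [sig_eq_dilS φ hm, kerNorm_smul, kerNorm_dilS (by positivity), abs_of_pos (by positivity)]
  have h1 : kerNorm (sig φ (m * Symbol.expD ((2 : ℝ) ^ j * t)) 0) ≤
      C * ((∑ p ∈ s, B p) * Real.exp ((2 : ℝ) ^ j * t / 2)) := by
    refine (h _).trans ?_
    gcongr
    refine Seminorm.finset_sup_apply_le (by have := Finset.sum_nonneg (s := s) fun p _ => hB0 p; positivity) fun p hp => ?_
    refine (hB p _ (mul_nonpos_of_nonneg_of_nonpos hj.le ht)).trans ?_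
    gcongr
    exact Finset.single_le_sum (fun p _ => hB0 p) hp
  calc _ ≤ (2 : ℝ) ^ (j * α) * (C * ((∑ p ∈ s, B p) * Real.exp ((2 : ℝ) ^ j * t / 2))) := by gcongr
    _ = (C * (∑ p ∈ s, B p)) * (2 : ℝ) ^ (j * α) * Real.exp ((2 : ℝ) ^ j * t / 2) := by ring
    _ ≤ _ := by gcongr; linarith

end DirichletNeumann

end

noncomputable section

namespace DirichletNeumann

variable {d : ℕ}

/-! ### The sup norm -/

/-- The sup norm with values in `[0, ∞]`. -/
def sn (g : E d → ℝ) : ℝ≥0∞ := ⨆ x, ‖g x‖ₑ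

theorem enorm_le_sn (g : E d → ℝ) (x : E d) : ‖g x‖ₑ ≤ sn g := le_iSup (fun x => ‖g x‖ₑ) x

theorem sn_le {g : E d → ℝ} {M : ℝ≥0∞} (h : ∀ x, ‖g x‖ₑ ≤ M) : sn g ≤ M := iSup_le h

theorem sn_le_ofReal {g : E d → ℝ} {M : ℝ} (h : ∀ x, |g x| ≤ M) : sn g ≤ ENNReal.ofReal M :=
  sn_le fun x => by
    rw [Real.enorm_eq_ofReal_abs]
    exact ENNReal.ofReal_le_ofReal (h x)

theorem abs_le_of_sn {g : E d → ℝ} (h : sn g ≠ ⊤) (x : E d) : |g x| ≤ (sn g).toReal := by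
  rw [← Real.norm_eq_abs, ← toReal_enorm]
  exact ENNReal.toReal_mono h (enorm_le_sn g x)

theorem sn_congr {g h : E d → ℝ} (hgh : ∀ x, g x = h x) : sn g = sn h := by
  rw [show g = h from funext hgh]

theorem sn_zero : sn (fun _ : E d => (0 : ℝ)) = 0 := by simp [sn]

theorem sn_add_le (g h : E d → ℝ) : sn (fun x => g x + h x) ≤ sn g + sn h :=
  sn_le fun x => (enorm_add_le _ _).trans (add_le_add (enorm_le_sn g x) (enorm_le_sn h x))

theorem sn_sub_le (g h : E d → ℝ) : sn (fun x => g x - h x) ≤ sn g + sn h :=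
  sn_le fun x => (enorm_sub_le).trans (add_le_add (enorm_le_sn g x) (enorm_le_sn h x))

theorem sn_neg (g : E d → ℝ) : sn (fun x => - g x) = sn g := by simp [sn]

theorem sn_const_mul (c : ℝ) (g : E d → ℝ) : sn (fun x => c * g x) = ‖c‖ₑ * sn g := by
  simp only [sn, enorm_mul, ENNReal.mul_iSup]

theorem sn_mul_le (g h : E d → ℝ) : sn (fun x => g x * h x) ≤ sn g * sn h :=
  sn_le fun x => by
    rw [enorm_mul]
    exact mul_le_mul' (enorm_le_sn g x) (enorm_le_sn h x)

theorem sn_sum_le {ι : Type*} (s : Finset ι) (g : ι → E d → ℝ) :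
    sn (fun x => ∑ i ∈ s, g i x) ≤ ∑ i ∈ s, sn (g i) :=
  sn_le fun x => (enorm_sum_le _ _).trans (Finset.sum_le_sum fun i _ => enorm_le_sn (g i) x)

theorem enorm_tsum_le_real {ι : Type*} (f : ι → ℝ) : ‖∑' i, f i‖ₑ ≤ ∑' i, ‖f i‖ₑ := by
  by_cases h : Summable fun i => ‖f i‖
  · rw [← ofReal_norm]
    refine (ENNReal.ofReal_le_ofReal (norm_tsum_le_tsum_norm h)).trans ?_
    rw [ENNReal.ofReal_tsum_of_nonneg (fun _ => norm_nonneg _) h]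
    simp only [ofReal_norm, le_refl]
  · rw [tsum_eq_zero_of_not_summable (by rwa [← summable_norm_iff])]
    simp

theorem summable_of_tsum_enorm {ι : Type*} {f : ι → ℝ} (h : ∑' i, ‖f i‖ₑ ≠ ⊤) : Summable f := by
  rw [← summable_norm_iff]
  have := ENNReal.summable_toReal h
  simpa using this

theorem sn_tsum_le {ι : Type*} (g : ι → E d → ℝ) :
    sn (fun x => ∑' i, g i x) ≤ ∑' i, sn (g i) :=
  sn_le fun x => (enorm_tsum_le_real _).trans (ENNReal.tsum_le_tsum fun i => enorm_le_sn (g i) x)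

theorem lintegral_enorm_ker (a : 𝓢(E d, ℂ)) : ∫⁻ y, ‖ker a y‖ₑ = ENNReal.ofReal (kerNorm a) := by
  rw [kerNorm, ofReal_integral_eq_lintegral_ofReal (integrable_ker a).abs
    (Eventually.of_forall fun _ => abs_nonneg _)]
  simp only [Real.enorm_eq_ofReal_abs]

theorem sn_cv_le (a : 𝓢(E d, ℂ)) (g : E d → ℝ) :
    sn (cv a g) ≤ ENNReal.ofReal (kerNorm a) * sn g := sn_le fun x => by
  rw [cv_eq_integral, ← lintegral_enorm_ker, ← lintegral_mul_const _
    (continuous_ker a).measurable.enorm]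
  refine (enorm_integral_le_lintegral_enorm _).trans (lintegral_mono fun y => ?_)
  rw [enorm_mul]
  gcongr
  exact enorm_le_sn g _

theorem measurable_cv (a : 𝓢(E d, ℂ)) {g : E d → ℝ} (hg : Measurable g) : Measurable (cv a g) := by
  refine (StronglyMeasurable.integral_prod_right (f := fun x y => ker a (x - y) * g y)
    (Measurable.stronglyMeasurable ?_)).measurable
  exact ((continuous_ker a).comp (continuous_fst.sub continuous_snd)).measurable.mul
    (hg.comp measurable_snd)

theorem LinGrowth.cv {g : E d → ℝ} (hg : LinGrowth g) (a : 𝓢(E d, ℂ)) : LinGrowth (cv a g) := by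
  refine ⟨measurable_cv a hg.1, ?_⟩
  obtain ⟨-, C, hC, hb⟩ := hg
  refine ⟨C * ∫ y, |ker a y| * (1 + ‖y‖) ^ 1, mul_nonneg hC
    (integral_nonneg fun y => by positivity), fun x => ?_⟩
  rw [cv_eq_integral, ← Real.norm_eq_abs]
  refine (norm_integral_le_of_norm_le (((integrable_ker_mul_pow a 1).const_mul C).mul_const
    (1 + ‖x‖)) (Eventually.of_forall fun y => ?_)).trans ?_
  · rw [Real.norm_eq_abs, abs_mul]
    calc |ker a y| * |g (x - y)| ≤ |ker a y| * (C * ((1 + ‖x‖) * (1 + ‖y‖))) := by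
          gcongr
          refine (hb _).trans ?_
          gcongr
          simpa using one_add_norm_le_mul x (x - y)
      _ = _ := by ring
  · rw [integral_mul_const, integral_const_mul]

theorem continuous_cv (a : 𝓢(E d, ℂ)) {g : E d → ℝ} (hg : Measurable g) {M : ℝ}
    (hM : ∀ x, |g x| ≤ M) : Continuous (cv a g) :=
  continuous_iff_continuousAt.mpr fun x => (hasFDerivAt_cv a hg hM x).continuousAt

/-! ### Bounds for the blocks -/

variable (φ : LittlewoodPaley d)

/-- The kernels of m(D)e^{t|D|} on the three blocks next to j are applied to n(D)Δ̇_j g. Passing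
from i to j costs at most 2^|α| in the homogeneity and, since 2^i ≥ 2^j/2, half of the exponential
rate, which is why 1/4 replaces 1/2. -/
theorem exists_sn_sig_expD_mul_le {m : Symbol d} {α : ℤ} (hm : m.IsHom α) (hr : m.IsReal) :
    ∃ C, 0 < C ∧ ∀ (n : Symbol d), n.IsReal → ∀ t ≤ 0, ∀ (j : ℤ) (g : E d → ℝ), LinGrowth g →
      sn (cv (sig φ (m * Symbol.expD t * n) j) g) ≤
        ENNReal.ofReal (C * (2 : ℝ) ^ (j * α) * Real.exp ((2 : ℝ) ^ j * t / 4)) *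
          sn (cv (sig φ n j) g) := by
  obtain ⟨C, hC, h⟩ := exists_kerNorm_sig_le φ hm
  refine ⟨C * 3 * 2 ^ |α|, by positivity, fun n hn t ht j g hg => ?_⟩
  rw [sn_congr (fun x => cv_sig_mul φ (hr.mul (.expD t)) hn j hg x)]
  refine (sn_sum_le _ _).trans ?_
  have key : ∀ i ∈ Finset.Icc (j - 1) (j + 1),
      sn (cv (sig φ (m * Symbol.expD t) i) (cv (sig φ n j) g)) ≤
      ENNReal.ofReal (C * 2 ^ |α| * (2 : ℝ) ^ (j * α) * Real.exp ((2 : ℝ) ^ j * t / 4)) *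
          sn (cv (sig φ n j) g) := by
    intro i hi
    refine (sn_cv_le _ _).trans ?_
    gcongr
    refine (h t ht i).trans ?_
    rw [Finset.mem_Icc] at hi
    have e1 : (2 : ℝ) ^ (i * α) ≤ 2 ^ |α| * 2 ^ (j * α) := by
      rw [← zpow_add₀ (by norm_num)]
      refine zpow_le_zpow_right₀ (by norm_num) ?_
      have : (i - j) * α ≤ |α| := by
        refine (le_abs_self _).trans ?_
        rw [abs_mul]
        have : |i - j| ≤ 1 := by rw [abs_le]; lia
        nlinarith [abs_nonneg α]
      linarith
    have e2 : Real.exp ((2 : ℝ) ^ i * t / 2) ≤ Real.exp ((2 : ℝ) ^ j * t / 4) := by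
      apply Real.exp_le_exp.mpr
      have h3 : (2 : ℝ) ^ j ≤ 2 * 2 ^ i := by
        rw [mul_comm, ← zpow_add_one₀ (by norm_num)]
        exact zpow_le_zpow_right₀ (by norm_num) (by lia)
      nlinarith
    calc C * (2 : ℝ) ^ (i * α) * Real.exp ((2 : ℝ) ^ i * t / 2)
        ≤ C * (2 ^ |α| * 2 ^ (j * α)) * Real.exp ((2 : ℝ) ^ j * t / 4) := by gcongr
      _ = _ := by ring
  refine (Finset.sum_le_sum key).trans ?_
  rw [Finset.sum_const, Int.card_Icc, nsmul_eq_mul, ← mul_assoc]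
  gcongr
  rw [show (j + 1 + 1 - (j - 1)).toNat = 3 by lia, ← ENNReal.ofReal_natCast,
    ← ENNReal.ofReal_mul (by positivity)]
  apply ENNReal.ofReal_le_ofReal
  apply le_of_eq
  push_cast
  ring

theorem exists_sn_sig_expD_le {m : Symbol d} {α : ℤ} (hm : m.IsHom α) (hr : m.IsReal) :
    ∃ C, 0 < C ∧ ∀ t ≤ 0, ∀ (j : ℤ) (g : E d → ℝ), LinGrowth g →
      sn (cv (sig φ (m * Symbol.expD t) j) g) ≤
        ENNReal.ofReal (C * (2 : ℝ) ^ (j * α) * Real.exp ((2 : ℝ) ^ j * t / 4)) *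
          sn (cv (sig φ 1 j) g) := by
  obtain ⟨C, hC, h⟩ := exists_sn_sig_expD_mul_le φ hm hr
  exact ⟨C, hC, fun t ht j g hg => by simpa only [Symbol.mul_one'] using h 1 .one t ht j g hg⟩

theorem Symbol.mul_expD_zero (m : Symbol d) : m * Symbol.expD 0 = m :=
  Symbol.ext' fun ξ => by simp [Symbol.expD]

theorem exists_sn_sig_le {m : Symbol d} {α : ℤ} (hm : m.IsHom α) (hr : m.IsReal) :
    ∃ C, 0 < C ∧ ∀ (j : ℤ) (g : E d → ℝ), LinGrowth g →
      sn (cv (sig φ m j) g) ≤ ENNReal.ofReal (C * (2 : ℝ) ^ (j * α)) * sn (cv (sig φ 1 j) g) := by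
  obtain ⟨C, hC, h⟩ := exists_sn_sig_expD_le φ hm hr
  refine ⟨C, hC, fun j g hg => ?_⟩
  have := h 0 le_rfl j g hg
  simpa [Symbol.mul_expD_zero] using this

theorem exists_kerNorm_sig_le' {m : Symbol d} {α : ℤ} (hm : m.IsHom α) :
    ∃ C, 0 < C ∧ ∀ j : ℤ, kerNorm (sig φ m j) ≤ C * (2 : ℝ) ^ (j * α) := by
  obtain ⟨C, hC, h⟩ := exists_kerNorm_sig_le φ hm
  refine ⟨C, hC, fun j => ?_⟩
  have := h 0 le_rfl j
  simpa [Symbol.mul_expD_zero] using this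

/-! ### Dependence on time -/

/-- The factor e^{t|ξ|} does not enlarge the support, so for all t the kernel is an integral over
one fixed compact set of a jointly continuous integrand. This gives the joint measurability needed
for every time integral below. -/
theorem continuous_ker_expD (m : Symbol d) (j : ℤ) :
    Continuous fun p : ℝ × E d => ker (sig φ (m * Symbol.expD p.1) j) p.2 := by
  have hc : HasCompactSupport (sig φ m j) := hasCompactSupport_sig φ m j
  have h : ∀ p : ℝ × E d, ker (sig φ (m * Symbol.expD p.1) j) p.2 =
      (∫ ξ in tsupport (sig φ m j), Complex.exp (((2 * Real.pi * inner ℝ ξ p.2 : ℝ) : ℂ) * Complex.I) *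
        (Real.exp (p.1 * ‖(2 * Real.pi) • ξ‖) • sig φ m j ξ)).re := by
    intro p
    rw [ker_eq_integral, setIntegral_eq_integral_of_forall_compl_eq_zero]
    · simp only [sig_mul_expD]
    · intro ξ hξ
      rw [image_eq_zero_of_notMem_tsupport hξ]
      simp
  simp only [h]
  refine Complex.continuous_re.comp (continuous_parametric_integral_of_continuous ?_ hc)
  have := (sig φ m j).continuous
  simp only [Function.uncurry_def]
  fun_prop

/-- Under the Fourier integral this is e^{tλ} - 1 = ∫_0^t λ e^{sλ} ds with λ = |2πξ|. It exhibits
the factor |D| gained by subtracting 1, which makes the low frequencies summable. -/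
theorem ker_expDSubOne (t : ℝ) (j : ℤ) (x : E d) :
    ker (sig φ (Symbol.expDSubOne t) j) x =
      ∫ s in (0 : ℝ)..t, ker (sig φ (Symbol.absD * Symbol.expD s) j) x := by
  have hF : ∀ s, ker (sig φ (Symbol.absD * Symbol.expD s) j) x =
      ∫ ξ, (Complex.exp (((2 * Real.pi * inner ℝ ξ x : ℝ) : ℂ) * Complex.I) *
        (Real.exp (s * ‖(2 * Real.pi) • ξ‖) • sig φ Symbol.absD j ξ)).re := by
    intro s
    rw [ker_eq_integral]
    have hi : Integrable fun ξ => Complex.exp (((2 * Real.pi * inner ℝ ξ x : ℝ) : ℂ) * Complex.I) *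
        sig φ (Symbol.absD * Symbol.expD s) j ξ := by
      refine (sig φ (Symbol.absD * Symbol.expD s) j).integrable.bdd_mul (c := 1)
        (Continuous.aestronglyMeasurable (by fun_prop)) (Eventually.of_forall fun ξ => ?_)
      rw [Complex.norm_exp_ofReal_mul_I]
    have := integral_re hi
    simp only [RCLike.re_to_complex] at this
    rw [← this]
    simp only [sig_mul_expD]
  have hG : ∀ ξ : E d, ∫ s in (0 : ℝ)..t, Real.exp (s * ‖(2 * Real.pi) • ξ‖) * ‖(2 * Real.pi) • ξ‖ =
      Real.exp (t * ‖(2 * Real.pi) • ξ‖) - 1 := by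
    intro ξ
    have hd : ∀ s ∈ Set.uIcc 0 t, HasDerivAt (fun s => Real.exp (s * ‖(2 * Real.pi) • ξ‖))
        (Real.exp (s * ‖(2 * Real.pi) • ξ‖) * ‖(2 * Real.pi) • ξ‖) s := by
      intro s _
      simpa using ((hasDerivAt_id s).mul_const ‖(2 * Real.pi) • ξ‖).exp
    rw [intervalIntegral.integral_eq_sub_of_hasDerivAt hd
      (Continuous.intervalIntegrable (by fun_prop) _ _)]
    simp
  simp only [hF]
  have hcs := (sig φ Symbol.absD j).continuous
  have hcomp : HasCompactSupport (sig φ (Symbol.absD : Symbol d) j) :=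
    hasCompactSupport_sig φ Symbol.absD j
  have hcont : Continuous fun p : ℝ × E d =>
      (Complex.exp (((2 * Real.pi * inner ℝ p.2 x : ℝ) : ℂ) * Complex.I) *
        (Real.exp (p.1 * ‖(2 * Real.pi) • p.2‖) • sig φ Symbol.absD j p.2)).re := by fun_prop
  rw [intervalIntegral_integral_swap]
  · rw [ker_eq_integral]
    have hi : Integrable fun ξ => Complex.exp (((2 * Real.pi * inner ℝ ξ x : ℝ) : ℂ) * Complex.I) *
        sig φ (Symbol.expDSubOne t) j ξ := by
      refine (sig φ (Symbol.expDSubOne t) j).integrable.bdd_mul (c := 1)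
        (Continuous.aestronglyMeasurable (by fun_prop)) (Eventually.of_forall fun ξ => ?_)
      rw [Complex.norm_exp_ofReal_mul_I]
    have := integral_re hi
    simp only [RCLike.re_to_complex] at this
    rw [← this]
    refine integral_congr_ae (Eventually.of_forall fun ξ => ?_)
    simp only
    set e := Complex.exp (((2 * Real.pi * inner ℝ ξ x : ℝ) : ℂ) * Complex.I)
    have h1 : ∀ s : ℝ, (e * (Real.exp (s * ‖(2 * Real.pi) • ξ‖) • sig φ Symbol.absD j ξ)).re =
        (Real.exp (s * ‖(2 * Real.pi) • ξ‖) * ‖(2 * Real.pi) • ξ‖) * (e * (phi φ j ξ : ℝ)).re := by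
      intro s
      rw [sig_apply, ← Complex.re_ofReal_mul, Complex.real_smul]
      simp only [Symbol.absD]
      congr 1
      push_cast
      ring
    simp only [h1]
    rw [intervalIntegral.integral_mul_const, hG, sig_apply, ← Complex.re_ofReal_mul]
    simp only [Symbol.expDSubOne, Symbol.expD]
    congr 1
    push_cast
    ring
  · refine Integrable.mono_measure (ν := (volume.restrict (Set.uIcc 0 t)).prod
      (volume : Measure (E d))) ?_ (Measure.prod_mono (Measure.restrict_mono
        Set.uIoc_subset_uIcc le_rfl) le_rfl)
    have hK : IsCompact (Set.uIcc 0 t ×ˢ tsupport (sig φ (Symbol.absD : Symbol d) j)) :=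
      isCompact_uIcc.prod hcomp
    have h1 := hcont.continuousOn.integrableOn_compact (μ := volume.prod volume) hK
    rw [← Measure.restrict_univ (μ := (volume : Measure (E d))), Measure.prod_restrict]
    refine IntegrableOn.of_forall_sdiff_eq_zero h1 (isCompact_uIcc.measurableSet.prod .univ) ?_
    rintro ⟨s, ξ⟩ ⟨hs, hξ⟩
    have : ξ ∉ tsupport (sig φ (Symbol.absD : Symbol d) j) := fun h => hξ ⟨hs.1, h⟩
    simp only [Function.uncurry]
    rw [image_eq_zero_of_notMem_tsupport this]
    simp

theorem measurable_cv_expD (m : Symbol d) (j : ℤ) {g : E d → ℝ} (hg : Measurable g) :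
    Measurable fun p : ℝ × E d => cv (sig φ (m * Symbol.expD p.1) j) g p.2 := by
  refine (StronglyMeasurable.integral_prod_right (f := fun (p : ℝ × E d) y =>
    ker (sig φ (m * Symbol.expD p.1) j) (p.2 - y) * g y)
    (Measurable.stronglyMeasurable ?_)).measurable
  refine Measurable.mul ?_ (hg.comp measurable_snd)
  have := (continuous_ker_expD φ m j).measurable
  exact this.comp (by fun_prop : Measurable fun q : (ℝ × E d) × E d => (q.1.1, q.1.2 - q.2))

theorem cv_expDSubOne_of_bounded (t : ℝ) (ht : t ≤ 0) (j : ℤ) {g : E d → ℝ} (hg : Measurable g)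
    {M : ℝ} (hM : ∀ x, |g x| ≤ M) (x : E d) :
    cv (sig φ (Symbol.expDSubOne t) j) g x =
      ∫ s in (0 : ℝ)..t, cv (sig φ (Symbol.absD * Symbol.expD s) j) g x := by
  simp only [cv]
  rw [intervalIntegral_integral_swap]
  · refine integral_congr_ae (Eventually.of_forall fun y => ?_)
    simp only
    rw [intervalIntegral.integral_mul_const, ker_expDSubOne]
  · have hcont : Continuous fun p : ℝ × E d =>
        ker (sig φ (Symbol.absD * Symbol.expD p.1) j) (x - p.2) :=
      (continuous_ker_expD φ Symbol.absD j).comp (by fun_prop : Continuous fun p : ℝ × E d =>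
        (p.1, x - p.2))
    have hm : Measurable fun p : ℝ × E d =>
        ker (sig φ (Symbol.absD * Symbol.expD p.1) j) (x - p.2) * g p.2 :=
      hcont.measurable.mul (hg.comp measurable_snd)
    obtain ⟨C, hC, hk⟩ := exists_kerNorm_sig_le φ (m := (Symbol.absD : Symbol d)) .absD
    have hM0 : 0 ≤ M := (abs_nonneg _).trans (hM 0)
    refine (integrable_prod_iff hm.aestronglyMeasurable).mpr ⟨?_, ?_⟩
    · exact Eventually.of_forall fun s =>
        (LinGrowth.of_bounded hg hM).integrable (sig φ (Symbol.absD * Symbol.expD s) j) x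
    · have : IsFiniteMeasure (volume.restrict (Set.uIoc 0 t)) :=
        ⟨by simp [Set.uIoc]⟩
      refine Integrable.of_bound (C := C * (2 : ℝ) ^ (j * 1) * M) ?_ ?_
      · exact (StronglyMeasurable.integral_prod_right
          (f := fun s y => ‖ker (sig φ (Symbol.absD * Symbol.expD s) j) (x - y) * g y‖)
          hm.norm.stronglyMeasurable).aestronglyMeasurable
      · filter_upwards [ae_restrict_mem measurableSet_uIoc] with s hs
        rw [Set.uIoc_of_ge ht] at hs
        rw [Real.norm_of_nonneg (integral_nonneg fun _ => norm_nonneg _)]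
        have h1 : ∫ y, ‖ker (sig φ (Symbol.absD * Symbol.expD s) j) (x - y) * g y‖ ≤
            kerNorm (sig φ (Symbol.absD * Symbol.expD s) j) * M := by
          rw [kerNorm, ← integral_mul_const, ← integral_sub_left_eq_self (fun y => |ker _ y| * M) _ x]
          refine integral_mono ?_ (((integrable_ker _).abs.mul_const M).comp_sub_left x) fun y => ?_
          · exact ((LinGrowth.of_bounded hg hM).integrable _ x).norm
          · simp only [norm_mul, Real.norm_eq_abs]
            gcongr
            exact hM y
        refine h1.trans ?_
        gcongr
        refine (hk s hs.2 j).trans ?_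
        have : Real.exp ((2 : ℝ) ^ j * s / 2) ≤ 1 := by
          rw [Real.exp_le_one_iff]
          have : (0 : ℝ) < 2 ^ j := by positivity
          nlinarith [hs.2]
        exact mul_le_of_le_one_right (by positivity) this

/-- `(e^{t|D|} - 1) Δ̇_j g = ∫_0^t |D| e^{s|D|} Δ̇_j g ds`. -/
theorem cv_expDSubOne (t : ℝ) (ht : t ≤ 0) (j : ℤ) {g : E d → ℝ} (hg : LinGrowth g)
    (hb : sn (cv (sig φ 1 j) g) ≠ ⊤) (x : E d) :
    cv (sig φ (Symbol.expDSubOne t) j) g x =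
      ∫ s in (0 : ℝ)..t, cv (sig φ (Symbol.absD * Symbol.expD s) j) g x := by
  have hM := abs_le_of_sn hb
  have hm := measurable_cv (sig φ 1 j) hg.1
  -- The function g may grow linearly, but its block Δ̇_j g is bounded; the three-block formula
  -- reduces to the bounded case.
  have h1 : ∀ s, cv (sig φ (Symbol.absD * Symbol.expD s) j) g x = _ :=
    fun s => cv_sig_eq_sum φ (.mul .absD (.expD s)) j hg x
  simp only [h1]
  rw [intervalIntegral.integral_finsetSum]
  · rw [cv_sig_eq_sum φ (.expDSubOne t) j hg]
    exact Finset.sum_congr rfl fun i _ => cv_expDSubOne_of_bounded φ t ht i hm hM x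
  · intro i _
    obtain ⟨C, hC, hk⟩ := exists_kerNorm_sig_le φ (m := (Symbol.absD : Symbol d)) .absD
    rw [intervalIntegrable_iff]
    refine Measure.integrableOn_of_bounded (M := C * (2 : ℝ) ^ (i * 1) *
      (sn (cv (sig φ 1 j) g)).toReal) (by simp [Set.uIoc])
      ((measurable_cv_expD φ Symbol.absD i hm).comp
      (by fun_prop : Measurable fun s : ℝ => (s, x))).aestronglyMeasurable ?_
    filter_upwards [ae_restrict_mem measurableSet_uIoc] with s hs
    rw [Set.uIoc_of_ge ht] at hs
    refine (abs_cv_le hM x).trans ?_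
    gcongr
    refine (hk s hs.2 i).trans ?_
    have : Real.exp ((2 : ℝ) ^ i * s / 2) ≤ 1 := by
      rw [Real.exp_le_one_iff]
      have : (0 : ℝ) < 2 ^ i := by positivity
      nlinarith [hs.2]
    exact mul_le_of_le_one_right (by positivity) this

end DirichletNeumann

end

/-! ### Gradients, low frequency cut-off, and the product estimate. -/

noncomputable section

namespace DirichletNeumann

variable {d : ℕ}

/-! ### Gradient bounds -/

/-- A bound for the `L¹` norm of the gradient of the kernel. -/
def gradNorm (a : 𝓢(E d, ℂ)) : ℝ := ∑ k : Fin d, kerNorm (dirS (EuclideanSpace.single k 1) a)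

theorem norm_sum_smul_proj_le (c : Fin d → ℝ) :
    ‖∑ k : Fin d, c k • (EuclideanSpace.proj k : E d →L[ℝ] ℝ)‖ ≤ ∑ k, |c k| := by
  refine (norm_sum_le _ _).trans (Finset.sum_le_sum fun k _ => ?_)
  rw [norm_smul, Real.norm_eq_abs]
  refine mul_le_of_le_one_right (abs_nonneg _) ?_
  refine ContinuousLinearMap.opNorm_le_bound _ zero_le_one fun x => ?_
  rw [one_mul]
  exact PiLp.norm_apply_le x k

theorem abs_cv_sub_le (a : 𝓢(E d, ℂ)) {g : E d → ℝ} (hg : Measurable g) {M : ℝ}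
    (hM : ∀ x, |g x| ≤ M) (x y : E d) :
    |cv a g x - cv a g y| ≤ gradNorm a * M * ‖x - y‖ := by
  have h := Convex.norm_image_sub_le_of_norm_hasFDerivWithin_le (𝕜 := ℝ) (s := Set.univ)
    (fun x _ => (hasFDerivAt_cv a hg hM x).hasFDerivWithinAt) (C := gradNorm a * M) ?_
    convex_univ (Set.mem_univ y) (Set.mem_univ x)
  · simpa using h
  · intro z _
    refine (norm_sum_smul_proj_le _).trans ?_
    rw [gradNorm, Finset.sum_mul]
    exact Finset.sum_le_sum fun k _ => abs_cv_le hM z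

theorem gradNorm_dilS {c : ℝ} (hc : 0 < c) (a : 𝓢(E d, ℂ)) :
    gradNorm (dilS c hc.ne' a) = c⁻¹ * gradNorm a := by
  rw [gradNorm, gradNorm, Finset.mul_sum]
  refine Finset.sum_congr rfl fun k _ => ?_
  have : dirS (EuclideanSpace.single k 1) (dilS c hc.ne' a) =
      ((c⁻¹ : ℝ) : ℂ) • dilS c hc.ne' (dirS (EuclideanSpace.single k 1) a) := by
    ext ξ
    have hc' : (c : ℂ) ≠ 0 := by exact_mod_cast hc.ne'
    simp only [dirS_apply, dilS_apply, smul_apply, inner_smul_left, smul_eq_mul]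
    simp
    field_simp
  rw [this, kerNorm_smul, kerNorm_dilS hc, abs_of_pos (by positivity)]

variable (φ : LittlewoodPaley d)

theorem dirS_sig (m : Symbol d) (k : Fin d) (j : ℤ) :
    dirS (EuclideanSpace.single k 1) (sig φ m j) =
      sig φ (m * (Symbol.absD * Symbol.riesz k)) j := by
  ext ξ
  rw [dirS_apply, sig_apply, sig_apply]
  by_cases hξ : ξ = 0
  · subst hξ
    simp [phi_zero]
  have h2 : ((‖ξ‖ : ℝ) : ℂ) ≠ 0 := by simpa using hξ
  have hpi : (Real.pi : ℂ) ≠ 0 := by simp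
  simp only [Symbol.mul_toFun, Symbol.absD, Symbol.riesz, norm_smul, EuclideanSpace.inner_single_right]
  simp
  rw [abs_of_pos Real.pi_pos]
  field_simp

/-! ### The low frequency cut-off -/

theorem contDiff_phi (j : ℤ) : ContDiff ℝ ∞ (phi φ j) :=
  φ.smooth.comp ((contDiff_const_smul _).comp (contDiff_const_smul _))

theorem phi_succ (ξ : E d) (j : ℤ) : phi φ j ((2 : ℝ)⁻¹ • ξ) = phi φ (j + 1) ξ := by
  simp only [phi]
  rw [smul_comm _ ((2 : ℝ)⁻¹), smul_smul, neg_add, zpow_add₀ (by norm_num : (2 : ℝ) ≠ 0)]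
  simp

theorem phi_eq_zero_of_lt {j : ℤ} {ξ : E d} (h : 2 * Real.pi * ‖ξ‖ < 3 / 4 * (2 : ℝ) ^ j) :
    phi φ j ξ = 0 := by
  by_contra h0
  linarith [(phi_support φ h0).1]

theorem phi_eq_zero_of_gt {j : ℤ} {ξ : E d} (h : 8 / 3 * (2 : ℝ) ^ j < 2 * Real.pi * ‖ξ‖) :
    phi φ j ξ = 0 := by
  by_contra h0
  linarith [(phi_support φ h0).2]

/-- For frequencies strictly between 4/3 and 3 the blocks of index at least 2 start too high, at 3,
and those of index at most -1 end too low, at 4/3. -/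
theorem phi_zero_add_phi_one {ξ : E d} (h1 : 4 / 3 < 2 * Real.pi * ‖ξ‖)
    (h2 : 2 * Real.pi * ‖ξ‖ < 3) : phi φ 0 ξ + phi φ 1 ξ = 1 := by
  have hξ : ξ ≠ 0 := by
    rintro rfl
    simp at h1
    linarith
  have h : HasSum (fun j : ℤ => phi φ j ξ) (∑ j ∈ ({0, 1} : Finset ℤ), phi φ j ξ) := by
    refine hasSum_sum_of_ne_finset_zero fun j hj => ?_
    simp only [Finset.mem_insert, Finset.mem_singleton, not_or] at hj
    rcases le_or_gt 2 j with h3 | h3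
    · apply phi_eq_zero_of_lt
      have : (2 : ℝ) ^ (2 : ℤ) ≤ 2 ^ j := zpow_le_zpow_right₀ (by norm_num) h3
      norm_num at this
      linarith
    · apply phi_eq_zero_of_gt
      have : (2 : ℝ) ^ j ≤ 2 ^ (-1 : ℤ) := zpow_le_zpow_right₀ (by norm_num) (by lia)
      norm_num at this
      linarith
  have := h.unique (hasSum_phi φ hξ)
  simpa using this

/-- The low frequency cut-off `∑_{j < 0} φ(2^{-j} 2πξ)`, extended by `1` at the origin. -/
def lowFun (ξ : E d) : ℝ := if 2 * Real.pi * ‖ξ‖ < 3 / 2 then 1 - phi φ 0 ξ else 0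

theorem lowFun_eq_zero {ξ : E d} (h : 4 / 3 < 2 * Real.pi * ‖ξ‖) : lowFun φ ξ = 0 := by
  rw [lowFun]
  split_ifs with h2
  · have h3 : phi φ 1 ξ = 0 := phi_eq_zero_of_lt φ (by norm_num; linarith)
    have := phi_zero_add_phi_one φ h (by linarith)
    linarith
  · rfl

/-- This is the relation Ṡ_1 = Ṡ_0 + Δ̇_0 on the level of symbols. In each case of the piecewise
definition it follows from φ_1 = 0 below 3/2, φ_0 + φ_1 = 1 on (4/3, 3), or φ_0 = 0 above 8/3. -/
theorem lowFun_half (ξ : E d) : lowFun φ ((2 : ℝ)⁻¹ • ξ) = lowFun φ ξ + phi φ 0 ξ := by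
  have hn : 2 * Real.pi * ‖(2 : ℝ)⁻¹ • ξ‖ = (2 * Real.pi * ‖ξ‖) / 2 := by
    rw [norm_smul]
    norm_num
    ring
  rw [lowFun, lowFun, hn, phi_succ, zero_add]
  split_ifs with h1 h2 h2
  · have : phi φ 1 ξ = 0 := phi_eq_zero_of_lt φ (by norm_num; linarith)
    linarith
  · have := phi_zero_add_phi_one φ (ξ := ξ) (by linarith) (by linarith)
    linarith
  · linarith
  · have : phi φ 0 ξ = 0 := phi_eq_zero_of_gt φ (by norm_num; linarith)
    linarith

/-- The formulas 1 - φ_0 and 0 agree on the overlap between 4/3 and 3/2, so near every point one of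
two smooth expressions is valid, including near the origin. -/
theorem contDiff_lowFun : ContDiff ℝ ∞ (lowFun φ) := by
  rw [contDiff_iff_contDiffAt]
  intro ξ
  have hc : Continuous fun ξ : E d => 2 * Real.pi * ‖ξ‖ := by fun_prop
  rcases lt_or_ge (2 * Real.pi * ‖ξ‖) (3 / 2) with h | h
  · have : lowFun φ =ᶠ[𝓝 ξ] fun ξ => 1 - phi φ 0 ξ := by
      filter_upwards [(isOpen_lt hc continuous_const).mem_nhds h] with ζ hζ
      exact if_pos hζ
    exact (contDiff_const.sub (contDiff_phi φ 0)).contDiffAt.congr_of_eventuallyEq this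
  · have : lowFun φ =ᶠ[𝓝 ξ] fun _ => 0 := by
      filter_upwards [(isOpen_lt continuous_const hc).mem_nhds
        (show 4 / 3 < 2 * Real.pi * ‖ξ‖ by linarith)] with ζ hζ
      exact lowFun_eq_zero φ hζ
    exact contDiffAt_const.congr_of_eventuallyEq this

theorem hasCompactSupport_lowFun : HasCompactSupport fun ξ : E d => ((lowFun φ ξ : ℝ) : ℂ) := by
  refine HasCompactSupport.intro (isCompact_closedBall (0 : E d) (4 / 3)) fun ξ hξ => ?_
  rw [mem_closedBall_zero_iff, not_le] at hξ
  rw [lowFun_eq_zero, Complex.ofReal_zero]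
  nlinarith [Real.pi_gt_three]

/-- The symbol of the low frequency cut-off `Ṡ_J`. -/
def low (J : ℤ) : 𝓢(E d, ℂ) :=
  dilS ((2 : ℝ) ^ (-J)) (by positivity) ((hasCompactSupport_lowFun φ).toSchwartzMap
    (Complex.ofRealCLM.contDiff.comp (contDiff_lowFun φ)))

theorem low_apply (J : ℤ) (ξ : E d) : low φ J ξ = (lowFun φ ((2 : ℝ) ^ (-J) • ξ) : ℝ) := rfl

theorem herm_low (J : ℤ) : Herm (low φ J) := fun ξ => by
  have h : ∀ ζ : E d, lowFun φ (-ζ) = lowFun φ ζ := fun ζ => by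
    have : phi φ 0 (-ζ) = phi φ 0 ζ := φ.radial _ _ (by simp)
    simp only [lowFun, norm_neg, this]
  rw [low_apply, low_apply, smul_neg, h]
  simp

theorem low_eq_dilS (J : ℤ) : low φ J = dilS ((2 : ℝ) ^ (-J)) (by positivity) (low φ 0) := by
  ext ξ
  rw [dilS_apply, low_apply, low_apply]
  simp

theorem low_at_zero (J : ℤ) : low φ J 0 = 1 := by
  rw [low_apply, smul_zero, lowFun]
  simp [phi_zero]

theorem low_succ (J : ℤ) : low φ (J + 1) = low φ J + sig φ 1 J := by
  ext ξ
  have h1 : (2 : ℝ) ^ (-(J + 1)) • ξ = (2 : ℝ)⁻¹ • (2 : ℝ) ^ (-J) • ξ := by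
    rw [smul_smul, neg_add, zpow_add₀ (by norm_num : (2 : ℝ) ≠ 0), mul_comm]
    simp
  have h2 : phi φ 0 ((2 : ℝ) ^ (-J) • ξ) = phi φ J ξ := by
    simp only [phi]
    rw [smul_comm _ ((2 : ℝ) ^ (-J))]
    simp
  rw [add_apply, low_apply, low_apply, sig_apply, h1, lowFun_half, h2]
  simp

theorem low_support {J : ℤ} {ξ : E d} (h : low φ J ξ ≠ 0) :
    2 * Real.pi * ‖ξ‖ ≤ 4 / 3 * (2 : ℝ) ^ J := by
  by_contra hlt
  apply h
  rw [low_apply, lowFun_eq_zero, Complex.ofReal_zero]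
  rw [norm_smul, Real.norm_of_nonneg (by positivity), zpow_neg]
  have : (0 : ℝ) < 2 ^ J := by positivity
  rw [show 2 * Real.pi * (((2 : ℝ) ^ J)⁻¹ * ‖ξ‖) = (2 * Real.pi * ‖ξ‖) / 2 ^ J by field_simp,
    lt_div_iff₀ this]
  linarith

attribute [irreducible] low

theorem kerNorm_low (J : ℤ) : kerNorm (low φ J) = kerNorm (low φ 0) := by
  rw [low_eq_dilS, kerNorm_dilS (by positivity)]

theorem tendsto_two_zpow_neg : Tendsto (fun J : ℤ => (2 : ℝ) ^ (-J)) atTop (𝓝 0) := by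
  have h := (tendsto_rpow_atTop_of_base_lt_one (2 : ℝ)⁻¹ (by norm_num) (by norm_num)).comp
    (tendsto_intCast_atTop_atTop (R := ℝ))
  refine h.congr fun J => ?_
  simp

/-- The kernels of Ṡ_J form an approximate identity: after rescaling, the kernel is fixed, has
integral 1 because the symbol is 1 at the origin, and g is evaluated at points tending to x. -/
theorem tendsto_cv_low {g : E d → ℝ} (hc : Continuous g) {M : ℝ} (hM : ∀ x, |g x| ≤ M) (x : E d) :
    Tendsto (fun J : ℤ => cv (low φ J) g x) atTop (𝓝 (g x)) := by
  have h : ∀ J : ℤ, cv (low φ J) g x = ∫ u, ker (low φ 0) u * g (x - (2 : ℝ) ^ (-J) • u) := by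
    intro J
    set c : ℝ := (2 : ℝ) ^ (-J) with hcdef
    have hc0 : 0 < c := by positivity
    have := Measure.integral_comp_smul (volume : Measure (E d))
      (fun y => ker (low φ 0) (c⁻¹ • y) * g (x - y)) c
    rw [finrank_euclideanSpace, Fintype.card_fin, abs_of_pos (by positivity), smul_eq_mul,
      ← integral_const_mul] at this
    rw [cv_eq_integral, low_eq_dilS]
    change ∫ y, ker (dilS c hc0.ne' (low φ 0)) y * g (x - y) = _
    simp only [ker_dilS hc0, mul_assoc]
    rw [← this]
    refine integral_congr_ae (Eventually.of_forall fun u => ?_)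
    beta_reduce
    rw [smul_smul, inv_mul_cancel₀ hc0.ne', one_smul]
  simp only [h]
  have h1 : g x = ∫ u, ker (low φ 0) u * g x := by
    rw [integral_mul_const, integral_ker, low_at_zero]
    simp
  rw [h1]
  refine tendsto_integral_filter_of_dominated_convergence (fun u => |ker (low φ 0) u| * M)
    (Eventually.of_forall fun J => ?_) (Eventually.of_forall fun J => Eventually.of_forall fun u => ?_)
    ((integrable_ker _).abs.mul_const M) (Eventually.of_forall fun u => ?_)
  · exact ((continuous_ker _).mul (hc.comp (by fun_prop))).aestronglyMeasurable
  · rw [Real.norm_eq_abs, abs_mul]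
    gcongr
    exact hM _
  · refine Tendsto.const_mul _ ((hc.tendsto x).comp ?_)
    have h2 := tendsto_two_zpow_neg
    simpa using (tendsto_const_nhds (x := x)).sub (h2.smul_const u)

/-- The gradient of Ṡ_J g is O(2^J), so as J → -∞ the low frequency part becomes constant. Only
differences converge: a bounded function may have a constant at frequency zero. -/
theorem tendsto_cv_low_sub {g : E d → ℝ} (hg : Measurable g) {M : ℝ} (hM : ∀ x, |g x| ≤ M)
    (x : E d) : Tendsto (fun J : ℤ => cv (low φ J) g x - cv (low φ J) g 0) atBot (𝓝 0) := by
  have h2 : Tendsto (fun J : ℤ => (2 : ℝ) ^ J * gradNorm (low φ 0) * M * ‖x‖) atBot (𝓝 0) := by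
    have : Tendsto (fun J : ℤ => (2 : ℝ) ^ J) atBot (𝓝 0) := by
      have h4 := tendsto_two_zpow_neg.comp tendsto_neg_atBot_atTop
      simpa only [Function.comp_def, neg_neg] using h4
    simpa using ((this.mul_const _).mul_const M).mul_const ‖x‖
  refine squeeze_zero_norm (fun J => ?_) h2
  rw [Real.norm_eq_abs]
  refine (abs_cv_sub_le _ hg hM x 0).trans ?_
  rw [low_eq_dilS, gradNorm_dilS (by positivity), sub_zero, zpow_neg, inv_inv]

theorem sum_cv_sig (J : ℤ) (n : ℕ) {g : E d → ℝ} (hg : LinGrowth g) (x : E d) :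
    ∑ i ∈ Finset.range n, cv (sig φ 1 (J + i)) g x = cv (low φ (J + n)) g x - cv (low φ J) g x := by
  induction n with
  | zero => simp
  | succ n ih =>
    rw [Finset.sum_range_succ, ih]
    push_cast
    rw [← add_assoc, low_succ, cv_add_symbol hg]
    ring

/-- A bounded continuous function whose blocks are summable is realized by its blocks. -/
theorem hasSum_cv_sub {g : E d → ℝ} (hc : Continuous g) {M : ℝ} (hM : ∀ x, |g x| ≤ M) (x : E d)
    (hs : Summable fun j : ℤ => cv (sig φ 1 j) g x - cv (sig φ 1 j) g 0) :
    HasSum (fun j : ℤ => cv (sig φ 1 j) g x - cv (sig φ 1 j) g 0) (g x - g 0) := by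
  have hl := LinGrowth.of_bounded hc.measurable hM
  have h1 : Tendsto (fun n : ℕ => ∑ j ∈ Finset.Ico (-(n : ℤ)) n,
      (cv (sig φ 1 j) g x - cv (sig φ 1 j) g 0)) atTop
      (𝓝 (∑' j : ℤ, (cv (sig φ 1 j) g x - cv (sig φ 1 j) g 0))) := by
    refine hs.hasSum.comp (tendsto_atTop.mpr fun s => ?_)
    obtain ⟨N, hN⟩ : ∃ N : ℕ, ∀ j ∈ s, |j| < N := by
      refine ⟨(∑ j ∈ s, |j|).toNat + 1, fun j hj => ?_⟩
      have := Finset.single_le_sum (f := fun j : ℤ => |j|) (fun i _ => abs_nonneg i) hj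
      lia
    filter_upwards [eventually_ge_atTop N] with n hn
    intro j hj
    have := hN j hj
    rw [abs_lt] at this
    rw [Finset.mem_Ico]
    lia
  -- Symmetric partial sums telescope to Ṡ_n - Ṡ_{-n}. The first part tends to g and the differences
  -- of the second tend to 0; summability identifies the limit with the unconditional sum.
  have h2 : ∀ n : ℕ, ∑ j ∈ Finset.Ico (-(n : ℤ)) n,
      (cv (sig φ 1 j) g x - cv (sig φ 1 j) g 0) =
      (cv (low φ n) g x - cv (low φ n) g 0) - (cv (low φ (-n)) g x - cv (low φ (-n)) g 0) := by
    intro n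
    have h3 : Finset.Ico (-(n : ℤ)) n = (Finset.range (2 * n)).image fun i : ℕ => -(n : ℤ) + i := by
      ext j
      simp only [Finset.mem_Ico, Finset.mem_image, Finset.mem_range]
      constructor
      · rintro ⟨h1, h2⟩
        exact ⟨(j + n).toNat, by lia, by lia⟩
      · rintro ⟨i, hi, rfl⟩
        lia
    rw [h3, Finset.sum_image (by intro a _ b _ hab; simpa using hab), Finset.sum_sub_distrib,
      sum_cv_sig φ _ _ hl, sum_cv_sig φ _ _ hl]
    push_cast
    rw [show -(n : ℤ) + 2 * n = n by ring]
    ring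
  simp only [h2] at h1
  have hn : Tendsto (fun n : ℕ => (n : ℤ)) atTop atTop := tendsto_natCast_atTop_atTop
  have h4 := (((tendsto_cv_low φ hc hM x).comp hn).sub ((tendsto_cv_low φ hc hM 0).comp hn)).sub
    ((tendsto_cv_low_sub φ hc.measurable hM x).comp (tendsto_neg_atTop_atBot.comp hn))
  have h5 := tendsto_nhds_unique h1 h4
  rw [sub_zero] at h5
  rw [← h5]
  exact hs.hasSum

/-! ### Products -/

theorem integral_mul_cv {K : E d → ℝ} (hK : Integrable K) (a : 𝓢(E d, ℂ)) {g : E d → ℝ}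
    (hg : Measurable g) {M : ℝ} (hM : ∀ x, |g x| ≤ M) :
    ∫ y, K y * cv a g y = ∫ s, g s * ∫ y, K y * ker a (y - s) := by
  have h1 : ∀ y, K y * cv a g y = ∫ s, K y * (ker a (y - s) * g s) := fun y => by
    rw [cv, integral_const_mul]
  have h2 : ∀ s, g s * ∫ y, K y * ker a (y - s) = ∫ y, K y * (ker a (y - s) * g s) := fun s => by
    rw [← integral_const_mul]
    congr 1
    ext y
    ring
  simp only [h1, h2]
  refine integral_integral_swap ?_
  have hka := continuous_ker a
  have hm : AEStronglyMeasurable (fun p : E d × E d => K p.1 * (ker a (p.1 - p.2) * g p.2))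
      (volume.prod volume) := by
    refine hK.aestronglyMeasurable.comp_fst.mul (Measurable.aestronglyMeasurable ?_)
    exact (hka.comp (continuous_fst.sub continuous_snd)).measurable.mul (hg.comp measurable_snd)
  have hM0 : 0 ≤ M := (abs_nonneg _).trans (hM 0)
  refine (integrable_prod_iff hm).mpr ⟨?_, ?_⟩
  · exact Eventually.of_forall fun y =>
      ((LinGrowth.of_bounded hg hM).integrable a y).const_mul (K y)
  · refine Integrable.mono' (hK.norm.mul_const (kerNorm a * M)) hm.norm.integral_prod_right'
      (Eventually.of_forall fun y => ?_)
    rw [Real.norm_of_nonneg (integral_nonneg fun _ => norm_nonneg _)]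
    simp only [norm_mul]
    rw [integral_const_mul]
    gcongr
    rw [kerNorm, ← integral_mul_const, ← integral_sub_left_eq_self (fun y => |ker a y| * M) _ y]
    refine integral_mono ?_ (((integrable_ker _).abs.mul_const M).comp_sub_left y) fun s => ?_
    · simpa only [norm_mul] using ((LinGrowth.of_bounded hg hM).integrable a y).norm
    · simp only [Real.norm_eq_abs]
      gcongr
      exact hM s

theorem fourierInv_translate (f : 𝓢(E d, ℂ)) (s ξ : E d) :
    𝓕⁻ (SchwartzMap.compSubConstCLM ℂ s f) ξ =
      Complex.exp (((2 * Real.pi * inner ℝ s ξ : ℝ) : ℂ) * Complex.I) * 𝓕⁻ f ξ := by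
  rw [SchwartzMap.fourierInv_coe, SchwartzMap.fourierInv_coe, Real.fourierInv_eq',
    Real.fourierInv_eq', ← integral_const_mul]
  conv_rhs => rw [← integral_sub_right_eq_self _ s]
  refine integral_congr_ae (Eventually.of_forall fun y => ?_)
  simp only [smul_eq_mul, SchwartzMap.compSubConstCLM_apply]
  rw [← mul_assoc, ← Complex.exp_add, inner_sub_left]
  congr 2
  push_cast
  ring

theorem fourier_eq_fourierInv_neg (f : 𝓢(E d, ℂ)) (ξ : E d) : 𝓕 f ξ = 𝓕⁻ f (-ξ) := by
  rw [SchwartzMap.fourierInv_coe, SchwartzMap.fourier_coe, Real.fourierInv_eq_fourier_neg, neg_neg]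

theorem fourierInv_fourierInv (a : 𝓢(E d, ℂ)) (ξ : E d) : 𝓕⁻ (𝓕⁻ a) ξ = a (-ξ) := by
  have h := fourier_eq_fourierInv_neg (𝓕⁻ a) (-ξ)
  rw [neg_neg] at h
  rw [← h, FourierTransform.fourier_fourierInv_eq (E := 𝓢(E d, ℂ)) (F := 𝓢(E d, ℂ)) a]

/-- A product of two kernels has spectrum in the sum of the spectra of its factors, so it is
orthogonal to a kernel with spectrum outside this sum. By Parseval the integral becomes a double
integral over c(ξ + ζ) a(ξ) b(ζ) up to phases, which encode the translations by x, s and t. -/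
theorem integral_ker_mul_ker_mul_ker {a b c : 𝓢(E d, ℂ)} (ha : Herm a) (hb : Herm b) (hc : Herm c)
    (h : ∀ ξ ζ, c (ξ + ζ) * a ξ * b ζ = 0) (x s t : E d) :
    ∫ y, ker c (x - y) * ker a (y - s) * ker b (y - t) = 0 := by
  set A := SchwartzMap.compSubConstCLM ℂ s (𝓕⁻ a) with hA
  set B := SchwartzMap.compSubConstCLM ℂ t (𝓕⁻ b) with hB
  set F := SchwartzMap.compSubConstCLM ℂ x (𝓕 c) with hF
  set a' : 𝓢(E d, ℂ) := 𝓕⁻ A with ha'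
  set b' : 𝓢(E d, ℂ) := 𝓕⁻ B with hb'
  set c' : 𝓢(E d, ℂ) := 𝓕⁻ F with hc'
  have eA : 𝓕 a' = A := FourierTransform.fourier_fourierInv_eq (E := 𝓢(E d, ℂ)) A
  have eB : 𝓕 b' = B := FourierTransform.fourier_fourierInv_eq (E := 𝓢(E d, ℂ)) B
  have eF : 𝓕 c' = F := FourierTransform.fourier_fourierInv_eq (E := 𝓢(E d, ℂ)) F
  set D := SchwartzMap.convolution (ContinuousLinearMap.mul ℂ ℂ) a' b' with hD
  have hprod : ∀ y, 𝓕 D y = A y * B y := by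
    intro y
    rw [hD, SchwartzMap.fourier_convolution, eA, eB]
    simp
  apply Complex.ofReal_injective
  rw [← integral_complex_ofReal, Complex.ofReal_zero]
  have h1 : ∀ y, ((ker c (x - y) * ker a (y - s) * ker b (y - t) : ℝ) : ℂ) = 𝓕 c' y * 𝓕 D y := by
    intro y
    push_cast
    rw [ofReal_ker ha, ofReal_ker hb, ofReal_ker hc, hprod, eF, mul_assoc]
    simp only [hA, hB, hF, SchwartzMap.compSubConstCLM_apply]
    rw [fourier_eq_fourierInv_neg, neg_sub]
  simp only [h1]
  rw [SchwartzMap.integral_fourier_mul_eq]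
  have h2 : ∀ ξ, c' ξ * 𝓕 (𝓕 D) ξ = 0 := by
    intro ξ
    have e1 : 𝓕 (𝓕 D) ξ = D (-ξ) := by
      rw [fourier_eq_fourierInv_neg, FourierTransform.fourierInv_fourier_eq (E := 𝓢(E d, ℂ)) D]
    rw [e1, hD, SchwartzMap.convolution_apply, convolution_def, ← integral_const_mul]
    rw [← integral_zero (E d) ℂ]
    congr 1
    ext η
    have ea : a' η = Complex.exp (((2 * Real.pi * inner ℝ s η : ℝ) : ℂ) * Complex.I) * a (-η) := by
      rw [ha', hA, fourierInv_translate, fourierInv_fourierInv]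
    have eb : b' (-ξ - η) = Complex.exp (((2 * Real.pi * inner ℝ t (-ξ - η) : ℝ) : ℂ) * Complex.I) *
        b (ξ + η) := by
      rw [hb', hB, fourierInv_translate, fourierInv_fourierInv]
      congr 2
      abel
    have ec : c' ξ = Complex.exp (((2 * Real.pi * inner ℝ x ξ : ℝ) : ℂ) * Complex.I) * c ξ := by
      rw [hc', hF, fourierInv_translate,
        FourierTransform.fourierInv_fourier_eq (E := 𝓢(E d, ℂ)) c]
    have h0 := h (-η) (ξ + η)
    rw [show -η + (ξ + η) = ξ by abel] at h0
    simp only [ContinuousLinearMap.mul_apply']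
    rw [ea, eb, ec]
    linear_combination (Complex.exp (((2 * Real.pi * inner ℝ x ξ : ℝ) : ℂ) * Complex.I) *
      Complex.exp (((2 * Real.pi * inner ℝ s η : ℝ) : ℂ) * Complex.I) *
      Complex.exp (((2 * Real.pi * inner ℝ t (-ξ - η) : ℝ) : ℂ) * Complex.I)) * h0
  simp only [h2, integral_zero]

/-- The functions g and f are merely bounded, so spectral localization of the product is not read
off from their Fourier transforms. Fubini moves both of them outside and leaves the vanishing triple
integral of kernels. -/
theorem cv_mul_eq_zero {a b c : 𝓢(E d, ℂ)} (ha : Herm a) (hb : Herm b) (hc : Herm c)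
    (h : ∀ ξ ζ, c (ξ + ζ) * a ξ * b ζ = 0) {g f : E d → ℝ} (hg : Measurable g) (hf : Measurable f)
    {M N : ℝ} (hM : ∀ x, |g x| ≤ M) (hN : ∀ x, |f x| ≤ N) (x : E d) :
    cv c (fun y => cv a g y * cv b f y) x = 0 := by
  have hcc := continuous_ker c
  have hk1 : Integrable fun y => ker c (x - y) := (integrable_ker c).comp_sub_left x
  have hK : Integrable fun y => ker c (x - y) * cv b f y := by
    refine hk1.mul_bdd (c := kerNorm b * N) (measurable_cv b hf).aestronglyMeasurable
      (Eventually.of_forall fun y => abs_cv_le hN y)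
  have e1 : cv c (fun y => cv a g y * cv b f y) x =
      ∫ y, (ker c (x - y) * cv b f y) * cv a g y := by
    rw [cv]
    congr 1
    ext y
    ring
  rw [e1, integral_mul_cv hK a hg hM, ← integral_zero (E d) ℝ]
  congr 1
  ext s
  have hka := continuous_ker a
  obtain ⟨Ca, -, hCa⟩ := ker_decay a 0
  have hK2 : Integrable fun y => ker c (x - y) * ker a (y - s) := by
    refine hk1.mul_bdd (c := Ca) (Continuous.aestronglyMeasurable (by fun_prop))
      (Eventually.of_forall fun y => by simpa using hCa (y - s))
  have e2 : ∫ y, ker c (x - y) * cv b f y * ker a (y - s) =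
      ∫ y, (ker c (x - y) * ker a (y - s)) * cv b f y := by
    congr 1
    ext y
    ring
  rw [e2, integral_mul_cv hK2 b hf hN]
  simp only [integral_ker_mul_ker_mul_ker ha hb hc h, mul_zero, integral_zero]

/-- The product of two functions with frequencies at most (4/3) 2^{k-2} has frequencies at most
(2/3) 2^k, below the annulus of index k, which starts at (3/4) 2^k. -/
theorem cv_low_mul_low (k : ℤ) {g f : E d → ℝ} (hg : Measurable g) (hf : Measurable f)
    {M N : ℝ} (hM : ∀ x, |g x| ≤ M) (hN : ∀ x, |f x| ≤ N) (x : E d) :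
    cv (sig φ 1 k) (fun y => cv (low φ (k - 2)) g y * cv (low φ (k - 2)) f y) x = 0 := by
  refine cv_mul_eq_zero (herm_low φ _) (herm_low φ _) (herm_sig φ .one k) ?_ hg hf hM hN x
  intro ξ ζ
  by_contra hne
  obtain ⟨h12, h3⟩ := mul_ne_zero_iff.mp hne
  obtain ⟨h1, h2⟩ := mul_ne_zero_iff.mp h12
  have b2 := low_support φ h2
  have b3 := low_support φ h3
  have b1 : phi φ k (ξ + ζ) ≠ 0 := by
    intro h0
    apply h1
    rw [sig_apply, h0]
    simp
  have b1 := (phi_support φ b1).1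
  have b4 := norm_add_le ξ ζ
  have hk : (0 : ℝ) < 2 ^ k := by positivity
  have e : (2 : ℝ) ^ (k - 2) = 2 ^ k / 4 := by
    rw [zpow_sub₀ (by norm_num)]
    norm_num
  rw [e] at b2 b3
  nlinarith [Real.pi_pos]

/-- The product estimate: `Δ̇_k (g f)` only sees the blocks of `g` and `f` with index at least
`k - 2`. -/
theorem exists_sn_cv_mul_le : ∃ C : ℝ≥0∞, C ≠ ⊤ ∧ ∀ (k : ℤ) (g f : E d → ℝ),
    Continuous g → Continuous f → sn g ≠ ⊤ → sn f ≠ ⊤ →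
    sn (cv (sig φ 1 k) (fun y => g y * f y)) ≤
      C * ∑' i : ℕ, (sn (cv (sig φ 1 (k - 2 + i)) g) * sn f + sn g * sn (cv (sig φ 1 (k - 2 + i)) f)) := by
  obtain ⟨K, hK, hk⟩ := exists_kerNorm_sig_le' φ (m := (1 : Symbol d)) .one
  set L := kerNorm (low φ (0 : ℤ)) with hL
  refine ⟨ENNReal.ofReal K * ENNReal.ofReal L, by finiteness, fun k g f hg hf sg sf => ?_⟩
  refine sn_le fun x => ?_
  have hM := abs_le_of_sn sg
  have hN := abs_le_of_sn sf
  have lg := LinGrowth.of_bounded hg.measurable hM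
  have lf := LinGrowth.of_bounded hf.measurable hN
  have mlow : ∀ (J : ℤ) {u : E d → ℝ} (_ : Measurable u) {M : ℝ} (_ : ∀ x, |u x| ≤ M),
      LinGrowth (cv (low φ J) u) := fun J u hu M hM =>
    LinGrowth.of_bounded (measurable_cv _ hu) (abs_cv_le hM)
  set P : ℤ → E d → ℝ := fun J y => cv (low φ J) g y * cv (low φ J) f y with hP
  have hPm : ∀ J, Measurable (P J) := fun J =>
    (measurable_cv _ hg.measurable).mul (measurable_cv _ hf.measurable)
  have hPb : ∀ J y, |P J y| ≤ (L * (sn g).toReal) * (L * (sn f).toReal) := fun J y => by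
    rw [hP, abs_mul]
    have h1 := abs_cv_le (a := low φ J) hM y
    have h2 := abs_cv_le (a := low φ J) hN y
    rw [kerNorm_low] at h1 h2
    exact mul_le_mul h1 h2 (abs_nonneg _) ((abs_nonneg _).trans h1)
  have hPl : ∀ J, LinGrowth (P J) := fun J => LinGrowth.of_bounded (hPm J) (hPb J)
  -- Discrete Leibniz rule: R j = P (j + 1) - P j, and each of its two terms contains a block of
  -- index exactly j next to a low frequency factor bounded by the sup norm.
  set R : ℤ → E d → ℝ := fun j y => cv (sig φ 1 j) g y * cv (low φ (j + 1)) f y +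
    cv (low φ j) g y * cv (sig φ 1 j) f y with hR
  have hRm : ∀ j, Measurable (R j) := fun j =>
    ((measurable_cv _ hg.measurable).mul (measurable_cv _ hf.measurable)).add
      ((measurable_cv _ hg.measurable).mul (measurable_cv _ hf.measurable))
  have hPR : ∀ j y, P (j + 1) y = P j y + R j y := fun j y => by
    simp only [hP, hR]
    have e1 : cv (low φ (j + 1)) g y = cv (low φ j) g y + cv (sig φ 1 j) g y := by
      rw [low_succ, cv_add_symbol lg]
    have e2 : cv (low φ (j + 1)) f y = cv (low φ j) f y + cv (sig φ 1 j) f y := by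
      rw [low_succ, cv_add_symbol lf]
    rw [e1, e2]
    ring
  have hRl : ∀ j, LinGrowth (R j) := fun j => by
    refine LinGrowth.of_bounded (M := 2 * ((L * (sn g).toReal) * (L * (sn f).toReal))) (hRm j)
      fun y => ?_
    have h1 := hPb (j + 1) y
    have h2 := hPb j y
    have h3 := hPR j y
    have h4 : R j y = P (j + 1) y - P j y := by linarith
    rw [h4]
    exact (abs_sub _ _).trans (by linarith)
  have snR : ∀ j, sn (R j) ≤ ENNReal.ofReal L *
      (sn (cv (sig φ 1 j) g) * sn f + sn g * sn (cv (sig φ 1 j) f)) := fun j => by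
    refine (sn_add_le _ _).trans ?_
    rw [mul_add]
    have h1 := sn_cv_le (low φ (j + 1)) f
    have h2 := sn_cv_le (low φ j) g
    rw [kerNorm_low] at h1 h2
    refine add_le_add ((sn_mul_le _ _).trans ?_) ((sn_mul_le _ _).trans ?_)
    · calc _ ≤ sn (cv (sig φ 1 j) g) * (ENNReal.ofReal L * sn f) := by gcongr
        _ = _ := by ring
    · calc _ ≤ (ENNReal.ofReal L * sn g) * sn (cv (sig φ 1 j) f) := by gcongr
        _ = _ := by ring
  -- The telescoping sum may start at k - 2 because the product of the cut-offs at k - 2 is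
  -- invisible to the block k.
  have hsum : ∀ n : ℕ, cv (sig φ 1 k) (P (k - 2 + n)) x =
      ∑ i ∈ Finset.range n, cv (sig φ 1 k) (R (k - 2 + i)) x := by
    intro n
    induction n with
    | zero => simpa using cv_low_mul_low φ k hg.measurable hf.measurable hM hN x
    | succ n ih =>
      rw [Finset.sum_range_succ, ← ih]
      push_cast
      rw [← add_assoc, show P (k - 2 + n + 1) = fun y => P (k - 2 + n) y + R (k - 2 + n) y from
        funext (hPR _), cv_add (hPl _) (hRl _)]
  have hbound : ∀ n : ℕ, ‖cv (sig φ 1 k) (P (k - 2 + n)) x‖ₑ ≤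
      ENNReal.ofReal K * ENNReal.ofReal L * ∑' i : ℕ,
        (sn (cv (sig φ 1 (k - 2 + i)) g) * sn f + sn g * sn (cv (sig φ 1 (k - 2 + i)) f)) := by
    intro n
    rw [hsum]
    refine (enorm_sum_le _ _).trans ?_
    rw [← ENNReal.tsum_mul_left]
    refine le_trans (Finset.sum_le_sum fun i _ => ?_) (ENNReal.sum_le_tsum (Finset.range n))
    refine (enorm_le_sn _ x).trans ((sn_cv_le _ _).trans ?_)
    rw [mul_assoc]
    gcongr
    · simpa using hk k
    · exact snR _
  have hlim : Tendsto (fun n : ℕ => cv (sig φ 1 k) (P (k - 2 + n)) x) atTop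
      (𝓝 (cv (sig φ 1 k) (fun y => g y * f y) x)) := by
    simp only [cv]
    refine tendsto_integral_filter_of_dominated_convergence
      (fun y => |ker (sig φ 1 k) (x - y)| * ((L * (sn g).toReal) * (L * (sn f).toReal)))
      (Eventually.of_forall fun n => ((hPl _).integrable _ x).aestronglyMeasurable)
      (Eventually.of_forall fun n => Eventually.of_forall fun y => ?_)
      (((integrable_ker _).comp_sub_left x).abs.mul_const _) (Eventually.of_forall fun y => ?_)
    · rw [Real.norm_eq_abs, abs_mul]
      gcongr
      exact hPb _ y
    · refine Tendsto.const_mul _ ?_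
      have hn : Tendsto (fun n : ℕ => k - 2 + (n : ℤ)) atTop atTop :=
        tendsto_atTop_add_const_left _ _ tendsto_natCast_atTop_atTop
      exact ((tendsto_cv_low φ hg hM y).comp hn).mul ((tendsto_cv_low φ hf hN y).comp hn)
  exact le_of_tendsto hlim.enorm (Eventually.of_forall hbound)

end DirichletNeumann

end

/-! ### From tempered distributions to functions recovered from their blocks. -/

noncomputable section
namespace DirichletNeumann
variable {d : ℕ}

/-! ### Tempered distributions and convolutions -/

open scoped BoundedContinuousFunction LineDeriv

/-- Bounded continuous functions with values in the multilinear maps of degree `n`. -/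
def DerivSpace (d n : ℕ) : Type := E d →ᵇ (E d) [×n]→L[ℝ] ℂ

instance (n : ℕ) : NormedAddCommGroup (DerivSpace d n) :=
  inferInstanceAs (NormedAddCommGroup (E d →ᵇ (E d) [×n]→L[ℝ] ℂ))

instance (n : ℕ) : NormedSpace ℂ (DerivSpace d n) :=
  inferInstanceAs (NormedSpace ℂ (E d →ᵇ (E d) [×n]→L[ℝ] ℂ))

instance (n : ℕ) : CompleteSpace (DerivSpace d n) :=
  inferInstanceAs (CompleteSpace (E d →ᵇ (E d) [×n]→L[ℝ] ℂ))

/-- The values of an element of `DerivSpace d n`. -/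
def DerivSpace.val {n : ℕ} (F : DerivSpace d n) (w : E d) : (E d) [×n]→L[ℝ] ℂ :=
  (show E d →ᵇ (E d) [×n]→L[ℝ] ℂ from F) w

theorem DerivSpace.ext {n : ℕ} {F G : DerivSpace d n} (h : ∀ w, F.val w = G.val w) : F = G :=
  BoundedContinuousFunction.ext h

theorem DerivSpace.norm_val_le {n : ℕ} (F : DerivSpace d n) (w : E d) : ‖F.val w‖ ≤ ‖F‖ :=
  BoundedContinuousFunction.norm_coe_le_norm F w

theorem DerivSpace.norm_le {n : ℕ} {F : DerivSpace d n} {C : ℝ} (hC : 0 ≤ C)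
    (h : ∀ w, ‖F.val w‖ ≤ C) : ‖F‖ ≤ C :=
  (BoundedContinuousFunction.norm_le hC).2 h

theorem DerivSpace.dist_le {n : ℕ} {F G : DerivSpace d n} {C : ℝ} (hC : 0 ≤ C)
    (h : ∀ w, dist (F.val w) (G.val w) ≤ C) : dist F G ≤ C :=
  (BoundedContinuousFunction.dist_le hC).2 h

/-- Evaluation of an element of `DerivSpace d n`. -/
def evalDeriv {n : ℕ} (w : E d) (m : Fin n → E d) : DerivSpace d n →L[ℂ] ℂ :=
  LinearMap.mkContinuous
    { toFun := fun F => F.val w m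
      map_add' := fun _ _ => rfl
      map_smul' := fun _ _ => rfl } (∏ i, ‖m i‖) fun F => by
    refine ((F.val w).le_opNorm m).trans ?_
    rw [mul_comm]
    exact mul_le_mul_of_nonneg_left (F.norm_val_le w)
      (by positivity)

/-- The bounded function `‖x‖^k D^n f(x)`. -/
def weightedDeriv (k n : ℕ) : 𝓢(E d, ℂ) →ₗ[ℂ] DerivSpace d n where
  toFun f := BoundedContinuousFunction.ofNormedAddCommGroup
    (fun x => ‖x‖ ^ k • iteratedFDeriv ℝ n f x)
    ((continuous_norm.pow k).smul ((f.smooth n).continuous_iteratedFDeriv le_rfl))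
    (SchwartzMap.seminorm ℂ k n f) (fun x => by
      rw [norm_smul, norm_pow, norm_norm]
      exact SchwartzMap.le_seminorm ℂ k n f x)
  map_add' f g := by
    refine BoundedContinuousFunction.ext fun x => ?_
    have : iteratedFDeriv ℝ n (⇑(f + g)) x = iteratedFDeriv ℝ n f x + iteratedFDeriv ℝ n g x :=
      iteratedFDeriv_add_apply ((f.smooth n).contDiffAt) ((g.smooth n).contDiffAt)
    change ‖x‖ ^ k • iteratedFDeriv ℝ n (⇑(f + g)) x = ‖x‖ ^ k • iteratedFDeriv ℝ n f x +
      ‖x‖ ^ k • iteratedFDeriv ℝ n g x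
    rw [this, smul_add]
  map_smul' c f := by
    refine BoundedContinuousFunction.ext fun x => ?_
    have : iteratedFDeriv ℝ n (⇑(c • f)) x = c • iteratedFDeriv ℝ n f x :=
      iteratedFDeriv_const_smul_apply ((f.smooth n).contDiffAt)
    change ‖x‖ ^ k • iteratedFDeriv ℝ n (⇑(c • f)) x = c • ‖x‖ ^ k • iteratedFDeriv ℝ n f x
    rw [this, smul_comm]

theorem weightedDeriv_apply (k n : ℕ) (f : 𝓢(E d, ℂ)) (x : E d) :
    (weightedDeriv k n f).val x = ‖x‖ ^ k • iteratedFDeriv ℝ n f x := rfl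

theorem seminorm_le_weightedDeriv (k n : ℕ) (f : 𝓢(E d, ℂ)) :
    SchwartzMap.seminorm ℂ k n f ≤ ‖weightedDeriv k n f‖ := by
  refine SchwartzMap.seminorm_le_bound ℂ k n f (norm_nonneg (weightedDeriv k n f)) fun x => ?_
  have := (weightedDeriv k n f).norm_val_le x
  rwa [weightedDeriv_apply, norm_smul, norm_pow, norm_norm] at this

/-- A functional that is dominated by the norm of the image under a linear map factors through
this map. -/
theorem exists_factor_of_norm_le {V Y : Type*} [AddCommGroup V] [Module ℂ V]
    [NormedAddCommGroup Y] [NormedSpace ℂ Y] (ι : V →ₗ[ℂ] Y) (u : V →ₗ[ℂ] ℂ) (C : ℝ)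
    (hC : ∀ f, ‖u f‖ ≤ C * ‖ι f‖) : ∃ ψ : StrongDual ℂ Y, ∀ f, u f = ψ (ι f) := by
  have hk : LinearMap.ker ι ≤ LinearMap.ker u := by
    intro f hf
    have h1 := hC f
    rw [LinearMap.mem_ker.1 hf, norm_zero, mul_zero] at h1
    exact norm_le_zero_iff.1 h1
  let f0 : LinearMap.range ι →ₗ[ℂ] ℂ :=
    ((LinearMap.ker ι).liftQ u hk).comp ι.quotKerEquivRange.symm.toLinearMap
  have hf0 : ∀ f, f0 ⟨ι f, LinearMap.mem_range_self ι f⟩ = u f := by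
    intro f
    have : ι.quotKerEquivRange.symm ⟨ι f, LinearMap.mem_range_self ι f⟩ =
        (LinearMap.ker ι).mkQ f := LinearMap.quotKerEquivRange_symm_apply_image ι f _
    simp only [f0, LinearMap.comp_apply, LinearEquiv.coe_coe, this]
    rfl
  let f1 : StrongDual ℂ (LinearMap.range ι) := f0.mkContinuous C (by
    rintro ⟨_, f, rfl⟩
    rw [hf0]
    exact hC f)
  obtain ⟨ψ, hψ, -⟩ := exists_extension_norm_eq (LinearMap.range ι) f1
  refine ⟨ψ, fun f => ?_⟩
  rw [← hf0 f]
  exact (hψ ⟨ι f, LinearMap.mem_range_self ι f⟩).symm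

/-- The version of `exists_factor_of_norm_le` for finitely many maps. -/
theorem exists_factor_sum {V κ : Type*} [Fintype κ] [DecidableEq κ] {Y : κ → Type*}
    [AddCommGroup V] [Module ℂ V] [∀ i, NormedAddCommGroup (Y i)] [∀ i, NormedSpace ℂ (Y i)]
    (ι : ∀ i, V →ₗ[ℂ] Y i) (u : V →ₗ[ℂ] ℂ) (C : ℝ)
    (hC : ∀ (f : V) (N : ℝ), 0 ≤ N → (∀ i, ‖ι i f‖ ≤ N) → ‖u f‖ ≤ C * N) :
    ∃ ψ : ∀ i, StrongDual ℂ (Y i), ∀ f, u f = ∑ i, ψ i (ι i f) := by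
  obtain ⟨ψ, hψ⟩ := exists_factor_of_norm_le (LinearMap.pi ι) u C fun f =>
    hC f _ (norm_nonneg _) fun i => norm_le_pi_norm (LinearMap.pi ι f) i
  refine ⟨fun i => ψ.comp (ContinuousLinearMap.single ℂ Y i), fun f => ?_⟩
  rw [hψ]
  conv_lhs => rw [← Finset.univ_sum_single (LinearMap.pi ι f), map_sum]
  rfl

/-- A tempered distribution is bounded by finitely many Schwartz seminorms, and each seminorm is
bounded by the sup norm of a weighted derivative; Hahn-Banach extends the resulting functionals.
This represents u through normed spaces, where it can be exchanged with Bochner integrals of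
translates. -/
theorem exists_functional (u : 𝓢'(E d, ℂ)) :
    ∃ (s : Finset (ℕ × ℕ)) (ψ : (i : s) → StrongDual ℂ (DerivSpace d i.1.2)),
      ∀ f, u f = ∑ i, ψ i (weightedDeriv i.1.1 i.1.2 f) := by
  classical
  let q : Seminorm ℂ 𝓢(E d, ℂ) := (normSeminorm ℂ ℂ).comp
    ((u : 𝓢(E d, ℂ) →L[ℂ] ℂ) : 𝓢(E d, ℂ) →ₗ[ℂ] ℂ)
  have hq : Continuous q := by
    change Continuous fun f => ‖u f‖
    exact (map_continuous u).norm
  obtain ⟨s, C, -, hC⟩ := Seminorm.bound_of_continuous (schwartz_withSeminorms ℂ (E d) ℂ) q hq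
  refine ⟨s, ?_⟩
  refine exists_factor_sum (Y := fun i : s => DerivSpace d i.1.2) (fun i : s => weightedDeriv i.1.1 i.1.2)
    ((u : 𝓢(E d, ℂ) →L[ℂ] ℂ) : 𝓢(E d, ℂ) →ₗ[ℂ] ℂ) C fun f N hN hi => ?_
  have h1 : q f ≤ (C • s.sup (schwartzSeminormFamily ℂ (E d) ℂ)) f := hC f
  refine h1.trans ?_
  change (C : ℝ) * _ ≤ _
  refine mul_le_mul_of_nonneg_left ?_ C.2
  exact Seminorm.finset_sup_apply_le hN fun i his =>
    (seminorm_le_weightedDeriv i.1 i.2 f).trans (hi ⟨i, his⟩)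

theorem pow_norm_mul_iteratedFDeriv_sub_le (κ : 𝓢(E d, ℂ)) (k n : ℕ) (y w : E d) :
    ‖w‖ ^ k * ‖iteratedFDeriv ℝ n κ (w - y)‖ ≤
      2 ^ k * (SchwartzMap.seminorm ℂ k n κ + ‖y‖ ^ k * SchwartzMap.seminorm ℂ 0 n κ) := by
  have h1 : ‖w‖ ^ k ≤ 2 ^ k * (‖w - y‖ ^ k + ‖y‖ ^ k) := by
    have : ‖w‖ ≤ ‖w - y‖ + ‖y‖ := by simpa using norm_add_le (w - y) y
    calc ‖w‖ ^ k ≤ (‖w - y‖ + ‖y‖) ^ k := by gcongr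
      _ ≤ 2 ^ (k - 1) * (‖w - y‖ ^ k + ‖y‖ ^ k) :=
        add_pow_le (norm_nonneg _) (norm_nonneg _) k
      _ ≤ _ := by
        gcongr
        · norm_num
        · lia
  have h2 := SchwartzMap.le_seminorm ℂ k n κ (w - y)
  have h3 := SchwartzMap.le_seminorm ℂ 0 n κ (w - y)
  rw [pow_zero, one_mul] at h3
  calc ‖w‖ ^ k * ‖iteratedFDeriv ℝ n κ (w - y)‖
      ≤ 2 ^ k * (‖w - y‖ ^ k + ‖y‖ ^ k) * ‖iteratedFDeriv ℝ n κ (w - y)‖ := by gcongr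
    _ = 2 ^ k * (‖w - y‖ ^ k * ‖iteratedFDeriv ℝ n κ (w - y)‖ +
        ‖y‖ ^ k * ‖iteratedFDeriv ℝ n κ (w - y)‖) := by ring
    _ ≤ _ := by gcongr

theorem weightedDeriv_translate_apply (κ : 𝓢(E d, ℂ)) (k n : ℕ) (y w : E d) :
    (weightedDeriv k n (SchwartzMap.compSubConstCLM ℂ y κ)).val w =
      ‖w‖ ^ k • iteratedFDeriv ℝ n κ (w - y) := by
  rw [weightedDeriv_apply]
  exact congrArg (‖w‖ ^ k • ·) (iteratedFDeriv_comp_sub (𝕜 := ℝ) (f := κ) n y w)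

theorem norm_weightedDeriv_translate_le (κ : 𝓢(E d, ℂ)) (k n : ℕ) (y : E d) :
    ‖weightedDeriv k n (SchwartzMap.compSubConstCLM ℂ y κ)‖ ≤
      2 ^ k * (SchwartzMap.seminorm ℂ k n κ + ‖y‖ ^ k * SchwartzMap.seminorm ℂ 0 n κ) := by
  refine DerivSpace.norm_le (by positivity) fun w => ?_
  rw [weightedDeriv_translate_apply, norm_smul, norm_pow, norm_norm]
  exact pow_norm_mul_iteratedFDeriv_sub_le κ k n y w

/-- In the sup norm, translation is locally Lipschitz: its derivative in y is a derivative of order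
n + 1, with the weight controlled on a unit ball around the base point. The continuity serves the
measurability in the Bochner integral. -/
theorem continuous_weightedDeriv_translate (κ : 𝓢(E d, ℂ)) (k n : ℕ) :
    Continuous fun y => weightedDeriv k n (SchwartzMap.compSubConstCLM ℂ y κ) := by
  rw [continuous_iff_continuousAt]
  intro y₀
  set R := ‖y₀‖ + 1
  set L : ℝ := 2 ^ k * (SchwartzMap.seminorm ℂ k (n + 1) κ +
    R ^ k * SchwartzMap.seminorm ℂ 0 (n + 1) κ)
  have hL : 0 ≤ L := by positivity
  have key : ∀ y ∈ Metric.ball y₀ 1, dist (weightedDeriv k n (SchwartzMap.compSubConstCLM ℂ y κ))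
      (weightedDeriv k n (SchwartzMap.compSubConstCLM ℂ y₀ κ)) ≤ L * dist y y₀ := by
    intro y hy
    refine DerivSpace.dist_le (by positivity) fun w => ?_
    rw [weightedDeriv_translate_apply, weightedDeriv_translate_apply, dist_eq_norm, dist_eq_norm]
    have hd : ∀ z, HasFDerivAt (fun y => ‖w‖ ^ k • iteratedFDeriv ℝ n κ (w - y))
        (‖w‖ ^ k • ((fderiv ℝ (iteratedFDeriv ℝ n κ) (w - z)).comp
          (-ContinuousLinearMap.id ℝ (E d)))) z := by
      intro z
      have h1 : HasFDerivAt (iteratedFDeriv ℝ n κ) (fderiv ℝ (iteratedFDeriv ℝ n κ) (w - z))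
          (w - z) :=
        ((κ.smooth (n + 1)).differentiable_iteratedFDeriv (by exact_mod_cast Nat.lt_succ_self n)
          (w - z)).hasFDerivAt
      have h2 : HasFDerivAt (fun y : E d => w - y) (-ContinuousLinearMap.id ℝ (E d)) z :=
        (hasFDerivAt_id z).const_sub w
      exact (h1.comp z h2).const_smul (‖w‖ ^ k)
    refine (convex_ball y₀ 1).norm_image_sub_le_of_norm_hasFDerivWithin_le
      (fun z _ => (hd z).hasFDerivWithinAt) (fun z hz => ?_) (Metric.mem_ball_self one_pos) hy
    have hzR : ‖z‖ ≤ R := by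
      have h1 : ‖z - y₀‖ ≤ 1 := by simpa [dist_eq_norm] using (Metric.mem_ball.1 hz).le
      have h2 : ‖z‖ ≤ ‖z - y₀‖ + ‖y₀‖ := by simpa using norm_add_le (z - y₀) y₀
      linarith
    have h1 : ‖‖w‖ ^ k • ((fderiv ℝ (iteratedFDeriv ℝ n κ) (w - z)).comp
        (-ContinuousLinearMap.id ℝ (E d)))‖ ≤
        ‖w‖ ^ k * (‖fderiv ℝ (iteratedFDeriv ℝ n κ) (w - z)‖ * 1) := by
      refine ContinuousLinearMap.opNorm_le_bound _ (by positivity) fun v => ?_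
      rw [smul_apply, ContinuousLinearMap.comp_apply, norm_smul, norm_pow,
        norm_norm, mul_one, mul_assoc]
      refine mul_le_mul_of_nonneg_left ?_ (by positivity)
      refine (ContinuousLinearMap.le_opNorm _ _).trans (le_of_eq ?_)
      simp
    rw [mul_one, norm_fderiv_iteratedFDeriv] at h1
    refine h1.trans ((pow_norm_mul_iteratedFDeriv_sub_le κ k (n + 1) z w).trans ?_)
    simp only [L]
    have h3 : ‖z‖ ^ k ≤ R ^ k := pow_le_pow_left₀ (norm_nonneg _) hzR k
    gcongr
  rw [ContinuousAt, tendsto_iff_dist_tendsto_zero]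
  refine squeeze_zero' (Eventually.of_forall fun _ => dist_nonneg)
    (eventually_of_mem (Metric.ball_mem_nhds y₀ one_pos) key) ?_
  have : Tendsto (fun y => L * dist y y₀) (𝓝 y₀) (𝓝 (L * dist y₀ y₀)) :=
    (continuous_const.mul (continuous_id.dist continuous_const)).tendsto y₀
  simpa using this

/-- The symbol of the iterated derivative of the Fourier transform of `b`. -/
def iterSymbol : {n : ℕ} → (Fin n → E d) → 𝓢(E d, ℂ) → 𝓢(E d, ℂ)
  | 0, _, b => b
  | _ + 1, m, b => -dirS (m 0) (iterSymbol (Fin.tail m) b)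

theorem iterSymbol_mulS {n : ℕ} (m : Fin n → E d) (a b : 𝓢(E d, ℂ)) :
    iterSymbol m (mulS a b) = mulS a (iterSymbol m b) := by
  induction n with
  | zero => rfl
  | succ n ih =>
    simp only [iterSymbol]
    rw [ih]
    ext ξ
    simp
    ring

theorem iteratedLineDerivOp_fourier {n : ℕ} (m : Fin n → E d) (b : 𝓢(E d, ℂ)) :
    ∂^{m} (𝓕 b : 𝓢(E d, ℂ)) = 𝓕 (iterSymbol m b) := by
  induction n with
  | zero => rfl
  | succ n ih =>
    rw [LineDeriv.iteratedLineDerivOp_succ_left, ih, SchwartzMap.lineDerivOp_fourier_eq]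
    congr 1
    ext ξ
    simp [iterSymbol, dirS]

theorem integral_ker_mul_fourier {a : 𝓢(E d, ℂ)} (ha : Herm a) (b : 𝓢(E d, ℂ)) (x w : E d) :
    ∫ y, ((ker a (x - y) : ℝ) : ℂ) * (𝓕 b : 𝓢(E d, ℂ)) (w - y) =
      (𝓕 (mulS a b) : 𝓢(E d, ℂ)) (w - x) := by
  have h2 : SchwartzMap.convolution (ContinuousLinearMap.mul ℂ ℂ) (𝓕⁻ a) (𝓕⁻ b) =
      𝓕⁻ (mulS a b) := by
    simp [SchwartzMap.convolution, mulS]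
  have h3 := SchwartzMap.convolution_apply (ContinuousLinearMap.mul ℂ ℂ) (𝓕⁻ a) (𝓕⁻ b) (x - w)
  rw [h2, convolution_def] at h3
  rw [fourier_eq_fourierInv_neg, neg_sub, h3, ← integral_sub_left_eq_self _ _ x]
  refine integral_congr_ae (Eventually.of_forall fun y => ?_)
  simp only [ofReal_ker ha, ContinuousLinearMap.mul_apply']
  rw [fourier_eq_fourierInv_neg]
  rw [sub_sub_cancel, neg_sub, sub_right_comm]

theorem integrable_ker_smul_weightedDeriv (a κ : 𝓢(E d, ℂ)) (k n : ℕ) (x : E d) :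
    Integrable fun y => ((ker a (x - y) : ℝ) : ℂ) •
      weightedDeriv k n (SchwartzMap.compSubConstCLM ℂ y κ) := by
  set A := SchwartzMap.seminorm ℂ k n κ
  set B := SchwartzMap.seminorm ℂ 0 n κ
  have hc : Continuous fun y => ((ker a (x - y) : ℝ) : ℂ) •
      weightedDeriv k n (SchwartzMap.compSubConstCLM ℂ y κ) :=
    (Complex.continuous_ofReal.comp ((continuous_ker a).comp (continuous_const.sub continuous_id))
      ).smul (continuous_weightedDeriv_translate κ k n)
  have h1 := (integrable_ker_mul_pow a k).comp_sub_left x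
  have h2 : Integrable fun y => 2 ^ k * (A + (1 + ‖x‖) ^ k * B) *
      ‖|ker a (x - y)| * (1 + ‖x - y‖) ^ k‖ := h1.norm.const_mul _
  refine h2.mono' hc.aestronglyMeasurable (Eventually.of_forall fun y => ?_)
  refine (norm_smul_le _ _).trans ?_
  rw [Complex.norm_real, norm_mul, norm_abs_eq_norm, Real.norm_of_nonneg
    (by positivity : (0 : ℝ) ≤ (1 + ‖x - y‖) ^ k)]
  have h3 := norm_weightedDeriv_translate_le κ k n y
  have h4 : ‖y‖ ^ k ≤ (1 + ‖x‖) ^ k * (1 + ‖x - y‖) ^ k := by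
    rw [← mul_pow]
    gcongr
    exact (le_add_of_nonneg_left zero_le_one).trans (one_add_norm_le_mul x y)
  have h5 : (1 : ℝ) ≤ (1 + ‖x - y‖) ^ k := one_le_pow₀ (by simp)
  have hA : 0 ≤ A := apply_nonneg _ _
  have hB : 0 ≤ B := apply_nonneg _ _
  calc ‖ker a (x - y)‖ * ‖weightedDeriv k n (SchwartzMap.compSubConstCLM ℂ y κ)‖
      ≤ ‖ker a (x - y)‖ * (2 ^ k * (A + ‖y‖ ^ k * B)) := by gcongr
    _ ≤ ‖ker a (x - y)‖ * (2 ^ k * (A * (1 + ‖x - y‖) ^ k +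
        ((1 + ‖x‖) ^ k * (1 + ‖x - y‖) ^ k) * B)) := by
        gcongr
        exact le_mul_of_one_le_right hA h5
    _ = _ := by ring

/-- Evaluation at a point and on fixed directions is continuous, so the vector-valued identity
reduces to the scalar convolution theorem; derivatives of a Fourier transform are absorbed into the
symbol by `iterSymbol`. -/
theorem integral_ker_smul_weightedDeriv {a : 𝓢(E d, ℂ)} (ha : Herm a) (b : 𝓢(E d, ℂ)) (k n : ℕ)
    (x : E d) :
    ∫ y, ((ker a (x - y) : ℝ) : ℂ) •
      weightedDeriv k n (SchwartzMap.compSubConstCLM ℂ y (𝓕 b : 𝓢(E d, ℂ))) =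
      weightedDeriv k n (SchwartzMap.compSubConstCLM ℂ x (𝓕 (mulS a b) : 𝓢(E d, ℂ))) := by
  suffices h : ∀ w (m : Fin n → E d), evalDeriv w m (∫ y, ((ker a (x - y) : ℝ) : ℂ) •
      weightedDeriv k n (SchwartzMap.compSubConstCLM ℂ y (𝓕 b : 𝓢(E d, ℂ)))) =
      evalDeriv w m
        (weightedDeriv k n (SchwartzMap.compSubConstCLM ℂ x (𝓕 (mulS a b) : 𝓢(E d, ℂ)))) from
    DerivSpace.ext fun w => ContinuousMultilinearMap.ext fun m => h w m
  intro w m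
  rw [← ContinuousLinearMap.integral_comp_comm (evalDeriv w m)
    (integrable_ker_smul_weightedDeriv a _ k n x)]
  have h1 : ∀ (c : 𝓢(E d, ℂ)) (y : E d), evalDeriv w m
      (weightedDeriv k n (SchwartzMap.compSubConstCLM ℂ y (𝓕 c : 𝓢(E d, ℂ)))) =
        ((‖w‖ ^ k : ℝ) : ℂ) * (𝓕 (iterSymbol m c) : 𝓢(E d, ℂ)) (w - y) := by
    intro c y
    change (weightedDeriv k n (SchwartzMap.compSubConstCLM ℂ y (𝓕 c : 𝓢(E d, ℂ)))).val w m = _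
    rw [weightedDeriv_translate_apply, ← iteratedLineDerivOp_fourier,
      SchwartzMap.iteratedLineDerivOp_eq_iteratedFDeriv]
    simp
  rw [h1, iterSymbol_mulS, ← integral_ker_mul_fourier ha, ← integral_const_mul]
  refine integral_congr_ae (Eventually.of_forall fun y => ?_)
  beta_reduce
  rw [map_smul, h1, smul_eq_mul]
  ring

/-- The convolution of a tempered distribution with the kernel of the symbol `b`. -/
def distConv (u : 𝓢'(E d, ℂ)) (b : 𝓢(E d, ℂ)) (x : E d) : ℂ :=
  u (SchwartzMap.compSubConstCLM ℂ x (𝓕 b : 𝓢(E d, ℂ)))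

/-- The associativity (u * b) * a = u * (ab) for a distribution u. It shows that the blocks of u
behave under convolution like blocks of a function. -/
theorem integral_ker_mul_distConv (u : 𝓢'(E d, ℂ)) {a : 𝓢(E d, ℂ)} (ha : Herm a) (b : 𝓢(E d, ℂ))
    (x : E d) :
    ∫ y, ((ker a (x - y) : ℝ) : ℂ) * distConv u b y = distConv u (mulS a b) x := by
  obtain ⟨s, ψ, hψ⟩ := exists_functional u
  simp only [distConv, hψ, Finset.mul_sum]
  have h0 : ∀ (i : s) (y : E d), ((ker a (x - y) : ℝ) : ℂ) * ψ i (weightedDeriv i.1.1 i.1.2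
      (SchwartzMap.compSubConstCLM ℂ y (𝓕 b : 𝓢(E d, ℂ)))) =
      ψ i (((ker a (x - y) : ℝ) : ℂ) • weightedDeriv i.1.1 i.1.2
      (SchwartzMap.compSubConstCLM ℂ y (𝓕 b : 𝓢(E d, ℂ)))) := by
    intro i y
    rw [map_smul, smul_eq_mul]
  simp only [h0]
  rw [integral_finsetSum _ fun i _ => (ψ i).integrable_comp
    (integrable_ker_smul_weightedDeriv a _ i.1.1 i.1.2 x)]
  refine Finset.sum_congr rfl fun i _ => ?_
  rw [ContinuousLinearMap.integral_comp_comm _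
    (integrable_ker_smul_weightedDeriv a _ i.1.1 i.1.2 x), integral_ker_smul_weightedDeriv ha]

theorem continuous_distConv (u : 𝓢'(E d, ℂ)) (b : 𝓢(E d, ℂ)) : Continuous (distConv u b) := by
  obtain ⟨s, ψ, hψ⟩ := exists_functional u
  have h : distConv u b = fun y => ∑ i : s, ψ i (weightedDeriv i.1.1 i.1.2
      (SchwartzMap.compSubConstCLM ℂ y (𝓕 b : 𝓢(E d, ℂ)))) := by
    ext y
    exact hψ _
  rw [h]
  exact continuous_finsetSum _ fun i _ =>
    (ψ i).continuous.comp (continuous_weightedDeriv_translate _ _ _)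

variable (φ : LittlewoodPaley d)

theorem block_eq_distConv (m : Symbol d) (j : ℤ) (u : 𝓢'(E d, ℂ)) (x : E d) :
    block φ m j u x = distConv u (sig φ m j) x := by
  rw [block, distConv]
  congr 1
  ext y
  rw [blockTest_apply, SchwartzMap.compSubConstCLM_apply, fourier_eq_fourierInv_neg, neg_sub]

theorem IsRealValued.im_distConv {u : 𝓢'(E d, ℂ)} (hu : IsRealValued u) {b : 𝓢(E d, ℂ)}
    (hb : Herm b) (x : E d) : (distConv u b x).im = 0 := by
  have h := hu (SchwartzMap.compSubConstCLM ℂ x (𝓕 b : 𝓢(E d, ℂ)))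
    (SchwartzMap.compSubConstCLM ℂ x (𝓕 b : 𝓢(E d, ℂ))) fun y => by
      rw [SchwartzMap.compSubConstCLM_apply, fourier_eq_fourierInv_neg, ← ofReal_ker hb]
      simp
  exact Complex.conj_eq_iff_im.1 h.symm

theorem distConv_add (u : 𝓢'(E d, ℂ)) (a b : 𝓢(E d, ℂ)) (x : E d) :
    distConv u (a + b) x = distConv u a x + distConv u b x := by
  simp [distConv, FourierTransform.fourier_add]

theorem distConv_sum {ι : Type*} (u : 𝓢'(E d, ℂ)) (s : Finset ι) (b : ι → 𝓢(E d, ℂ)) (x : E d) :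
    distConv u (∑ i ∈ s, b i) x = ∑ i ∈ s, distConv u (b i) x := by
  classical
  induction s using Finset.induction_on with
  | empty => simp [distConv, FourierTransform.fourier_zero]
  | insert i s hi ih => rw [Finset.sum_insert hi, Finset.sum_insert hi, distConv_add, ih]

theorem cv_re_distConv (u : 𝓢'(E d, ℂ)) {a b : 𝓢(E d, ℂ)} (hu : IsRealValued u)
    (ha : Herm a) (hb : Herm b) (x : E d) :
    cv a (fun y => (distConv u b y).re) x = (distConv u (mulS a b) x).re := by
  rw [← integral_ker_mul_distConv u ha, cv]
  have h : ∀ y, ((ker a (x - y) : ℝ) : ℂ) * distConv u b y =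
      ((ker a (x - y) * (distConv u b y).re : ℝ) : ℂ) := by
    intro y
    apply Complex.ext
    · simp
    · simp [hu.im_distConv hb]
  simp only [h]
  rw [integral_complex_ofReal, Complex.ofReal_re]

end DirichletNeumann

end

/-! ### Synthesis of functions from families of blocks. -/

noncomputable section
namespace DirichletNeumann
variable {d : ℕ} (φ : LittlewoodPaley d)

/-! ### Functions that are recovered from their dyadic blocks -/

theorem Symbol.IsHom.absD_mul_riesz (k : Fin d) :
    (Symbol.absD * Symbol.riesz k : Symbol d).IsHom 1 := by
  simpa using Symbol.IsHom.absD.mul (Symbol.IsHom.riesz k)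

theorem Symbol.IsReal.absD_mul_riesz (k : Fin d) :
    (Symbol.absD * Symbol.riesz k : Symbol d).IsReal := .mul .absD (.riesz k)

theorem hasSum_cv {ι : Type*} [Countable ι] (a : 𝓢(E d, ℂ)) {g : ι → E d → ℝ} {G : E d → ℝ}
    {b : ι → ℝ} (hm : ∀ i, Measurable (g i)) (hb : ∀ i x, |g i x| ≤ b i * (1 + ‖x‖))
    (hs : Summable b) (hG : ∀ x, HasSum (fun i => g i x) (G x)) (x : E d) :
    HasSum (fun i => cv a (g i) x) (cv a G x) := by
  simp only [cv]
  have hk := (integrable_ker_mul_pow a 1).comp_sub_left x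
  refine hasSum_integral_of_dominated_convergence
    (fun i y => b i * ((1 + ‖x‖) * (|ker a (x - y)| * (1 + ‖x - y‖) ^ 1)))
    (fun i => (((continuous_ker a).comp (continuous_const.sub continuous_id)).measurable.mul
      (hm i)).aestronglyMeasurable) (fun i => Eventually.of_forall fun y => ?_)
    (Eventually.of_forall fun y => hs.mul_right _) ?_
    (Eventually.of_forall fun y => (hG y).mul_left _)
  · have hb0 : 0 ≤ b i := by
      have h := (abs_nonneg _).trans (hb i 0)
      simpa using h
    rw [Real.norm_eq_abs, abs_mul, pow_one]
    calc |ker a (x - y)| * |g i y| ≤ |ker a (x - y)| * (b i * ((1 + ‖x‖) * (1 + ‖x - y‖))) := by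
          gcongr
          exact (hb i y).trans (mul_le_mul_of_nonneg_left (one_add_norm_le_mul x y) hb0)
      _ = _ := by ring
  · simp only [tsum_mul_right]
    exact (hk.const_mul _).const_mul _

/-- Although g may be unbounded, Δ̇_j g is bounded. Differentiating the reproducing formula Δ̇_j g =
∑_i Δ̇_i Δ̇_j g puts the derivative on the outer kernels. -/
theorem hasFDerivAt_block {j : ℤ} {g : E d → ℝ} (hg : LinGrowth g)
    (hs : sn (cv (sig φ 1 j) g) ≠ ⊤) (x : E d) :
    HasFDerivAt (cv (sig φ 1 j) g) (∑ k : Fin d, cv (sig φ (Symbol.absD * Symbol.riesz k) j) g x •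
      (EuclideanSpace.proj k : E d →L[ℝ] ℝ)) x := by
  have h1 : cv (sig φ 1 j) g = fun y => ∑ i ∈ Finset.Icc (j - 1) (j + 1),
      cv (sig φ 1 i) (cv (sig φ 1 j) g) y := by
    ext y
    exact cv_sig_eq_sum φ .one j hg y
  have h2 : (∑ k : Fin d, cv (sig φ (Symbol.absD * Symbol.riesz k) j) g x •
      (EuclideanSpace.proj k : E d →L[ℝ] ℝ)) = ∑ i ∈ Finset.Icc (j - 1) (j + 1),
      ∑ k : Fin d, cv (dirS (EuclideanSpace.single k 1) (sig φ 1 i)) (cv (sig φ 1 j) g) x •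
      (EuclideanSpace.proj k : E d →L[ℝ] ℝ) := by
    rw [Finset.sum_comm]
    refine Finset.sum_congr rfl fun k _ => ?_
    rw [cv_sig_eq_sum φ (.absD_mul_riesz k) j hg, Finset.sum_smul]
    refine Finset.sum_congr rfl fun i _ => ?_
    rw [dirS_sig, Symbol.one_mul']
  rw [h1, h2]
  exact HasFDerivAt.fun_sum fun i _ =>
    hasFDerivAt_cv _ (measurable_cv _ hg.1) (abs_le_of_sn hs) x

theorem exists_fderiv_block_le : ∃ C : ℝ, 0 < C ∧ ∀ (j : ℤ) (g : E d → ℝ), LinGrowth g →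
    sn (cv (sig φ 1 j) g) ≠ ⊤ → ∀ x,
    ‖(∑ k : Fin d, cv (sig φ (Symbol.absD * Symbol.riesz k) j) g x •
      (EuclideanSpace.proj k : E d →L[ℝ] ℝ))‖ ≤ C * ((2 : ℝ) ^ j * (sn (cv (sig φ 1 j) g)).toReal) := by
  choose C hC h using fun k : Fin d =>
    exists_sn_sig_le φ (Symbol.IsHom.absD_mul_riesz k) (.absD_mul_riesz k)
  refine ⟨∑ k, C k + 1, add_pos_of_nonneg_of_pos (Finset.sum_nonneg fun k _ => (hC k).le) one_pos,
    fun j g hg hs x => ?_⟩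
  set S := (sn (cv (sig φ 1 j) g)).toReal
  have hk : ∀ k, |cv (sig φ (Symbol.absD * Symbol.riesz k) j) g x| ≤ C k * ((2 : ℝ) ^ j * S) := by
    intro k
    have h1 := h k j g hg
    rw [mul_one] at h1
    have h2 := abs_le_of_sn (ne_top_of_le_ne_top (ENNReal.mul_ne_top ENNReal.ofReal_ne_top hs) h1) x
    refine h2.trans ((ENNReal.toReal_mono
      (ENNReal.mul_ne_top ENNReal.ofReal_ne_top hs) h1).trans (le_of_eq ?_))
    rw [ENNReal.toReal_mul, ENNReal.toReal_ofReal (by have := hC k; positivity), mul_assoc]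
  have hS : 0 ≤ S := ENNReal.toReal_nonneg
  refine (norm_sum_smul_proj_le _).trans ?_
  refine (Finset.sum_le_sum fun k _ => hk k).trans ?_
  rw [← Finset.sum_mul]
  gcongr
  simp

theorem exists_abs_block_sub_le : ∃ C : ℝ, 0 < C ∧ ∀ (j : ℤ) (g : E d → ℝ), LinGrowth g →
    sn (cv (sig φ 1 j) g) ≠ ⊤ → ∀ x y, |cv (sig φ 1 j) g x - cv (sig φ 1 j) g y| ≤
      C * ((2 : ℝ) ^ j * (sn (cv (sig φ 1 j) g)).toReal) * ‖x - y‖ := by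
  obtain ⟨C, hC, h⟩ := exists_fderiv_block_le φ
  refine ⟨C, hC, fun j g hg hs x y => ?_⟩
  exact convex_univ.norm_image_sub_le_of_norm_hasFDerivWithin_le (𝕜 := ℝ)
    (fun x _ => (hasFDerivAt_block φ hg hs x).hasFDerivWithinAt) (fun x _ => h j g hg hs x)
    (Set.mem_univ y) (Set.mem_univ x)

/-- The dyadic weight `2^j`. -/
def pw (j : ℤ) : ℝ≥0∞ := ENNReal.ofReal ((2 : ℝ) ^ j)

theorem pw_ne_top (j : ℤ) : pw j ≠ ⊤ := ENNReal.ofReal_ne_top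

theorem pw_ne_zero (j : ℤ) : pw j ≠ 0 := by
  rw [pw, Ne, ENNReal.ofReal_eq_zero, not_le]
  positivity

theorem toReal_pw_mul (j : ℤ) (s : ℝ≥0∞) : (pw j * s).toReal = (2 : ℝ) ^ j * s.toReal := by
  rw [ENNReal.toReal_mul, pw, ENNReal.toReal_ofReal (by positivity)]

theorem ne_top_of_tsum_pw {s : ℤ → ℝ≥0∞} (h : ∑' j, pw j * s j ≠ ⊤) (j : ℤ) : s j ≠ ⊤ := by
  intro hj
  have := ENNReal.ne_top_of_tsum_ne_top h j
  rw [hj, ENNReal.mul_top (pw_ne_zero j)] at this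
  exact this rfl

theorem summable_pw {s : ℤ → ℝ≥0∞} (h : ∑' j, pw j * s j ≠ ⊤) :
    Summable fun j : ℤ => (2 : ℝ) ^ j * (s j).toReal := by
  simpa only [toReal_pw_mul] using ENNReal.summable_toReal h

/-- A family of functions that behaves like the dyadic blocks of an element of `Ḃ¹_{∞,1}`. -/
structure LPFamily (h : ℤ → E d → ℝ) : Prop where
  meas : ∀ j, Measurable (h j)
  comm : ∀ i j x, cv (sig φ 1 i) (h j) x = cv (sig φ 1 j) (h i) x
  repr : ∀ j x, h j x = ∑ i ∈ Finset.Icc (j - 1) (j + 1), cv (sig φ 1 i) (h j) x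
  sum : ∑' j, pw j * sn (h j) ≠ ⊤

/-- The function `g` is, up to a constant, recovered from its dyadic blocks. -/
structure Realized (g : E d → ℝ) : Prop where
  growth : LinGrowth g
  sum : ∑' j, pw j * sn (cv (sig φ 1 j) g) ≠ ⊤
  eq : ∀ x, g x - g 0 = ∑' j, (cv (sig φ 1 j) g x - cv (sig φ 1 j) g 0)

variable {φ}

theorem LPFamily.ne_top {h : ℤ → E d → ℝ} (H : LPFamily φ h) (j : ℤ) : sn (h j) ≠ ⊤ :=
  ne_top_of_tsum_pw H.sum j

theorem LPFamily.growth {h : ℤ → E d → ℝ} (H : LPFamily φ h) (j : ℤ) : LinGrowth (h j) :=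
  .of_bounded (H.meas j) (abs_le_of_sn (H.ne_top j))

theorem LPFamily.eq_zero {h : ℤ → E d → ℝ} (H : LPFamily φ h) {i j : ℤ} (hij : 1 < |i - j|)
    (x : E d) : cv (sig φ 1 i) (h j) x = 0 := by
  have h1 : h j = fun x => ∑ k ∈ Finset.Icc (j - 1) (j + 1), cv (sig φ 1 k) (h j) x :=
    funext (H.repr j)
  rw [h1, cv_sum fun k _ => (H.growth j).cv _]
  refine Finset.sum_eq_zero fun k _ => ?_
  rw [show cv (sig φ 1 k) (h j) = cv (sig φ 1 j) (h k) from funext fun x => H.comm k j x]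
  exact cv_cv_eq_zero (herm_sig φ .one i) (herm_sig φ .one j) (H.growth k)
    (sig_mul_eq_zero φ 1 1 hij) x

/-- The blocks of `∑_j (h_j - h_j(0))` are the `h_j`. -/
theorem hasSum_cv_of_growth {h : ℤ → E d → ℝ} {G : E d → ℝ} (hm : ∀ j, Measurable (h j))
    {C : ℝ} (hlip : ∀ j x, |h j x - h j 0| ≤ C * ((2 : ℝ) ^ j * (sn (h j)).toReal) * ‖x‖)
    (hC : 0 ≤ C) (hb : ∀ j, sn (h j) ≠ ⊤) (hs : ∑' j, pw j * sn (h j) ≠ ⊤)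
    (hG : LinGrowth G) (heq : ∀ x, HasSum (fun j => h j x - h j 0) (G x - G 0))
    {a : 𝓢(E d, ℂ)} (ha : a 0 = 0) (x : E d) :
    HasSum (fun j => cv a (h j) x) (cv a G x) := by
  -- A symbol vanishing at the origin annihilates constants, so the normalizing constants h_j(0),
  -- whose sum need not converge, disappear.
  have hc : ∀ (g : E d → ℝ), LinGrowth g → cv a (fun y => g y - g 0) x = cv a g x := by
    intro g hg
    rw [cv_sub hg (.of_bounded measurable_const (M := |g 0|) fun _ => le_rfl), cv_const, ha]
    simp
  have h1 := hasSum_cv a (g := fun j x => h j x - h j 0) (G := fun x => G x - G 0)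
    (b := fun j => C * ((2 : ℝ) ^ j * (sn (h j)).toReal)) (fun j => (hm j).sub_const _)
    (fun j x => (hlip j x).trans (by
      have : 0 ≤ C * ((2 : ℝ) ^ j * (sn (h j)).toReal) := by positivity
      gcongr
      linarith)) ((summable_pw hs).mul_left C) heq x
  rw [hc G hG] at h1
  refine h1.congr_fun fun j => ?_
  exact (hc _ (.of_bounded (hm j) (abs_le_of_sn (hb j)))).symm

theorem Realized.ne_top {g : E d → ℝ} (hg : Realized φ g) (j : ℤ) : sn (cv (sig φ 1 j) g) ≠ ⊤ :=
  ne_top_of_tsum_pw hg.sum j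

theorem summable_block_sub {g : E d → ℝ} (hg : LinGrowth g)
    (hs : ∑' j, pw j * sn (cv (sig φ 1 j) g) ≠ ⊤) (x y : E d) :
    Summable fun j => cv (sig φ 1 j) g x - cv (sig φ 1 j) g y := by
  obtain ⟨C, hC, h⟩ := exists_abs_block_sub_le φ
  refine Summable.of_norm_bounded (((summable_pw hs).mul_left C).mul_right ‖x - y‖) fun j => ?_
  exact h j g hg (ne_top_of_tsum_pw hs j) x y

theorem Realized.hasSum {g : E d → ℝ} (hg : Realized φ g) (x : E d) :
    HasSum (fun j => cv (sig φ 1 j) g x - cv (sig φ 1 j) g 0) (g x - g 0) := by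
  rw [hg.eq x]
  exact (summable_block_sub hg.growth hg.sum x 0).hasSum

/-- The sum of an `LPFamily`. -/
theorem LPFamily.realized {h : ℤ → E d → ℝ} (H : LPFamily φ h) {G : E d → ℝ}
    (hG : ∀ x, G x - G 0 = ∑' j, (h j x - h j 0)) :
    Realized φ G ∧ ∀ j x, cv (sig φ 1 j) G x = h j x := by
  obtain ⟨C, hC, hlip⟩ := exists_abs_block_sub_le φ
  have hsn : ∀ i j, sn (cv (sig φ 1 i) (h j)) ≠ ⊤ := fun i j =>
    ne_top_of_le_ne_top (ENNReal.mul_ne_top ENNReal.ofReal_ne_top (H.ne_top j)) (sn_cv_le _ _)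
  obtain ⟨K, hK, hK1⟩ := exists_sn_sig_le φ (m := (1 : Symbol d)) Symbol.IsHom.one .one
  obtain ⟨K', hK', hker⟩ := exists_kerNorm_sig_le' φ (m := (1 : Symbol d)) Symbol.IsHom.one
  set S : ℤ → ℝ := fun j => (sn (h j)).toReal
  have hS : ∀ j, 0 ≤ S j := fun j => ENNReal.toReal_nonneg
  set L := C * (2 * K') * 3
  -- An `LPFamily` has no smoothness assumption; the reproducing formula makes h_j a combination of
  -- smooth blocks, and this gives the Lipschitz constant of order 2^j sup |h_j|.
  have hlip' : ∀ j x, |h j x - h j 0| ≤ L * ((2 : ℝ) ^ j * S j) * ‖x‖ := by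
    intro j x
    rw [H.repr j x, H.repr j 0, ← Finset.sum_sub_distrib]
    refine (Finset.abs_sum_le_sum_abs _ _).trans ?_
    have h1 : ∀ i ∈ Finset.Icc (j - 1) (j + 1),
        |cv (sig φ 1 i) (h j) x - cv (sig φ 1 i) (h j) 0| ≤
          C * (2 * K') * ((2 : ℝ) ^ j * S j) * ‖x‖ := by
      intro i hi
      have h2 := hlip i (h j) (H.growth j) (hsn i j) x 0
      rw [sub_zero] at h2
      have h3 : (sn (cv (sig φ 1 i) (h j))).toReal ≤ K' * S j := by
        have h4 := ENNReal.toReal_mono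
          (ENNReal.mul_ne_top ENNReal.ofReal_ne_top (H.ne_top j)) (sn_cv_le (sig φ 1 i) (h j))
        rw [ENNReal.toReal_mul, ENNReal.toReal_ofReal (kerNorm_nonneg _)] at h4
        refine h4.trans ?_
        have := hker i
        rw [mul_zero, zpow_zero, mul_one] at this
        exact mul_le_mul_of_nonneg_right this (hS j)
      have h5 : (2 : ℝ) ^ i ≤ 2 * (2 : ℝ) ^ j := by
        rw [Finset.mem_Icc] at hi
        calc (2 : ℝ) ^ i ≤ 2 ^ (j + 1) := zpow_le_zpow_right₀ (by norm_num) hi.2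
          _ = 2 * 2 ^ j := by rw [zpow_add₀ (by norm_num)]; ring
      have hSj := hS j
      calc _ ≤ C * ((2 : ℝ) ^ i * (sn (cv (sig φ 1 i) (h j))).toReal) * ‖x‖ := h2
        _ ≤ C * ((2 * (2 : ℝ) ^ j) * (K' * S j)) * ‖x‖ := by gcongr
        _ = _ := by ring
    refine (Finset.sum_le_sum h1).trans (le_of_eq ?_)
    rw [Finset.sum_const, Int.card_Icc, show (j + 1 + 1 - (j - 1)).toNat = 3 by lia]
    simp only [L]
    ring
  have hL : 0 ≤ L := by positivity
  have hb0 : ∀ j, 0 ≤ L * ((2 : ℝ) ^ j * S j) := fun j => by have := hS j; positivity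
  have hsumm : Summable fun j => L * ((2 : ℝ) ^ j * S j) := (summable_pw H.sum).mul_left L
  have hsum : ∀ x, Summable fun j => h j x - h j 0 := fun x =>
    Summable.of_norm_bounded (hsumm.mul_right ‖x‖) fun j => hlip' j x
  have heq : ∀ x, HasSum (fun j => h j x - h j 0) (G x - G 0) := fun x => by
    rw [hG x]
    exact (hsum x).hasSum
  have hGm : Measurable G := by
    have h1 : G = fun x => G 0 + ∑' j, (h j x - h j 0) := by
      ext x
      rw [← hG x]
      ring
    rw [h1]
    exact measurable_const.add (Measurable.tsum fun j => (H.meas j).sub_const _)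
  have hgrow : LinGrowth G := by
    refine ⟨hGm, |G 0| + ∑' j, L * ((2 : ℝ) ^ j * S j),
      add_nonneg (abs_nonneg _) (tsum_nonneg hb0), fun x => ?_⟩
    have h1 : |G x - G 0| ≤ (∑' j, L * ((2 : ℝ) ^ j * S j)) * ‖x‖ := by
      rw [hG x, ← tsum_mul_right]
      exact tsum_of_norm_bounded (f := fun j => h j x - h j 0) (hsumm.mul_right ‖x‖).hasSum
        fun j => hlip' j x
    have h2 : |G x| ≤ |G x - G 0| + |G 0| := by simpa using abs_add_le (G x - G 0) (G 0)
    have h3 : 0 ≤ ∑' j, L * ((2 : ℝ) ^ j * S j) := tsum_nonneg hb0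
    nlinarith [norm_nonneg x, abs_nonneg (G 0), mul_nonneg (abs_nonneg (G 0)) (norm_nonneg x)]
  have hblock : ∀ j x, cv (sig φ 1 j) G x = h j x := by
    intro j x
    have h1 := hasSum_cv_of_growth H.meas hlip' hL H.ne_top H.sum hgrow heq (sig_zero φ 1 j) x
    rw [H.repr j x]
    -- Commutation exchanges Δ̇_j h_i with Δ̇_i h_j, and only the three neighbours of j contribute,
    -- so the sum over i is the reproducing formula for h_j.
    refine h1.unique ?_
    simp only [H.comm j]
    refine hasSum_sum_of_ne_finset_zero fun i hi => H.eq_zero ?_ x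
    rw [Finset.mem_Icc] at hi
    rw [lt_abs]
    lia
  refine ⟨⟨hgrow, ?_, fun x => ?_⟩, hblock⟩
  · have : ∀ j, cv (sig φ 1 j) G = h j := fun j => funext (hblock j)
    simp only [this]
    exact H.sum
  · rw [hG x]
    simp only [hblock]

/-- Termwise differentiation is justified since the derivatives of the blocks are bounded by a
multiple of 2^j ‖Δ̇_j g‖, which is summable; the block differences vanish at 0, so the series
converges there. -/
theorem Realized.hasFDerivAt {g : E d → ℝ} (hg : Realized φ g) (x : E d) :
    HasFDerivAt g (∑' j : ℤ, ∑ k : Fin d, cv (sig φ (Symbol.absD * Symbol.riesz k) j) g x •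
      (EuclideanSpace.proj k : E d →L[ℝ] ℝ)) x := by
  obtain ⟨C, hC, h⟩ := exists_fderiv_block_le φ
  have h1 := hasFDerivAt_tsum (𝕜 := ℝ) (f := fun j y => cv (sig φ 1 j) g y - cv (sig φ 1 j) g 0)
    ((summable_pw hg.sum).mul_left C)
    (fun j y => (hasFDerivAt_block φ hg.growth (hg.ne_top j) y).sub_const _)
    (fun j y => h j g hg.growth (hg.ne_top j) y) (x₀ := 0) (by simp) x
  simp only [← hg.eq] at h1
  simpa using h1.add_const (g 0)

theorem Realized.hasSum_mult_riesz {g : E d → ℝ} (hg : Realized φ g) (k : Fin d) (x : E d) :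
    HasSum (fun j => cv (sig φ (Symbol.absD * Symbol.riesz k) j) g x) (gradient g x k) := by
  obtain ⟨C, hC, h⟩ := exists_fderiv_block_le φ
  have hs : Summable fun j : ℤ => ∑ k : Fin d, cv (sig φ (Symbol.absD * Symbol.riesz k) j) g x •
      (EuclideanSpace.proj k : E d →L[ℝ] ℝ) :=
    Summable.of_norm_bounded ((summable_pw hg.sum).mul_left C)
      fun j => h j g hg.growth (hg.ne_top j) x
  have h1 : gradient g x k = fderiv ℝ g x (EuclideanSpace.single k 1) := by
    have h2 := EuclideanSpace.inner_single_left k (1 : ℝ) (gradient g x)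
    simpa using h2.symm
  rw [h1, (hg.hasFDerivAt x).fderiv]
  have h3 := hs.hasSum.mapL (ContinuousLinearMap.apply ℝ ℝ (EuclideanSpace.single k (1 : ℝ)))
  refine h3.congr_fun fun j => ?_
  simp

end DirichletNeumann

end

/-! ### The Poisson semigroup on realized functions. -/

noncomputable section
namespace DirichletNeumann
variable {d : ℕ}

/-! ### Series of bounded functions -/

theorem ne_top_of_tsum_sn {ι : Type*} {g : ι → E d → ℝ} (hs : ∑' i, sn (g i) ≠ ⊤) (i : ι) :
    sn (g i) ≠ ⊤ := ENNReal.ne_top_of_tsum_ne_top hs i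

theorem summable_of_sn {ι : Type*} {g : ι → E d → ℝ} (hs : ∑' i, sn (g i) ≠ ⊤) (x : E d) :
    Summable fun i => g i x :=
  summable_of_tsum_enorm (ne_top_of_le_ne_top hs (ENNReal.tsum_le_tsum fun i => enorm_le_sn (g i) x))

theorem continuous_tsum_of_sn {ι : Type*} {g : ι → E d → ℝ} (hc : ∀ i, Continuous (g i))
    (hs : ∑' i, sn (g i) ≠ ⊤) : Continuous fun x => ∑' i, g i x :=
  continuous_tsum hc (ENNReal.summable_toReal hs) fun i x => abs_le_of_sn (ne_top_of_tsum_sn hs i) x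

theorem hasSum_cv_of_sn {ι : Type*} [Countable ι] (a : 𝓢(E d, ℂ)) {g : ι → E d → ℝ}
    (hm : ∀ i, Measurable (g i)) (hs : ∑' i, sn (g i) ≠ ⊤) (x : E d) :
    HasSum (fun i => cv a (g i) x) (cv a (fun y => ∑' i, g i y) x) := by
  refine hasSum_cv a (b := fun i => (sn (g i)).toReal) hm (fun i x => ?_)
    (ENNReal.summable_toReal hs) (fun y => (summable_of_sn hs y).hasSum) x
  refine (abs_le_of_sn (ne_top_of_tsum_sn hs i) x).trans ?_
  exact le_mul_of_one_le_right ENNReal.toReal_nonneg (by simp)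

variable (φ : LittlewoodPaley d)

theorem hasSum_cv_cv_sig {m n : Symbol d} (hm : m.IsReal) (hn : n.IsReal) (j : ℤ) {g : E d → ℝ}
    (hg : LinGrowth g) (x : E d) :
    HasSum (fun i => cv (sig φ m j) (cv (sig φ n i) g) x) (cv (sig φ (m * n) j) g x) := by
  rw [Symbol.mul_comm', cv_sig_mul φ hn hm j hg]
  simp only [cv_cv_comm (herm_sig φ hn _) (herm_sig φ hm _) hg]
  refine hasSum_sum_of_ne_finset_zero fun i hi => ?_
  refine cv_cv_eq_zero (herm_sig φ hm j) (herm_sig φ hn i) hg (sig_mul_eq_zero φ m n ?_) x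
  rw [Finset.mem_Icc] at hi
  rw [lt_abs]
  lia

/-! ### The Poisson extension at a fixed time -/

/-- Integrating |D|e^{s|D|} over s from 0 to t gains |t| 2^j. The Ḃ¹ bound then makes (e^{t|D|} -
1)g a convergent series of bounded functions even when g itself is unbounded. -/
theorem exists_sn_expDSubOne_le : ∃ C : ℝ, 0 < C ∧ ∀ t ≤ 0, ∀ (j : ℤ) (g : E d → ℝ), LinGrowth g →
    sn (cv (sig φ 1 j) g) ≠ ⊤ → sn (cv (sig φ (Symbol.expDSubOne t) j) g) ≤
      ENNReal.ofReal (C * |t|) * (pw j * sn (cv (sig φ 1 j) g)) := by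
  obtain ⟨C, hC, h⟩ := exists_sn_sig_expD_le φ (m := (Symbol.absD : Symbol d)) .absD .absD
  refine ⟨C, hC, fun t ht j g hg hs => ?_⟩
  have h1 : ∀ x, |cv (sig φ (Symbol.expDSubOne t) j) g x| ≤
      C * |t| * ((2 : ℝ) ^ j * (sn (cv (sig φ 1 j) g)).toReal) := by
    intro x
    rw [cv_expDSubOne φ t ht j hg hs]
    have h2 := intervalIntegral.norm_integral_le_of_norm_le_const (a := (0 : ℝ)) (b := t)
      (f := fun s => cv (sig φ (Symbol.absD * Symbol.expD s) j) g x)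
      (C := C * (2 : ℝ) ^ j * (sn (cv (sig φ 1 j) g)).toReal) (fun s hs' => ?_)
    · rw [Real.norm_eq_abs, sub_zero] at h2
      refine h2.trans (le_of_eq ?_)
      ring
    · rw [Set.uIoc_of_ge ht] at hs'
      have h3 := h s hs'.2 j g hg
      have h4 := abs_le_of_sn (ne_top_of_le_ne_top (ENNReal.mul_ne_top ENNReal.ofReal_ne_top hs) h3) x
      refine h4.trans ((ENNReal.toReal_mono (ENNReal.mul_ne_top ENNReal.ofReal_ne_top hs) h3).trans ?_)
      rw [ENNReal.toReal_mul, ENNReal.toReal_ofReal (by positivity), mul_one]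
      refine mul_le_mul_of_nonneg_right ?_ ENNReal.toReal_nonneg
      refine mul_le_of_le_one_right (by positivity) ?_
      rw [Real.exp_le_one_iff]
      have : (0 : ℝ) < 2 ^ j := by positivity
      nlinarith [hs'.2]
  refine (sn_le_ofReal h1).trans (le_of_eq ?_)
  rw [ENNReal.ofReal_mul (by positivity), ENNReal.ofReal_mul (by positivity : (0 : ℝ) ≤ 2 ^ j),
    ENNReal.ofReal_toReal hs, pw]

variable {φ}

theorem tsum_sn_expDSubOne_ne_top {t : ℝ} (ht : t ≤ 0) {g : E d → ℝ} (hg : LinGrowth g)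
    (hs : ∑' j, pw j * sn (cv (sig φ 1 j) g) ≠ ⊤) :
    ∑' j, sn (cv (sig φ (Symbol.expDSubOne t) j) g) ≠ ⊤ := by
  obtain ⟨C, hC, h⟩ := exists_sn_expDSubOne_le φ
  refine ne_top_of_le_ne_top ?_
    (ENNReal.tsum_le_tsum fun j => h t ht j g hg (ne_top_of_tsum_pw hs j))
  rw [ENNReal.tsum_mul_left]
  exact ENNReal.mul_ne_top ENNReal.ofReal_ne_top hs

theorem measurable_mult (m : Symbol d) (hm : m.IsReal) {g : E d → ℝ} (hg : Measurable g) :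
    Measurable (mult φ m g) := by
  rw [funext (mult_eq φ hm g)]
  exact Measurable.tsum fun j => measurable_cv _ hg

theorem linGrowth_mult {m : Symbol d} (hm : m.IsReal) {g : E d → ℝ} (hg : Measurable g)
    (hs : ∑' j, sn (cv (sig φ m j) g) ≠ ⊤) : LinGrowth (mult φ m g) := by
  refine .of_bounded (M := (∑' j, sn (cv (sig φ m j) g)).toReal) (measurable_mult m hm hg)
    fun x => ?_
  rw [mult_eq φ hm]
  have h1 := sn_tsum_le (fun j => cv (sig φ m j) g)
  exact (abs_le_of_sn (ne_top_of_le_ne_top hs h1) x).trans (ENNReal.toReal_mono hs h1)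

theorem linGrowth_poisson {t : ℝ} (ht : t ≤ 0) {g : E d → ℝ} (hg : LinGrowth g)
    (hs : ∑' j, pw j * sn (cv (sig φ 1 j) g) ≠ ⊤) : LinGrowth (poisson φ t g) :=
  hg.add (linGrowth_mult (.expDSubOne t) hg.1 (tsum_sn_expDSubOne_ne_top ht hg hs))

/-- The extension g + (e^{t|D|} - 1)g, defined with an untouched zero frequency, has the blocks
expected of e^{t|D|}g, because every block symbol vanishes at the origin and 1 + (e^{t|ξ|} - 1) =
e^{t|ξ|} elsewhere. -/
theorem cv_sig_poisson {m : Symbol d} (hm : m.IsReal) {t : ℝ} (ht : t ≤ 0) (j : ℤ) {g : E d → ℝ}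
    (hg : LinGrowth g) (hs : ∑' j, pw j * sn (cv (sig φ 1 j) g) ≠ ⊤) (x : E d) :
    cv (sig φ m j) (poisson φ t g) x = cv (sig φ (m * Symbol.expD t) j) g x := by
  have h0 := tsum_sn_expDSubOne_ne_top ht hg hs
  have h1 : cv (sig φ m j) (mult φ (Symbol.expDSubOne t) g) x =
      cv (sig φ (m * Symbol.expDSubOne t) j) g x := by
    rw [funext (mult_eq φ (.expDSubOne t) g)]
    exact (hasSum_cv_of_sn _ (fun i => measurable_cv _ hg.1) h0 x).unique
      (hasSum_cv_cv_sig φ hm (.expDSubOne t) j hg x)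
  change cv (sig φ m j) (fun y => g y + mult φ (Symbol.expDSubOne t) g y) x = _
  rw [cv_add hg (linGrowth_mult (.expDSubOne t) hg.1 h0), h1, ← cv_add_symbol hg]
  refine cv_symbol_congr (fun ξ => ?_) g x
  rw [add_apply, sig_apply, sig_apply, sig_apply]
  simp only [Symbol.mul_toFun, Symbol.expDSubOne]
  ring

theorem tsum_pw_sn_expD_ne_top {t : ℝ} (ht : t ≤ 0) {g : E d → ℝ} (hg : LinGrowth g)
    (hs : ∑' j, pw j * sn (cv (sig φ 1 j) g) ≠ ⊤) :
    ∑' j, pw j * sn (cv (sig φ (1 * Symbol.expD t) j) g) ≠ ⊤ := by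
  obtain ⟨C, hC, h⟩ := exists_sn_sig_expD_le φ (m := (1 : Symbol d)) .one .one
  have h1 : ∀ j, pw j * sn (cv (sig φ (1 * Symbol.expD t) j) g) ≤
      ENNReal.ofReal C * (pw j * sn (cv (sig φ 1 j) g)) := by
    intro j
    rw [mul_left_comm]
    gcongr
    refine (h t ht j g hg).trans ?_
    gcongr
    rw [mul_zero, zpow_zero, mul_one]
    refine mul_le_of_le_one_right hC.le ?_
    rw [Real.exp_le_one_iff]
    have : (0 : ℝ) < 2 ^ j := by positivity
    nlinarith
  refine ne_top_of_le_ne_top ?_ (ENNReal.tsum_le_tsum h1)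
  rw [ENNReal.tsum_mul_left]
  exact ENNReal.mul_ne_top ENNReal.ofReal_ne_top hs

theorem Realized.poisson {t : ℝ} (ht : t ≤ 0) {g : E d → ℝ} (hg : Realized φ g) :
    Realized φ (poisson φ t g) := by
  have h0 := tsum_sn_expDSubOne_ne_top ht hg.growth hg.sum
  have hb : ∀ j x, cv (sig φ 1 j) (DirichletNeumann.poisson φ t g) x =
      cv (sig φ (1 * Symbol.expD t) j) g x :=
    fun j x => cv_sig_poisson .one ht j hg.growth hg.sum x
  refine ⟨linGrowth_poisson ht hg.growth hg.sum, ?_, fun x => ?_⟩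
  · simp only [sn_congr (hb _)]
    exact tsum_pw_sn_expD_ne_top ht hg.growth hg.sum
  · have h1 := (hg.hasSum x).add ((summable_of_sn h0 x).hasSum.sub (summable_of_sn h0 0).hasSum)
    rw [← mult_eq φ (.expDSubOne t), ← mult_eq φ (.expDSubOne t)] at h1
    have h2 : DirichletNeumann.poisson φ t g x - DirichletNeumann.poisson φ t g 0 = g x - g 0 +
        (mult φ (Symbol.expDSubOne t) g x - mult φ (Symbol.expDSubOne t) g 0) := by
      simp only [DirichletNeumann.poisson]
      ring
    rw [h2, ← h1.tsum_eq]
    refine tsum_congr fun j => ?_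
    have h3 : ∀ y, cv (sig φ (1 * Symbol.expD t) j) g y =
        cv (sig φ 1 j) g y + cv (sig φ (Symbol.expDSubOne t) j) g y := by
      intro y
      rw [← cv_add_symbol hg.growth]
      refine cv_symbol_congr (fun ξ => ?_) g y
      rw [add_apply, sig_apply, sig_apply, sig_apply]
      simp only [Symbol.mul_toFun, Symbol.one_toFun, Symbol.expDSubOne]
      ring
    rw [hb, hb, h3, h3]
    ring

theorem Realized.of_bounded {g : E d → ℝ} (hc : Continuous g) {M : ℝ} (hM : ∀ x, |g x| ≤ M)
    (hs : ∑' j, pw j * sn (cv (sig φ 1 j) g) ≠ ⊤) : Realized φ g := by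
  have hg := LinGrowth.of_bounded hc.measurable hM
  exact ⟨hg, hs, fun x => (hasSum_cv_sub φ hc hM x (summable_block_sub hg hs x 0)).tsum_eq.symm⟩

theorem Realized.add {g h : E d → ℝ} (hg : Realized φ g) (hh : Realized φ h) :
    Realized φ (fun x => g x + h x) := by
  have hb : ∀ j x, cv (sig φ 1 j) (fun x => g x + h x) x =
      cv (sig φ 1 j) g x + cv (sig φ 1 j) h x := fun j x => cv_add hg.growth hh.growth x
  refine ⟨hg.growth.add hh.growth, ?_, fun x => ?_⟩
  · refine ne_top_of_le_ne_top (ENNReal.add_ne_top.2 ⟨hg.sum, hh.sum⟩) ?_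
    rw [← ENNReal.tsum_add]
    refine ENNReal.tsum_le_tsum fun j => ?_
    rw [← mul_add, sn_congr (hb j)]
    gcongr
    exact sn_add_le _ _
  · have h1 := ((hg.hasSum x).add (hh.hasSum x)).tsum_eq
    simp only [hb]
    rw [add_sub_add_comm, ← h1]
    exact tsum_congr fun j => by ring

theorem Realized.realization_pair {g : E d → ℝ} (hg : Realized φ g) (x : E d) :
    realization φ (pair g) x = g x - g 0 := by
  rw [hg.eq x, realization]
  refine tsum_congr fun j => ?_
  rw [block_pair φ .one, block_pair φ .one, ← Complex.ofReal_sub, Complex.ofReal_re]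

/-! ### The inverse of `|D|` -/

/-- `|D|⁻¹`. -/
def Symbol.invAbsD : Symbol d :=
  ⟨fun ξ => (((‖ξ‖ : ℝ) : ℂ))⁻¹, contDiffOn_ofReal_norm.inv fun ξ hξ => by simpa using hξ⟩

theorem Symbol.IsReal.invAbsD : (Symbol.invAbsD : Symbol d).IsReal :=
  fun ξ => by simp [Symbol.invAbsD]

theorem Symbol.IsHom.invAbsD : (Symbol.invAbsD : Symbol d).IsHom (-1) := fun j ξ => by
  simp [Symbol.invAbsD, norm_smul, mul_comm]

/-- On a dyadic block |D| is invertible with a smooth symbol, and the kernel of |D|⁻¹ has mass of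
order 2^{-j}. -/
theorem exists_pw_mul_sn_le (φ : LittlewoodPaley d) : ∃ C : ℝ, 0 < C ∧ ∀ (j : ℤ) (g : E d → ℝ),
    LinGrowth g → pw j * sn (cv (sig φ 1 j) g) ≤
      ENNReal.ofReal C * sn (cv (sig φ Symbol.absD j) g) := by
  obtain ⟨C, hC, h⟩ := exists_sn_sig_expD_mul_le φ (m := (Symbol.invAbsD : Symbol d)) .invAbsD
    .invAbsD
  refine ⟨C, hC, fun j g hg => ?_⟩
  have h1 := h Symbol.absD .absD 0 le_rfl j g hg
  have h2 : ∀ x, cv (sig φ (Symbol.invAbsD * Symbol.expD 0 * Symbol.absD) j) g x =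
      cv (sig φ 1 j) g x := by
    refine cv_symbol_congr (fun ξ => ?_) g
    by_cases hξ : ξ = 0
    · rw [hξ, sig_zero, sig_zero]
    · rw [sig_apply, sig_apply, Symbol.mul_expD_zero]
      have : (((‖(2 * Real.pi) • ξ‖ : ℝ) : ℂ)) ≠ 0 := by
        have := Real.pi_pos
        simp [hξ, Real.pi_ne_zero]
      simp only [Symbol.mul_toFun, Symbol.invAbsD, Symbol.absD, Symbol.one_toFun]
      rw [inv_mul_cancel₀ this]
  rw [sn_congr h2, mul_zero, zero_div, Real.exp_zero, mul_one] at h1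
  calc pw j * sn (cv (sig φ 1 j) g)
      ≤ pw j * (ENNReal.ofReal (C * (2 : ℝ) ^ (j * -1)) * sn (cv (sig φ Symbol.absD j) g)) := by
        gcongr
    _ = _ := by
        rw [← mul_assoc, pw, ← ENNReal.ofReal_mul (by positivity)]
        congr 2
        rw [mul_neg_one, zpow_neg]
        field_simp

/-! ### Real-valued tempered distributions in `Ḃ¹_{∞,1}` -/

/-- The dyadic weight `2^{js}`. -/
def pwr (s : ℝ) (j : ℤ) : ℝ≥0∞ := ENNReal.ofReal ((2 : ℝ) ^ ((j : ℝ) * s))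

theorem pwr_one (j : ℤ) : pwr 1 j = pw j := by
  rw [pwr, pw, mul_one, Real.rpow_intCast]

theorem pwr_zero (j : ℤ) : pwr 0 j = 1 := by simp [pwr]

theorem pwr_add (s t : ℝ) (j : ℤ) : pwr (s + t) j = pwr s j * pwr t j := by
  rw [pwr, pwr, pwr, ← ENNReal.ofReal_mul (by positivity), mul_add, Real.rpow_add (by norm_num)]

theorem besovNorm_pair {m : Symbol d} (hm : m.IsReal) (s : ℝ) (g : E d → ℝ) :
    besovNorm φ m s (pair g) = ∑' j, pwr s j * sn (cv (sig φ m j) g) := by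
  simp only [besovNorm, block_pair φ hm, sn, pwr]
  simp [enorm]

theorem lpFamily_block {u : 𝓢'(E d, ℂ)} (hu : IsRealValued u) (h : besovNorm φ 1 1 u < ⊤) :
    LPFamily φ fun j x => (distConv u (sig φ 1 j) x).re := by
  refine ⟨fun j => Complex.measurable_re.comp (continuous_distConv u _).measurable,
    fun i j x => ?_, fun j x => ?_, ?_⟩
  · rw [cv_re_distConv u hu (herm_sig φ .one i) (herm_sig φ .one j),
      cv_re_distConv u hu (herm_sig φ .one j) (herm_sig φ .one i)]
    congr 2
    ext ξ
    simp [mul_comm]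
  · simp only [cv_re_distConv u hu (herm_sig φ .one _) (herm_sig φ .one j)]
    rw [← Complex.re_sum, ← distConv_sum, ← sig_mul_eq_sum, Symbol.one_mul']
  · refine ne_top_of_le_ne_top h.ne (ENNReal.tsum_le_tsum fun j => ?_)
    rw [← pwr_one]
    refine mul_le_mul_right (sn_le fun x => ?_) _
    refine le_trans ?_ (le_iSup _ x)
    rw [block_eq_distConv, ← ofReal_norm, ← ofReal_norm]
    exact ENNReal.ofReal_le_ofReal (Complex.abs_re_le_norm _)

/-- The blocks of a real-valued distribution in Ḃ¹ form an `LPFamily`, so their normalized sum is a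
genuine function with the same blocks. The distributions η and f enter the estimates through these
functions. -/
theorem realized_realization {u : 𝓢'(E d, ℂ)} (hu : IsRealValued u)
    (h : besovNorm φ 1 1 u < ⊤) : Realized φ (realization φ u) ∧ ∀ j x,
      cv (sig φ 1 j) (realization φ u) x = (distConv u (sig φ 1 j) x).re := by
  refine (lpFamily_block hu h).realized fun x => ?_
  have h0 : realization φ u 0 = 0 := by simp [realization]
  rw [h0, sub_zero, realization]
  refine tsum_congr fun j => ?_
  rw [block_eq_distConv, block_eq_distConv, Complex.sub_re]

theorem block_eq_cv_realization {u : 𝓢'(E d, ℂ)} (hu : IsRealValued u)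
    (h : besovNorm φ 1 1 u < ⊤) {m : Symbol d} (hm : m.IsReal) (j : ℤ) (x : E d) :
    block φ m j u x = ((cv (sig φ m j) (realization φ u) x : ℝ) : ℂ) := by
  obtain ⟨h1, h2⟩ := realized_realization hu h
  have h3 : cv (sig φ 1 j) (realization φ u) = fun x => (distConv u (sig φ 1 j) x).re :=
    funext (h2 j)
  rw [cv_sig_eq_sum φ hm j h1.growth, h3]
  simp only [cv_re_distConv u hu (herm_sig φ hm _) (herm_sig φ .one j)]
  rw [← Complex.re_sum, ← distConv_sum, ← sig_mul_eq_sum, Symbol.mul_one', block_eq_distConv]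
  apply Complex.ext
  · simp
  · simp [hu.im_distConv (herm_sig φ hm j)]

theorem besovNorm_eq {u : 𝓢'(E d, ℂ)} (hu : IsRealValued u) (h : besovNorm φ 1 1 u < ⊤)
    {m : Symbol d} (hm : m.IsReal) (s : ℝ) :
    besovNorm φ m s u = ∑' j, pwr s j * sn (cv (sig φ m j) (realization φ u)) := by
  simp only [besovNorm, block_eq_cv_realization hu h hm, sn, pwr]
  simp [enorm]

end DirichletNeumann

end

/-! ### The Banach space L^∞ ∩ L̃¹ with weights, and its bounded operations. -/

noncomputable section
namespace DirichletNeumann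
variable {d : ℕ} (φ : LittlewoodPaley d)

/-! ### A Banach space of functions of `(z, x)` -/

theorem measurable_cv_uncurry (a : 𝓢(E d, ℂ)) {g : ℝ → E d → ℝ}
    (hg : Measurable (Function.uncurry g)) :
    Measurable (Function.uncurry fun z => cv a (g z)) := by
  refine (StronglyMeasurable.integral_prod_right (f := fun (p : ℝ × E d) y =>
    ker a (p.2 - y) * g p.1 y) (Measurable.stronglyMeasurable ?_)).measurable
  exact ((continuous_ker a).measurable.comp
    (by fun_prop : Measurable fun q : (ℝ × E d) × E d => q.1.2 - q.2)).mul
    (hg.comp (by fun_prop : Measurable fun q : (ℝ × E d) × E d => (q.1.1, q.2)))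

/-- By continuity the supremum is taken over a countable dense set, which makes it measurable in a
parameter. -/
theorem sn_eq_iSup_denseSeq {g : E d → ℝ} (hg : Continuous g) :
    sn g = ⨆ n : ℕ, ‖g (TopologicalSpace.denseSeq (E d) n)‖ₑ := by
  refine le_antisymm (iSup_le fun x => ?_) (iSup_le fun n => enorm_le_sn g _)
  have hc : IsClosed {x | ‖g x‖ₑ ≤ ⨆ n : ℕ, ‖g (TopologicalSpace.denseSeq (E d) n)‖ₑ} :=
    isClosed_le hg.enorm continuous_const
  have h := (TopologicalSpace.denseRange_denseSeq (E d)).closure_range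
  have h2 : closure (Set.range (TopologicalSpace.denseSeq (E d))) ⊆
      {x | ‖g x‖ₑ ≤ ⨆ n : ℕ, ‖g (TopologicalSpace.denseSeq (E d) n)‖ₑ} := by
    refine hc.closure_subset_iff.2 ?_
    rintro _ ⟨n, rfl⟩
    exact le_iSup (fun n => ‖g (TopologicalSpace.denseSeq (E d) n)‖ₑ) n
  exact h2 (h ▸ Set.mem_univ x)

theorem measurable_sn {ι : Type*} [MeasurableSpace ι] {g : ι → E d → ℝ}
    (hg : Measurable (Function.uncurry g)) (hc : ∀ z, Continuous (g z)) :
    Measurable fun z => sn (g z) := by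
  simp only [fun z => sn_eq_iSup_denseSeq (hc z)]
  exact Measurable.iSup fun n => (hg.comp (measurable_id.prodMk measurable_const)).enorm

/-- The norm of `L¹(J; L^∞)` of the `j`-th block. -/
def blockInt (j : ℤ) (g : ℝ → E d → ℝ) : ℝ≥0∞ :=
  ∫⁻ z in Set.Iio (0 : ℝ), sn (cv (sig φ 1 j) (g z))

/-- The norm of the space `L^∞ ∩ L̃¹(J; B)`, where `B` is the Besov space with weights `W`. -/
def spNorm (W : ℤ → ℝ≥0∞) (g : ℝ → E d → ℝ) : ℝ≥0∞ :=
  (⨆ z, sn (g z)) + ∑' j, W j * blockInt φ j g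

/-- The elements of the space `L^∞ ∩ L̃¹(J; B)`. -/
structure MemSp (W : ℤ → ℝ≥0∞) (g : ℝ → E d → ℝ) : Prop where
  meas : Measurable (Function.uncurry g)
  cont : ∀ z, Continuous (g z)
  fin : spNorm φ W g ≠ ⊤

variable {φ} {W : ℤ → ℝ≥0∞}

theorem sn_le_spNorm (g : ℝ → E d → ℝ) (z : ℝ) : sn (g z) ≤ spNorm φ W g :=
  (le_iSup (fun z => sn (g z)) z).trans le_self_add

theorem tsum_blockInt_le_spNorm (g : ℝ → E d → ℝ) : ∑' j, W j * blockInt φ j g ≤ spNorm φ W g :=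
  le_add_self

theorem MemSp.sn_ne_top {g : ℝ → E d → ℝ} (hg : MemSp φ W g) (z : ℝ) : sn (g z) ≠ ⊤ :=
  ne_top_of_le_ne_top hg.fin (sn_le_spNorm g z)

theorem MemSp.measurable {g : ℝ → E d → ℝ} (hg : MemSp φ W g) (z : ℝ) : Measurable (g z) :=
  (hg.cont z).measurable

theorem MemSp.growth {g : ℝ → E d → ℝ} (hg : MemSp φ W g) (z : ℝ) : LinGrowth (g z) :=
  .of_bounded (hg.measurable z) (abs_le_of_sn (hg.sn_ne_top z))

theorem MemSp.continuous_cv {g : ℝ → E d → ℝ} (hg : MemSp φ W g) (a : 𝓢(E d, ℂ)) (z : ℝ) :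
    Continuous (cv a (g z)) :=
  DirichletNeumann.continuous_cv a (hg.measurable z) (abs_le_of_sn (hg.sn_ne_top z))

theorem MemSp.measurable_sn_cv {g : ℝ → E d → ℝ} (hg : MemSp φ W g) (a : 𝓢(E d, ℂ)) :
    Measurable fun z => sn (cv a (g z)) :=
  measurable_sn (measurable_cv_uncurry a hg.meas) (hg.continuous_cv a)

/-- Countable subadditivity holds since blocks commute with sup-norm convergent series and the
Tonelli theorem exchanges sum and time integral. Completeness and the synthesis lemma both rest on
it. -/
theorem spNorm_tsum_le {ι : Type*} [Countable ι] {g : ι → ℝ → E d → ℝ}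
    (hg : ∀ i, MemSp φ W (g i)) (hs : ∑' i, spNorm φ W (g i) ≠ ⊤) :
    spNorm φ W (fun z x => ∑' i, g i z x) ≤ ∑' i, spNorm φ W (g i) := by
  have hsn : ∀ z, ∑' i, sn (g i z) ≠ ⊤ := fun z =>
    ne_top_of_le_ne_top hs (ENNReal.tsum_le_tsum fun i => sn_le_spNorm (g i) z)
  have hJ : ∀ j, blockInt φ j (fun z x => ∑' i, g i z x) ≤ ∑' i, blockInt φ j (g i) := by
    intro j
    simp only [blockInt]
    rw [← lintegral_tsum fun i => ((hg i).measurable_sn_cv _).aemeasurable]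
    refine lintegral_mono fun z => ?_
    have h1 : cv (sig φ 1 j) (fun x => ∑' i, g i z x) =
        fun x => ∑' i, cv (sig φ 1 j) (g i z) x := by
      ext x
      exact (hasSum_cv_of_sn _ (fun i => (hg i).measurable z) (hsn z) x).tsum_eq.symm
    rw [h1]
    exact sn_tsum_le _
  simp only [spNorm]
  rw [ENNReal.tsum_add]
  refine add_le_add (iSup_le fun z => (sn_tsum_le fun i => g i z).trans
    (ENNReal.tsum_le_tsum fun i => le_iSup (fun z => sn (g i z)) z)) ?_
  rw [ENNReal.tsum_comm]
  refine ENNReal.tsum_le_tsum fun j => ?_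
  rw [ENNReal.tsum_mul_left]
  gcongr
  exact hJ j

theorem memSp_tsum {ι : Type*} [Countable ι] {g : ι → ℝ → E d → ℝ}
    (hg : ∀ i, MemSp φ W (g i)) (hs : ∑' i, spNorm φ W (g i) ≠ ⊤) :
    MemSp φ W (fun z x => ∑' i, g i z x) := by
  refine ⟨?_, fun z => continuous_tsum_of_sn (fun i => (hg i).cont z)
    (ne_top_of_le_ne_top hs (ENNReal.tsum_le_tsum fun i => sn_le_spNorm (g i) z)),
    ne_top_of_le_ne_top hs (spNorm_tsum_le hg hs)⟩
  change Measurable fun p : ℝ × E d => ∑' i, g i p.1 p.2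
  exact Measurable.tsum fun i => (hg i).meas

theorem cv_zero_fun (a : 𝓢(E d, ℂ)) : cv a (fun _ => 0) = fun _ => 0 := by
  ext x
  simp [cv]

theorem spNorm_zero : spNorm φ W (fun _ _ => 0) = 0 := by
  simp [spNorm, blockInt, cv_zero_fun, sn_zero]

theorem memSp_zero : MemSp φ W (fun _ _ => 0) :=
  ⟨measurable_const, fun _ => continuous_const, by rw [spNorm_zero]; exact ENNReal.zero_ne_top⟩

theorem spNorm_add_le {g h : ℝ → E d → ℝ} (hg : MemSp φ W g) (hh : MemSp φ W h) :
    spNorm φ W (fun z x => g z x + h z x) ≤ spNorm φ W g + spNorm φ W h := by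
  have hJ : ∀ j, blockInt φ j (fun z x => g z x + h z x) ≤ blockInt φ j g + blockInt φ j h := by
    intro j
    simp only [blockInt]
    rw [← lintegral_add_left (hg.measurable_sn_cv _)]
    refine lintegral_mono fun z => ?_
    rw [sn_congr (cv_add (hg.growth z) (hh.growth z))]
    exact sn_add_le _ _
  simp only [spNorm]
  rw [add_add_add_comm]
  refine add_le_add (iSup_le fun z => (sn_add_le _ _).trans (add_le_add
    (le_iSup (fun z => sn (g z)) z) (le_iSup (fun z => sn (h z)) z))) ?_
  rw [← ENNReal.tsum_add]
  refine ENNReal.tsum_le_tsum fun j => ?_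
  rw [← mul_add]
  gcongr
  exact hJ j

theorem spNorm_const_mul (c : ℝ) (g : ℝ → E d → ℝ) :
    spNorm φ W (fun z x => c * g z x) = ‖c‖ₑ * spNorm φ W g := by
  have hJ : ∀ j, blockInt φ j (fun z x => c * g z x) = ‖c‖ₑ * blockInt φ j g := by
    intro j
    simp only [blockInt]
    rw [← lintegral_const_mul' _ _ enorm_ne_top]
    refine lintegral_congr fun z => ?_
    rw [sn_congr (cv_const_mul _ c (g z)), sn_const_mul]
  simp only [spNorm, hJ]
  rw [mul_add, ENNReal.mul_iSup, ← ENNReal.tsum_mul_left]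
  simp only [sn_const_mul]
  congr 1
  exact tsum_congr fun j => by ring

variable (φ W) in
/-- The functions in `L^∞ ∩ L̃¹(J; B)` as a submodule. -/
def spSubmodule : Submodule ℝ (ℝ → E d → ℝ) where
  carrier := {g | MemSp φ W g}
  zero_mem' := memSp_zero
  add_mem' := fun {g h} hg hh => ⟨hg.meas.add hh.meas, fun z => (hg.cont z).add (hh.cont z),
    ne_top_of_le_ne_top (ENNReal.add_ne_top.2 ⟨hg.fin, hh.fin⟩) (spNorm_add_le hg hh)⟩
  smul_mem' := fun c g hg => ⟨hg.meas.const_mul c, fun z => (hg.cont z).const_mul c, by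
    have h := spNorm_const_mul (φ := φ) (W := W) c g
    exact fun h1 => ENNReal.mul_ne_top enorm_ne_top hg.fin (h.symm.trans h1)⟩

variable (φ W) in
/-- The space `L^∞ ∩ L̃¹(J; B)`. -/
def Sp : Type := spSubmodule φ W

namespace Sp

instance : AddCommGroup (Sp φ W) := inferInstanceAs (AddCommGroup (spSubmodule φ W))

instance : Module ℝ (Sp φ W) := inferInstanceAs (Module ℝ (spSubmodule φ W))

/-- The underlying function. -/
def val (g : Sp φ W) : ℝ → E d → ℝ := Subtype.val g

theorem mem (g : Sp φ W) : MemSp φ W g.val := Subtype.property g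

/-- Constructor for `Sp`. -/
def mk (g : ℝ → E d → ℝ) (hg : MemSp φ W g) : Sp φ W := ⟨g, hg⟩

@[simp] theorem val_mk (g : ℝ → E d → ℝ) (hg : MemSp φ W g) : (mk g hg).val = g := rfl

theorem ext {g h : Sp φ W} (H : ∀ z x, g.val z x = h.val z x) : g = h :=
  Subtype.ext (funext fun z => funext fun x => H z x)

@[simp] theorem val_zero (z : ℝ) (x : E d) : (0 : Sp φ W).val z x = 0 := rfl

@[simp] theorem val_add (g h : Sp φ W) (z : ℝ) (x : E d) :
    (g + h).val z x = g.val z x + h.val z x := rfl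

@[simp] theorem val_sub (g h : Sp φ W) (z : ℝ) (x : E d) :
    (g - h).val z x = g.val z x - h.val z x := rfl

@[simp] theorem val_neg (g : Sp φ W) (z : ℝ) (x : E d) : (-g).val z x = -g.val z x := rfl

@[simp] theorem val_smul (c : ℝ) (g : Sp φ W) (z : ℝ) (x : E d) :
    (c • g).val z x = c * g.val z x := rfl

theorem val_sum {ι : Type*} (s : Finset ι) (g : ι → Sp φ W) (z : ℝ) (x : E d) :
    (∑ i ∈ s, g i).val z x = ∑ i ∈ s, (g i).val z x := by
  classical
  induction s using Finset.induction_on with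
  | empty => simp
  | insert i s hi ih => rw [Finset.sum_insert hi, Finset.sum_insert hi, val_add, ih]

instance : Norm (Sp φ W) := ⟨fun g => (spNorm φ W g.val).toReal⟩

theorem norm_def (g : Sp φ W) : ‖g‖ = (spNorm φ W g.val).toReal := rfl

/-- The norm uses the supremum over every z, not an essential supremum. Hence norm zero means
identically zero, no quotient is needed, and the value at z = 0, which enters `G`, is meaningful. -/
theorem core : NormedSpace.Core ℝ (Sp φ W) where
  norm_nonneg _ := ENNReal.toReal_nonneg
  norm_smul c g := by
    have h : spNorm φ W (c • g).val = ‖c‖ₑ * spNorm φ W g.val := spNorm_const_mul c g.val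
    rw [norm_def, h, ENNReal.toReal_mul, norm_def]
    simp
  norm_triangle g h := by
    rw [norm_def, norm_def, norm_def, ← ENNReal.toReal_add g.mem.fin h.mem.fin]
    exact ENNReal.toReal_mono (ENNReal.add_ne_top.2 ⟨g.mem.fin, h.mem.fin⟩)
      (spNorm_add_le g.mem h.mem)
  norm_eq_zero_iff g := by
    constructor
    · intro h
      have h1 : spNorm φ W g.val = 0 := by
        rcases (ENNReal.toReal_eq_zero_iff _).1 h with h1 | h1
        · exact h1
        · exact absurd h1 g.mem.fin
      refine Sp.ext fun z x => ?_
      have h2 := (enorm_le_sn (g.val z) x).trans (sn_le_spNorm (φ := φ) (W := W) g.val z)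
      rw [h1] at h2
      simpa using h2
    · rintro rfl
      rw [norm_def]
      have : (0 : Sp φ W).val = fun _ _ => 0 := rfl
      rw [this, spNorm_zero]
      rfl

instance : NormedAddCommGroup (Sp φ W) := NormedAddCommGroup.ofCore core

instance : NormedSpace ℝ (Sp φ W) := NormedSpace.ofCore core

theorem ofReal_norm_eq (g : Sp φ W) : ENNReal.ofReal ‖g‖ = spNorm φ W g.val :=
  ENNReal.ofReal_toReal g.mem.fin

theorem norm_le_of_spNorm_le {g : Sp φ W} {C : ℝ} (hC : 0 ≤ C)
    (h : spNorm φ W g.val ≤ ENNReal.ofReal C) : ‖g‖ ≤ C := by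
  rw [norm_def]
  exact (ENNReal.toReal_mono ENNReal.ofReal_ne_top h).trans_eq (ENNReal.toReal_ofReal hC)

theorem abs_val_le (g : Sp φ W) (z : ℝ) (x : E d) : |g.val z x| ≤ ‖g‖ :=
  (abs_le_of_sn (g.mem.sn_ne_top z) x).trans (ENNReal.toReal_mono g.mem.fin (sn_le_spNorm g.val z))

/-- It suffices that absolutely convergent series converge: the limit is the pointwise sum, and
countable subadditivity bounds the remainder by the tail of the series of norms. -/
instance : CompleteSpace (Sp φ W) := by
  refine NormedAddCommGroup.completeSpace_of_summable_imp_tendsto fun u hu => ?_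
  have hs : ∑' n, spNorm φ W (u n).val ≠ ⊤ := by
    have h1 : ∑' n, spNorm φ W (u n).val = ENNReal.ofReal (∑' n, ‖u n‖) := by
      rw [ENNReal.ofReal_tsum_of_nonneg (fun n => norm_nonneg _) hu]
      exact tsum_congr fun n => (ofReal_norm_eq (u n)).symm
    rw [h1]
    exact ENNReal.ofReal_ne_top
  have hm : ∀ n, MemSp φ W (u n).val := fun n => (u n).mem
  refine ⟨mk _ (memSp_tsum hm hs), ?_⟩
  rw [tendsto_iff_norm_sub_tendsto_zero]
  have htail : Tendsto (fun N : ℕ => (∑' n, spNorm φ W (u (n + N)).val).toReal) atTop (𝓝 0) := by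
    have h2 := (tendsto_sum_nat_add fun n => ‖u n‖)
    refine h2.congr fun N => ?_
    rw [ENNReal.tsum_toReal_eq fun n => (u (n + N)).mem.fin]
    rfl
  refine squeeze_zero (fun _ => norm_nonneg _) (fun N => ?_) htail
  have hsN : ∑' n, spNorm φ W (u (n + N)).val ≠ ⊤ := by
    refine ne_top_of_le_ne_top hs ?_
    exact ENNReal.tsum_comp_le_tsum_of_injective (add_left_injective N)
      (fun n => spNorm φ W (u n).val)
  have h3 := spNorm_tsum_le (fun n => hm (n + N)) hsN
  rw [norm_sub_rev, norm_def]
  refine ENNReal.toReal_mono hsN (le_of_eq_of_le (congrArg _ ?_) h3)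
  funext z x
  have h4 : Summable fun n => (u n).val z x := by
    refine summable_of_sn (g := fun n => (u n).val z) ?_ x
    exact ne_top_of_le_ne_top hs (ENNReal.tsum_le_tsum fun n => sn_le_spNorm (u n).val z)
  rw [val_sub, val_mk, val_sum, ← h4.sum_add_tsum_nat_add N]
  ring

end Sp

end DirichletNeumann

end

noncomputable section
namespace DirichletNeumann
variable {d : ℕ} (φ : LittlewoodPaley d)

/-! ### Weights and products -/

/-- Weights that dominate `2^j` and grow at most geometrically. -/
structure IsWeight (K : ℝ≥0∞) (W : ℤ → ℝ≥0∞) : Prop where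
  const_ne_top : K ≠ ⊤
  pw_le : ∀ j, pw j ≤ W j
  tsum_le : ∀ j, ∑' i : ℕ, W (j + 2 - i) ≤ K * W j

theorem IsWeight.le_of_mem {K : ℝ≥0∞} {W : ℤ → ℝ≥0∞} (hW : IsWeight K W) {i j : ℤ}
    (hi : i ∈ Finset.Icc (j - 1) (j + 1)) : W i ≤ K * W j := by
  rw [Finset.mem_Icc] at hi
  have h1 : i = j + 2 - ((j + 2 - i).toNat : ℤ) := by lia
  refine le_trans ?_ (hW.tsum_le j)
  conv_lhs => rw [h1]
  exact ENNReal.le_tsum (f := fun i : ℕ => W (j + 2 - i)) (j + 2 - i).toNat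

theorem IsWeight.tsum_shift_le {K : ℝ≥0∞} {W : ℤ → ℝ≥0∞} (hW : IsWeight K W) (b : ℤ → ℝ≥0∞) :
    ∑' k : ℤ, W k * ∑' i : ℕ, b (k - 2 + i) ≤ K * ∑' j, W j * b j := by
  simp only [← ENNReal.tsum_mul_left]
  rw [ENNReal.tsum_comm]
  have h1 : ∀ i : ℕ, ∑' k : ℤ, W k * b (k - 2 + i) = ∑' j : ℤ, W (j + 2 - i) * b j := by
    intro i
    rw [← (Equiv.addRight (2 - (i : ℤ))).tsum_eq]
    refine tsum_congr fun j => ?_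
    simp only [Equiv.coe_addRight]
    congr 2 <;> ring
  simp only [h1]
  rw [ENNReal.tsum_comm]
  refine ENNReal.tsum_le_tsum fun j => ?_
  rw [ENNReal.tsum_mul_right, ← mul_assoc]
  gcongr
  exact hW.tsum_le j

/-- Block k of the product is controlled by blocks of index at least k - 2 of one factor times the
sup norm of the other. Summing against W_k and exchanging sums leaves, for each block j, the total
weight of the indices up to j + 2, which the weight condition bounds by K W_j. The constant depends
on W through K only. -/
theorem exists_spNorm_mul_le : ∃ C : ℝ≥0∞, C ≠ ⊤ ∧ ∀ (K : ℝ≥0∞) (W : ℤ → ℝ≥0∞), IsWeight K W →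
    ∀ g f : ℝ → E d → ℝ, MemSp φ W g → MemSp φ W f →
      spNorm φ W (fun z x => g z x * f z x) ≤ (1 + C * K) * (spNorm φ W g * spNorm φ W f) := by
  obtain ⟨C, hC, h⟩ := exists_sn_cv_mul_le φ
  refine ⟨C, hC, fun K W hW g f hg hf => ?_⟩
  set S : (ℝ → E d → ℝ) → ℝ≥0∞ := fun g => ⨆ z, sn (g z) with hS
  have hSl : ∀ (g : ℝ → E d → ℝ) z, sn (g z) ≤ S g := fun g z => le_iSup (fun z => sn (g z)) z
  have hSt : ∀ {g}, MemSp φ W g → S g ≠ ⊤ := fun hg => ne_top_of_le_ne_top hg.fin le_self_add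
  have hJ : ∀ k, blockInt φ k (fun z x => g z x * f z x) ≤
      C * (S f * ∑' i : ℕ, blockInt φ (k - 2 + i) g + S g * ∑' i : ℕ, blockInt φ (k - 2 + i) f) := by
    intro k
    have h1 : ∀ i : ℕ, ∫⁻ z in Set.Iio (0 : ℝ), (sn (cv (sig φ 1 (k - 2 + i)) (g z)) * S f +
        S g * sn (cv (sig φ 1 (k - 2 + i)) (f z))) =
        S f * blockInt φ (k - 2 + i) g + S g * blockInt φ (k - 2 + i) f := by
      intro i
      rw [lintegral_add_left ((hg.measurable_sn_cv _).mul_const _),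
        lintegral_mul_const' _ _ (hSt hf), lintegral_const_mul' _ _ (hSt hg), mul_comm (S f)]
      rfl
    rw [← ENNReal.tsum_mul_left, ← ENNReal.tsum_mul_left, ← ENNReal.tsum_add]
    simp only [← h1]
    have hmeas : ∀ i : ℕ, Measurable fun z => sn (cv (sig φ 1 (k - 2 + i)) (g z)) * S f +
        S g * sn (cv (sig φ 1 (k - 2 + i)) (f z)) := fun i =>
      ((hg.measurable_sn_cv _).mul_const _).add ((hf.measurable_sn_cv _).const_mul _)
    rw [← lintegral_tsum fun i => (hmeas i).aemeasurable, ← lintegral_const_mul' _ _ hC, blockInt]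
    refine lintegral_mono fun z => ?_
    refine (h k (g z) (f z) (hg.cont z) (hf.cont z) (hg.sn_ne_top z) (hf.sn_ne_top z)).trans ?_
    gcongr
    · exact hSl f z
    · exact hSl g z
  have hN : ∑' k, W k * blockInt φ k (fun z x => g z x * f z x) ≤
      C * K * (S f * (∑' j, W j * blockInt φ j g) + S g * ∑' j, W j * blockInt φ j f) := by
    refine (ENNReal.tsum_le_tsum fun k => mul_le_mul_right (hJ k) (W k)).trans ?_
    have h2 : ∀ k, W k * (C * (S f * ∑' i : ℕ, blockInt φ (k - 2 + i) g +
        S g * ∑' i : ℕ, blockInt φ (k - 2 + i) f)) =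
        C * S f * (W k * ∑' i : ℕ, blockInt φ (k - 2 + i) g) +
        C * S g * (W k * ∑' i : ℕ, blockInt φ (k - 2 + i) f) := fun k => by ring
    simp only [h2]
    rw [ENNReal.tsum_add, ENNReal.tsum_mul_left, ENNReal.tsum_mul_left]
    calc _ ≤ C * S f * (K * ∑' j, W j * blockInt φ j g) +
        C * S g * (K * ∑' j, W j * blockInt φ j f) := by
          gcongr
          · exact hW.tsum_shift_le fun j => blockInt φ j g
          · exact hW.tsum_shift_le fun j => blockInt φ j f
      _ = _ := by ring
  have hsup : (⨆ z, sn (fun x => g z x * f z x)) ≤ S g * S f :=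
    iSup_le fun z => (sn_mul_le _ _).trans (mul_le_mul' (hSl g z) (hSl f z))
  set Ng := ∑' j, W j * blockInt φ j g
  set Nf := ∑' j, W j * blockInt φ j f
  calc spNorm φ W (fun z x => g z x * f z x) ≤ S g * S f + C * K * (S f * Ng + S g * Nf) :=
        add_le_add hsup hN
    -- Nonnegative terms are added to complete the product of the two norms.
    _ ≤ S g * S f + C * K * (S f * Ng + S g * Nf) +
        (Ng * S f + S g * Nf + Ng * Nf + C * K * (S g * S f + Ng * Nf)) := le_self_add
    _ = (1 + C * K) * ((S g + Ng) * (S f + Nf)) := by ring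

variable {φ}

theorem MemSp.mul {K : ℝ≥0∞} {W : ℤ → ℝ≥0∞} (hW : IsWeight K W) {g f : ℝ → E d → ℝ}
    (hg : MemSp φ W g) (hf : MemSp φ W f) : MemSp φ W (fun z x => g z x * f z x) := by
  obtain ⟨C, hC, h⟩ := exists_spNorm_mul_le φ
  refine ⟨hg.meas.mul hf.meas, fun z => (hg.cont z).mul (hf.cont z),
    ne_top_of_le_ne_top ?_ (h K W hW g f hg hf)⟩
  have := hW.const_ne_top
  have := hg.fin
  have := hf.fin
  finiteness

/-- Multiplication as a bilinear map. -/
def Sp.mul {K : ℝ≥0∞} {W : ℤ → ℝ≥0∞} (hW : IsWeight K W) : Sp φ W →ₗ[ℝ] Sp φ W →ₗ[ℝ] Sp φ W :=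
  LinearMap.mk₂ ℝ (fun g f => Sp.mk _ (g.mem.mul hW f.mem))
    (fun g g' f => Sp.ext fun z x => by simp [add_mul])
    (fun c g f => Sp.ext fun z x => by simp [mul_assoc])
    (fun g f f' => Sp.ext fun z x => by simp [mul_add])
    (fun c g f => Sp.ext fun z x => by simp [mul_left_comm])

@[simp] theorem Sp.val_mul {K : ℝ≥0∞} {W : ℤ → ℝ≥0∞} (hW : IsWeight K W) (g f : Sp φ W) (z : ℝ)
    (x : E d) : (Sp.mul hW g f).val z x = g.val z x * f.val z x := rfl

variable (φ) in
theorem Sp.exists_norm_mul_le (K : ℝ≥0∞) (hK : K ≠ ⊤) : ∃ M : ℝ, 0 < M ∧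
    ∀ (W : ℤ → ℝ≥0∞) (hW : IsWeight K W) (g f : Sp φ W), ‖Sp.mul hW g f‖ ≤ M * ‖g‖ * ‖f‖ := by
  obtain ⟨C, hC, h⟩ := exists_spNorm_mul_le φ
  have h1 : 1 + C * K ≠ ⊤ := by finiteness
  refine ⟨(1 + C * K).toReal, ENNReal.toReal_pos (by simp) h1, fun W hW g f => ?_⟩
  refine Sp.norm_le_of_spNorm_le (by positivity) ((h K W hW _ _ g.mem f.mem).trans (le_of_eq ?_))
  rw [ENNReal.ofReal_mul (by positivity), ENNReal.ofReal_mul (by positivity),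
    ENNReal.ofReal_toReal h1, Sp.ofReal_norm_eq, Sp.ofReal_norm_eq, mul_assoc]

/-! ### Synthesis from functions with localized spectrum -/

variable (φ) in
-- Each u_j meets only three blocks, so its L̃¹ norm is comparable to W_j times its time integral.
-- The sup bound may lose the factor 2^j relative to the time integral because W_j ≥ 2^j.
theorem exists_spNorm_tsum_le : ∃ C : ℝ≥0∞, C ≠ ⊤ ∧ ∀ (K : ℝ≥0∞) (W : ℤ → ℝ≥0∞), IsWeight K W →
    ∀ (u : ℤ → ℝ → E d → ℝ) (b : ℤ → ℝ≥0∞) (c : ℝ≥0∞),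
      (∀ j, Measurable (Function.uncurry (u j))) → (∀ j z, Continuous (u j z)) →
      (∀ i j, 1 < |i - j| → ∀ z x, cv (sig φ 1 i) (u j z) x = 0) →
      (∀ j z, sn (u j z) ≤ c * (pw j * b j)) →
      (∀ j, ∫⁻ z in Set.Iio (0 : ℝ), sn (u j z) ≤ c * b j) →
      c ≠ ⊤ → ∑' j, W j * b j ≠ ⊤ →
      MemSp φ W (fun z x => ∑' j, u j z x) ∧
      spNorm φ W (fun z x => ∑' j, u j z x) ≤ (1 + C * K) * (c * ∑' j, W j * b j) := by
  obtain ⟨k, hk, hker⟩ := exists_kerNorm_sig_le' φ (m := (1 : Symbol d)) .one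
  refine ⟨3 * ENNReal.ofReal k, by finiteness, fun K W hW u b c hm hc hsupp hsup hint hcT hs => ?_⟩
  have hbl : ∀ i j, blockInt φ i (u j) ≤ ENNReal.ofReal k * (c * b j) := by
    intro i j
    refine le_trans ?_ (mul_le_mul_right (hint j) _)
    rw [blockInt, ← lintegral_const_mul' _ _ ENNReal.ofReal_ne_top]
    refine lintegral_mono fun z => (sn_cv_le _ _).trans ?_
    gcongr
    simpa using hker i
  have hz : ∀ i j, 1 < |i - j| → blockInt φ i (u j) = 0 := by
    intro i j hij
    rw [blockInt]
    have : ∀ z, sn (cv (sig φ 1 i) (u j z)) = 0 := fun z => by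
      rw [sn_congr (hsupp i j hij z), sn_zero]
    simp [this]
  have hN : ∀ j, spNorm φ W (u j) ≤ (1 + 3 * ENNReal.ofReal k * K) * (c * (W j * b j)) := by
    intro j
    have h1 : ∑' i, W i * blockInt φ i (u j) =
        ∑ i ∈ Finset.Icc (j - 1) (j + 1), W i * blockInt φ i (u j) := by
      refine tsum_eq_sum fun i hi => ?_
      rw [hz i j, mul_zero]
      rw [Finset.mem_Icc] at hi
      rw [lt_abs]
      lia
    have h2 : ∑ i ∈ Finset.Icc (j - 1) (j + 1), W i * blockInt φ i (u j) ≤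
        3 * (K * W j * (ENNReal.ofReal k * (c * b j))) := by
      refine (Finset.sum_le_sum fun i hi => mul_le_mul' (hW.le_of_mem hi) (hbl i j)).trans ?_
      rw [Finset.sum_const, Int.card_Icc, show (j + 1 + 1 - (j - 1)).toNat = 3 by lia,
        nsmul_eq_mul]
      simp
    rw [spNorm, h1]
    calc _ ≤ c * (W j * b j) + 3 * (K * W j * (ENNReal.ofReal k * (c * b j))) :=
          add_le_add (iSup_le fun z => (hsup j z).trans (by gcongr; exact hW.pw_le j)) h2
      _ = _ := by ring
  have hK := hW.const_ne_top
  have hsum : ∑' j, spNorm φ W (u j) ≤ (1 + 3 * ENNReal.ofReal k * K) * (c * ∑' j, W j * b j) := by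
    rw [← ENNReal.tsum_mul_left, ← ENNReal.tsum_mul_left]
    exact ENNReal.tsum_le_tsum hN
  have hfin : (1 + 3 * ENNReal.ofReal k * K) * (c * ∑' j, W j * b j) ≠ ⊤ := by finiteness
  have hmem : ∀ j, MemSp φ W (u j) := fun j => ⟨hm j, hc j, ENNReal.ne_top_of_tsum_ne_top
    (ne_top_of_le_ne_top hfin hsum) j⟩
  exact ⟨memSp_tsum hmem (ne_top_of_le_ne_top hfin hsum),
    (spNorm_tsum_le hmem (ne_top_of_le_ne_top hfin hsum)).trans hsum⟩

end DirichletNeumann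

end

noncomputable section
namespace DirichletNeumann
variable {d : ℕ} {φ : LittlewoodPaley d}

/-! ### Exponential integrals -/

theorem lintegral_exp_Iio {c : ℝ} (hc : 0 < c) :
    ∫⁻ z in Set.Iio (0 : ℝ), ENNReal.ofReal (c * Real.exp (c * z / 4)) = 4 := by
  have h1 : IntegrableOn (fun z => c * Real.exp (c / 4 * z)) (Set.Iic (0 : ℝ)) :=
    (integrableOn_exp_mul_Iic (by positivity) 0).const_mul c
  rw [setLIntegral_congr Iio_ae_eq_Iic]
  have h2 : ∀ z : ℝ, c * Real.exp (c * z / 4) = c * Real.exp (c / 4 * z) := fun z => by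
    congr 2
    ring
  simp only [h2]
  rw [← ofReal_integral_eq_lintegral_ofReal h1 (Eventually.of_forall fun z => by positivity),
    integral_const_mul, integral_exp_mul_Iic (by positivity), mul_zero, Real.exp_zero]
  rw [show c * (1 / (c / 4)) = 4 by field_simp]
  norm_num

/-- The value is independent of c: with c = 2^j the factor 2^j lost by an operator of order one is
recovered by integrating in time. This is the maximal regularity of e^{-|z||D|} on dyadic blocks. -/
theorem lintegral_exp_neg_abs {c : ℝ} (hc : 0 < c) (τ : ℝ) :
    ∫⁻ z : ℝ, ENNReal.ofReal (c * Real.exp (c * (-|z - τ|) / 4)) = 8 := by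
  rw [lintegral_sub_right_eq_self (fun z => ENNReal.ofReal (c * Real.exp (c * (-|z|) / 4))) τ,
    ← lintegral_add_compl _ (measurableSet_Iio (a := (0 : ℝ)))]
  have h1 : ∫⁻ z in Set.Iio (0 : ℝ), ENNReal.ofReal (c * Real.exp (c * (-|z|) / 4)) = 4 := by
    rw [← lintegral_exp_Iio hc]
    refine setLIntegral_congr_fun measurableSet_Iio fun z hz => ?_
    rw [abs_of_neg hz, neg_neg]
  have h2 : ∫⁻ z in (Set.Iio (0 : ℝ))ᶜ, ENNReal.ofReal (c * Real.exp (c * (-|z|) / 4)) = 4 := by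
    rw [Set.compl_Iio, ← h1, setLIntegral_congr Iio_ae_eq_Iic]
    have h3 := (Measure.measurePreserving_neg (volume : Measure ℝ)).setLIntegral_comp_preimage_emb
      (MeasurableEquiv.neg ℝ).measurableEmbedding
      (fun z => ENNReal.ofReal (c * Real.exp (c * (-|z|) / 4))) (Set.Iic 0)
    rw [← h3]
    simp
  rw [h1, h2]
  norm_num

/-! ### Integrals in time -/

theorem cv_integral {μ : Measure ℝ} [SFinite μ] (a : 𝓢(E d, ℂ)) {F : ℝ → E d → ℝ}
    (hF : Measurable (Function.uncurry F)) {b : ℝ → ℝ} (hb : Integrable b μ)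
    (hFb : ∀ᵐ τ ∂μ, ∀ y, |F τ y| ≤ b τ) (x : E d) :
    cv a (fun y => ∫ τ, F τ y ∂μ) x = ∫ τ, cv a (F τ) x ∂μ := by
  simp only [cv, ← integral_const_mul]
  refine integral_integral_swap ?_
  have h1 := Integrable.mul_prod ((integrable_ker a).comp_sub_left x).norm hb
  have h2 : ∀ᵐ p ∂((volume : Measure (E d)).prod μ), ∀ y, |F p.2 y| ≤ b p.2 :=
    Measure.quasiMeasurePreserving_snd.ae hFb
  refine h1.mono' ?_ (h2.mono fun p hp => ?_)
  · refine Measurable.aestronglyMeasurable ?_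
    exact ((continuous_ker a).measurable.comp
      (by fun_prop : Measurable fun q : E d × ℝ => x - q.1)).mul
      (hF.comp (by fun_prop : Measurable fun q : E d × ℝ => (q.2, q.1)))
  · simp only [Function.uncurry, norm_mul, Real.norm_eq_abs]
    gcongr
    exact hp _

variable (φ) in
theorem measurable_cv_expD_uncurry (m : Symbol d) (j : ℤ) {g : ℝ → E d → ℝ}
    (hg : Measurable (Function.uncurry g)) :
    Measurable fun q : ℝ × ℝ × E d => cv (sig φ (m * Symbol.expD q.1) j) (g q.2.1) q.2.2 := by
  refine (StronglyMeasurable.integral_prod_right (f := fun (p : ℝ × ℝ × E d) y =>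
    ker (sig φ (m * Symbol.expD p.1) j) (p.2.2 - y) * g p.2.1 y)
    (Measurable.stronglyMeasurable ?_)).measurable
  exact ((continuous_ker_expD φ m j).measurable.comp
    (by fun_prop : Measurable fun q : (ℝ × ℝ × E d) × E d => (q.1.1, q.1.2.2 - q.2))).mul
    (hg.comp (by fun_prop : Measurable fun q : (ℝ × ℝ × E d) × E d => (q.1.2.1, q.2)))

variable (φ) in
/-- `∫_{τ < 0, τ ∈ A z} e^{-|z-τ||D|} m(D) Δ̇_j g(τ) dτ`. -/
def timeBlock (m : Symbol d) (A : ℝ → Set ℝ) (j : ℤ) (g : ℝ → E d → ℝ) (z : ℝ) (x : E d) : ℝ :=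
  ∫ τ in Set.Iio (0 : ℝ), (A z).indicator
    (fun τ => cv (sig φ (m * Symbol.expD (-|z - τ|)) j) (g τ) x) τ

variable (φ) in
/-- `∫_{τ < 0, τ ∈ A z} e^{-|z-τ||D|} m(D) g(τ) dτ`. -/
def timeOp (m : Symbol d) (A : ℝ → Set ℝ) (g : ℝ → E d → ℝ) (z : ℝ) (x : E d) : ℝ :=
  ∑' j, timeBlock φ m A j g z x

variable (φ) in
/-- The bound for the blocks of `e^{t|D|} m(D)` for a symbol `m` of order one. -/
def ExpBound (m : Symbol d) (C : ℝ) : Prop :=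
  0 < C ∧ ∀ t ≤ 0, ∀ (j : ℤ) (g : E d → ℝ), LinGrowth g →
    sn (cv (sig φ (m * Symbol.expD t) j) g) ≤
      ENNReal.ofReal C * (ENNReal.ofReal ((2 : ℝ) ^ j * Real.exp ((2 : ℝ) ^ j * t / 4)) *
        sn (cv (sig φ 1 j) g))

variable (φ) in
theorem exists_expBound {m : Symbol d} (hm : m.IsHom 1) (hr : m.IsReal) : ∃ C, ExpBound φ m C := by
  obtain ⟨C, hC, h⟩ := exists_sn_sig_expD_le φ hm hr
  refine ⟨C, hC, fun t ht j g hg => (h t ht j g hg).trans (le_of_eq ?_)⟩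
  rw [mul_one, ← mul_assoc, ← ENNReal.ofReal_mul hC.le, mul_assoc]

variable {W : ℤ → ℝ≥0∞} {K : ℝ≥0∞} {m : Symbol d} {C : ℝ} {A : ℝ → Set ℝ} {g : ℝ → E d → ℝ}

theorem MemSp.tsum_ne_top (hg : MemSp φ W g) : ∑' j, W j * blockInt φ j g ≠ ⊤ :=
  ne_top_of_le_ne_top hg.fin (tsum_blockInt_le_spNorm g)

theorem MemSp.tsum_pw_ne_top (hW : IsWeight K W) (hg : MemSp φ W g) :
    ∑' j, pw j * blockInt φ j g ≠ ⊤ :=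
  ne_top_of_le_ne_top hg.tsum_ne_top (ENNReal.tsum_le_tsum fun j => mul_le_mul_left (hW.pw_le j) _)

theorem MemSp.blockInt_ne_top (hW : IsWeight K W) (hg : MemSp φ W g) (j : ℤ) :
    blockInt φ j g ≠ ⊤ := ne_top_of_tsum_pw (hg.tsum_pw_ne_top hW) j

theorem MemSp.sn_cv_ne_top (hg : MemSp φ W g) (a : 𝓢(E d, ℂ)) (z : ℝ) : sn (cv a (g z)) ≠ ⊤ :=
  ne_top_of_le_ne_top (ENNReal.mul_ne_top ENNReal.ofReal_ne_top (hg.sn_ne_top z)) (sn_cv_le _ _)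

theorem ExpBound.enorm_indicator_le (hC : ExpBound φ m C) (hg : MemSp φ W g) (j : ℤ) (z τ : ℝ)
    (x : E d) :
    ‖(A z).indicator (fun τ => cv (sig φ (m * Symbol.expD (-|z - τ|)) j) (g τ) x) τ‖ₑ ≤
      ENNReal.ofReal C * (ENNReal.ofReal ((2 : ℝ) ^ j * Real.exp ((2 : ℝ) ^ j * (-|z - τ|) / 4)) *
        sn (cv (sig φ 1 j) (g τ))) := by
  refine (enorm_indicator_le_enorm_self _ _).trans ?_
  exact (enorm_le_sn _ x).trans (hC.2 _ (by simp) j _ (hg.growth τ))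

theorem ExpBound.enorm_indicator_le' (hC : ExpBound φ m C) (hg : MemSp φ W g) (j : ℤ) (z τ : ℝ)
    (x : E d) :
    ‖(A z).indicator (fun τ => cv (sig φ (m * Symbol.expD (-|z - τ|)) j) (g τ) x) τ‖ₑ ≤
      ENNReal.ofReal C * (pw j * sn (cv (sig φ 1 j) (g τ))) := by
  refine (hC.enorm_indicator_le hg j z τ x).trans ?_
  rw [pw]
  gcongr
  refine mul_le_of_le_one_right (by positivity) ?_
  rw [Real.exp_le_one_iff]
  have : (0 : ℝ) < 2 ^ j := by positivity
  nlinarith [abs_nonneg (z - τ)]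

theorem measurable_indicator_timeBlock (hA : MeasurableSet {p : ℝ × ℝ | p.2 ∈ A p.1})
    (hg : Measurable (Function.uncurry g)) (m : Symbol d) (j : ℤ) :
    Measurable fun q : (ℝ × E d) × ℝ => (A q.1.1).indicator
      (fun τ => cv (sig φ (m * Symbol.expD (-|q.1.1 - τ|)) j) (g τ) q.1.2) q.2 := by
  have h0 : Measurable fun q : (ℝ × E d) × ℝ => (-|q.1.1 - q.2|, q.2, q.1.2) := by fun_prop
  have h1 := (measurable_cv_expD_uncurry φ m j hg).comp h0
  simp only [Function.comp_def] at h1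
  have h2 : MeasurableSet {q : (ℝ × E d) × ℝ | q.2 ∈ A q.1.1} :=
    hA.preimage (by fun_prop : Measurable fun q : (ℝ × E d) × ℝ => (q.1.1, q.2))
  convert h1.indicator h2 using 1
  ext q
  by_cases hq : q.2 ∈ A q.1.1
  · rw [Set.indicator_of_mem hq,
      Set.indicator_of_mem (s := {q : (ℝ × E d) × ℝ | q.2 ∈ A q.1.1}) hq]
  · rw [Set.indicator_of_notMem hq,
      Set.indicator_of_notMem (s := {q : (ℝ × E d) × ℝ | q.2 ∈ A q.1.1}) hq]

theorem measurable_indicator_time (hA : MeasurableSet {p : ℝ × ℝ | p.2 ∈ A p.1})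
    (hg : Measurable (Function.uncurry g)) (m : Symbol d) (j : ℤ) (z : ℝ) (x : E d) :
    Measurable ((A z).indicator
      (fun τ => cv (sig φ (m * Symbol.expD (-|z - τ|)) j) (g τ) x)) :=
  (measurable_indicator_timeBlock hA hg m j).comp
    (by fun_prop : Measurable fun τ : ℝ => (((z, x), τ) : (ℝ × E d) × ℝ))

theorem lintegral_pw_sn (j : ℤ) (g : ℝ → E d → ℝ) (C : ℝ) :
    ∫⁻ τ in Set.Iio (0 : ℝ), ENNReal.ofReal C * (pw j * sn (cv (sig φ 1 j) (g τ))) =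
      ENNReal.ofReal C * (pw j * blockInt φ j g) := by
  rw [lintegral_const_mul' _ _ ENNReal.ofReal_ne_top, lintegral_const_mul' _ _ (pw_ne_top j)]
  rfl

theorem ExpBound.integrableOn (hC : ExpBound φ m C) (hW : IsWeight K W) (hg : MemSp φ W g)
    (hA : MeasurableSet {p : ℝ × ℝ | p.2 ∈ A p.1}) (j : ℤ) (z : ℝ) (x : E d) :
    IntegrableOn ((A z).indicator
      (fun τ => cv (sig φ (m * Symbol.expD (-|z - τ|)) j) (g τ) x)) (Set.Iio 0) := by
  refine ⟨(measurable_indicator_time hA hg.meas m j z x).aestronglyMeasurable, ?_⟩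
  rw [hasFiniteIntegral_iff_enorm]
  refine lt_of_le_of_lt (lintegral_mono fun τ => hC.enorm_indicator_le' hg j z τ x) ?_
  rw [lintegral_pw_sn]
  have := hg.blockInt_ne_top hW j
  have := pw_ne_top j
  finiteness

theorem ExpBound.sn_timeBlock_le (hC : ExpBound φ m C) (hg : MemSp φ W g) (A : ℝ → Set ℝ)
    (j : ℤ) (z : ℝ) :
    sn (timeBlock φ m A j g z) ≤ ENNReal.ofReal C * (pw j * blockInt φ j g) := by
  refine sn_le fun x => (enorm_integral_le_lintegral_enorm _).trans ?_
  rw [← lintegral_pw_sn]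
  exact lintegral_mono fun τ => hC.enorm_indicator_le' hg j z τ x

/-- Young's inequality in time: Tonelli, followed by integrating the kernel 2^j e^{-2^j|z-τ|/4} in z
over the whole line. -/
theorem ExpBound.lintegral_sn_timeBlock_le (hC : ExpBound φ m C) (hg : MemSp φ W g)
    (A : ℝ → Set ℝ) (j : ℤ) :
    ∫⁻ z in Set.Iio (0 : ℝ), sn (timeBlock φ m A j g z) ≤
      ENNReal.ofReal C * (8 * blockInt φ j g) := by
  have h1 : ∀ z, sn (timeBlock φ m A j g z) ≤ ∫⁻ τ in Set.Iio (0 : ℝ), ENNReal.ofReal C *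
      (ENNReal.ofReal ((2 : ℝ) ^ j * Real.exp ((2 : ℝ) ^ j * (-|z - τ|) / 4)) *
        sn (cv (sig φ 1 j) (g τ))) := fun z =>
    sn_le fun x => (enorm_integral_le_lintegral_enorm _).trans
      (lintegral_mono fun τ => hC.enorm_indicator_le hg j z τ x)
  refine (lintegral_mono h1).trans ((setLIntegral_le_lintegral _ _).trans ?_)
  have hs := hg.measurable_sn_cv (sig φ 1 j)
  rw [lintegral_lintegral_swap]
  · have h2 : ∀ τ, ∫⁻ z : ℝ, ENNReal.ofReal C *
        (ENNReal.ofReal ((2 : ℝ) ^ j * Real.exp ((2 : ℝ) ^ j * (-|z - τ|) / 4)) *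
        sn (cv (sig φ 1 j) (g τ))) = ENNReal.ofReal C * (8 * sn (cv (sig φ 1 j) (g τ))) := by
      intro τ
      rw [lintegral_const_mul' _ _ ENNReal.ofReal_ne_top,
        lintegral_mul_const' _ _ (hg.sn_cv_ne_top _ τ), lintegral_exp_neg_abs (by positivity)]
    simp only [h2]
    rw [lintegral_const_mul' _ _ ENNReal.ofReal_ne_top, lintegral_const_mul' _ _ (by norm_num)]
    rfl
  · refine Measurable.aemeasurable ?_
    refine Measurable.const_mul (Measurable.mul ?_ (hs.comp measurable_snd)) _
    fun_prop

theorem measurable_timeBlock (hA : MeasurableSet {p : ℝ × ℝ | p.2 ∈ A p.1})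
    (hg : Measurable (Function.uncurry g)) (m : Symbol d) (j : ℤ) :
    Measurable (Function.uncurry (timeBlock φ m A j g)) :=
  (StronglyMeasurable.integral_prod_right
    (measurable_indicator_timeBlock hA hg m j).stronglyMeasurable).measurable

theorem integrableOn_toReal_sn (hW : IsWeight K W) (hg : MemSp φ W g) (C : ℝ) (j : ℤ) :
    IntegrableOn (fun τ => (ENNReal.ofReal C * (pw j * sn (cv (sig φ 1 j) (g τ)))).toReal)
      (Set.Iio (0 : ℝ)) := by
  refine integrable_toReal_of_lintegral_ne_top
    ((((hg.measurable_sn_cv _).const_mul _).const_mul _).aemeasurable) ?_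
  rw [lintegral_pw_sn]
  have := hg.blockInt_ne_top hW j
  have := pw_ne_top j
  finiteness

theorem ExpBound.abs_indicator_le (hC : ExpBound φ m C) (hg : MemSp φ W g) (j : ℤ) (z τ : ℝ)
    (x : E d) :
    |(A z).indicator (fun τ => cv (sig φ (m * Symbol.expD (-|z - τ|)) j) (g τ) x) τ| ≤
      (ENNReal.ofReal C * (pw j * sn (cv (sig φ 1 j) (g τ)))).toReal := by
  have h := hC.enorm_indicator_le' (A := A) hg j z τ x
  have h1 := hg.sn_cv_ne_top (sig φ 1 j) τ
  have h2 := pw_ne_top j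
  have h3 := ENNReal.toReal_mono (by finiteness) h
  simpa using h3

theorem ExpBound.continuous_timeBlock (hC : ExpBound φ m C) (hW : IsWeight K W) (hg : MemSp φ W g)
    (hA : MeasurableSet {p : ℝ × ℝ | p.2 ∈ A p.1}) (j : ℤ) (z : ℝ) :
    Continuous (timeBlock φ m A j g z) := by
  refine continuous_of_dominated
    (fun x => (measurable_indicator_time hA hg.meas m j z x).aestronglyMeasurable)
    (fun x => Eventually.of_forall fun τ => hC.abs_indicator_le hg j z τ x)
    (integrableOn_toReal_sn hW hg C j) (Eventually.of_forall fun τ => ?_)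
  by_cases hτ : τ ∈ A z
  · simp only [Set.indicator_of_mem hτ]
    exact hg.continuous_cv _ τ
  · simp only [Set.indicator_of_notMem hτ]
    exact continuous_const

theorem ExpBound.cv_timeBlock (hC : ExpBound φ m C) (hW : IsWeight K W) (hg : MemSp φ W g)
    (hA : MeasurableSet {p : ℝ × ℝ | p.2 ∈ A p.1}) (a : 𝓢(E d, ℂ)) (j : ℤ) (z : ℝ) (x : E d) :
    cv a (timeBlock φ m A j g z) x = ∫ τ in Set.Iio (0 : ℝ), (A z).indicator
      (fun τ => cv a (cv (sig φ (m * Symbol.expD (-|z - τ|)) j) (g τ)) x) τ := by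
  have h1 := cv_integral a (μ := volume.restrict (Set.Iio (0 : ℝ)))
    (F := fun τ y => (A z).indicator
      (fun τ => cv (sig φ (m * Symbol.expD (-|z - τ|)) j) (g τ) y) τ)
    ((measurable_indicator_timeBlock hA hg.meas m j).comp
      (by fun_prop : Measurable fun p : ℝ × E d => (((z, p.2), p.1) : (ℝ × E d) × ℝ)))
    (integrableOn_toReal_sn hW hg C j)
    (Eventually.of_forall fun τ y => hC.abs_indicator_le hg j z τ y) x
  refine h1.trans (integral_congr_ae (Eventually.of_forall fun τ => ?_))
  beta_reduce
  by_cases hτ : τ ∈ A z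
  · simp only [Set.indicator_of_mem hτ]
  · simp only [Set.indicator_of_notMem hτ, cv_zero_fun]

theorem ExpBound.cv_timeBlock_eq_zero (hC : ExpBound φ m C) (hr : m.IsReal) (hW : IsWeight K W)
    (hg : MemSp φ W g) (hA : MeasurableSet {p : ℝ × ℝ | p.2 ∈ A p.1}) {i j : ℤ} (hij : 1 < |i - j|)
    (z : ℝ) (x : E d) : cv (sig φ 1 i) (timeBlock φ m A j g z) x = 0 := by
  rw [hC.cv_timeBlock hW hg hA]
  refine integral_eq_zero_of_ae (Eventually.of_forall fun τ => ?_)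
  by_cases hτ : τ ∈ A z
  · simp only [Set.indicator_of_mem hτ, Pi.zero_apply]
    exact cv_cv_eq_zero (herm_sig φ .one i) (herm_sig φ (hr.mul (.expD _)) j) (hg.growth τ)
      (sig_mul_eq_zero φ 1 _ hij) x
  · simp only [Set.indicator_of_notMem hτ, Pi.zero_apply]

variable (φ) in
-- The sup bound uses the kernel size 2^j against the time integral of the block, and the time
-- integral uses Young's inequality. The set A z serves both directions: τ < z for `w`, and z < τ <
-- 0 for the Duhamel integral.
theorem exists_spNorm_timeOp_le (hm : m.IsHom 1) (hr : m.IsReal) (hK : K ≠ ⊤) :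
    ∃ M : ℝ≥0∞, M ≠ ⊤ ∧
    ∀ (W : ℤ → ℝ≥0∞), IsWeight K W → ∀ (A : ℝ → Set ℝ), MeasurableSet {p : ℝ × ℝ | p.2 ∈ A p.1} →
    ∀ g, MemSp φ W g →
      MemSp φ W (timeOp φ m A g) ∧ spNorm φ W (timeOp φ m A g) ≤ M * spNorm φ W g := by
  obtain ⟨C, hC⟩ := exists_expBound φ hm hr
  obtain ⟨L, hL, h⟩ := exists_spNorm_tsum_le φ
  refine ⟨(1 + L * K) * (8 * ENNReal.ofReal C), by finiteness, fun W hW A hA g hg => ?_⟩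
  obtain ⟨h1, h2⟩ := h K W hW (fun j => timeBlock φ m A j g) (fun j => blockInt φ j g)
    (8 * ENNReal.ofReal C) (fun j => measurable_timeBlock hA hg.meas m j)
    (fun j z => hC.continuous_timeBlock hW hg hA j z)
    (fun i j hij z x => hC.cv_timeBlock_eq_zero hr hW hg hA hij z x)
    (fun j z => (hC.sn_timeBlock_le hg A j z).trans (by
      gcongr
      exact le_mul_of_one_le_left (zero_le) (by norm_num)))
    (fun j => (hC.lintegral_sn_timeBlock_le hg A j).trans (le_of_eq (by ring)))
    (by finiteness) hg.tsum_ne_top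
  refine ⟨h1, h2.trans ?_⟩
  rw [← mul_assoc]
  exact mul_le_mul_right (tsum_blockInt_le_spNorm g) _

theorem ExpBound.tsum_sn_timeBlock_ne_top (hC : ExpBound φ m C) (hW : IsWeight K W)
    (hg : MemSp φ W g) (A : ℝ → Set ℝ) (z : ℝ) : ∑' j, sn (timeBlock φ m A j g z) ≠ ⊤ := by
  refine ne_top_of_le_ne_top ?_ (ENNReal.tsum_le_tsum fun j => hC.sn_timeBlock_le hg A j z)
  rw [ENNReal.tsum_mul_left]
  exact ENNReal.mul_ne_top ENNReal.ofReal_ne_top (hg.tsum_pw_ne_top hW)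

theorem ExpBound.timeOp_add (hC : ExpBound φ m C) (hW : IsWeight K W)
    (hA : MeasurableSet {p : ℝ × ℝ | p.2 ∈ A p.1}) {g h : ℝ → E d → ℝ}
    (hg : MemSp φ W g) (hh : MemSp φ W h) (z : ℝ) (x : E d) :
    timeOp φ m A (fun z x => g z x + h z x) z x = timeOp φ m A g z x + timeOp φ m A h z x := by
  rw [timeOp, timeOp, timeOp,
    ← (summable_of_sn (hC.tsum_sn_timeBlock_ne_top hW hg A z) x).tsum_add
      (summable_of_sn (hC.tsum_sn_timeBlock_ne_top hW hh A z) x)]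
  refine tsum_congr fun j => ?_
  rw [timeBlock, timeBlock, timeBlock,
    ← integral_add (hC.integrableOn hW hg hA j z x) (hC.integrableOn hW hh hA j z x)]
  refine integral_congr_ae (Eventually.of_forall fun τ => ?_)
  by_cases hτ : τ ∈ A z
  · simp only [Set.indicator_of_mem hτ]
    exact cv_add (hg.growth τ) (hh.growth τ) x
  · simp only [Set.indicator_of_notMem hτ, add_zero]

theorem timeOp_const_mul (m : Symbol d) (A : ℝ → Set ℝ) (c : ℝ) (g : ℝ → E d → ℝ) (z : ℝ)
    (x : E d) : timeOp φ m A (fun z x => c * g z x) z x = c * timeOp φ m A g z x := by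
  rw [timeOp, timeOp, ← tsum_mul_left]
  refine tsum_congr fun j => ?_
  rw [timeBlock, timeBlock, ← integral_const_mul]
  refine integral_congr_ae (Eventually.of_forall fun τ => ?_)
  by_cases hτ : τ ∈ A z
  · simp only [Set.indicator_of_mem hτ, cv_const_mul]
  · simp only [Set.indicator_of_notMem hτ, mul_zero]

theorem timeOp_congr (m : Symbol d) (A : ℝ → Set ℝ) {g h : ℝ → E d → ℝ}
    (hgh : ∀ᵐ τ, τ < 0 → g τ =ᵐ[volume] h τ) (z : ℝ) (x : E d) :
    timeOp φ m A g z x = timeOp φ m A h z x := by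
  refine tsum_congr fun j => ?_
  refine setIntegral_congr_ae measurableSet_Iio ?_
  filter_upwards [hgh] with τ hτ hτ0
  simp only [Set.indicator]
  split_ifs
  · refine integral_congr_ae ?_
    filter_upwards [hτ hτ0] with y hy
    rw [hy]
  · rfl

/-- `timeOp` as a linear map. -/
def Sp.timeOp (hW : IsWeight K W) (hm : m.IsHom 1) (hr : m.IsReal)
    (hA : MeasurableSet {p : ℝ × ℝ | p.2 ∈ A p.1}) : Sp φ W →ₗ[ℝ] Sp φ W where
  toFun g := Sp.mk (DirichletNeumann.timeOp φ m A g.val)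
    ((exists_spNorm_timeOp_le φ hm hr hW.const_ne_top).choose_spec.2 W hW A hA g.val g.mem).1
  map_add' g h := Sp.ext fun z x => by
    obtain ⟨C, hC⟩ := exists_expBound φ hm hr
    exact hC.timeOp_add hW hA g.mem h.mem z x
  map_smul' c g := Sp.ext fun z x => timeOp_const_mul m A c g.val z x

@[simp] theorem Sp.val_timeOp (hW : IsWeight K W) (hm : m.IsHom 1) (hr : m.IsReal)
    (hA : MeasurableSet {p : ℝ × ℝ | p.2 ∈ A p.1}) (g : Sp φ W) :
    (Sp.timeOp hW hm hr hA g).val = DirichletNeumann.timeOp φ m A g.val := rfl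

variable (φ) in
theorem Sp.exists_norm_timeOp_le (hm : m.IsHom 1) (hr : m.IsReal) (hK : K ≠ ⊤) :
    ∃ M : ℝ, 0 < M ∧ ∀ (W : ℤ → ℝ≥0∞) (hW : IsWeight K W) (A : ℝ → Set ℝ)
      (hA : MeasurableSet {p : ℝ × ℝ | p.2 ∈ A p.1}) (g : Sp φ W),
      ‖Sp.timeOp hW hm hr hA g‖ ≤ M * ‖g‖ := by
  obtain ⟨M, hM, h⟩ := exists_spNorm_timeOp_le φ hm hr hK
  refine ⟨M.toReal + 1, by positivity, fun W hW A hA g => ?_⟩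
  refine Sp.norm_le_of_spNorm_le (by positivity) ((h W hW A hA g.val g.mem).2.trans ?_)
  rw [ENNReal.ofReal_mul (by positivity), Sp.ofReal_norm_eq]
  gcongr
  rw [← ENNReal.ofReal_toReal hM]
  exact ENNReal.ofReal_le_ofReal (by simp)

end DirichletNeumann

end

/-! ### Poisson extension, `w` and Duhamel integral in the space `Sp`. -/

noncomputable section
namespace DirichletNeumann
variable {d : ℕ} {φ : LittlewoodPaley d}

/-! ### The Poisson extension of a function as an element of the space `Sp` -/

theorem Symbol.IsReal.absD_mul {n : Symbol d} (hn : n.IsReal) : (Symbol.absD * n).IsReal :=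
  .mul .absD hn

theorem Symbol.mul_expD_mul_absD (n : Symbol d) (t : ℝ) :
    n * Symbol.expD t * Symbol.absD = Symbol.absD * n * Symbol.expD t :=
  Symbol.ext' fun ξ => by simp only [Symbol.mul_toFun]; ring

variable (φ) in
/-- `e^{z|D|} |D| n(D) u` for `z < 0`. -/
def heat (n : Symbol d) (u : E d → ℝ) (z : ℝ) (x : E d) : ℝ :=
  if z < 0 then ∑' j, cv (sig φ (Symbol.absD * n * Symbol.expD z) j) u x else 0

variable (φ) in
/-- The blocks of `heat`. -/
def heatBlock (n : Symbol d) (u : E d → ℝ) (j : ℤ) (z : ℝ) (x : E d) : ℝ :=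
  if z < 0 then cv (sig φ (Symbol.absD * n * Symbol.expD z) j) u x else 0

theorem heat_eq_tsum (n : Symbol d) (u : E d → ℝ) (z : ℝ) (x : E d) :
    heat φ n u z x = ∑' j, heatBlock φ n u j z x := by
  simp only [heat, heatBlock]
  split_ifs <;> simp

theorem measurable_heatBlock (n : Symbol d) {u : E d → ℝ} (hu : Measurable u) (j : ℤ) :
    Measurable (Function.uncurry (heatBlock φ n u j)) := by
  have h1 := measurable_cv_expD φ (Symbol.absD * n) j hu
  exact Measurable.ite (measurableSet_Iio.preimage measurable_fst) h1 measurable_const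

variable (φ) in
-- The time integral of e^{2^j z/4} over the half-line is of order 2^{-j}, so a datum with |D|u in
-- the Besov space of weights 2^{-j} W_j extends to an element of the space; multipliers of degree 0
-- are harmless on blocks.
theorem exists_spNorm_heat_le {n : Symbol d} (hn : n.IsHom 0) (hr : n.IsReal) {K : ℝ≥0∞}
    (hK : K ≠ ⊤) : ∃ M : ℝ≥0∞, M ≠ ⊤ ∧ ∀ (W : ℤ → ℝ≥0∞), IsWeight K W → ∀ u : E d → ℝ,
      LinGrowth u → (∀ j, sn (cv (sig φ Symbol.absD j) u) ≠ ⊤) →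
      ∑' j, W j * ((pw j)⁻¹ * sn (cv (sig φ Symbol.absD j) u)) ≠ ⊤ →
      MemSp φ W (heat φ n u) ∧ spNorm φ W (heat φ n u) ≤
        M * ∑' j, W j * ((pw j)⁻¹ * sn (cv (sig φ Symbol.absD j) u)) ∧
      ∀ z, ∑' j, sn (heatBlock φ n u j z) ≠ ⊤ := by
  obtain ⟨C, hC, h⟩ := exists_sn_sig_expD_mul_le φ hn hr
  obtain ⟨L, hL, hs⟩ := exists_spNorm_tsum_le φ
  refine ⟨(1 + L * K) * ENNReal.ofReal (C * 4), by finiteness, fun W hW u hu ha hsum => ?_⟩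
  set a : ℤ → ℝ≥0∞ := fun j => sn (cv (sig φ Symbol.absD j) u) with ha_def
  have hb : ∀ j, ∀ z < 0, sn (heatBlock φ n u j z) ≤
      ENNReal.ofReal C * (ENNReal.ofReal (Real.exp ((2 : ℝ) ^ j * z / 4)) * a j) := by
    intro j z hz
    have h1 := h Symbol.absD .absD z hz.le j u hu
    rw [mul_zero, zpow_zero, mul_one, Symbol.mul_expD_mul_absD, ENNReal.ofReal_mul hC.le,
      mul_assoc] at h1
    rwa [show heatBlock φ n u j z = cv (sig φ (Symbol.absD * n * Symbol.expD z) j) u from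
      funext fun x => if_pos hz]
  have h0 : ∀ j, ∀ z, ¬ z < 0 → sn (heatBlock φ n u j z) = 0 := by
    intro j z hz
    rw [show heatBlock φ n u j z = fun _ => 0 from funext fun x => if_neg hz]
    exact sn_zero
  have hpa : ∀ j, pw j * ((pw j)⁻¹ * a j) = a j := fun j => by
    rw [← mul_assoc, ENNReal.mul_inv_cancel (pw_ne_zero j) (pw_ne_top j), one_mul]
  -- The factor 4 is not needed for the sup bound; it comes from the time integral, and the
  -- synthesis lemma takes one constant for both.
  have hsup : ∀ j z, sn (heatBlock φ n u j z) ≤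
      ENNReal.ofReal (C * 4) * (pw j * ((pw j)⁻¹ * a j)) := by
    intro j z
    rw [hpa]
    by_cases hz : z < 0
    · refine (hb j z hz).trans ?_
      rw [← mul_assoc, ← ENNReal.ofReal_mul hC.le]
      gcongr
      have h2 : (0 : ℝ) < 2 ^ j := by positivity
      have : Real.exp ((2 : ℝ) ^ j * z / 4) ≤ 1 := by
        rw [Real.exp_le_one_iff]
        nlinarith
      linarith
    · rw [h0 j z hz]
      exact zero_le
  have hcont : ∀ j z, Continuous (heatBlock φ n u j z) := by
    intro j z
    by_cases hz : z < 0
    · have h1 : heatBlock φ n u j z = fun x => ∑ i ∈ Finset.Icc (j - 1) (j + 1),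
          cv (sig φ (n * Symbol.expD z) i) (cv (sig φ Symbol.absD j) u) x := by
        ext x
        rw [heatBlock, if_pos hz, ← Symbol.mul_expD_mul_absD,
          cv_sig_mul φ (hr.mul (.expD z)) .absD j hu]
      rw [h1]
      exact continuous_finsetSum _ fun i _ =>
        continuous_cv _ (measurable_cv _ hu.1) (abs_le_of_sn (ha j))
    · have h1 : heatBlock φ n u j z = fun _ => 0 := by
        ext x
        rw [heatBlock, if_neg hz]
      rw [h1]
      exact continuous_const
  have hint : ∀ j, ∫⁻ z in Set.Iio (0 : ℝ), sn (heatBlock φ n u j z) ≤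
      ENNReal.ofReal (C * 4) * ((pw j)⁻¹ * a j) := by
    intro j
    have h3 : ∀ z : ℝ, ENNReal.ofReal (Real.exp ((2 : ℝ) ^ j * z / 4)) =
        (pw j)⁻¹ * ENNReal.ofReal ((2 : ℝ) ^ j * Real.exp ((2 : ℝ) ^ j * z / 4)) := fun z => by
      rw [ENNReal.ofReal_mul (by positivity), ← mul_assoc, ← pw,
        ENNReal.inv_mul_cancel (pw_ne_zero j) (pw_ne_top j), one_mul]
    have h4 : ∫⁻ z in Set.Iio (0 : ℝ), sn (heatBlock φ n u j z) ≤
        ∫⁻ z in Set.Iio (0 : ℝ), ENNReal.ofReal C * ((pw j)⁻¹ *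
          ENNReal.ofReal ((2 : ℝ) ^ j * Real.exp ((2 : ℝ) ^ j * z / 4)) * a j) := by
      refine setLIntegral_mono' measurableSet_Iio fun z hz => ?_
      rw [← h3]
      exact hb j z hz
    refine h4.trans (le_of_eq ?_)
    rw [lintegral_const_mul' _ _ ENNReal.ofReal_ne_top, lintegral_mul_const' _ _ (ha j),
      lintegral_const_mul' _ _ (ENNReal.inv_ne_top.2 (pw_ne_zero j)),
      lintegral_exp_Iio (by positivity), ENNReal.ofReal_mul hC.le]
    norm_num
    simp only [ha_def]
    ring
  obtain ⟨h1, h2⟩ := hs K W hW (heatBlock φ n u) (fun j => (pw j)⁻¹ * a j)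
    (ENNReal.ofReal (C * 4)) (fun j => measurable_heatBlock n hu.1 j) hcont
    (fun i j hij z x => by
      by_cases hz : z < 0
      · simp only [funext fun x => show heatBlock φ n u j z x = _ from if_pos hz]
        exact cv_cv_eq_zero (herm_sig φ .one i) (herm_sig φ (hr.absD_mul.mul (.expD z)) j) hu
          (sig_mul_eq_zero φ 1 _ hij) x
      · simp only [funext fun x => show heatBlock φ n u j z x = _ from if_neg hz, cv_zero_fun])
    hsup hint ENNReal.ofReal_ne_top hsum
  have h3 : (fun z x => ∑' j, heatBlock φ n u j z x) = heat φ n u := by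
    ext z x
    rw [heat_eq_tsum]
  rw [h3] at h1 h2
  refine ⟨h1, h2.trans (le_of_eq (by ring)), fun z => ?_⟩
  refine ne_top_of_le_ne_top ?_ (ENNReal.tsum_le_tsum fun j => hsup j z)
  rw [ENNReal.tsum_mul_left]
  refine ENNReal.mul_ne_top ENNReal.ofReal_ne_top (ne_top_of_le_ne_top hsum
    (ENNReal.tsum_le_tsum fun j => ?_))
  gcongr
  exact hW.pw_le j

/-! ### The operators `w` -/

variable {W : ℤ → ℝ≥0∞} {K : ℝ≥0∞} {m : Symbol d} {C : ℝ} {A : ℝ → Set ℝ} {g : ℝ → E d → ℝ}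

theorem ExpBound.tsum_lintegral_ne_top (hC : ExpBound φ m C) (hW : IsWeight K W)
    (hg : MemSp φ W g) (A : ℝ → Set ℝ) (z : ℝ) (x : E d) :
    ∑' j : ℤ, ∫⁻ τ in Set.Iio (0 : ℝ), ‖(A z).indicator
      (fun τ => cv (sig φ (m * Symbol.expD (-|z - τ|)) j) (g τ) x) τ‖ₑ ≠ ⊤ := by
  refine ne_top_of_le_ne_top (b := ∑' j, ENNReal.ofReal C * (pw j * blockInt φ j g)) ?_
    (ENNReal.tsum_le_tsum fun j => ?_)
  · rw [ENNReal.tsum_mul_left]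
    exact ENNReal.mul_ne_top ENNReal.ofReal_ne_top (hg.tsum_pw_ne_top hW)
  · rw [← lintegral_pw_sn]
    exact lintegral_mono fun τ => hC.enorm_indicator_le' hg j z τ x

theorem ExpBound.timeOp_eq_integral (hC : ExpBound φ m C) (hr : m.IsReal) (hW : IsWeight K W)
    (hg : MemSp φ W g) (hA : MeasurableSet {p : ℝ × ℝ | p.2 ∈ A p.1}) (z : ℝ) (x : E d) :
    IntegrableOn ((A z).indicator fun τ => mult φ (m * Symbol.expD (-|z - τ|)) (g τ) x)
      (Set.Iio 0) ∧ timeOp φ m A g z x = ∫ τ in Set.Iio (0 : ℝ), (A z).indicator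
        (fun τ => mult φ (m * Symbol.expD (-|z - τ|)) (g τ) x) τ := by
  have h1 : ((A z).indicator fun τ => mult φ (m * Symbol.expD (-|z - τ|)) (g τ) x) =
      fun τ => ∑' j, (A z).indicator
        (fun τ => cv (sig φ (m * Symbol.expD (-|z - τ|)) j) (g τ) x) τ := by
    ext τ
    by_cases hτ : τ ∈ A z
    · simp only [Set.indicator_of_mem hτ, mult_eq φ (hr.mul (.expD _))]
    · simp only [Set.indicator_of_notMem hτ, tsum_zero]
  have hm := fun j => measurable_indicator_time (φ := φ) hA hg.meas m j z x
  have hT := hC.tsum_lintegral_ne_top hW hg A z x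
  rw [h1]
  refine ⟨⟨(Measurable.tsum hm).aestronglyMeasurable, ?_⟩, ?_⟩
  · rw [hasFiniteIntegral_iff_enorm]
    refine lt_of_le_of_lt (lintegral_mono fun τ => enorm_tsum_le_real _) ?_
    rw [lintegral_tsum fun j => (hm j).enorm.aemeasurable]
    exact hT.lt_top
  · rw [integral_tsum (fun j => (hm j).aestronglyMeasurable) hT]
    rfl

theorem measurableSet_mem_Iio : MeasurableSet {p : ℝ × ℝ | p.2 ∈ Set.Iio p.1} :=
  measurableSet_lt measurable_snd measurable_fst

theorem measurableSet_mem_Ioi : MeasurableSet {p : ℝ × ℝ | p.2 ∈ Set.Ioi p.1} :=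
  measurableSet_lt measurable_fst measurable_snd

theorem mult_congr_ae (m : Symbol d) (hr : m.IsReal) {g h : E d → ℝ} (hgh : g =ᵐ[volume] h)
    (x : E d) : mult φ m g x = mult φ m h x := by
  rw [mult_eq φ hr, mult_eq φ hr]
  refine tsum_congr fun j => integral_congr_ae ?_
  filter_upwards [hgh] with y hy
  rw [hy]

theorem ExpBound.timeOp_Iio_eq (hC : ExpBound φ m C) (hr : m.IsReal) (hW : IsWeight K W)
    (hg : MemSp φ W g) {z : ℝ} (hz : z ≤ 0) (x : E d) :
    IntegrableOn (fun τ => mult φ (m * Symbol.expD (-(z - τ))) (g τ) x) (Set.Iio z) ∧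
    timeOp φ m Set.Iio g z x =
      ∫ τ in Set.Iio z, mult φ (m * Symbol.expD (-(z - τ))) (g τ) x := by
  obtain ⟨h1, h2⟩ := hC.timeOp_eq_integral hr hW hg measurableSet_mem_Iio z x
  have h3 : Set.Iio (0 : ℝ) ∩ Set.Iio z = Set.Iio z := by
    rw [Set.Iio_inter_Iio, min_eq_right hz]
  rw [IntegrableOn, integrable_indicator_iff measurableSet_Iio, IntegrableOn,
    Measure.restrict_restrict measurableSet_Iio, Set.inter_comm, h3] at h1
  rw [setIntegral_indicator measurableSet_Iio, h3] at h2
  have h4 : ∀ᵐ τ, τ ∈ Set.Iio z → mult φ (m * Symbol.expD (-|z - τ|)) (g τ) x =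
      mult φ (m * Symbol.expD (-(z - τ))) (g τ) x := Eventually.of_forall fun τ hτ => by
    rw [abs_of_pos (sub_pos.2 hτ)]
  refine ⟨?_, h2.trans (setIntegral_congr_ae measurableSet_Iio h4)⟩
  exact h1.congr ((ae_restrict_iff' measurableSet_Iio).2 h4)

/-- The function `R(x, z)` agrees almost everywhere with `g(z, x)`, both for all `x` and almost
every `z`, and for almost all `z` and `x`. -/
def Agree (R : E d → ℝ → ℝ) (g : ℝ → E d → ℝ) : Prop :=
  (∀ x, ∀ᵐ z, z < 0 → R x z = g z x) ∧ ∀ᵐ z, z < 0 → ∀ᵐ x, R x z = g z x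

/-- For each x, the integrand depends on the source at time τ only up to a null set in space, and τ
itself may avoid a null set. Thus representatives in `Sp` can replace the pointwise defined `B` and
`Qa`. -/
theorem w_eq {η : 𝓢(E d, ℂ) → ℂ} {v : E d → ℝ → ℝ} {b : Fin d → ℝ → E d → ℝ}
    {a : ℝ → E d → ℝ} (hW : IsWeight K W) (hb : ∀ k, MemSp φ W (b k)) (ha : MemSp φ W a)
    (hbB : ∀ k, Agree (fun x z => B φ η v x z k) (b k)) (haQ : Agree (Qa φ η v) a)
    {z : ℝ} (hz : z ≤ 0) (x : E d) :
    w φ η v x z = (∑ k, timeOp φ (Symbol.absD * Symbol.riesz k) Set.Iio (b k) z x) -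
      timeOp φ Symbol.absD Set.Iio a z x := by
  choose C hC using fun k : Fin d =>
    exists_expBound φ (Symbol.IsHom.absD_mul_riesz k) (.absD_mul_riesz k)
  obtain ⟨C', hC'⟩ := exists_expBound φ (Symbol.IsHom.absD (d := d)) .absD
  have h1 := fun k => (hC k).timeOp_Iio_eq (.absD_mul_riesz k) hW (hb k) hz x
  have h2 := hC'.timeOp_Iio_eq .absD hW ha hz x
  simp only [fun k => (h1 k).2, h2.2]
  rw [← integral_finsetSum _ fun k _ => (h1 k).1,
    ← integral_sub (integrable_finsetSum _ fun k _ => (h1 k).1) h2.1, w]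
  refine setIntegral_congr_ae measurableSet_Iio ?_
  have h3 : ∀ᵐ τ, ∀ k, τ < 0 → ∀ᵐ x, B φ η v x τ k = b k τ x :=
    ae_all_iff.2 fun k => (hbB k).2
  filter_upwards [h3, haQ.2] with τ h3 h4 hτ
  have hτ0 : τ < 0 := lt_of_lt_of_le hτ hz
  rw [multQb, mult_congr_ae _ (.mul .absD (.expD _)) (h4 hτ0)]
  congr 1
  refine Finset.sum_congr rfl fun k _ => ?_
  have h5 : Symbol.absD * Symbol.expD (-(z - τ)) * Symbol.riesz k =
      Symbol.absD * Symbol.riesz k * Symbol.expD (-(z - τ)) :=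
    Symbol.ext' fun ξ => by simp only [Symbol.mul_toFun]; ring
  rw [h5, mult_congr_ae _ (.mul (.absD_mul_riesz k) (.expD _)) (h3 k hτ0)]

end DirichletNeumann

end

/-! ### The Duhamel integral and the Poisson extension as integrals in z. -/

noncomputable section
namespace DirichletNeumann
variable {d : ℕ} {φ : LittlewoodPaley d}

/-! ### The Duhamel integral -/

theorem cv_sig_expDSubOne (φ : LittlewoodPaley d) (t : ℝ) (j : ℤ) {g : E d → ℝ} (hg : LinGrowth g)
    (x : E d) : cv (sig φ (Symbol.expDSubOne t) j) g x =
      cv (sig φ (1 * Symbol.expD t) j) g x - cv (sig φ 1 j) g x := by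
  have h : sig φ (1 * Symbol.expD t) j = sig φ (Symbol.expDSubOne t) j + sig φ 1 j := by
    ext ξ
    simp only [add_apply, sig_apply, Symbol.mul_toFun, Symbol.one_toFun,
      Symbol.expDSubOne]
    ring
  rw [h, cv_add_symbol hg]
  ring

variable {W : ℤ → ℝ≥0∞} {K : ℝ≥0∞} {g : ℝ → E d → ℝ}

theorem MemSp.measurable_cv_expDSubOne (hg : MemSp φ W g) (j : ℤ) (z : ℝ) :
    Measurable fun p : ℝ × E d => cv (sig φ (Symbol.expDSubOne (z - p.1)) j) (g p.1) p.2 := by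
  simp only [fun (p : ℝ × E d) => cv_sig_expDSubOne φ (z - p.1) j (hg.growth p.1) p.2]
  have h0 : Measurable fun p : ℝ × E d => (z - p.1, p.1, p.2) := by fun_prop
  have h1 := (measurable_cv_expD_uncurry φ 1 j hg.meas).comp h0
  simp only [Function.comp_def] at h1
  exact h1.sub (measurable_cv_uncurry _ hg.meas)

theorem MemSp.measurable_poisson (hg : MemSp φ W g) (z : ℝ) :
    Measurable fun p : ℝ × E d => poisson φ (z - p.1) (g p.1) p.2 := by
  simp only [poisson, fun t => mult_eq φ (.expDSubOne t)]
  exact hg.meas.add (Measurable.tsum fun j => hg.measurable_cv_expDSubOne j z)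

variable (φ) in
/-- The norm of `u` in the space `B^1_{∞,1}`. -/
def lipSum (u : E d → ℝ) : ℝ≥0∞ := ∑' j, pw j * sn (cv (sig φ 1 j) u)

theorem MemSp.measurable_lipSum (hg : MemSp φ W g) : Measurable fun τ => lipSum φ (g τ) :=
  Measurable.tsum fun _ => (hg.measurable_sn_cv _).const_mul _

theorem MemSp.lintegral_lipSum_ne_top (hW : IsWeight K W) (hg : MemSp φ W g) :
    ∫⁻ τ in Set.Iio (0 : ℝ), lipSum φ (g τ) ≠ ⊤ := by
  simp only [lipSum]
  rw [lintegral_tsum fun j => ((hg.measurable_sn_cv _).const_mul _).aemeasurable]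
  simp only [fun j => lintegral_const_mul' (μ := volume.restrict (Set.Iio (0 : ℝ))) (pw j)
    (fun τ => sn (cv (sig φ 1 j) (g τ))) (pw_ne_top j)]
  exact hg.tsum_pw_ne_top hW

theorem MemSp.ae_lipSum_ne_top (hW : IsWeight K W) (hg : MemSp φ W g) :
    ∀ᵐ τ, τ < 0 → lipSum φ (g τ) ≠ ⊤ := by
  have h := ae_lt_top hg.measurable_lipSum (hg.lintegral_lipSum_ne_top hW)
  rw [ae_restrict_iff' measurableSet_Iio] at h
  filter_upwards [h] with τ h hτ
  exact (h hτ).ne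

variable (φ) in
theorem exists_tsum_sn_expDSubOne_le : ∃ C : ℝ, 0 < C ∧ ∀ t ≤ 0, ∀ u : E d → ℝ,
    LinGrowth u → (∀ j, sn (cv (sig φ 1 j) u) ≠ ⊤) →
    ∑' j, sn (cv (sig φ (Symbol.expDSubOne t) j) u) ≤ ENNReal.ofReal (C * |t|) * lipSum φ u := by
  obtain ⟨C, hC, h⟩ := exists_sn_expDSubOne_le φ
  refine ⟨C, hC, fun t ht u hu hs => ?_⟩
  rw [lipSum, ← ENNReal.tsum_mul_left]
  exact ENNReal.tsum_le_tsum fun j => h t ht j u hu (hs j)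

variable (φ) in
/-- `∫_0^z e^{(z-z')|D|} g(z') dz'`. -/
def duhamel (g : ℝ → E d → ℝ) (z : ℝ) (x : E d) : ℝ :=
  ∫ τ in (0 : ℝ)..z, poisson φ (z - τ) (g τ) x

theorem intervalIntegral_eq_neg_Ioo (F : ℝ → ℝ) {z : ℝ} (hz : z ≤ 0) :
    ∫ τ in (0 : ℝ)..z, F τ = -∫ τ in Set.Ioo z 0, F τ := by
  rw [intervalIntegral.integral_of_ge hz, integral_Ioc_eq_integral_Ioo]

theorem duhamel_eq_Ioo (g : ℝ → E d → ℝ) {z : ℝ} (hz : z ≤ 0) (x : E d) :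
    duhamel φ g z x = ∫ τ in Set.Ioo z 0, -poisson φ (z - τ) (g τ) x := by
  rw [duhamel, intervalIntegral_eq_neg_Ioo _ hz, integral_neg]

variable (φ) in
-- Domination for the Duhamel integral: e^{(z-τ)|D|}g(τ) is at most the sup norm plus |z| times the
-- Ḃ¹ norm of g(τ), and the latter is integrable in τ, in particular finite for almost every τ.
theorem exists_ae_abs_poisson_le : ∃ C : ℝ, 0 < C ∧ ∀ (W : ℤ → ℝ≥0∞) (K : ℝ≥0∞) (g : ℝ → E d → ℝ),
    IsWeight K W → MemSp φ W g → ∀ z ≤ 0, ∀ᵐ τ, τ ∈ Set.Ioo z 0 → ∀ x,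
      |poisson φ (z - τ) (g τ) x| ≤
        (spNorm φ W g).toReal + (ENNReal.ofReal (C * |z|) * lipSum φ (g τ)).toReal := by
  obtain ⟨C, hC, h⟩ := exists_tsum_sn_expDSubOne_le φ
  refine ⟨C, hC, fun W K g hW hg z hz => ?_⟩
  filter_upwards [hg.ae_lipSum_ne_top hW] with τ hτ hτz x
  have h1 := h (z - τ) (by linarith [hτz.1]) (g τ) (hg.growth τ) fun _ => hg.sn_cv_ne_top _ _
  have h2 : ‖mult φ (Symbol.expDSubOne (z - τ)) (g τ) x‖ₑ ≤
      ENNReal.ofReal (C * |z|) * lipSum φ (g τ) := by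
    rw [mult_eq φ (.expDSubOne _)]
    refine (enorm_tsum_le_real _).trans ((ENNReal.tsum_le_tsum fun j => enorm_le_sn _ x).trans
      (h1.trans ?_))
    gcongr ENNReal.ofReal (C * ?_) * _
    rw [abs_of_nonpos (by linarith [hτz.1]), abs_of_nonpos hz]
    linarith [hτz.2]
  have h3 : |mult φ (Symbol.expDSubOne (z - τ)) (g τ) x| ≤
      (ENNReal.ofReal (C * |z|) * lipSum φ (g τ)).toReal := by
    have := hτ hτz.2
    have := ENNReal.toReal_mono (by finiteness) h2
    simpa using this
  have h4 : |g τ x| ≤ (spNorm φ W g).toReal :=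
    (abs_le_of_sn (hg.sn_ne_top τ) x).trans (ENNReal.toReal_mono hg.fin (sn_le_spNorm g τ))
  rw [poisson]
  exact (abs_add_le _ _).trans (add_le_add h4 h3)

theorem MemSp.integrableOn_lipSum (hW : IsWeight K W) (hg : MemSp φ W g) (M C z : ℝ) :
    IntegrableOn (fun τ => M + (ENNReal.ofReal C * lipSum φ (g τ)).toReal) (Set.Ioo z 0) := by
  refine (integrableOn_const (by simp)).add ?_
  refine integrable_toReal_of_lintegral_ne_top (hg.measurable_lipSum.const_mul _).aemeasurable ?_
  rw [lintegral_const_mul' _ _ ENNReal.ofReal_ne_top]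
  refine ENNReal.mul_ne_top ENNReal.ofReal_ne_top (ne_top_of_le_ne_top
    (hg.lintegral_lipSum_ne_top hW) ?_)
  exact lintegral_mono_set fun τ hτ => hτ.2

theorem MemSp.integrableOn_poisson (hW : IsWeight K W) (hg : MemSp φ W g) {z : ℝ} (hz : z ≤ 0)
    (x : E d) : IntegrableOn (fun τ => poisson φ (z - τ) (g τ) x) (Set.Ioo z 0) := by
  obtain ⟨C, hC, h⟩ := exists_ae_abs_poisson_le φ
  refine (hg.integrableOn_lipSum hW _ (C * |z|) z).mono' ?_
    ((ae_restrict_iff' measurableSet_Ioo).2 ?_) (g := fun τ => (spNorm φ W g).toReal + _)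
  · exact ((hg.measurable_poisson z).comp
      (by fun_prop : Measurable fun τ : ℝ => (τ, x))).aestronglyMeasurable
  · filter_upwards [h W K g hW hg z hz] with τ h1 hτ
    exact h1 hτ x

theorem MemSp.cv_duhamel (hW : IsWeight K W) (hg : MemSp φ W g) (a : 𝓢(E d, ℂ)) {z : ℝ}
    (hz : z ≤ 0) (x : E d) :
    cv a (duhamel φ g z) x = -∫ τ in Set.Ioo z 0, cv a (poisson φ (z - τ) (g τ)) x := by
  obtain ⟨C, hC, h⟩ := exists_ae_abs_poisson_le φ
  rw [funext (duhamel_eq_Ioo g hz), cv_integral a (F := fun τ y => -poisson φ (z - τ) (g τ) y)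
    (hg.measurable_poisson z).neg (hg.integrableOn_lipSum hW (spNorm φ W g).toReal (C * |z|) z)
    ?_ x, ← integral_neg]
  · congr 1
    ext τ
    have := cv_const_mul a (-1) (poisson φ (z - τ) (g τ)) x
    simpa using this
  · rw [ae_restrict_iff' measurableSet_Ioo]
    filter_upwards [h W K g hW hg z hz] with τ h1 hτ x
    rw [abs_neg]
    exact h1 hτ x

theorem timeBlock_Ioi_eq (m : Symbol d) (j : ℤ) (g : ℝ → E d → ℝ) (z : ℝ) (x : E d) :
    timeBlock φ m Set.Ioi j g z x =
      ∫ τ in Set.Ioo z 0, cv (sig φ (m * Symbol.expD (z - τ)) j) (g τ) x := by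
  rw [timeBlock, setIntegral_indicator measurableSet_Ioi, Set.Iio_inter_Ioi]
  refine setIntegral_congr_fun measurableSet_Ioo fun τ hτ => ?_
  rw [abs_of_neg (by linarith [hτ.1]), neg_neg]

/-- The minus sign comes from integrating from 0 down to z ≤ 0: derivatives of the Duhamel integral
are minus the operator `timeOp` over z < τ < 0. -/
theorem MemSp.cv_sig_duhamel (hW : IsWeight K W) (hg : MemSp φ W g) {m : Symbol d} (hm : m.IsReal)
    (j : ℤ) {z : ℝ} (hz : z ≤ 0) (x : E d) :
    cv (sig φ m j) (duhamel φ g z) x = -timeBlock φ m Set.Ioi j g z x := by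
  rw [hg.cv_duhamel hW _ hz, timeBlock_Ioi_eq]
  congr 1
  refine setIntegral_congr_ae measurableSet_Ioo ?_
  filter_upwards [hg.ae_lipSum_ne_top hW] with τ hτ hτz
  exact cv_sig_poisson hm (by linarith [hτz.1]) j (hg.growth τ) (hτ hτz.2) x

/-- Fubini on the triangle z < σ < τ < 0, where the inner integral is ∫_z^τ |D| e^{(σ-τ)|D|} dσ = 1
- e^{(z-τ)|D|}. -/
theorem MemSp.integral_timeBlock_absD (hW : IsWeight K W) (hg : MemSp φ W g) (j : ℤ) (z : ℝ)
    (x : E d) : ∫ σ in Set.Ioo z 0, timeBlock φ Symbol.absD Set.Ioi j g σ x =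
      -∫ τ in Set.Ioo z 0, cv (sig φ (Symbol.expDSubOne (z - τ)) j) (g τ) x := by
  obtain ⟨C, hC⟩ := exists_expBound φ (Symbol.IsHom.absD (d := d)) .absD
  simp only [timeBlock]
  rw [integral_integral_swap]
  · have h1 : ∀ τ, ∫ σ in Set.Ioo z 0, (Set.Ioi σ).indicator
        (fun τ => cv (sig φ (Symbol.absD * Symbol.expD (-|σ - τ|)) j) (g τ) x) τ =
        ∫ σ in Set.Ioo z 0, (Set.Iio τ).indicator
        (fun σ => cv (sig φ (Symbol.absD * Symbol.expD (-|σ - τ|)) j) (g τ) x) σ := by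
      intro τ
      congr 1
    have h2 : ∀ τ ∈ Set.Iio (0 : ℝ), ∫ σ in Set.Ioo z 0, (Set.Ioi σ).indicator
        (fun τ => cv (sig φ (Symbol.absD * Symbol.expD (-|σ - τ|)) j) (g τ) x) τ =
        (Set.Ioi z).indicator
          (fun τ => -cv (sig φ (Symbol.expDSubOne (z - τ)) j) (g τ) x) τ := by
      intro τ hτ
      rw [h1, setIntegral_indicator measurableSet_Iio, Set.Ioo_inter_Iio, min_eq_right hτ.le]
      by_cases hzτ : z < τ
      · rw [Set.indicator_of_mem (show τ ∈ Set.Ioi z from hzτ), cv_expDSubOne φ _ (by linarith) j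
          (hg.growth τ) (hg.sn_cv_ne_top _ _), ← intervalIntegral.integral_symm,
          ← integral_Ioc_eq_integral_Ioo, ← intervalIntegral.integral_of_le hzτ.le]
        have h3 := intervalIntegral.integral_comp_sub_right (a := z) (b := τ)
          (fun s => cv (sig φ (Symbol.absD * Symbol.expD s) j) (g τ) x) τ
        rw [sub_self] at h3
        rw [← h3]
        refine intervalIntegral.integral_congr fun σ hσ => ?_
        rw [Set.uIcc_of_le hzτ.le] at hσ
        rw [abs_of_nonpos (by linarith [hσ.2]), neg_neg]
      · rw [Set.indicator_of_notMem (show τ ∉ Set.Ioi z from hzτ),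
          Set.Ioo_eq_empty (by simpa using hzτ), setIntegral_empty]
    rw [setIntegral_congr_fun measurableSet_Iio h2, setIntegral_indicator measurableSet_Ioi,
      Set.Iio_inter_Ioi, integral_neg]
  · have h0 : Measurable fun p : ℝ × ℝ => ((p.1, x), p.2) := by fun_prop
    have h1 := (measurable_indicator_timeBlock measurableSet_mem_Ioi hg.meas Symbol.absD j
      (φ := φ)).comp h0
    simp only [Function.comp_def] at h1
    have hb := integrableOn_toReal_sn hW hg C j
    have h2 : IntegrableOn (fun _ : ℝ => (1 : ℝ)) (Set.Ioo z 0) := integrableOn_const (by simp)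
    refine (Integrable.mul_prod h2 hb).mono' h1.aestronglyMeasurable
      (Eventually.of_forall fun p => ?_)
    rw [one_mul, Real.norm_eq_abs]
    exact hC.abs_indicator_le (A := Set.Ioi) hg j p.1 p.2 x

theorem MemSp.tsum_lintegral_timeBlock_ne_top (hW : IsWeight K W) (hg : MemSp φ W g) (z : ℝ)
    (x : E d) :
    ∑' j, ∫⁻ σ in Set.Ioo z 0, ‖timeBlock φ Symbol.absD Set.Ioi j g σ x‖ₑ ≠ ⊤ := by
  obtain ⟨C, hC⟩ := exists_expBound φ (Symbol.IsHom.absD (d := d)) .absD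
  have hsum := hg.tsum_pw_ne_top hW
  refine ne_top_of_le_ne_top (b := ∑' j, ENNReal.ofReal C * (pw j * blockInt φ j g) *
    volume (Set.Ioo z 0)) ?_ (ENNReal.tsum_le_tsum fun j => ?_)
  · rw [ENNReal.tsum_mul_right, ENNReal.tsum_mul_left, Real.volume_Ioo]
    finiteness
  · rw [← setLIntegral_const]
    exact lintegral_mono fun σ => (enorm_le_sn _ x).trans (hC.sn_timeBlock_le hg _ j σ)

theorem MemSp.tsum_lintegral_expDSubOne_ne_top (hW : IsWeight K W) (hg : MemSp φ W g) {z : ℝ}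
    (hz : z ≤ 0) (x : E d) : ∑' j, ∫⁻ τ in Set.Ioo z 0,
      ‖cv (sig φ (Symbol.expDSubOne (z - τ)) j) (g τ) x‖ₑ ≠ ⊤ := by
  obtain ⟨C, hC, h⟩ := exists_sn_expDSubOne_le φ
  have hsum := hg.tsum_pw_ne_top hW
  refine ne_top_of_le_ne_top (b := ∑' j, ENNReal.ofReal (C * |z|) * (pw j * blockInt φ j g)) ?_
    (ENNReal.tsum_le_tsum fun j => ?_)
  · rw [ENNReal.tsum_mul_left]
    finiteness
  · rw [← lintegral_pw_sn]
    have h1 : ∀ τ ∈ Set.Ioo z 0, ‖cv (sig φ (Symbol.expDSubOne (z - τ)) j) (g τ) x‖ₑ ≤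
        ENNReal.ofReal (C * |z|) * (pw j * sn (cv (sig φ 1 j) (g τ))) := by
      intro τ hτ
      refine (enorm_le_sn _ x).trans ((h (z - τ) (by linarith [hτ.1]) j (g τ) (hg.growth τ)
        (hg.sn_cv_ne_top _ _)).trans ?_)
      gcongr ENNReal.ofReal (C * ?_) * _
      rw [abs_of_nonpos (by linarith [hτ.1]), abs_of_nonpos hz]
      linarith [hτ.2]
    exact (setLIntegral_mono' measurableSet_Ioo h1).trans
      (lintegral_mono_set Set.Ioo_subset_Iio_self)

theorem MemSp.integral_timeOp_absD (hW : IsWeight K W) (hg : MemSp φ W g) {z : ℝ} (hz : z ≤ 0)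
    (x : E d) : ∫ σ in Set.Ioo z 0, timeOp φ Symbol.absD Set.Ioi g σ x =
      -∫ τ in Set.Ioo z 0, mult φ (Symbol.expDSubOne (z - τ)) (g τ) x := by
  have hm : ∀ j, Measurable fun σ => timeBlock φ Symbol.absD Set.Ioi j g σ x := fun j => by
    have h0 : Measurable fun σ : ℝ => (σ, x) := by fun_prop
    have h1 := (measurable_timeBlock (φ := φ) measurableSet_mem_Ioi hg.meas Symbol.absD j).comp h0
    simpa only [Function.comp_def, Function.uncurry] using h1
  have hm' : ∀ j, Measurable fun τ => cv (sig φ (Symbol.expDSubOne (z - τ)) j) (g τ) x := fun j => by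
    have h0 : Measurable fun σ : ℝ => (σ, x) := by fun_prop
    have h1 := (hg.measurable_cv_expDSubOne j z).comp h0
    simpa only [Function.comp_def] using h1
  have h1 : ∀ τ, mult φ (Symbol.expDSubOne (z - τ)) (g τ) x =
      ∑' j, cv (sig φ (Symbol.expDSubOne (z - τ)) j) (g τ) x :=
    fun τ => mult_eq φ (.expDSubOne _) _ x
  have h2 := integral_tsum (fun j => (hm j).aestronglyMeasurable)
    (hg.tsum_lintegral_timeBlock_ne_top hW z x)
  have h3 := integral_tsum (fun j => (hm' j).aestronglyMeasurable)
    (hg.tsum_lintegral_expDSubOne_ne_top hW hz x)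
  simp only [h1]
  refine h2.trans (Eq.trans ?_ (congrArg Neg.neg h3.symm))
  rw [← tsum_neg]
  exact tsum_congr fun j => hg.integral_timeBlock_absD hW j z x

theorem integrableOn_of_abs_le {F : ℝ → ℝ} (hF : Measurable F) {M : ℝ} (hM : ∀ s, |F s| ≤ M)
    (z : ℝ) : IntegrableOn F (Set.Ioo z 0) :=
  Integrable.mono' (g := fun _ => M) (integrableOn_const (by simp)) hF.aestronglyMeasurable
    (Eventually.of_forall hM)

theorem MemSp.measurable_time (hg : MemSp φ W g) (x : E d) : Measurable fun z => g z x :=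
  hg.meas.comp (by fun_prop : Measurable fun z : ℝ => (z, x))

theorem MemSp.exists_abs_le (hg : MemSp φ W g) : ∃ M, 0 ≤ M ∧ ∀ z x, |g z x| ≤ M :=
  ⟨(spNorm φ W g).toReal, ENNReal.toReal_nonneg, fun z x =>
    (abs_le_of_sn (hg.sn_ne_top z) x).trans (ENNReal.toReal_mono hg.fin (sn_le_spNorm g z))⟩

theorem MemSp.integrableOn (hg : MemSp φ W g) (z : ℝ) (x : E d) :
    IntegrableOn (fun σ => g σ x) (Set.Ioo z 0) := by
  obtain ⟨M, _, hM⟩ := hg.exists_abs_le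
  exact integrableOn_of_abs_le (hg.measurable_time x) (fun s => hM s x) z

theorem MemSp.timeOp {m : Symbol d} (hW : IsWeight K W) (hg : MemSp φ W g) (hm : m.IsHom 1)
    (hr : m.IsReal) {A : ℝ → Set ℝ} (hA : MeasurableSet {p : ℝ × ℝ | p.2 ∈ A p.1}) :
    MemSp φ W (timeOp φ m A g) :=
  ((exists_spNorm_timeOp_le φ hm hr hW.const_ne_top).choose_spec.2 W hW A hA g hg).1

/-- The equation ∂_z u = g + |D|u in integrated form, with |D|u = -`timeOp` over later times. It
shows that u is bounded for fixed z and identifies its derivative in z without differentiating under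
the integral. -/
theorem MemSp.duhamel_eq (hW : IsWeight K W) (hg : MemSp φ W g) {z : ℝ} (hz : z ≤ 0) (x : E d) :
    duhamel φ g z x =
      ∫ σ in (0 : ℝ)..z, (g σ x - DirichletNeumann.timeOp φ Symbol.absD Set.Ioi g σ x) := by
  have h1 := hg.integrableOn z x
  have h2 := (hg.timeOp hW .absD .absD measurableSet_mem_Ioi).integrableOn z x
  have h3 : IntegrableOn (fun τ => mult φ (Symbol.expDSubOne (z - τ)) (g τ) x) (Set.Ioo z 0) :=
    ((hg.integrableOn_poisson hW hz x).sub h1).congr (Eventually.of_forall fun τ => by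
      simp [poisson])
  rw [intervalIntegral_eq_neg_Ioo _ hz, integral_sub h1 h2, hg.integral_timeOp_absD hW hz,
    duhamel, intervalIntegral_eq_neg_Ioo _ hz]
  simp only [poisson]
  rw [integral_add h1 h3]
  ring

theorem continuous_intervalIntegral_of_abs_le {F : ℝ → E d → ℝ}
    (hF : Measurable (Function.uncurry F)) (hc : ∀ s, Continuous (F s)) {M : ℝ}
    (hM : ∀ s x, |F s x| ≤ M) (z : ℝ) : Continuous fun x => ∫ s in (0 : ℝ)..z, F s x := by
  refine intervalIntegral.continuous_of_dominated_interval (bound := fun _ => M) (fun x => ?_)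
    (fun x => Eventually.of_forall fun s _ => hM s x) intervalIntegrable_const
    (Eventually.of_forall fun s _ => hc s)
  exact (hF.comp (by fun_prop : Measurable fun s : ℝ => (s, x))).aestronglyMeasurable

theorem MemSp.sub {h : ℝ → E d → ℝ} (hg : MemSp φ W g) (hh : MemSp φ W h) :
    MemSp φ W fun z x => g z x - h z x :=
  (Sp.mk g hg - Sp.mk h hh).mem

/-- Boundedness and continuity follow from the integrated equation, and summability of 2^j ‖Δ̇_j u‖
from that of the blocks of |D|u after inverting |D| on each block. -/
theorem MemSp.realized_duhamel (hW : IsWeight K W) (hg : MemSp φ W g) {z : ℝ} (hz : z ≤ 0) :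
    Realized φ (duhamel φ g z) := by
  have h1 := hg.sub (hg.timeOp hW .absD .absD measurableSet_mem_Ioi)
  obtain ⟨M, _, hM⟩ := h1.exists_abs_le
  obtain ⟨C, hC⟩ := exists_expBound φ (Symbol.IsHom.absD (d := d)) .absD
  obtain ⟨C', hC', h⟩ := exists_pw_mul_sn_le φ
  have hb : ∀ x, |duhamel φ g z x| ≤ M * |z| := by
    intro x
    rw [hg.duhamel_eq hW hz]
    have := intervalIntegral.norm_integral_le_of_norm_le_const (a := 0) (b := z)
      fun s _ => (Real.norm_eq_abs _).trans_le (hM s x)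
    simpa using this
  have hc : Continuous (duhamel φ g z) := by
    rw [funext (hg.duhamel_eq hW hz)]
    exact continuous_intervalIntegral_of_abs_le h1.meas h1.cont hM z
  refine .of_bounded hc hb ?_
  have hl := LinGrowth.of_bounded hc.measurable hb
  refine ne_top_of_le_ne_top ?_ (ENNReal.tsum_le_tsum fun j => h j _ hl)
  have h2 : ∀ j, sn (cv (sig φ Symbol.absD j) (duhamel φ g z)) =
      sn (timeBlock φ Symbol.absD Set.Ioi j g z) := fun j => by
    rw [sn_congr (hg.cv_sig_duhamel hW .absD j hz), sn_neg]
  simp only [h2]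
  rw [ENNReal.tsum_mul_left]
  exact ENNReal.mul_ne_top ENNReal.ofReal_ne_top (hC.tsum_sn_timeBlock_ne_top hW hg _ z)

theorem MemSp.gradient_duhamel (hW : IsWeight K W) (hg : MemSp φ W g) {z : ℝ} (hz : z ≤ 0)
    (x : E d) (k : Fin d) : gradient (duhamel φ g z) x k =
      -DirichletNeumann.timeOp φ (Symbol.absD * Symbol.riesz k) Set.Ioi g z x := by
  rw [← ((hg.realized_duhamel hW hz).hasSum_mult_riesz k x).tsum_eq,
    DirichletNeumann.timeOp, ← tsum_neg]
  exact tsum_congr fun j => hg.cv_sig_duhamel hW (.absD_mul_riesz k) j hz x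

/-! ### The Poisson extension of a realized function -/

variable {u : E d → ℝ}

/-- The same integrated form for the homogeneous equation, summed over the blocks of (e^{z|D|} -
1)u. -/
theorem Realized.poisson_eq (hu : Realized φ u) {z : ℝ} (hz : z ≤ 0) (x : E d) :
    DirichletNeumann.poisson φ z u x = u x + ∫ s in (0 : ℝ)..z, heat φ 1 u s x := by
  obtain ⟨C, hC⟩ := exists_expBound φ (Symbol.IsHom.absD (d := d)) .absD
  have hsum := hu.sum
  have hm : ∀ j, Measurable fun s => heatBlock φ 1 u j s x := fun j =>
    (measurable_heatBlock 1 hu.growth.1 j).comp (by fun_prop : Measurable fun s : ℝ => (s, x))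
  have hb : ∀ j s, sn (heatBlock φ 1 u j s) ≤
      ENNReal.ofReal C * (pw j * sn (cv (sig φ 1 j) u)) := by
    intro j s
    by_cases hs : s < 0
    · rw [show heatBlock φ 1 u j s = cv (sig φ (Symbol.absD * Symbol.expD s) j) u from
        funext fun x => (if_pos hs).trans (by rw [Symbol.mul_one'])]
      refine (hC.2 s hs.le j u hu.growth).trans ?_
      rw [pw]
      gcongr
      refine mul_le_of_le_one_right (by positivity) ?_
      rw [Real.exp_le_one_iff]
      have : (0 : ℝ) < 2 ^ j := by positivity
      nlinarith
    · rw [show heatBlock φ 1 u j s = fun _ => 0 from funext fun x => if_neg hs, sn_zero]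
      exact zero_le
  rw [DirichletNeumann.poisson, mult_eq φ (.expDSubOne z), intervalIntegral_eq_neg_Ioo _ hz]
  simp only [heat_eq_tsum]
  rw [integral_tsum fun j => (hm j).aestronglyMeasurable, ← tsum_neg]
  · congr 1
    refine tsum_congr fun j => ?_
    rw [cv_expDSubOne φ z hz j hu.growth (hu.ne_top j), intervalIntegral_eq_neg_Ioo _ hz]
    congr 1
    refine setIntegral_congr_fun measurableSet_Ioo fun s hs => ?_
    rw [heatBlock, if_pos hs.2, Symbol.mul_one']
  · refine ne_top_of_le_ne_top (b := ∑' j, ENNReal.ofReal C * (pw j * sn (cv (sig φ 1 j) u)) *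
      volume (Set.Ioo z 0)) ?_ (ENNReal.tsum_le_tsum fun j => ?_)
    · rw [ENNReal.tsum_mul_right, ENNReal.tsum_mul_left, Real.volume_Ioo]
      finiteness
    · rw [← setLIntegral_const]
      exact lintegral_mono fun σ => (enorm_le_sn _ x).trans (hb j σ)

theorem Realized.gradient_poisson (hu : Realized φ u) {z : ℝ} (hz : z < 0) (x : E d) (k : Fin d) :
    gradient (DirichletNeumann.poisson φ z u) x k = heat φ (Symbol.riesz k) u z x := by
  rw [← ((hu.poisson hz.le).hasSum_mult_riesz k x).tsum_eq, heat, if_pos hz]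
  exact tsum_congr fun j => cv_sig_poisson (.absD_mul_riesz k) hz.le j hu.growth hu.sum x

theorem Realized.mult_absD_poisson (hu : Realized φ u) {z : ℝ} (hz : z < 0) (x : E d) :
    mult φ Symbol.absD (DirichletNeumann.poisson φ z u) x = heat φ 1 u z x := by
  rw [mult_eq φ .absD, heat, if_pos hz, Symbol.mul_one']
  exact tsum_congr fun j => cv_sig_poisson .absD hz.le j hu.growth hu.sum x

end DirichletNeumann

end

/-! ### The linear equation for the gradient and its coefficients. -/

noncomputable section
namespace DirichletNeumann
variable {d : ℕ} {φ : LittlewoodPaley d}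

/-! ### The linearised system -/

/-- Banach's fixed point theorem for an affine contraction. It is applied both to the gradient
equation and to the division by 1 + |D|H. -/
theorem exists_eq_add_of_norm_le {X : Type*} [NormedAddCommGroup X] [NormedSpace ℝ X]
    [CompleteSpace X] (L : X →ₗ[ℝ] X) (hL : ∀ x, ‖L x‖ ≤ 1 / 2 * ‖x‖) (b : X) :
    ∃ y, y = b + L y ∧ ‖y‖ ≤ 2 * ‖b‖ := by
  have h : ContractingWith (1 / 2) (fun y => b + L y) := by
    refine ⟨by norm_num, LipschitzWith.of_dist_le_mul fun x y => ?_⟩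
    rw [dist_eq_norm, dist_eq_norm, add_sub_add_left_eq_sub, ← map_sub]
    simpa using hL (x - y)
  have h1 := h.fixedPoint_isFixedPt.eq
  refine ⟨h.fixedPoint, h1.symm, ?_⟩
  have h2 : ‖h.fixedPoint‖ ≤ ‖b‖ + 1 / 2 * ‖h.fixedPoint‖ := by
    conv_lhs => rw [← h1]
    exact (norm_add_le _ _).trans (add_le_add_right (hL _) _)
  linarith

variable {W : ℤ → ℝ≥0∞} {K : ℝ≥0∞}

variable (φ W) in
/-- The space of pairs `(∇ₓv, ∂_z v)`. -/
abbrev GradSp : Type := (Fin d → Sp φ W) × Sp φ W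

namespace GradSp

variable (hW : IsWeight K W) (A₁ : Fin d → Sp φ W) (A₂ A₃ : Sp φ W)

/-- The source `Q_a`. -/
def qa : GradSp φ W →ₗ[ℝ] Sp φ W :=
  ∑ k, Sp.mul hW (A₁ k) ∘ₗ LinearMap.proj k ∘ₗ LinearMap.fst ℝ _ _ -
    Sp.mul hW A₃ ∘ₗ LinearMap.snd ℝ _ _

/-- The `k`-th component of the vector field `B`. -/
def b (k : Fin d) : GradSp φ W →ₗ[ℝ] Sp φ W :=
  Sp.mul hW (A₁ k) ∘ₗ LinearMap.snd ℝ _ _ -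
    Sp.mul hW A₂ ∘ₗ LinearMap.proj k ∘ₗ LinearMap.fst ℝ _ _

/-- The function `w`. -/
def w : GradSp φ W →ₗ[ℝ] Sp φ W :=
  ∑ k, Sp.timeOp hW (Symbol.IsHom.absD_mul_riesz k) (.absD_mul_riesz k) measurableSet_mem_Iio ∘ₗ
    b hW A₁ A₂ k -
  Sp.timeOp hW Symbol.IsHom.absD .absD measurableSet_mem_Iio ∘ₗ qa hW A₁ A₃

/-- The source `w + Q_a` of the fixed point equation. -/
def src : GradSp φ W →ₗ[ℝ] Sp φ W := w hW A₁ A₂ A₃ + qa hW A₁ A₃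

/-- The gradient of the Duhamel integral. -/
def gradDuhamel : Sp φ W →ₗ[ℝ] GradSp φ W :=
  (LinearMap.pi fun k => -Sp.timeOp hW (Symbol.IsHom.absD_mul_riesz k) (.absD_mul_riesz k)
    measurableSet_mem_Ioi).prod
  (LinearMap.id - Sp.timeOp hW Symbol.IsHom.absD .absD measurableSet_mem_Ioi)

theorem qa_apply (y : GradSp φ W) (z : ℝ) (x : E d) : (qa hW A₁ A₃ y).val z x =
    (∑ k, (A₁ k).val z x * (y.1 k).val z x) - A₃.val z x * y.2.val z x := by
  simp [qa, Sp.val_sum, LinearMap.sum_apply]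

theorem b_apply (k : Fin d) (y : GradSp φ W) (z : ℝ) (x : E d) : (b hW A₁ A₂ k y).val z x =
    (A₁ k).val z x * y.2.val z x - A₂.val z x * (y.1 k).val z x := by
  simp [b]

theorem w_apply (y : GradSp φ W) (z : ℝ) (x : E d) : (w hW A₁ A₂ A₃ y).val z x =
    (∑ k, timeOp φ (Symbol.absD * Symbol.riesz k) Set.Iio (b hW A₁ A₂ k y).val z x) -
      timeOp φ Symbol.absD Set.Iio (qa hW A₁ A₃ y).val z x := by
  simp [w, Sp.val_sum, LinearMap.sum_apply]

theorem src_apply (y : GradSp φ W) (z : ℝ) (x : E d) : (src hW A₁ A₂ A₃ y).val z x =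
    (w hW A₁ A₂ A₃ y).val z x + (qa hW A₁ A₃ y).val z x := rfl

theorem gradDuhamel_fst (g : Sp φ W) (k : Fin d) (z : ℝ) (x : E d) :
    ((gradDuhamel hW g).1 k).val z x =
      -timeOp φ (Symbol.absD * Symbol.riesz k) Set.Ioi g.val z x := rfl

theorem gradDuhamel_snd (g : Sp φ W) (z : ℝ) (x : E d) :
    (gradDuhamel hW g).2.val z x = g.val z x - timeOp φ Symbol.absD Set.Ioi g.val z x := rfl

theorem norm_fst_apply_le (y : GradSp φ W) (k : Fin d) : ‖y.1 k‖ ≤ ‖y‖ :=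
  (norm_le_pi_norm y.1 k).trans (norm_fst_le y)

variable (φ) in
-- Every term of `qa` and `b` is a product with one coefficient, whence the factor α; the time
-- operators are bounded. The constant depends on the weight only through K, which later allows a
-- weight adapted to η.
theorem exists_norm_le (hK : K ≠ ⊤) : ∃ M : ℝ, 0 < M ∧ ∀ (W : ℤ → ℝ≥0∞) (hW : IsWeight K W)
    (A₁ : Fin d → Sp φ W) (A₂ A₃ : Sp φ W) (α : ℝ), 0 ≤ α → (∀ k, ‖A₁ k‖ ≤ α) → ‖A₂‖ ≤ α →
    ‖A₃‖ ≤ α → (∀ y, ‖qa hW A₁ A₃ y‖ ≤ M * α * ‖y‖) ∧ (∀ k y, ‖b hW A₁ A₂ k y‖ ≤ M * α * ‖y‖) ∧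
      ∀ y, ‖gradDuhamel hW (src hW A₁ A₂ A₃ y)‖ ≤ M * α * ‖y‖ := by
  obtain ⟨M₁, hM₁, h₁⟩ := Sp.exists_norm_mul_le φ K hK
  obtain ⟨M₂, hM₂, h₂⟩ := Sp.exists_norm_timeOp_le φ (Symbol.IsHom.absD (d := d)) .absD hK
  choose M₃ hM₃ h₃ using fun k : Fin d =>
    Sp.exists_norm_timeOp_le φ (Symbol.IsHom.absD_mul_riesz k) (.absD_mul_riesz k) hK
  set S : ℝ := ∑ k, M₃ k with hS
  have hS0 : 0 ≤ S := Finset.sum_nonneg fun k _ => (hM₃ k).le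
  have hle : ∀ k, M₃ k ≤ S := fun k =>
    Finset.single_le_sum (fun k _ => (hM₃ k).le) (Finset.mem_univ k)
  set Q : ℝ := (d + 1) * M₁ with hQ
  have hQ0 : 0 ≤ Q := by positivity
  set N : ℝ := S * (2 * M₁) + M₂ * Q + Q with hN
  have hN0 : 0 ≤ N := by positivity
  have hP0 : 0 ≤ (S + 1 + M₂) * N := by positivity
  refine ⟨Q + 2 * M₁ + (S + 1 + M₂) * N, by positivity,
    fun W hW A₁ A₂ A₃ α hα hA₁ hA₂ hA₃ => ?_⟩
  have hmul : ∀ (A g : Sp φ W) (c : ℝ), ‖A‖ ≤ α → ‖g‖ ≤ c → ‖Sp.mul hW A g‖ ≤ M₁ * α * c := by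
    intro A g c hA hg
    refine (h₁ W hW A g).trans ?_
    have := norm_nonneg A
    have := norm_nonneg g
    gcongr
  have hqa : ∀ y, ‖qa hW A₁ A₃ y‖ ≤ Q * α * ‖y‖ := by
    intro y
    have e : qa hW A₁ A₃ y = ∑ k, Sp.mul hW (A₁ k) (y.1 k) - Sp.mul hW A₃ y.2 := by
      simp [qa, LinearMap.sum_apply]
    rw [e]
    refine (norm_sub_le _ _).trans ((add_le_add (norm_sum_le_of_le _ fun k _ =>
      hmul (A₁ k) (y.1 k) ‖y‖ (hA₁ k) (norm_fst_apply_le y k))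
      (hmul A₃ y.2 ‖y‖ hA₃ (norm_snd_le y))).trans (le_of_eq ?_))
    simp only [Finset.sum_const, Finset.card_univ, Fintype.card_fin, nsmul_eq_mul, hQ]
    ring
  have hb : ∀ k y, ‖b hW A₁ A₂ k y‖ ≤ 2 * M₁ * α * ‖y‖ := by
    intro k y
    refine (norm_sub_le _ _).trans ((add_le_add (hmul (A₁ k) y.2 ‖y‖ (hA₁ k) (norm_snd_le y))
      (hmul A₂ (y.1 k) ‖y‖ hA₂ (norm_fst_apply_le y k))).trans (le_of_eq (by ring)))
  have hsrc : ∀ y, ‖src hW A₁ A₂ A₃ y‖ ≤ N * α * ‖y‖ := by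
    intro y
    have e : src hW A₁ A₂ A₃ y = ∑ k, Sp.timeOp hW (Symbol.IsHom.absD_mul_riesz k)
        (.absD_mul_riesz k) measurableSet_mem_Iio (b hW A₁ A₂ k y) -
        Sp.timeOp hW Symbol.IsHom.absD .absD measurableSet_mem_Iio (qa hW A₁ A₃ y) +
        qa hW A₁ A₃ y := by
      simp [src, w, LinearMap.sum_apply]
    rw [e]
    refine (norm_add_le _ _).trans ((add_le_add ((norm_sub_le _ _).trans (add_le_add
      (norm_sum_le_of_le _ fun k _ => (h₃ k W hW _ _ _).trans
        (mul_le_mul_of_nonneg_left (hb k y) (hM₃ k).le))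
      ((h₂ W hW _ _ _).trans (mul_le_mul_of_nonneg_left (hqa y) hM₂.le)))) (hqa y)).trans
      (le_of_eq ?_))
    rw [← Finset.sum_mul, hN]
    ring
  have hgd : ∀ g : Sp φ W, ‖gradDuhamel hW g‖ ≤ (S + 1 + M₂) * ‖g‖ := by
    intro g
    have hg := norm_nonneg g
    refine norm_prod_le_iff.2 ⟨(pi_norm_le_iff_of_nonneg (by positivity)).2 fun k => ?_, ?_⟩
    · change ‖-Sp.timeOp hW _ _ _ g‖ ≤ _
      rw [norm_neg]
      refine (h₃ k W hW _ _ g).trans ?_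
      gcongr
      linarith [hle k]
    · change ‖g - Sp.timeOp hW _ _ _ g‖ ≤ _
      refine (norm_sub_le _ _).trans ((add_le_add_right (h₂ W hW _ _ g) _).trans ?_)
      nlinarith
  refine ⟨fun y => (hqa y).trans ?_, fun k y => (hb k y).trans ?_, fun y => ?_⟩
  · gcongr
    linarith
  · gcongr
    linarith
  · refine (hgd _).trans ((mul_le_mul_of_nonneg_left (hsrc y) (by positivity)).trans ?_)
    rw [← mul_assoc, ← mul_assoc]
    gcongr
    linarith

end GradSp

/-! ### The coefficients -/

variable (φ W) in
/-- The norm of `|D| u` in the space `B^0_{∞,1}` (and `B^r_{∞,1}`), for the weight `W`. -/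
def gradSum (u : E d → ℝ) : ℝ≥0∞ := ∑' j, W j * ((pw j)⁻¹ * sn (cv (sig φ Symbol.absD j) u))

theorem sn_cv_absD_ne_top {u : E d → ℝ} (hW : IsWeight K W) (h : gradSum φ W u ≠ ⊤) (j : ℤ) :
    sn (cv (sig φ Symbol.absD j) u) ≠ ⊤ := by
  refine ne_top_of_le_ne_top (ENNReal.ne_top_of_tsum_ne_top h j) ?_
  calc sn (cv (sig φ Symbol.absD j) u)
      = pw j * ((pw j)⁻¹ * sn (cv (sig φ Symbol.absD j) u)) := by
        rw [← mul_assoc, ENNReal.mul_inv_cancel (pw_ne_zero j) (pw_ne_top j), one_mul]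
    _ ≤ _ := by gcongr; exact hW.pw_le j

/-- The gradient of the Poisson extension of `u`, as an element of `GradSp`. -/
structure IsHeat (u : E d → ℝ) (y : GradSp φ W) : Prop where
  fst : ∀ k, (y.1 k).val = heat φ (Symbol.riesz k) u
  snd : y.2.val = heat φ 1 u

variable (φ) in
theorem exists_isHeat (hK : K ≠ ⊤) : ∃ M : ℝ, 0 < M ∧ ∀ (W : ℤ → ℝ≥0∞), IsWeight K W →
    ∀ u : E d → ℝ, LinGrowth u → gradSum φ W u ≠ ⊤ →
      ∃ y : GradSp φ W, IsHeat u y ∧ ‖y‖ ≤ M * (gradSum φ W u).toReal := by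
  obtain ⟨M, hM, h⟩ := exists_spNorm_heat_le φ (Symbol.IsHom.one (d := d)) .one hK
  choose N hN h' using fun k : Fin d =>
    exists_spNorm_heat_le φ (Symbol.IsHom.riesz k) (.riesz k) hK
  have hS : ∑ k, N k ≠ ⊤ := ENNReal.sum_ne_top.2 fun k _ => hN k
  have hT : M + ∑ k, N k ≠ ⊤ := by finiteness
  refine ⟨(M + ∑ k, N k).toReal + 1, by positivity, fun W hW u hu hs => ?_⟩
  have ha := sn_cv_absD_ne_top hW hs
  obtain ⟨h1, h2, -⟩ := h W hW u hu ha hs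
  have h3 := fun k => h' k W hW u hu ha hs
  have key : ∀ (g : ℝ → E d → ℝ) (hg : MemSp φ W g) (c : ℝ≥0∞), c ≤ M + ∑ k, N k →
      spNorm φ W g ≤ c * gradSum φ W u →
      ‖Sp.mk g hg‖ ≤ ((M + ∑ k, N k).toReal + 1) * (gradSum φ W u).toReal := by
    intro g hg c hc hgc
    refine Sp.norm_le_of_spNorm_le (by positivity) (hgc.trans ?_)
    rw [ENNReal.ofReal_mul (by positivity), ENNReal.ofReal_toReal hs]
    gcongr
    refine hc.trans ?_
    rw [ENNReal.ofReal_add (by positivity) zero_le_one, ENNReal.ofReal_toReal hT]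
    exact le_self_add
  refine ⟨(fun k => Sp.mk _ (h3 k).1, Sp.mk _ h1), ⟨fun k => rfl, rfl⟩, norm_prod_le_iff.2
    ⟨(pi_norm_le_iff_of_nonneg (by positivity)).2 fun k => ?_, ?_⟩⟩
  · exact key _ _ (N k) ((Finset.single_le_sum (f := N) (fun _ _ => zero_le)
      (Finset.mem_univ k)).trans le_add_self) (h3 k).2.1
  · exact key _ _ M le_self_add h2

/-- The coefficients of the equation: `A = (∇ₓH, |D|H)` and
`A₃ = (|∇ₓH|² - |D|H) / (1 + |D|H)`. -/
structure IsCoeff (A : GradSp φ W) (A₃ : Sp φ W) : Prop where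
  abs_le : ∀ z x, |A.2.val z x| ≤ 1 / 2
  eq : ∀ z x, A₃.val z x = ((∑ k, (A.1 k).val z x ^ 2) - A.2.val z x) / (1 + A.2.val z x)

variable (φ) in
-- The quotient is obtained without composing with a nonlinear function: it solves the linear
-- equation A₃ = (|A₁|² - A₂) - A₂ A₃, a contraction when A₂ is small. Smallness also keeps |A₂| ≤
-- 1/2 pointwise, so dividing by 1 + A₂ is legitimate.
theorem exists_isCoeff (hK : K ≠ ⊤) : ∃ c : ℝ, 0 < c ∧ c ≤ 1 ∧ ∃ M : ℝ, 1 ≤ M ∧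
    ∀ (W : ℤ → ℝ≥0∞), IsWeight K W → ∀ A : GradSp φ W, ‖A‖ ≤ c →
      ∃ A₃ : Sp φ W, IsCoeff A A₃ ∧ ‖A₃‖ ≤ M * ‖A‖ := by
  obtain ⟨M, hM, h⟩ := Sp.exists_norm_mul_le φ K hK
  refine ⟨1 / (2 * (M + 1)), by positivity, ?_, 2 * (d * M + 1), ?_, fun W hW A hA => ?_⟩
  · rw [div_le_one (by positivity)]
    linarith
  · have : 0 ≤ d * M := by positivity
    linarith
  have hA0 := norm_nonneg A
  have hA1 : M * ‖A‖ ≤ 1 / 2 := by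
    rw [le_div_iff₀ (by positivity)] at hA
    linarith
  have hA2 : ‖A‖ ≤ 1 / 2 := by
    rw [le_div_iff₀ (by positivity)] at hA
    nlinarith
  obtain ⟨A₃, h1, h2⟩ := exists_eq_add_of_norm_le (-Sp.mul hW A.2) (fun x => by
    rw [LinearMap.neg_apply, norm_neg]
    refine (h W hW A.2 x).trans ?_
    have : M * ‖A.2‖ ≤ M * ‖A‖ := by gcongr; exact norm_snd_le A
    gcongr
    linarith) (∑ k, Sp.mul hW (A.1 k) (A.1 k) - A.2)
  have h3 : ∀ z x, |A.2.val z x| ≤ 1 / 2 := fun z x =>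
    (Sp.abs_val_le A.2 z x).trans ((norm_snd_le A).trans hA2)
  refine ⟨A₃, ⟨h3, fun z x => ?_⟩, ?_⟩
  · have h4 := congrArg (fun g : Sp φ W => g.val z x) h1
    simp only [Sp.val_add, Sp.val_sub, Sp.val_sum, LinearMap.neg_apply, Sp.val_neg,
      Sp.val_mul] at h4
    have h5 := (abs_le.1 (h3 z x)).1
    rw [eq_div_iff (by linarith)]
    simp only [pow_two]
    linarith
  · refine h2.trans ?_
    have h4 : ‖∑ k, Sp.mul hW (A.1 k) (A.1 k)‖ ≤ d * (M * ‖A‖) := by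
      have h5 : ∀ k, ‖Sp.mul hW (A.1 k) (A.1 k)‖ ≤ M * ‖A‖ := fun k => by
        have h6 := GradSp.norm_fst_apply_le A k
        have h7 := norm_nonneg (A.1 k)
        refine (h W hW (A.1 k) (A.1 k)).trans ((mul_le_of_le_one_right (by positivity) ?_).trans ?_)
        · linarith
        · gcongr
      exact (norm_sum_le_of_le _ fun k _ => h5 k).trans (le_of_eq (by simp))
    have h6 := norm_sub_le (∑ k, Sp.mul hW (A.1 k) (A.1 k)) A.2
    have h7 := norm_snd_le A
    nlinarith

end DirichletNeumann

end

/-! ### Translation between `T` and the gradient equation. -/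

noncomputable section
namespace DirichletNeumann
variable {d : ℕ} {φ : LittlewoodPaley d}

/-! ### The operator `𝒯` in terms of the gradient of `v` -/

variable {W : ℤ → ℝ≥0∞} {K : ℝ≥0∞} {η f : 𝓢(E d, ℂ) → ℂ} {v : E d → ℝ → ℝ}
  {A y : GradSp φ W} {A₃ : Sp φ W}

/-- The components of `y` are `∇ₓv` and `∂_z v`. -/
structure IsGradient (v : E d → ℝ → ℝ) (y : GradSp φ W) : Prop where
  fst : ∀ x z, z < 0 → ∀ k, gradX v x z k = (y.1 k).val z x
  snd : Agree (dz v) y.2.val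

theorem gradH_eq (hη : Realized φ (realization φ η)) (hA : IsHeat (realization φ η) A) {z : ℝ}
    (hz : z < 0) (x : E d) (k : Fin d) : gradH φ η x z k = (A.1 k).val z x := by
  rw [hA.fst]
  exact hη.gradient_poisson hz x k

theorem absDH_eq (hη : Realized φ (realization φ η)) (hA : IsHeat (realization φ η) A) {z : ℝ}
    (hz : z < 0) (x : E d) : absDH φ η x z = A.2.val z x := by
  rw [hA.snd]
  exact hη.mult_absD_poisson hz x

theorem Qa_eq (hη : Realized φ (realization φ η)) (hA : IsHeat (realization φ η) A)
    (hA₃ : IsCoeff A A₃) (hW : IsWeight K W) (hy : IsGradient v y) {z : ℝ} (hz : z < 0) {x : E d}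
    (h : dz v x z = y.2.val z x) : Qa φ η v x z = (GradSp.qa hW A.1 A₃ y).val z x := by
  rw [Qa, GradSp.qa_apply, h, hA₃.eq, absDH_eq hη hA hz, EuclideanSpace.norm_sq_eq,
    PiLp.inner_apply]
  simp only [gradH_eq hη hA hz, hy.fst x z hz, Real.norm_eq_abs, sq_abs]
  congr 1
  refine Finset.sum_congr rfl fun k _ => ?_
  simp [mul_comm]

theorem B_eq (hη : Realized φ (realization φ η)) (hA : IsHeat (realization φ η) A)
    (hW : IsWeight K W) (hy : IsGradient v y) {z : ℝ} (hz : z < 0) {x : E d}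
    (h : dz v x z = y.2.val z x) (k : Fin d) :
    B φ η v x z k = (GradSp.b hW A.1 A.2 k y).val z x := by
  rw [B, GradSp.b_apply, h, absDH_eq hη hA hz]
  simp only [PiLp.sub_apply, PiLp.smul_apply, smul_eq_mul, gradH_eq hη hA hz, hy.fst x z hz]
  ring

theorem Agree.imp {R R' : E d → ℝ → ℝ} {g g' : ℝ → E d → ℝ} (h : Agree R g)
    (h' : ∀ x z, z < 0 → R x z = g z x → R' x z = g' z x) : Agree R' g' := by
  refine ⟨fun x => (h.1 x).mono fun z hz hz0 => h' x z hz0 (hz hz0), h.2.mono fun z hz hz0 => ?_⟩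
  exact (hz hz0).mono fun x hx => h' x z hz0 hx

theorem IsGradient.agree_Qa (hy : IsGradient v y) (hη : Realized φ (realization φ η))
    (hA : IsHeat (realization φ η) A) (hA₃ : IsCoeff A A₃) (hW : IsWeight K W) :
    Agree (Qa φ η v) (GradSp.qa hW A.1 A₃ y).val :=
  hy.snd.imp fun _ _ hz h => Qa_eq hη hA hA₃ hW hy hz h

theorem IsGradient.w_eq (hy : IsGradient v y) (hη : Realized φ (realization φ η))
    (hA : IsHeat (realization φ η) A) (hA₃ : IsCoeff A A₃) (hW : IsWeight K W) {z : ℝ}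
    (hz : z ≤ 0) (x : E d) : w φ η v x z = (GradSp.w hW A.1 A.2 A₃ y).val z x := by
  rw [GradSp.w_apply]
  exact DirichletNeumann.w_eq hW (fun k => (GradSp.b hW A.1 A.2 k y).mem)
    (GradSp.qa hW A.1 A₃ y).mem (fun k => hy.snd.imp fun _ _ hz h => B_eq hη hA hW hy hz h k)
    (hy.agree_Qa hη hA hA₃ hW) hz x

/-- Both clauses of `Agree` are used: `poisson` contains the value of the source at x itself, needed
for almost every time, while its convolution part sees the source at almost every point of space. -/
theorem IsGradient.T_eq (hy : IsGradient v y) (hη : Realized φ (realization φ η))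
    (hA : IsHeat (realization φ η) A) (hA₃ : IsCoeff A A₃) (hW : IsWeight K W) {z : ℝ}
    (hz : z ≤ 0) (x : E d) : T φ η f v x z = poisson φ z (realization φ f) x +
      duhamel φ (GradSp.src hW A.1 A.2 A₃ y).val z x := by
  have hQ := hy.agree_Qa hη hA hA₃ hW
  rw [T, duhamel, intervalIntegral_eq_neg_Ioo _ hz, intervalIntegral_eq_neg_Ioo _ hz]
  congr 2
  refine setIntegral_congr_ae measurableSet_Ioo ?_
  filter_upwards [hQ.1 x, hQ.2] with τ h1 h2 hτ
  have h3 : (fun y => w φ η v y τ + Qa φ η v y τ) =ᵐ[volume]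
      (GradSp.src hW A.1 A.2 A₃ y).val τ := by
    filter_upwards [h2 hτ.2] with x' hx'
    rw [GradSp.src_apply, hx', hy.w_eq hη hA hA₃ hW hτ.2.le]
  rw [poisson, poisson, mult_congr_ae _ (.expDSubOne _) h3, GradSp.src_apply, h1 hτ.2,
    hy.w_eq hη hA hA₃ hW hτ.2.le]

/-! ### The function with a given gradient -/

theorem Sp.measurable_time (g : Sp φ W) (x : E d) : Measurable fun z => g.val z x :=
  g.mem.measurable_time x

theorem Sp.intervalIntegrable (g : Sp φ W) (x : E d) (a b : ℝ) :
    IntervalIntegrable (fun z => g.val z x) volume a b := by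
  rw [intervalIntegrable_iff]
  exact Measure.integrableOn_of_bounded (M := ‖g‖) (by simp)
    (g.measurable_time x).aestronglyMeasurable
    (Eventually.of_forall fun z => g.abs_val_le z x)

theorem Sp.locallyIntegrable (g : Sp φ W) (x : E d) :
    LocallyIntegrable (fun z => g.val z x) volume := by
  refine locallyIntegrable_iff.2 fun k hk => ?_
  exact Measure.integrableOn_of_bounded (M := ‖g‖) hk.measure_lt_top.ne
    (g.measurable_time x).aestronglyMeasurable
    (Eventually.of_forall fun z => g.abs_val_le z x)

/-- `u + ∫_0^z q`. -/
def primitive (u : E d → ℝ) (q : Sp φ W) (x : E d) (z : ℝ) : ℝ :=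
  u x + ∫ σ in (0 : ℝ)..z, q.val σ x

theorem ae_dz_primitive (u : E d → ℝ) (q : Sp φ W) (x : E d) :
    ∀ᵐ z, dz (primitive u q) x z = q.val z x := by
  filter_upwards [LocallyIntegrable.ae_hasDerivAt_integral (q.locallyIntegrable x)] with z hz
  exact ((hz 0).const_add (u x)).deriv

theorem abs_primitive_sub_le (u : E d → ℝ) (q : Sp φ W) (x : E d) (z t : ℝ) :
    |primitive u q x z - primitive u q x t| ≤ ‖q‖ * |z - t| := by
  rw [primitive, primitive, add_sub_add_left_eq_sub, intervalIntegral.integral_interval_sub_left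
    (q.intervalIntegrable x 0 z) (q.intervalIntegrable x 0 t)]
  exact intervalIntegral.norm_integral_le_of_norm_le_const fun s _ =>
    (Real.norm_eq_abs _).trans_le (q.abs_val_le s x)

/-- A function that is Lipschitz for `z < 0`. -/
def LipNeg (v : E d → ℝ → ℝ) : Prop :=
  ∃ M : ℝ, ∀ (x y : E d) (z t : ℝ), z < 0 → t < 0 → |v x z - v y t| ≤ M * (‖x - y‖ + |z - t|)

/-- The values of v for z ≥ 0 are arbitrary. A continuous extension from z < 0 permits the joint
measurability of the derivative in z, and derivatives at z < 0 do not notice the change. -/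
theorem LipNeg.exists_extension (hv : LipNeg v) : ∃ V : E d → ℝ → ℝ,
    Continuous (Function.uncurry V) ∧ ∀ x z, z < 0 → V x z = v x z := by
  obtain ⟨M, hM⟩ := hv
  have h1 : LipschitzOnWith (Real.toNNReal (2 * |M|)) (Function.uncurry v)
      {p : E d × ℝ | p.2 < 0} := by
    refine LipschitzOnWith.of_dist_le_mul fun p hp q hq => ?_
    rw [Real.coe_toNNReal _ (by positivity)]
    refine (hM p.1 q.1 p.2 q.2 hp hq).trans ?_
    have h2 : ‖p.1 - q.1‖ ≤ dist p q := by
      rw [← dist_eq_norm]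
      exact le_max_left _ _
    have h3 : |p.2 - q.2| ≤ dist p q := by
      rw [← Real.dist_eq]
      exact le_max_right _ _
    calc M * (‖p.1 - q.1‖ + |p.2 - q.2|) ≤ |M| * (dist p q + dist p q) := by
          gcongr
          exact le_abs_self M
      _ = _ := by ring
  obtain ⟨V, hV, hV'⟩ := h1.extend_real
  exact ⟨Function.curry V, by simpa using hV.continuous, fun x z hz => (hV' (x := (x, z)) hz).symm⟩

theorem dz_congr {V : E d → ℝ → ℝ} {x : E d} {z : ℝ} (hz : z < 0)
    (h : ∀ t, t < 0 → V x t = v x t) : dz V x z = dz v x z :=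
  Filter.EventuallyEq.deriv_eq (by filter_upwards [Iio_mem_nhds hz] with t ht using h t ht)

theorem LipNeg.exists_measurable_dz (hv : LipNeg v) : ∃ D : E d → ℝ → ℝ,
    Measurable (Function.uncurry D) ∧ ∀ x z, z < 0 → D x z = dz v x z := by
  obtain ⟨V, hV, hVv⟩ := hv.exists_extension
  exact ⟨dz V, measurable_deriv_with_param hV, fun x z hz => dz_congr hz fun t ht => hVv x t ht⟩

/-- Equality for every x at almost every z becomes equality for almost every z at almost every x by
exchanging null sets, which requires the exceptional set to be jointly measurable. -/
theorem LipNeg.agree (hv : LipNeg v) {q : ℝ → E d → ℝ} (hq : Measurable (Function.uncurry q))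
    (h : ∀ x, ∀ᵐ z, z < 0 → dz v x z = q z x) : Agree (dz v) q := by
  obtain ⟨D, hD, hDv⟩ := hv.exists_measurable_dz
  refine ⟨h, ?_⟩
  have h1 : MeasurableSet {p : E d × ℝ | p.2 < 0 → D p.1 p.2 = q p.2 p.1} := by
    have h2 : MeasurableSet {p : E d × ℝ | D p.1 p.2 = q p.2 p.1} :=
      measurableSet_eq_fun hD (hq.comp measurable_swap)
    have h3 : MeasurableSet {p : E d × ℝ | p.2 < 0} := measurableSet_Iio.preimage measurable_snd
    exact h3.imp h2
  have h4 : ∀ᵐ x : E d, ∀ᵐ z : ℝ, z < 0 → D x z = q z x := Eventually.of_forall fun x =>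
    (h x).mono fun z hz hz0 => (hDv x z hz0).trans (hz hz0)
  have h5 := (Measure.ae_ae_comm (p := fun (x : E d) (z : ℝ) => z < 0 → D x z = q z x) h1).1 h4
  filter_upwards [h5] with z hz hz0
  filter_upwards [hz] with x hx
  rw [← hDv x z hz0, hx hz0]

theorem Realized.gradient_add {g h : E d → ℝ} (hg : Realized φ g) (hh : Realized φ h) (x : E d)
    (k : Fin d) : gradient (fun x => g x + h x) x k = gradient g x k + gradient h x k := by
  refine ((hg.add hh).hasSum_mult_riesz k x).unique ?_
  convert (hg.hasSum_mult_riesz k x).add (hh.hasSum_mult_riesz k x) using 2 with j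
  exact cv_add hg.growth hh.growth x

end DirichletNeumann

end

/-! ### Existence: the candidate built from a solution of the gradient equation. -/

noncomputable section
namespace DirichletNeumann
variable {d : ℕ} {φ : LittlewoodPaley d}

/-! ### Existence of a fixed point -/

theorem Realized.tsum_sn_ne_top {m : Symbol d} (hm : m.IsHom 1) (hr : m.IsReal) {g : E d → ℝ}
    (hg : Realized φ g) : ∑' j, sn (cv (sig φ m j) g) ≠ ⊤ := by
  obtain ⟨C, hC, h⟩ := exists_sn_sig_le φ hm hr
  refine ne_top_of_le_ne_top (b := ∑' j, ENNReal.ofReal C * (pw j * sn (cv (sig φ 1 j) g))) ?_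
    (ENNReal.tsum_le_tsum fun j => ?_)
  · rw [ENNReal.tsum_mul_left]
    exact ENNReal.mul_ne_top ENNReal.ofReal_ne_top hg.sum
  · refine (h j g hg.growth).trans (le_of_eq ?_)
    rw [mul_one, ENNReal.ofReal_mul hC.le, mul_assoc]
    rfl

theorem Realized.cv_mult {m n : Symbol d} (hm : m.IsHom 1) (hr : m.IsReal) (hn : n.IsReal)
    {g : E d → ℝ} (hg : Realized φ g) (j : ℤ) (x : E d) :
    cv (sig φ n j) (mult φ m g) x = cv (sig φ (n * m) j) g x := by
  rw [funext (mult_eq φ hr g)]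
  exact (hasSum_cv_of_sn _ (fun i => measurable_cv _ hg.growth.1)
    (hg.tsum_sn_ne_top hm hr) x).unique (hasSum_cv_cv_sig φ hn hr j hg.growth x)

theorem Realized.mult_add {m : Symbol d} (hm : m.IsHom 1) (hr : m.IsReal) {g h : E d → ℝ}
    (hg : Realized φ g) (hh : Realized φ h) (x : E d) :
    mult φ m (fun x => g x + h x) x = mult φ m g x + mult φ m h x := by
  simp only [mult_eq φ hr]
  rw [← (summable_of_sn (hg.tsum_sn_ne_top hm hr) x).tsum_add
    (summable_of_sn (hh.tsum_sn_ne_top hm hr) x)]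
  exact tsum_congr fun j => cv_add hg.growth hh.growth x

theorem cheminLernerNorm_eq {m : Symbol d} (hm : m.IsReal) (v : E d → ℝ → ℝ) :
    cheminLernerNorm φ m 1 v =
      ∑' j, pw j * ∫⁻ z in Set.Iio (0 : ℝ), sn (cv (sig φ m j) fun x => v x z) := by
  refine tsum_congr fun j => ?_
  simp only [block_pair φ hm, sn]
  simp [enorm, pw, mul_one]

theorem norm_gradient_le {g : E d → ℝ} {x : E d} {M : ℝ} (hM : ∀ k, |gradient g x k| ≤ M) :
    ‖gradient g x‖ ≤ Real.sqrt (d * M ^ 2) := by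
  rw [EuclideanSpace.norm_eq]
  refine Real.sqrt_le_sqrt ((Finset.sum_le_sum fun k _ => pow_le_pow_left₀ (norm_nonneg _)
    (hM k) 2).trans (le_of_eq (by simp)))

theorem Realized.abs_sub_le {g : E d → ℝ} (hg : Realized φ g) {M : ℝ}
    (hM : ∀ x k, |gradient g x k| ≤ M) (x y : E d) :
    |g x - g y| ≤ Real.sqrt (d * M ^ 2) * ‖x - y‖ := by
  refine Convex.norm_image_sub_le_of_norm_fderiv_le (𝕜 := ℝ) (s := Set.univ)
    (fun x _ => (hg.hasFDerivAt x).differentiableAt) (fun x _ => ?_) convex_univ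
    (Set.mem_univ y) (Set.mem_univ x)
  have h := norm_gradient_le (hM x)
  rwa [gradient, LinearIsometryEquiv.norm_map] at h

variable {W : ℤ → ℝ≥0∞} {K : ℝ≥0∞} {u : E d → ℝ} {Y : GradSp φ W}

/-- The candidate has two expressions: as a primitive in z it has the right ∂_z almost everywhere,
and as Poisson extension plus Duhamel integral it is realized and has the right ∇ₓ. They agree
because the second component of the right side is the integrand of both integrated equations. -/
theorem primitive_eq (hW : IsWeight K W) (hu : Realized φ u) (hY : IsHeat u Y) (g : Sp φ W)
    {z : ℝ} (hz : z ≤ 0) (x : E d) :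
    primitive u (Y + GradSp.gradDuhamel hW g).2 x z = poisson φ z u x + duhamel φ g.val z x := by
  rw [hu.poisson_eq hz, g.mem.duhamel_eq hW hz, add_assoc, ← intervalIntegral.integral_add,
    primitive, ← hY.snd]
  · rfl
  · rw [← hY.snd]
    exact Y.2.intervalIntegrable x 0 z
  · exact (GradSp.gradDuhamel hW g).2.intervalIntegrable x 0 z

theorem realized_primitive (hW : IsWeight K W) (hu : Realized φ u) (hY : IsHeat u Y) (g : Sp φ W)
    {z : ℝ} (hz : z ≤ 0) :
    Realized φ fun x => primitive u (Y + GradSp.gradDuhamel hW g).2 x z := by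
  rw [funext fun x => primitive_eq hW hu hY g hz x]
  exact (hu.poisson hz).add (g.mem.realized_duhamel hW hz)

theorem gradX_primitive (hW : IsWeight K W) (hu : Realized φ u) (hY : IsHeat u Y) (g : Sp φ W)
    {z : ℝ} (hz : z < 0) (x : E d) (k : Fin d) :
    gradX (primitive u (Y + GradSp.gradDuhamel hW g).2) x z k =
      ((Y + GradSp.gradDuhamel hW g).1 k).val z x := by
  rw [gradX, funext fun x => primitive_eq hW hu hY g hz.le x,
    (hu.poisson hz.le).gradient_add (g.mem.realized_duhamel hW hz.le),
    g.mem.gradient_duhamel hW hz.le, hu.gradient_poisson hz, ← hY.fst]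
  rfl

/-- This is |D|v = ∂_z v - source. It places |D|v in the same space as ∂_z v and the source, as
membership in 𝒱_* demands. -/
theorem mult_absD_primitive (hW : IsWeight K W) (hu : Realized φ u) (hY : IsHeat u Y) (g : Sp φ W)
    {z : ℝ} (hz : z < 0) (x : E d) :
    mult φ Symbol.absD (fun x => primitive u (Y + GradSp.gradDuhamel hW g).2 x z) x =
      ((Y + GradSp.gradDuhamel hW g).2 - g).val z x := by
  have h1 : mult φ Symbol.absD (duhamel φ g.val z) x = -timeOp φ Symbol.absD Set.Ioi g.val z x := by
    rw [mult_eq φ .absD, timeOp, ← tsum_neg]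
    exact tsum_congr fun j => g.mem.cv_sig_duhamel hW .absD j hz.le x
  have h2 : (Y + GradSp.gradDuhamel hW g).2.val z x =
      Y.2.val z x + (g.val z x - timeOp φ Symbol.absD Set.Ioi g.val z x) := rfl
  rw [funext fun x => primitive_eq hW hu hY g hz.le x,
    (hu.poisson hz.le).mult_add .absD .absD (g.mem.realized_duhamel hW hz.le), h1,
    hu.mult_absD_poisson hz, ← hY.snd, Sp.val_sub, h2]
  ring

theorem lipNeg_primitive (hW : IsWeight K W) (hu : Realized φ u) (hY : IsHeat u Y) (g : Sp φ W) :
    LipNeg (primitive u (Y + GradSp.gradDuhamel hW g).2) := by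
  set y := Y + GradSp.gradDuhamel hW g with hy
  set L := Real.sqrt (d * ‖y‖ ^ 2) with hL
  have hL0 : 0 ≤ L := Real.sqrt_nonneg _
  refine ⟨L + ‖y.2‖, fun x x' z t hz ht => ?_⟩
  have h1 : |primitive u y.2 x z - primitive u y.2 x' z| ≤ L * ‖x - x'‖ :=
    (realized_primitive hW hu hY g hz.le).abs_sub_le (fun x k => by
      have h2 := gradX_primitive hW hu hY g hz x k
      rw [gradX] at h2
      rw [h2]
      exact (Sp.abs_val_le _ z x).trans (GradSp.norm_fst_apply_le y k)) x x'
  have h2 := abs_primitive_sub_le u y.2 x' z t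
  have h3 := abs_sub_le (primitive u y.2 x z) (primitive u y.2 x' z) (primitive u y.2 x' t)
  have h4 := norm_nonneg y.2
  have h5 := norm_nonneg (x - x')
  have h6 := abs_nonneg (z - t)
  nlinarith [mul_nonneg h4 h5, mul_nonneg hL0 h6]

theorem isGradient_primitive (hW : IsWeight K W) (hu : Realized φ u) (hY : IsHeat u Y)
    (g : Sp φ W) : IsGradient (primitive u (Y + GradSp.gradDuhamel hW g).2)
      (Y + GradSp.gradDuhamel hW g) :=
  ⟨fun x _ hz k => gradX_primitive hW hu hY g hz x k,
    (lipNeg_primitive hW hu hY g).agree (Sp.mem _).meas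
      fun x => (ae_dz_primitive u _ x).mono fun _ h _ => h⟩

theorem memV_primitive (hW : IsWeight K W) (hu : Realized φ u) (hY : IsHeat u Y) (g : Sp φ W) :
    MemV φ (primitive u (Y + GradSp.gradDuhamel hW g).2) := by
  have hr := fun z hz => realized_primitive hW hu hY g (z := z) hz
  refine ⟨lipNeg_primitive hW hu hY g, fun x z hz => ((hr z hz.le).realization_pair x).symm,
    ⟨‖(Y + GradSp.gradDuhamel hW g).2 - g‖, fun x z hz => ?_⟩, ?_, ?_⟩
  · rw [mult_absD_primitive hW hu hY g hz]
    exact Sp.abs_val_le _ z x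
  · rw [cheminLernerNorm_eq .absD]
    refine lt_of_le_of_lt (ENNReal.tsum_le_tsum fun j => ?_)
      (((Y + GradSp.gradDuhamel hW g).2 - g).mem.tsum_pw_ne_top hW).lt_top
    rw [blockInt]
    refine mul_le_mul_right (setLIntegral_mono' measurableSet_Iio fun z hz => le_of_eq ?_) _
    refine sn_congr fun x => ?_
    rw [← funext fun x => mult_absD_primitive hW hu hY g hz x,
      (hr z (le_of_lt hz)).cv_mult .absD .absD .one, Symbol.one_mul']
  · rw [cheminLernerNorm_eq .one]
    refine lt_of_le_of_lt (ENNReal.tsum_le_tsum fun j => ?_)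
      ((Y + GradSp.gradDuhamel hW g).2.mem.tsum_pw_ne_top hW).lt_top
    rw [blockInt]
    refine mul_le_mul_right (le_of_eq (setLIntegral_congr_fun_ae measurableSet_Iio ?_)) _
    filter_upwards [(isGradient_primitive hW hu hY g).snd.2] with z hz hz0
    refine sn_congr fun x => integral_congr_ae ?_
    filter_upwards [hz hz0] with y hy
    rw [hy]

/-- A solution y equals the right side of its own equation, so the candidate has gradient y, and `T`
applied to it returns the same Poisson and Duhamel expression. -/
theorem isFixedPoint_primitive {η f : 𝓢(E d, ℂ) → ℂ} {A y : GradSp φ W} {A₃ : Sp φ W}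
    (hη : Realized φ (realization φ η)) (hA : IsHeat (realization φ η) A) (hA₃ : IsCoeff A A₃)
    (hf : Realized φ (realization φ f)) (hY : IsHeat (realization φ f) Y) (hW : IsWeight K W)
    (hy : y = Y + GradSp.gradDuhamel hW (GradSp.src hW A.1 A.2 A₃ y)) :
    IsGradient (primitive (realization φ f) y.2) y ∧
      IsFixedPoint φ η f (primitive (realization φ f) y.2) := by
  have h1 := isGradient_primitive hW hf hY (GradSp.src hW A.1 A.2 A₃ y)
  have h2 := memV_primitive hW hf hY (GradSp.src hW A.1 A.2 A₃ y)
  rw [← hy] at h1 h2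
  refine ⟨h1, h2, 0, fun x z hz => ?_⟩
  rw [h1.T_eq hη hA hA₃ hW hz.le, ← primitive_eq hW hf hY _ hz.le, ← hy, add_zero]

end DirichletNeumann

end

/-! ### Uniqueness, preparation: the spatial gradient of an element of 𝒱_*. -/

noncomputable section
namespace DirichletNeumann
variable {d : ℕ} {φ : LittlewoodPaley d}

/-! ### Regularity of the functions in `𝒱_*` -/

variable {v : E d → ℝ → ℝ}

/-- `∂_z v`, extended by zero to `z ≥ 0`. -/
def dzNeg (v : E d → ℝ → ℝ) (z : ℝ) (x : E d) : ℝ := if z < 0 then dz v x z else 0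

theorem LipNeg.lipschitzOnWith (hv : LipNeg v) :
    ∃ M : NNReal, ∀ x, LipschitzOnWith M (v x) (Set.Iio 0) := by
  obtain ⟨M, hM⟩ := hv
  refine ⟨Real.toNNReal |M|, fun x => LipschitzOnWith.of_dist_le_mul fun z hz t ht => ?_⟩
  rw [Real.coe_toNNReal _ (abs_nonneg M), Real.dist_eq, Real.dist_eq]
  refine (hM x x z t hz ht).trans ?_
  rw [sub_self, norm_zero, zero_add]
  gcongr
  exact le_abs_self M

theorem LipNeg.exists_abs_dzNeg_le (hv : LipNeg v) : ∃ M, 0 ≤ M ∧ ∀ z x, |dzNeg v z x| ≤ M := by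
  obtain ⟨M, hM⟩ := hv.lipschitzOnWith
  refine ⟨M, M.2, fun z x => ?_⟩
  by_cases hz : z < 0
  · rw [dzNeg, if_pos hz]
    exact norm_deriv_le_of_lipschitzOn (Iio_mem_nhds hz) (hM x)
  · rw [dzNeg, if_neg hz, abs_zero]
    exact M.2

theorem LipNeg.measurable_dzNeg (hv : LipNeg v) : Measurable (Function.uncurry (dzNeg v)) := by
  obtain ⟨D, hD, hDv⟩ := hv.exists_measurable_dz
  have h : Function.uncurry (dzNeg v) = fun p => if p.1 < 0 then D p.2 p.1 else 0 := by
    ext ⟨z, x⟩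
    by_cases hz : z < 0
    · simp [dzNeg, hz, hDv x z hz]
    · simp [dzNeg, hz]
  rw [h]
  exact Measurable.ite (measurableSet_Iio.preimage measurable_fst) (hD.comp measurable_swap)
    measurable_const

theorem LipNeg.dzNeg_growth (hv : LipNeg v) (z : ℝ) : LinGrowth (dzNeg v z) := by
  obtain ⟨M, _, hM⟩ := hv.exists_abs_dzNeg_le
  exact .of_bounded (hv.measurable_dzNeg.comp measurable_prodMk_left) (hM z)

theorem LipNeg.sn_cv_dzNeg_ne_top (hv : LipNeg v) (a : 𝓢(E d, ℂ)) (z : ℝ) :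
    sn (cv a (dzNeg v z)) ≠ ⊤ := by
  obtain ⟨M, _, hM⟩ := hv.exists_abs_dzNeg_le
  exact ne_top_of_le_ne_top (ENNReal.mul_ne_top ENNReal.ofReal_ne_top
    (ne_top_of_le_ne_top ENNReal.ofReal_ne_top (sn_le_ofReal (hM z)))) (sn_cv_le _ _)

theorem LipNeg.measurable_sn_cv_dzNeg (hv : LipNeg v) (a : 𝓢(E d, ℂ)) :
    Measurable fun z => sn (cv a (dzNeg v z)) := by
  obtain ⟨M, _, hM⟩ := hv.exists_abs_dzNeg_le
  exact measurable_sn (measurable_cv_uncurry a hv.measurable_dzNeg) fun z =>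
    continuous_cv a (hv.dzNeg_growth z).1 (hM z)

theorem LipNeg.growth (hv : LipNeg v) {z : ℝ} (hz : z < 0) : LinGrowth fun x => v x z := by
  obtain ⟨V, hV, hVv⟩ := hv.exists_extension
  obtain ⟨M, hM⟩ := hv
  refine ⟨?_, |v 0 z| + |M|, by positivity, fun x => ?_⟩
  · simp only [← fun x => hVv x z hz]
    exact (hV.comp (by fun_prop : Continuous fun x : E d => (x, z))).measurable
  · have h1 := hM x 0 z z hz hz
    rw [sub_zero, sub_self, abs_zero, add_zero] at h1
    have h2 := abs_sub_abs_le_abs_sub (v x z) (v 0 z)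
    have h3 : M * ‖x‖ ≤ |M| * ‖x‖ := by gcongr; exact le_abs_self M
    nlinarith [abs_nonneg (v 0 z), abs_nonneg M, norm_nonneg x,
      mul_nonneg (abs_nonneg (v 0 z)) (norm_nonneg x)]

theorem uIoc_subset_Iio {t z : ℝ} (ht : t < 0) (hz : z < 0) : Set.uIoc t z ⊆ Set.Iio 0 :=
  fun _ hs => lt_of_le_of_lt hs.2 (max_lt ht hz)

theorem LipNeg.sub_eq_integral (hv : LipNeg v) {t z : ℝ} (ht : t < 0) (hz : z < 0) (x : E d) :
    v x z - v x t = ∫ s in t..z, dzNeg v s x := by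
  obtain ⟨M, hM⟩ := hv.lipschitzOnWith
  have h1 : Set.uIcc t z ⊆ Set.Iio 0 := fun s hs => lt_of_le_of_lt hs.2 (max_lt ht hz)
  rw [← (((hM x).mono h1).absolutelyContinuousOnInterval).integral_deriv_eq_sub]
  refine intervalIntegral.integral_congr fun s hs => ?_
  simp only [dzNeg, if_pos (show s < 0 from h1 hs)]
  rfl

theorem LipNeg.cv_sub_eq_integral (hv : LipNeg v) {t z : ℝ} (ht : t < 0) (hz : z < 0)
    (a : 𝓢(E d, ℂ)) (x : E d) : cv a (fun x => v x z) x - cv a (fun x => v x t) x =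
      ∫ s in t..z, cv a (dzNeg v s) x := by
  obtain ⟨M, _, hM⟩ := hv.exists_abs_dzNeg_le
  rw [← cv_sub (hv.growth hz) (hv.growth ht)]
  simp only [fun x => hv.sub_eq_integral ht hz x,
    intervalIntegral.intervalIntegral_eq_integral_uIoc, smul_eq_mul, cv_const_mul]
  congr 1
  exact cv_integral a hv.measurable_dzNeg (b := fun _ => M)
    (integrableOn_const (by simp)) (Eventually.of_forall hM) x

theorem enorm_intervalIntegral_le (F : ℝ → ℝ) (a b : ℝ) :
    ‖∫ s in a..b, F s‖ₑ ≤ ∫⁻ s in Set.uIoc a b, ‖F s‖ₑ := by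
  rw [← ofReal_norm, intervalIntegral.norm_intervalIntegral_eq, ofReal_norm]
  exact enorm_integral_le_lintegral_enorm _

variable (φ) in
theorem exists_sn_absD_sub_le : ∃ C : ℝ, 0 < C ∧ ∀ v : E d → ℝ → ℝ, LipNeg v →
    ∀ (j : ℤ) (t z : ℝ), t < 0 → z < 0 → sn (cv (sig φ Symbol.absD j) fun x => v x z) ≤
      sn (cv (sig φ Symbol.absD j) fun x => v x t) +
        ENNReal.ofReal C * (pw j * blockInt φ j (dzNeg v)) := by
  obtain ⟨C, hC, h⟩ := exists_sn_sig_le φ (Symbol.IsHom.absD (d := d)) .absD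
  refine ⟨C, hC, fun v hv j t z ht hz => sn_le fun x => ?_⟩
  have h1 := hv.cv_sub_eq_integral ht hz (sig φ Symbol.absD j) x
  rw [sub_eq_iff_eq_add'] at h1
  rw [h1]
  refine (enorm_add_le _ _).trans (add_le_add (enorm_le_sn _ x) ?_)
  refine (enorm_intervalIntegral_le _ _ _).trans
    ((lintegral_mono_set (uIoc_subset_Iio ht hz)).trans ?_)
  rw [← lintegral_pw_sn]
  refine lintegral_mono fun s => (enorm_le_sn _ x).trans ((h j _ (hv.dzNeg_growth s)).trans
    (le_of_eq ?_))
  rw [mul_one, ENNReal.ofReal_mul hC.le, mul_assoc]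
  rfl

theorem MemV.tsum_dzNeg_ne_top (hv : MemV φ v) : ∑' j, pw j * blockInt φ j (dzNeg v) ≠ ⊤ := by
  have h := hv.dz_besov
  rw [cheminLernerNorm_eq .one] at h
  refine ne_top_of_le_ne_top h.ne (ENNReal.tsum_le_tsum fun j =>
    mul_le_mul_right (setLIntegral_mono' measurableSet_Iio fun z hz => le_of_eq ?_) _)
  rw [show dzNeg v z = fun x => dz v x z from funext fun x => if_pos hz]

theorem MemV.tsum_absD_ne_top (hv : MemV φ v) :
    ∑' j, pw j * ∫⁻ z in Set.Iio (0 : ℝ), sn (cv (sig φ Symbol.absD j) fun x => v x z) ≠ ⊤ := by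
  have h := hv.absD_besov
  rw [cheminLernerNorm_eq .absD] at h
  exact h.ne

theorem exists_le_of_lintegral_Iio_ne_top {F : ℝ → ℝ≥0∞}
    (hF : ∫⁻ z in Set.Iio (0 : ℝ), F z ≠ ⊤) {ε : ℝ≥0∞} (hε : ε ≠ 0) : ∃ t < 0, F t ≤ ε := by
  by_contra! h
  refine hF (top_le_iff.1 ?_)
  calc ⊤ = ∫⁻ _ in Set.Iio (0 : ℝ), ε := by
        rw [setLIntegral_const, Real.volume_Iio, ENNReal.mul_top hε]
    _ ≤ _ := setLIntegral_mono' measurableSet_Iio fun z hz => (h z hz).le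

variable (φ) in
-- Integrability of the block over a half-line of infinite length provides times where it is
-- arbitrarily small. From such a time to z it changes by at most the time integral of |D|Δ̇_j ∂_z
-- v. This is the L̃^∞ bound for |D|v that membership in 𝒱_* does not state explicitly.
theorem exists_sn_absD_le : ∃ C : ℝ, 0 < C ∧ ∀ v : E d → ℝ → ℝ, MemV φ v → ∀ (j : ℤ) (z : ℝ),
    z < 0 → sn (cv (sig φ Symbol.absD j) fun x => v x z) ≤
      ENNReal.ofReal C * (pw j * blockInt φ j (dzNeg v)) := by
  obtain ⟨C, hC, h⟩ := exists_sn_absD_sub_le φ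
  refine ⟨C, hC, fun v hv j z hz => ?_⟩
  refine ENNReal.le_of_forall_pos_le_add fun ε hε _ => ?_
  obtain ⟨t, ht, hle⟩ := exists_le_of_lintegral_Iio_ne_top
    (ne_top_of_tsum_pw hv.tsum_absD_ne_top j) (ε := ε) (by exact_mod_cast hε.ne')
  rw [add_comm]
  exact (h v hv.lipschitz j t z ht hz).trans (add_le_add_left hle _)

theorem MemV.realized' (hv : MemV φ v) {z : ℝ} (hz : z < 0) : Realized φ fun x => v x z := by
  obtain ⟨C, hC, h⟩ := exists_sn_absD_le φ
  obtain ⟨C', hC', h'⟩ := exists_pw_mul_sn_le φ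
  have hg := LipNeg.growth hv.lipschitz hz
  refine ⟨hg, ?_, fun x => ?_⟩
  · refine ne_top_of_le_ne_top ?_ (ENNReal.tsum_le_tsum fun j => (h' j _ hg).trans
      (mul_le_mul_right (h v hv j z hz) _))
    rw [ENNReal.tsum_mul_left, ENNReal.tsum_mul_left]
    exact ENNReal.mul_ne_top ENNReal.ofReal_ne_top
      (ENNReal.mul_ne_top ENNReal.ofReal_ne_top hv.tsum_dzNeg_ne_top)
  · rw [hv.realized x z hz, realization]
    refine tsum_congr fun j => ?_
    rw [block_pair φ .one, block_pair φ .one, ← Complex.ofReal_sub, Complex.ofReal_re]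

/-- The geometric sum of 2^{j+2-i} over i ≥ 0 is 8 · 2^j. -/
theorem isWeight_pw {K : ℝ≥0∞} (hK : K ≠ ⊤) (h : 8 ≤ K) : IsWeight K pw := by
  refine ⟨hK, fun j => le_rfl, fun j => ?_⟩
  have h1 : ∀ i : ℕ, pw (j + 2 - i) = 4 * pw j * (2⁻¹ : ℝ≥0∞) ^ i := by
    intro i
    rw [pw, pw, zpow_sub₀ two_ne_zero, zpow_add₀ two_ne_zero, ENNReal.ofReal_div_of_pos
      (by positivity), ENNReal.ofReal_mul (by positivity), zpow_natCast,
      ENNReal.ofReal_pow zero_le_two, div_eq_mul_inv, ENNReal.inv_pow]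
    norm_num
    ring
  simp only [h1]
  rw [ENNReal.tsum_mul_left, ENNReal.tsum_geometric, ENNReal.one_sub_inv_two, inv_inv]
  calc 4 * pw j * 2 = 8 * pw j := by ring
    _ ≤ K * pw j := by gcongr

/-- The blocks of ∇ₓv are Riesz transforms of those of |D|v, bounded blockwise, so the synthesis
lemma applies and the sum of the blocks is the gradient since v(·, z) is realized. -/
theorem exists_memSp_gradX {K : ℝ≥0∞} (hW : IsWeight K pw) (hv : MemV φ v) (k : Fin d) :
    ∃ p : ℝ → E d → ℝ, MemSp φ pw p ∧ ∀ z < 0, ∀ x, gradX v x z k = p z x := by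
  obtain ⟨C₁, hC₁, h₁⟩ := exists_sn_absD_le φ
  obtain ⟨C₂, hC₂, h₂⟩ := exists_sn_sig_expD_mul_le φ (Symbol.IsHom.riesz k) (.riesz k)
  obtain ⟨L, hL, hs⟩ := exists_spNorm_tsum_le φ
  have hlip : LipNeg v := hv.lipschitz
  have h2 : ∀ (j : ℤ) (g : E d → ℝ), LinGrowth g →
      sn (cv (sig φ (Symbol.absD * Symbol.riesz k) j) g) ≤
        ENNReal.ofReal C₂ * sn (cv (sig φ Symbol.absD j) g) := by
    intro j g hg
    have := h₂ Symbol.absD .absD 0 le_rfl j g hg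
    rwa [Symbol.mul_expD_zero, mul_zero, mul_zero, zero_div, Real.exp_zero, zpow_zero, mul_one,
      mul_one, Symbol.mul_comm'] at this
  obtain ⟨V, hV, hVv⟩ := hlip.exists_extension
  set u : ℤ → ℝ → E d → ℝ := fun j z x => if z < 0 then
    cv (sig φ (Symbol.absD * Symbol.riesz k) j) (fun x => V x z) x else 0 with hu
  have hu1 : ∀ j, ∀ z < 0, u j z =
      cv (sig φ (Symbol.absD * Symbol.riesz k) j) fun x => v x z := by
    intro j z hz
    ext x
    simp only [hu, if_pos hz, hVv _ z hz]
  have hu2 : ∀ j z, ¬z < 0 → u j z = fun _ => 0 := fun j z hz => funext fun x => if_neg hz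
  set a : ℤ → ℝ≥0∞ := fun j =>
    ∫⁻ z in Set.Iio (0 : ℝ), sn (cv (sig φ Symbol.absD j) fun x => v x z) with ha
  have h3 : MemSp φ pw fun z x => ∑' j, u j z x := by
    -- The two summands play different roles: the block of ∂_z v bounds the supremum in z, and the
    -- block of |D|v bounds the time integral.
    refine (hs K pw hW u (fun j => blockInt φ j (dzNeg v) + a j)
      (ENNReal.ofReal C₂ * (1 + ENNReal.ofReal C₁)) (fun j => ?meas) (fun j z => ?cont)
      (fun i j hij z x => ?supp) (fun j z => ?sup) (fun j => ?int) (by finiteness) ?sum).1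
    case meas =>
      exact Measurable.ite (measurableSet_Iio.preimage measurable_fst)
        (measurable_cv_uncurry _ (g := fun z x => V x z) (hV.measurable.comp measurable_swap))
        measurable_const
    case cont =>
      by_cases hz : z < 0
      · rw [hu1 j z hz, Symbol.mul_comm',
          funext (cv_sig_mul φ (.riesz k) .absD j (hlip.growth hz))]
        refine continuous_finsetSum _ fun i _ =>
          continuous_cv _ (measurable_cv _ (hlip.growth hz).1) (abs_le_of_sn ?_)
        exact ne_top_of_tsum_sn ((hv.realized' hz).tsum_sn_ne_top .absD .absD) j
      · rw [hu2 j z hz]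
        exact continuous_const
    case supp =>
      by_cases hz : z < 0
      · rw [hu1 j z hz]
        exact cv_cv_eq_zero (herm_sig φ .one i) (herm_sig φ (.absD_mul_riesz k) j) (hlip.growth hz)
          (sig_mul_eq_zero φ 1 _ hij) x
      · rw [hu2 j z hz, cv_zero_fun]
    case sup =>
      by_cases hz : z < 0
      · rw [hu1 j z hz]
        refine (h2 j _ (hlip.growth hz)).trans ?_
        rw [mul_assoc]
        refine mul_le_mul_right ((h₁ v hv j z hz).trans ?_) _
        gcongr
        · exact le_add_self
        · exact le_self_add
      · rw [hu2 j z hz, sn_zero]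
        exact zero_le
    case int =>
      have h4 : ∫⁻ z in Set.Iio (0 : ℝ), sn (u j z) ≤ ENNReal.ofReal C₂ * a j := by
        rw [ha, ← lintegral_const_mul' _ _ ENNReal.ofReal_ne_top]
        refine setLIntegral_mono' measurableSet_Iio fun z hz => ?_
        rw [hu1 j z hz]
        exact h2 j _ (hlip.growth hz)
      refine h4.trans ?_
      rw [mul_assoc]
      gcongr
      exact le_mul_of_one_le_of_le le_self_add le_add_self
    case sum =>
      simp only [mul_add]
      rw [ENNReal.tsum_add]
      exact ENNReal.add_ne_top.2 ⟨hv.tsum_dzNeg_ne_top, hv.tsum_absD_ne_top⟩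
  refine ⟨_, h3, fun z hz x => ?_⟩
  simp only [hu1 _ z hz]
  exact ((hv.realized' hz).hasSum_mult_riesz k x).tsum_eq.symm

end DirichletNeumann

end

/-! ### Uniqueness: a continuous representative of ∂_z v, and the comparison of solutions. -/

noncomputable section
namespace DirichletNeumann
variable {d : ℕ} {φ : LittlewoodPaley d}

variable {v : E d → ℝ → ℝ}

theorem lpFamily_cv {g : E d → ℝ} (hg : LinGrowth g) (hs : lipSum φ g ≠ ⊤) :
    LPFamily φ fun j => cv (sig φ 1 j) g :=
  ⟨fun _ => measurable_cv _ hg.1,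
    fun i j x => cv_cv_comm (herm_sig φ .one i) (herm_sig φ .one j) hg x,
    fun j x => cv_sig_eq_sum φ .one j hg x, hs⟩

variable (φ) in
theorem exists_enorm_block_sub_le : ∃ C : ℝ, 0 < C ∧ ∀ (j : ℤ) (g : E d → ℝ), LinGrowth g →
    sn (cv (sig φ 1 j) g) ≠ ⊤ → ∀ x, ‖cv (sig φ 1 j) g x - cv (sig φ 1 j) g 0‖ₑ ≤
      ENNReal.ofReal (C * ‖x‖) * (pw j * sn (cv (sig φ 1 j) g)) := by
  obtain ⟨C, hC, h⟩ := exists_abs_block_sub_le φ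
  refine ⟨C, hC, fun j g hg hs x => ?_⟩
  have h1 := h j g hg hs x 0
  rw [sub_zero] at h1
  rw [← ofReal_norm, Real.norm_eq_abs]
  refine (ENNReal.ofReal_le_ofReal h1).trans (le_of_eq ?_)
  rw [mul_right_comm, ENNReal.ofReal_mul (by positivity), ENNReal.ofReal_mul (p := 2 ^ j)
    (by positivity), ENNReal.ofReal_toReal hs, pw]

variable (φ) in
/-- The continuous representative of `∂_z v(·, z)`. -/
def dzRep (v : E d → ℝ → ℝ) (z : ℝ) (x : E d) : ℝ :=
  dzNeg v z 0 + ∑' j, (cv (sig φ 1 j) (dzNeg v z) x - cv (sig φ 1 j) (dzNeg v z) 0)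

theorem LipNeg.realized_dzRep (hv : LipNeg v) {z : ℝ} (hs : lipSum φ (dzNeg v z) ≠ ⊤) :
    Realized φ (dzRep φ v z) ∧ ∀ j x, cv (sig φ 1 j) (dzRep φ v z) x =
      cv (sig φ 1 j) (dzNeg v z) x :=
  (lpFamily_cv (hv.dzNeg_growth z) hs).realized fun x => by simp [dzRep]

theorem LipNeg.measurable_blockSub (hv : LipNeg v) (j : ℤ) :
    Measurable fun p : ℝ × E d =>
      cv (sig φ 1 j) (dzNeg v p.1) p.2 - cv (sig φ 1 j) (dzNeg v p.1) 0 := by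
  have h := measurable_cv_uncurry (sig φ 1 j) hv.measurable_dzNeg
  have h0 : Measurable fun p : ℝ × E d => (p.1, (0 : E d)) := by fun_prop
  have h1 := h.comp h0
  simp only [Function.comp_def, Function.uncurry] at h1
  exact h.sub h1

theorem LipNeg.measurable_dzRep (hv : LipNeg v) : Measurable (Function.uncurry (dzRep φ v)) := by
  have h0 : Measurable fun p : ℝ × E d => (p.1, (0 : E d)) := by fun_prop
  have h1 := hv.measurable_dzNeg.comp h0
  simp only [Function.comp_def, Function.uncurry] at h1
  exact h1.add (Measurable.tsum fun j => hv.measurable_blockSub j)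

theorem LipNeg.measurable_lipSum (hv : LipNeg v) : Measurable fun z => lipSum φ (dzNeg v z) :=
  Measurable.tsum fun _ => (hv.measurable_sn_cv_dzNeg _).const_mul _

theorem MemV.lintegral_lipSum_ne_top (hv : MemV φ v) :
    ∫⁻ z in Set.Iio (0 : ℝ), lipSum φ (dzNeg v z) ≠ ⊤ := by
  have hl : LipNeg v := hv.lipschitz
  simp only [lipSum]
  rw [lintegral_tsum fun j => ((hl.measurable_sn_cv_dzNeg _).const_mul _).aemeasurable]
  simp only [fun j => lintegral_const_mul' (μ := volume.restrict (Set.Iio (0 : ℝ))) (pw j)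
    (fun τ => sn (cv (sig φ 1 j) (dzNeg v τ))) (pw_ne_top j)]
  exact hv.tsum_dzNeg_ne_top

theorem MemV.ae_lipSum_ne_top (hv : MemV φ v) : ∀ᵐ z, z < 0 → lipSum φ (dzNeg v z) ≠ ⊤ := by
  have h := ae_lt_top (LipNeg.measurable_lipSum (φ := φ) hv.lipschitz) hv.lintegral_lipSum_ne_top
  rw [ae_restrict_iff' measurableSet_Iio] at h
  filter_upwards [h] with τ h hτ
  exact (h hτ).ne

theorem MemV.tsum_lintegral_blockSub_ne_top (hv : MemV φ v) (x : E d) {S : Set ℝ}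
    (hS : S ⊆ Set.Iio 0) : ∑' j, ∫⁻ s in S,
      ‖cv (sig φ 1 j) (dzNeg v s) x - cv (sig φ 1 j) (dzNeg v s) 0‖ₑ ≠ ⊤ := by
  have hl : LipNeg v := hv.lipschitz
  obtain ⟨C, hC, h⟩ := exists_enorm_block_sub_le φ
  refine ne_top_of_le_ne_top (b := ∑' j, ENNReal.ofReal (C * ‖x‖) *
    (pw j * blockInt φ j (dzNeg v))) ?_ (ENNReal.tsum_le_tsum fun j => ?_)
  · rw [ENNReal.tsum_mul_left]
    exact ENNReal.mul_ne_top ENNReal.ofReal_ne_top hv.tsum_dzNeg_ne_top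
  · rw [← lintegral_pw_sn]
    exact (lintegral_mono_set hS).trans (lintegral_mono fun s =>
      h j _ (hl.dzNeg_growth s) (hl.sn_cv_dzNeg_ne_top _ s) x)

theorem LipNeg.measurable_blockSub_time (hv : LipNeg v) (j : ℤ) (x : E d) :
    Measurable fun s => cv (sig φ 1 j) (dzNeg v s) x - cv (sig φ 1 j) (dzNeg v s) 0 := by
  have h0 : Measurable fun s : ℝ => (s, x) := by fun_prop
  have h1 := (hv.measurable_blockSub (φ := φ) j).comp h0
  simpa only [Function.comp_def] using h1

theorem MemV.integrableOn_tsum_blockSub (hv : MemV φ v) (x : E d) {S : Set ℝ}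
    (hS : S ⊆ Set.Iio 0) : IntegrableOn (fun s =>
      ∑' j, (cv (sig φ 1 j) (dzNeg v s) x - cv (sig φ 1 j) (dzNeg v s) 0)) S := by
  have hl : LipNeg v := hv.lipschitz
  have hm := fun j => hl.measurable_blockSub_time (φ := φ) j x
  refine ⟨(Measurable.tsum hm).aestronglyMeasurable, ?_⟩
  rw [hasFiniteIntegral_iff_enorm]
  refine lt_of_le_of_lt (lintegral_mono fun s => enorm_tsum_le_real _) ?_
  rw [lintegral_tsum fun j => (hm j).enorm.aemeasurable]
  exact (hv.tsum_lintegral_blockSub_ne_top x hS).lt_top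

theorem LipNeg.integrableOn_cv (hv : LipNeg v) (a : 𝓢(E d, ℂ)) (x : E d) (b c : ℝ) :
    IntervalIntegrable (fun s => cv a (dzNeg v s) x) volume b c := by
  obtain ⟨M, _, hM⟩ := hv.exists_abs_dzNeg_le
  have h0 : Measurable fun s : ℝ => (s, x) := by fun_prop
  have h1 := (measurable_cv_uncurry a hv.measurable_dzNeg).comp h0
  simp only [Function.comp_def, Function.uncurry] at h1
  rw [intervalIntegrable_iff]
  exact Measure.integrableOn_of_bounded (by simp) h1.aestronglyMeasurable
    (Eventually.of_forall fun s => abs_cv_le (hM s) x)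

theorem LipNeg.intervalIntegrable_dzNeg (hv : LipNeg v) (x : E d) (b c : ℝ) :
    IntervalIntegrable (fun s => dzNeg v s x) volume b c := by
  obtain ⟨M, _, hM⟩ := hv.exists_abs_dzNeg_le
  have h0 : Measurable fun s : ℝ => (s, x) := by fun_prop
  have h1 := hv.measurable_dzNeg.comp h0
  simp only [Function.comp_def, Function.uncurry] at h1
  rw [intervalIntegrable_iff]
  exact Measure.integrableOn_of_bounded (by simp) h1.aestronglyMeasurable
    (Eventually.of_forall fun s => hM s x)

/-- For fixed z the pointwise derivative ∂_z v(·, z) need not be continuous in x. Expanding v(·, z)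
and v(·, t) in blocks, writing each difference as a time integral and summing under the integral
shows that the sum of the blocks of ∂_z v is also a density for v. -/
theorem MemV.sub_eq_integral_dzRep (hv : MemV φ v) {t z : ℝ} (ht : t < 0) (hz : z < 0) (x : E d) :
    v x z - v x t = ∫ s in t..z, dzRep φ v s x := by
  have hl : LipNeg v := hv.lipschitz
  have h1 := ((hv.realized' hz).hasSum x).sub ((hv.realized' ht).hasSum x)
  have h2 : ∀ j, cv (sig φ 1 j) (fun x => v x z) x - cv (sig φ 1 j) (fun x => v x z) 0 -
      (cv (sig φ 1 j) (fun x => v x t) x - cv (sig φ 1 j) (fun x => v x t) 0) =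
      ∫ s in t..z, (cv (sig φ 1 j) (dzNeg v s) x - cv (sig φ 1 j) (dzNeg v s) 0) := by
    intro j
    rw [intervalIntegral.integral_sub (hl.integrableOn_cv _ x t z) (hl.integrableOn_cv _ 0 t z),
      ← hl.cv_sub_eq_integral ht hz, ← hl.cv_sub_eq_integral ht hz]
    ring
  simp only [h2, intervalIntegral.intervalIntegral_eq_integral_uIoc] at h1
  have h3 := integral_tsum (μ := volume.restrict (Set.uIoc t z))
    (fun j => (hl.measurable_blockSub_time (φ := φ) j x).aestronglyMeasurable)
    (hv.tsum_lintegral_blockSub_ne_top x (uIoc_subset_Iio ht hz))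
  have h4 := h1.tsum_eq
  rw [tsum_const_smul''] at h4
  rw [← h3, ← intervalIntegral.intervalIntegral_eq_integral_uIoc] at h4
  have h5 : IntervalIntegrable (fun s => ∑' j, (cv (sig φ 1 j) (dzNeg v s) x -
      cv (sig φ 1 j) (dzNeg v s) 0)) volume t z := by
    rw [intervalIntegrable_iff]
    exact hv.integrableOn_tsum_blockSub x (uIoc_subset_Iio ht hz)
  simp only [dzRep]
  rw [intervalIntegral.integral_add (hl.intervalIntegrable_dzNeg 0 t z) h5, h4,
    ← hl.sub_eq_integral ht hz]
  ring

theorem MemV.locallyIntegrable_dzRep (hv : MemV φ v) (x : E d) :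
    LocallyIntegrable (fun s => dzRep φ v s x) volume := by
  have hl : LipNeg v := hv.lipschitz
  obtain ⟨M, _, hM⟩ := hl.exists_abs_dzNeg_le
  refine locallyIntegrable_iff.2 fun k hk => ?_
  have h0 : Measurable fun s : ℝ => (s, (0 : E d)) := by fun_prop
  have h1 := hl.measurable_dzNeg.comp h0
  simp only [Function.comp_def, Function.uncurry] at h1
  have h2 : IntegrableOn (fun s => dzNeg v s 0) (k ∩ Set.Iio 0) :=
    Measure.integrableOn_of_bounded (ne_top_of_le_ne_top hk.measure_lt_top.ne
      (measure_mono Set.inter_subset_left)) h1.aestronglyMeasurable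
      (Eventually.of_forall fun s => hM s 0)
  refine (h2.add (hv.integrableOn_tsum_blockSub x Set.inter_subset_right)).of_forall_sdiff_eq_zero
    hk.measurableSet fun s hs => ?_
  have h3 : ¬s < 0 := fun h => hs.2 ⟨hs.1, h⟩
  have h4 : dzNeg v s = fun _ => 0 := funext fun x => if_neg h3
  simp [h4, cv_zero_fun]

/-- Lebesgue differentiation of the preceding integral formula; the exceptional set of times depends
on x. -/
theorem MemV.ae_dz_eq_dzRep (hv : MemV φ v) (x : E d) :
    ∀ᵐ z, z < 0 → dz v x z = dzRep φ v z x := by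
  filter_upwards [LocallyIntegrable.ae_hasDerivAt_integral (hv.locallyIntegrable_dzRep x)]
    with z hz hz0
  have h1 := (hz (-1)).const_add (v x (-1))
  rw [← h1.deriv]
  refine Filter.EventuallyEq.deriv_eq ?_
  filter_upwards [Iio_mem_nhds hz0] with t ht
  rw [← hv.sub_eq_integral_dzRep (by norm_num) ht x]
  ring

theorem eq_of_eq_denseSeq {g h : E d → ℝ} (hg : Continuous g) (hh : Continuous h)
    (H : ∀ n, g (TopologicalSpace.denseSeq (E d) n) = h (TopologicalSpace.denseSeq (E d) n))
    (x : E d) : g x = h x :=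
  congrFun ((TopologicalSpace.denseRange_denseSeq (E d)).equalizer hg hh (funext H)) x

/-- At almost every time the representative agrees with ∂_z v on a countable dense set of points,
where the Lipschitz bound holds, and continuity extends the bound to all x. -/
theorem MemV.ae_abs_dzRep_le (hv : MemV φ v) :
    ∃ M : ℝ, ∀ᵐ z, z < 0 → ∀ x, |dzRep φ v z x| ≤ M := by
  have hl : LipNeg v := hv.lipschitz
  obtain ⟨M, _, hM⟩ := hl.exists_abs_dzNeg_le
  refine ⟨M, ?_⟩
  have h1 := ae_all_iff.2 fun n => hv.ae_dz_eq_dzRep (TopologicalSpace.denseSeq (E d) n)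
  filter_upwards [h1, hv.ae_lipSum_ne_top] with z h1 h2 hz x
  have hc : Continuous (dzRep φ v z) := continuous_iff_continuousAt.2 fun x =>
    ((hl.realized_dzRep (h2 hz)).1.hasFDerivAt x).continuousAt
  refine (TopologicalSpace.denseRange_denseSeq (E d)).induction_on x
    (isClosed_le hc.abs continuous_const) fun n => ?_
  have h3 := hM z (TopologicalSpace.denseSeq (E d) n)
  rwa [dzNeg, if_pos hz, h1 n hz] at h3

open Classical in
-- The representative is kept on a measurable set of good times of full measure and set to zero
-- elsewhere, so that continuity and the sup bound hold for every z, as the space requires.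
theorem exists_memSp_dz (hv : MemV φ v) : ∃ q : ℝ → E d → ℝ, MemSp φ pw q ∧ Agree (dz v) q := by
  have hl : LipNeg v := hv.lipschitz
  obtain ⟨M, hM⟩ := hv.ae_abs_dzRep_le
  have h1 : ∀ᵐ z, z < 0 → lipSum φ (dzNeg v z) ≠ ⊤ ∧ ∀ x, |dzRep φ v z x| ≤ M := by
    filter_upwards [hM, hv.ae_lipSum_ne_top] with z h h' hz
    exact ⟨h' hz, h hz⟩
  obtain ⟨N, hN, hNm, hN0⟩ := exists_measurable_superset_of_null (ae_iff.1 h1)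
  set S : Set ℝ := Nᶜ ∩ Set.Iio 0 with hS
  have hSm : MeasurableSet S := hNm.compl.inter measurableSet_Iio
  have hgood : ∀ z ∈ S, lipSum φ (dzNeg v z) ≠ ⊤ ∧ ∀ x, |dzRep φ v z x| ≤ M := fun z hz =>
    (not_not.1 fun h => hz.1 (hN h)) hz.2
  have hae : ∀ᵐ z, z < 0 → z ∈ S := by
    filter_upwards [compl_mem_ae_iff.2 hN0] with z hz hz0 using ⟨hz, hz0⟩
  set q : ℝ → E d → ℝ := fun z x => if z ∈ S then dzRep φ v z x else 0 with hq
  have hq1 : ∀ z ∈ S, q z = dzRep φ v z := fun z hz => funext fun x => if_pos hz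
  have hq2 : ∀ z, z ∉ S → q z = fun _ => 0 := fun z hz => funext fun x => if_neg hz
  have hqm : Measurable (Function.uncurry q) :=
    Measurable.ite (hSm.preimage measurable_fst) hl.measurable_dzRep measurable_const
  refine ⟨q, ⟨hqm, fun z => ?_, ne_of_lt ?_⟩, hl.agree hqm fun x => ?_⟩
  · by_cases hz : z ∈ S
    · rw [hq1 z hz]
      exact continuous_iff_continuousAt.2 fun x =>
        ((hl.realized_dzRep (hgood z hz).1).1.hasFDerivAt x).continuousAt
    · rw [hq2 z hz]
      exact continuous_const
  · rw [spNorm, ENNReal.add_lt_top]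
    constructor
    · refine lt_of_le_of_lt (iSup_le fun z => ?_) (ENNReal.ofReal_lt_top (r := M))
      by_cases hz : z ∈ S
      · rw [hq1 z hz]
        exact sn_le_ofReal (hgood z hz).2
      · rw [hq2 z hz, sn_zero]
        exact zero_le
    · refine lt_of_le_of_lt (ENNReal.tsum_le_tsum fun j => mul_le_mul_right ?_ _)
        hv.tsum_dzNeg_ne_top.lt_top
      refine lintegral_mono fun z => ?_
      by_cases hz : z ∈ S
      · rw [hq1 z hz, sn_congr ((hl.realized_dzRep (hgood z hz).1).2 j)]
      · rw [hq2 z hz, cv_zero_fun, sn_zero]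
        exact zero_le
  · filter_upwards [hae, hv.ae_dz_eq_dzRep x] with z h2 h3 hz
    rw [h3 hz, hq1 z (h2 hz)]

theorem exists_isGradient {K : ℝ≥0∞} (hW : IsWeight K pw) (hv : MemV φ v) :
    ∃ y : GradSp φ pw, IsGradient v y := by
  choose p hp hpv using fun k => exists_memSp_gradX hW hv k
  obtain ⟨q, hq, hqv⟩ := exists_memSp_dz hv
  exact ⟨(fun k => Sp.mk (p k) (hp k), Sp.mk q hq), fun x z hz k => hpv k z hz x, hqv⟩

/-! ### Uniqueness of the fixed point -/

variable {W : ℤ → ℝ≥0∞} {K : ℝ≥0∞}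

open Classical in
-- Cutting off in time does not increase the norm. Since the norm sees every z, identities known
-- only for almost every z must be restricted to a set of good times before norms are compared.
theorem exists_restrict (φ : LittlewoodPaley d) (W : ℤ → ℝ≥0∞) {S : Set ℝ} (hS : MeasurableSet S) :
    ∃ R : Sp φ W → Sp φ W, (∀ g, ‖R g‖ ≤ ‖g‖) ∧ (∀ g, ∀ z ∈ S, ∀ x, (R g).val z x = g.val z x) ∧
      ∀ g, ∀ z ∉ S, ∀ x, (R g).val z x = 0 := by
  have key : ∀ g : Sp φ W, spNorm φ W (fun z x => if z ∈ S then g.val z x else 0) ≤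
      spNorm φ W g.val := by
    intro g
    have h1 : ∀ z ∈ S, (fun x => if z ∈ S then g.val z x else 0) = g.val z := fun z hz =>
      funext fun x => if_pos hz
    have h2 : ∀ z ∉ S, (fun x => if z ∈ S then g.val z x else 0) = fun _ => 0 := fun z hz =>
      funext fun x => if_neg hz
    refine add_le_add (iSup_mono fun z => ?_) (ENNReal.tsum_le_tsum fun j =>
      mul_le_mul_right (lintegral_mono fun z => ?_) _)
    · by_cases hz : z ∈ S
      · exact le_of_eq (congrArg sn (h1 z hz))
      · exact (congrArg sn (h2 z hz)).trans_le (by rw [sn_zero]; exact zero_le)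
    · by_cases hz : z ∈ S
      · exact le_of_eq (congrArg (fun u => sn (cv (sig φ 1 j) u)) (h1 z hz))
      · exact (congrArg (fun u => sn (cv (sig φ 1 j) u)) (h2 z hz)).trans_le
          (by rw [cv_zero_fun, sn_zero]; exact zero_le)
  refine ⟨fun g => Sp.mk (fun z x => if z ∈ S then g.val z x else 0)
    ⟨Measurable.ite (hS.preimage measurable_fst) g.mem.meas measurable_const, fun z => ?_,
      ne_top_of_le_ne_top g.mem.fin (key g)⟩, fun g => ?_, fun g z hz x => if_pos hz,
    fun g z hz x => if_neg hz⟩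
  · by_cases hz : z ∈ S
    · simpa only [if_pos hz] using g.mem.cont z
    · simpa only [if_neg hz] using continuous_const
  · exact ENNReal.toReal_mono g.mem.fin (key g)

theorem GradSp.src_congr (hW : IsWeight K W) (A₁ : Fin d → Sp φ W) (A₂ A₃ : Sp φ W)
    {y y' : GradSp φ W} (h : ∀ᵐ z, z < 0 → ∀ x,
      (∀ k, (y.1 k).val z x = (y'.1 k).val z x) ∧ y.2.val z x = y'.2.val z x) {z : ℝ}
    (hz : ∀ x, (∀ k, (y.1 k).val z x = (y'.1 k).val z x) ∧ y.2.val z x = y'.2.val z x) (x : E d) :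
    (src hW A₁ A₂ A₃ y).val z x = (src hW A₁ A₂ A₃ y').val z x := by
  have hq : ∀ z x, (∀ k, (y.1 k).val z x = (y'.1 k).val z x) ∧ y.2.val z x = y'.2.val z x →
      (qa hW A₁ A₃ y).val z x = (qa hW A₁ A₃ y').val z x := fun z x h => by
    simp only [qa_apply, h.1, h.2]
  have hb : ∀ k z x, (∀ k, (y.1 k).val z x = (y'.1 k).val z x) ∧ y.2.val z x = y'.2.val z x →
      (b hW A₁ A₂ k y).val z x = (b hW A₁ A₂ k y').val z x := fun k z x h => by
    simp only [b_apply, h.1, h.2]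
  rw [src_apply, src_apply, w_apply, w_apply, hq z x (hz x)]
  congr 2
  · refine Finset.sum_congr rfl fun k _ => timeOp_congr _ _ ?_ z x
    filter_upwards [h] with τ hτ hτ0
    exact Eventually.of_forall fun x => hb k τ x (hτ hτ0 x)
  · refine timeOp_congr _ _ ?_ z x
    filter_upwards [h] with τ hτ hτ0
    exact Eventually.of_forall fun x => hq τ x (hτ hτ0 x)

theorem GradSp.gradDuhamel_congr (hW : IsWeight K W) {g h : Sp φ W}
    (hgh : ∀ᵐ z, z < 0 → ∀ x, g.val z x = h.val z x) {z : ℝ} (hz : ∀ x, g.val z x = h.val z x)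
    (x : E d) : (∀ k, ((gradDuhamel hW g).1 k).val z x = ((gradDuhamel hW h).1 k).val z x) ∧
      (gradDuhamel hW g).2.val z x = (gradDuhamel hW h).2.val z x := by
  have h1 : ∀ᵐ τ, τ < 0 → g.val τ =ᵐ[volume] h.val τ := by
    filter_upwards [hgh] with τ hτ hτ0
    exact Eventually.of_forall fun x => hτ hτ0 x
  refine ⟨fun k => ?_, ?_⟩
  · rw [gradDuhamel_fst, gradDuhamel_fst, timeOp_congr _ _ h1]
  · rw [gradDuhamel_snd, gradDuhamel_snd, timeOp_congr _ _ h1, hz]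

/-- Let y be the gradient of the given fixed point and y' = Y + L y. They agree for almost every
time only. The difference y' - y₀ = L(y - y₀), cut off to the good times, is a fixed point of the
cut-off contraction and hence zero; integrating the second component recovers v up to a constant. -/
theorem eq_primitive_of_isFixedPoint {η f : 𝓢(E d, ℂ) → ℂ} {A Y y₀ : GradSp φ pw} {A₃ : Sp φ pw}
    (hη : Realized φ (realization φ η)) (hA : IsHeat (realization φ η) A) (hA₃ : IsCoeff A A₃)
    (hf : Realized φ (realization φ f)) (hY : IsHeat (realization φ f) Y) (hW : IsWeight K pw)
    (hy₀ : y₀ = Y + GradSp.gradDuhamel hW (GradSp.src hW A.1 A.2 A₃ y₀))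
    (hsmall : ∀ y, ‖GradSp.gradDuhamel hW (GradSp.src hW A.1 A.2 A₃ y)‖ ≤ 1 / 2 * ‖y‖)
    (hv : IsFixedPoint φ η f v) :
    ∃ k : ℝ, ∀ x z, z < 0 → v x z = primitive (realization φ f) y₀.2 x z + k := by
  obtain ⟨y, hy⟩ := exists_isGradient hW hv.mem
  set L := fun y => GradSp.gradDuhamel hW (GradSp.src hW A.1 A.2 A₃ y) with hL
  set y' := Y + L y with hy'
  obtain ⟨k, hk⟩ := hv.fixed
  have hv' : ∀ x z, z < 0 → v x z = primitive (realization φ f) y'.2 x z + k := fun x z hz => by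
    rw [hk x z hz, hy.T_eq hη hA hA₃ hW hz.le, ← primitive_eq hW hf hY _ hz.le]
  have hfst : ∀ z < 0, ∀ x k, (y.1 k).val z x = (y'.1 k).val z x := by
    intro z hz x k
    rw [← hy.fst x z hz, gradX, funext fun x => hv' x z hz,
      ← gradX_primitive hW hf hY _ hz]
    simp only [gradX, gradient, fderiv_add_const]
    rfl
  have hsnd : ∀ᵐ z, z < 0 → ∀ x, y.2.val z x = y'.2.val z x := by
    have h1 : ∀ x, ∀ᵐ z, z < 0 → y.2.val z x = y'.2.val z x := by
      intro x
      filter_upwards [hy.snd.1 x, ae_dz_primitive (realization φ f) y'.2 x] with z h1 h2 hz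
      rw [← h1 hz, ← h2, dz_congr (v := fun x t => primitive (realization φ f) y'.2 x t + k) hz
        (fun t ht => hv' x t ht)]
      simp only [dz, deriv_add_const]
    filter_upwards [ae_all_iff.2 fun n => h1 (TopologicalSpace.denseSeq (E d) n)] with z h2 hz x
    exact eq_of_eq_denseSeq (y.2.mem.cont z) (y'.2.mem.cont z) (fun n => h2 n hz) x
  obtain ⟨N, hN, hNm, hN0⟩ := exists_measurable_superset_of_null (ae_iff.1 hsnd)
  set S : Set ℝ := Nᶜ ∩ Set.Iio 0 with hS
  have hSm : MeasurableSet S := hNm.compl.inter measurableSet_Iio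
  have hgood : ∀ z ∈ S, ∀ x, y.2.val z x = y'.2.val z x := fun z hz =>
    (not_not.1 fun h => hz.1 (hN h)) hz.2
  have hae : ∀ᵐ z, z < 0 → z ∈ S := by
    filter_upwards [compl_mem_ae_iff.2 hN0] with z hz hz0 using ⟨hz, hz0⟩
  obtain ⟨R, hR, hR1, hR0⟩ := exists_restrict φ pw hSm
  set e : GradSp φ pw := (fun k => R ((y' - y₀).1 k), R (y' - y₀).2) with he
  have hdiff : y' - y₀ = L (y - y₀) := by
    have h1 : y₀ = Y + L y₀ := hy₀
    have h2 : L (y - y₀) = L y - L y₀ := by simp [hL]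
    rw [h2]
    conv_lhs => rw [h1, hy']
    abel
  have hey : ∀ z ∈ S, ∀ x, (∀ k, (e.1 k).val z x = ((y - y₀).1 k).val z x) ∧
      e.2.val z x = (y - y₀).2.val z x := by
    intro z hz x
    refine ⟨fun k => ?_, ?_⟩
    · change (R ((y' - y₀).1 k)).val z x = _
      rw [hR1 _ z hz]
      change (y'.1 k).val z x - _ = (y.1 k).val z x - _
      rw [hfst z hz.2]
    · change (R (y' - y₀).2).val z x = _
      rw [hR1 _ z hz]
      change y'.2.val z x - _ = y.2.val z x - _
      rw [hgood z hz]
  have heyae : ∀ᵐ z, z < 0 → ∀ x, (∀ k, (e.1 k).val z x = ((y - y₀).1 k).val z x) ∧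
      e.2.val z x = (y - y₀).2.val z x := by
    filter_upwards [hae] with z hz hz0 x using hey z (hz hz0) x
  have hsrc : ∀ z ∈ S, ∀ x, (GradSp.src hW A.1 A.2 A₃ e).val z x =
      (GradSp.src hW A.1 A.2 A₃ (y - y₀)).val z x := fun z hz x =>
    GradSp.src_congr hW A.1 A.2 A₃ heyae (hey z hz) x
  have hsrcae : ∀ᵐ z, z < 0 → ∀ x, (GradSp.src hW A.1 A.2 A₃ e).val z x =
      (GradSp.src hW A.1 A.2 A₃ (y - y₀)).val z x := by
    filter_upwards [hae] with z hz hz0 x using hsrc z (hz hz0) x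
  have hLe : ∀ z ∈ S, ∀ x, (∀ k, ((L e).1 k).val z x = ((y' - y₀).1 k).val z x) ∧
      (L e).2.val z x = (y' - y₀).2.val z x := fun z hz x => by
    rw [hdiff]
    exact GradSp.gradDuhamel_congr hW hsrcae (hsrc z hz) x
  have hRe : ∀ g h : Sp φ pw, (∀ z ∈ S, ∀ x, g.val z x = h.val z x) → R g = R h := by
    intro g h hgh
    refine Sp.ext fun z x => ?_
    by_cases hz : z ∈ S
    · rw [hR1 _ z hz, hR1 _ z hz, hgh z hz]
    · rw [hR0 _ z hz, hR0 _ z hz]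
  -- Time integrals ignore null sets, so L e and L(y - y₀) = y' - y₀ coincide on the good times, and
  -- e is the restriction of L e to them.
  have he' : ‖e‖ ≤ ‖L e‖ := by
    have h1 : e = (fun k => R ((L e).1 k), R (L e).2) := by
      rw [he]
      refine Prod.ext (funext fun k => hRe _ _ fun z hz x => ((hLe z hz x).1 k).symm)
        (hRe _ _ fun z hz x => (hLe z hz x).2.symm)
    conv_lhs => rw [h1]
    exact norm_prod_le_iff.2 ⟨(pi_norm_le_iff_of_nonneg (norm_nonneg _)).2 fun k =>
      (hR _).trans (GradSp.norm_fst_apply_le _ k), (hR _).trans (norm_snd_le _)⟩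
  have he0 : e = 0 := by
    have h1 := hsmall e
    have h2 := norm_nonneg e
    exact norm_le_zero_iff.1 (by linarith)
  refine ⟨k, fun x z hz => ?_⟩
  rw [hv' x z hz, primitive, primitive]
  congr 2
  -- The restricted difference is zero, so the second components of y' and y₀ agree at all good
  -- times, which suffices under the integral.
  refine intervalIntegral.integral_congr_ae ?_
  have h0 : ∀ᵐ s : ℝ, s ≠ 0 := by simp [ae_iff]
  filter_upwards [hae, h0] with s hs hs0 hsz
  have h1 : s < 0 := lt_of_le_of_ne (by
    rw [Set.uIoc_of_ge hz.le] at hsz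
    exact hsz.2) hs0
  have h2 : e.2.val s x = y'.2.val s x - y₀.2.val s x := hR1 _ s (hs h1) x
  rw [he0] at h2
  have h3 : (0 : GradSp φ pw).2.val s x = 0 := rfl
  linarith

end DirichletNeumann

end

/-! ### Higher regularity: weights with a free parameter. -/

noncomputable section
namespace DirichletNeumann
variable {d : ℕ} {φ : LittlewoodPaley d}

/-! ### The weights -/

theorem pwr_ne_zero (s : ℝ) (j : ℤ) : pwr s j ≠ 0 :=
  (ENNReal.ofReal_pos.2 (by positivity)).ne'

theorem pwr_one_add (r : ℝ) (j : ℤ) : pwr (1 + r) j = pw j * pwr r j := by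
  rw [pwr_add, pwr_one]

/-- For s ≥ 1 the terms 2^{-is} are at most 2^{-i}, so the geometric sum is at most 2; the shift by
2 contributes 2^{2s}. -/
theorem tsum_pwr_le {s : ℝ} (hs : 1 ≤ s) (j : ℤ) :
    ∑' i : ℕ, pwr s (j + 2 - i) ≤ ENNReal.ofReal (2 ^ (2 * s) * 2) * pwr s j := by
  have h1 : ∀ i : ℕ, pwr s (j + 2 - i) ≤
      ENNReal.ofReal ((2 : ℝ) ^ (2 * s)) * pwr s j * (2⁻¹ : ℝ≥0∞) ^ i := by
    intro i
    have h2 : (2⁻¹ : ℝ≥0∞) ^ i = ENNReal.ofReal ((2 : ℝ) ^ (-(i : ℝ))) := by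
      rw [Real.rpow_neg zero_le_two, ENNReal.ofReal_inv_of_pos (by positivity), Real.rpow_natCast,
        ENNReal.ofReal_pow zero_le_two, ENNReal.inv_pow]
      norm_num
    rw [h2, pwr, pwr, ← ENNReal.ofReal_mul (by positivity), ← ENNReal.ofReal_mul (by positivity),
      ← Real.rpow_add two_pos, ← Real.rpow_add two_pos]
    refine ENNReal.ofReal_le_ofReal (Real.rpow_le_rpow_of_exponent_le one_le_two ?_)
    push_cast
    have : (i : ℝ) ≤ i * s := le_mul_of_one_le_right (Nat.cast_nonneg i) hs
    nlinarith
  refine (ENNReal.tsum_le_tsum h1).trans (le_of_eq ?_)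
  rw [ENNReal.tsum_mul_left, ENNReal.tsum_geometric, ENNReal.one_sub_inv_two, inv_inv,
    ENNReal.ofReal_mul (by positivity)]
  norm_num
  ring

/-- The weights `2^j + δ 2^{j (1 + r)}`. -/
def weight (r : ℝ) (δ : ℝ≥0∞) (j : ℤ) : ℝ≥0∞ := pw j + δ * pwr (1 + r) j

/-- Each of the two summands satisfies the weight condition separately, so the constant is
independent of δ. Consequently the smallness threshold and all operator bounds are uniform in δ. -/
theorem isWeight_weight {r : ℝ} (hr : 0 ≤ r) (δ : ℝ≥0∞) :
    IsWeight (ENNReal.ofReal (2 ^ (2 * (1 + r)) * 2)) (weight r δ) := by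
  refine ⟨ENNReal.ofReal_ne_top, fun j => le_self_add, fun j => ?_⟩
  have h1 := tsum_pwr_le (le_refl (1 : ℝ)) j
  have h2 := tsum_pwr_le (show (1 : ℝ) ≤ 1 + r by linarith) j
  simp only [pwr_one] at h1
  simp only [weight]
  rw [ENNReal.tsum_add, ENNReal.tsum_mul_left, mul_add, mul_left_comm]
  refine add_le_add (h1.trans ?_) (mul_le_mul_right h2 _)
  refine mul_le_mul_left (ENNReal.ofReal_le_ofReal ?_) _
  gcongr
  · norm_num
  · linarith

theorem eight_le {r : ℝ} (hr : 0 ≤ r) : (8 : ℝ≥0∞) ≤ ENNReal.ofReal (2 ^ (2 * (1 + r)) * 2) := by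
  rw [show (8 : ℝ≥0∞) = ENNReal.ofReal 8 by norm_num]
  refine ENNReal.ofReal_le_ofReal ?_
  have : (2 : ℝ) ^ (2 : ℝ) ≤ 2 ^ (2 * (1 + r)) :=
    Real.rpow_le_rpow_of_exponent_le one_le_two (by linarith)
  norm_num at this
  linarith

theorem gradSum_pw (u : E d → ℝ) : gradSum φ pw u = ∑' j, sn (cv (sig φ Symbol.absD j) u) :=
  tsum_congr fun j => by
    rw [← mul_assoc, ENNReal.mul_inv_cancel (pw_ne_zero j) (pw_ne_top j), one_mul]

theorem gradSum_weight (r : ℝ) (δ : ℝ≥0∞) (u : E d → ℝ) : gradSum φ (weight r δ) u =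
    ∑' j, sn (cv (sig φ Symbol.absD j) u) +
      δ * ∑' j, pwr r j * sn (cv (sig φ Symbol.absD j) u) := by
  rw [← ENNReal.tsum_mul_left, ← ENNReal.tsum_add]
  refine tsum_congr fun j => ?_
  rw [weight, pwr_one_add, add_mul, ← mul_assoc (pw j),
    ENNReal.mul_inv_cancel (pw_ne_zero j) (pw_ne_top j), one_mul]
  congr 1
  calc δ * (pw j * pwr r j) * ((pw j)⁻¹ * sn (cv (sig φ Symbol.absD j) u))
      = pw j * (pw j)⁻¹ * (δ * (pwr r j * sn (cv (sig φ Symbol.absD j) u))) := by ring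
    _ = _ := by rw [ENNReal.mul_inv_cancel (pw_ne_zero j) (pw_ne_top j), one_mul]

/-! ### The blocks of `w` -/

theorem pwr_le_of_mem {r : ℝ} (hr : 0 ≤ r) {i j : ℤ} (hj : j ∈ Finset.Icc (i - 1) (i + 1)) :
    pwr r j ≤ ENNReal.ofReal (2 ^ r) * pwr r i := by
  rw [Finset.mem_Icc] at hj
  rw [pwr, pwr, ← ENNReal.ofReal_mul (by positivity), ← Real.rpow_add two_pos]
  refine ENNReal.ofReal_le_ofReal (Real.rpow_le_rpow_of_exponent_le one_le_two ?_)
  have : (j : ℝ) ≤ i + 1 := by exact_mod_cast hj.2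
  nlinarith

variable (φ) in
-- At a fixed z the kernel size 2^j trades one derivative for the time integral: the Ḃʳ norm of the
-- result is controlled by the L̃¹(Ḃ^{1+r}) norm of the source. With z = 0 this turns bounds on the
-- sources into bounds on the Dirichlet-Neumann operator.
theorem exists_tsum_sn_timeOp_le {m : Symbol d} (hm : m.IsHom 1) (hmr : m.IsReal) {r : ℝ}
    (hr : 0 ≤ r) : ∃ C : ℝ≥0∞, C ≠ ⊤ ∧ ∀ (K : ℝ≥0∞) (W : ℤ → ℝ≥0∞), IsWeight K W →
      ∀ g, MemSp φ W g → ∀ A : ℝ → Set ℝ, MeasurableSet {p : ℝ × ℝ | p.2 ∈ A p.1} → ∀ z,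
        ∑' j, pwr r j * sn (cv (sig φ 1 j) (timeOp φ m A g z)) ≤
          C * ∑' j, pwr (1 + r) j * blockInt φ j g := by
  obtain ⟨C, hC⟩ := exists_expBound φ hm hmr
  obtain ⟨k, hk, hker⟩ := exists_kerNorm_sig_le' φ (m := (1 : Symbol d)) .one
  refine ⟨3 * ENNReal.ofReal (2 ^ r) * ENNReal.ofReal k * ENNReal.ofReal C, by finiteness,
    fun K W hW g hg A hA z => ?_⟩
  have h1 : ∀ j, sn (cv (sig φ 1 j) (timeOp φ m A g z)) ≤
      ∑' i, sn (cv (sig φ 1 j) (timeBlock φ m A i g z)) := by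
    intro j
    have h2 : cv (sig φ 1 j) (timeOp φ m A g z) =
        fun x => ∑' i, cv (sig φ 1 j) (timeBlock φ m A i g z) x := by
      ext x
      exact (hasSum_cv_of_sn _ (fun i => (hC.continuous_timeBlock hW hg hA i z).measurable)
        (hC.tsum_sn_timeBlock_ne_top hW hg A z) x).tsum_eq.symm
    rw [h2]
    exact sn_tsum_le _
  have h2 : ∀ i, ∑' j, pwr r j * sn (cv (sig φ 1 j) (timeBlock φ m A i g z)) ≤
      3 * ENNReal.ofReal (2 ^ r) * ENNReal.ofReal k * ENNReal.ofReal C *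
        (pwr (1 + r) i * blockInt φ i g) := by
    intro i
    have h3 : ∑' j, pwr r j * sn (cv (sig φ 1 j) (timeBlock φ m A i g z)) =
        ∑ j ∈ Finset.Icc (i - 1) (i + 1),
          pwr r j * sn (cv (sig φ 1 j) (timeBlock φ m A i g z)) := by
      refine tsum_eq_sum fun j hj => ?_
      rw [sn_congr fun x => hC.cv_timeBlock_eq_zero hmr hW hg hA (i := j) (j := i) ?_ z x, sn_zero,
        mul_zero]
      rw [Finset.mem_Icc] at hj
      rw [lt_abs]
      lia
    have h4 : ∀ j, sn (cv (sig φ 1 j) (timeBlock φ m A i g z)) ≤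
        ENNReal.ofReal k * (ENNReal.ofReal C * (pw i * blockInt φ i g)) := fun j => by
      refine (sn_cv_le _ _).trans ?_
      gcongr
      · simpa using hker j
      · exact hC.sn_timeBlock_le hg A i z
    rw [h3]
    refine (Finset.sum_le_sum fun j hj => mul_le_mul' (pwr_le_of_mem hr hj) (h4 j)).trans
      (le_of_eq ?_)
    rw [Finset.sum_const, Int.card_Icc, show (i + 1 + 1 - (i - 1)).toNat = 3 by lia,
      nsmul_eq_mul, pwr_one_add]
    push_cast
    ring
  refine (ENNReal.tsum_le_tsum fun j => mul_le_mul_right (h1 j) _).trans ?_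
  simp only [← ENNReal.tsum_mul_left]
  rw [ENNReal.tsum_comm]
  exact ENNReal.tsum_le_tsum h2

theorem tsum_pwr_blockInt_le (r : ℝ) (δ : ℝ≥0∞) (g : Sp φ (weight r δ)) :
    δ * ∑' j, pwr (1 + r) j * blockInt φ j g.val ≤ ENNReal.ofReal ‖g‖ := by
  rw [Sp.ofReal_norm_eq, ← ENNReal.tsum_mul_left]
  refine le_trans (ENNReal.tsum_le_tsum fun j => ?_) (tsum_blockInt_le_spNorm g.val)
  rw [← mul_assoc]
  exact mul_le_mul_left le_add_self _

variable (φ) in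
theorem exists_tsum_sn_w_le {r : ℝ} (hr : 0 ≤ r) : ∃ C : ℝ≥0∞, C ≠ ⊤ ∧
    ∀ (δ : ℝ≥0∞) (A₁ : Fin d → Sp φ (weight r δ)) (A₂ A₃ : Sp φ (weight r δ))
      (y : GradSp φ (weight r δ)) (β : ℝ),
      (∀ k, ‖GradSp.b (isWeight_weight hr δ) A₁ A₂ k y‖ ≤ β) →
      ‖GradSp.qa (isWeight_weight hr δ) A₁ A₃ y‖ ≤ β →
      δ * ∑' j, pwr r j * sn (cv (sig φ 1 j)
        ((GradSp.w (isWeight_weight hr δ) A₁ A₂ A₃ y).val 0)) ≤ C * ENNReal.ofReal β := by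
  obtain ⟨C, hC, h⟩ := exists_tsum_sn_timeOp_le φ (Symbol.IsHom.absD (d := d)) .absD hr
  choose C' hC' h' using fun k : Fin d =>
    exists_tsum_sn_timeOp_le φ (Symbol.IsHom.absD_mul_riesz k) (.absD_mul_riesz k) hr
  have hS : ∑ k, C' k ≠ ⊤ := ENNReal.sum_ne_top.2 fun k _ => hC' k
  refine ⟨∑ k, C' k + C, by finiteness, fun δ A₁ A₂ A₃ y β hb hq => ?_⟩
  set hW := isWeight_weight hr δ with hW_def
  set b := fun k => GradSp.b hW A₁ A₂ k y with hb_def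
  set q := GradSp.qa hW A₁ A₃ y with hq_def
  have hmb := fun k => (b k).mem.timeOp hW (Symbol.IsHom.absD_mul_riesz k) (.absD_mul_riesz k)
    measurableSet_mem_Iio
  have hmq := q.mem.timeOp hW Symbol.IsHom.absD .absD measurableSet_mem_Iio
  have h1 : ∀ j, sn (cv (sig φ 1 j) ((GradSp.w hW A₁ A₂ A₃ y).val 0)) ≤
      ∑ k, sn (cv (sig φ 1 j) (timeOp φ (Symbol.absD * Symbol.riesz k) Set.Iio (b k).val 0)) +
        sn (cv (sig φ 1 j) (timeOp φ Symbol.absD Set.Iio q.val 0)) := by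
    intro j
    have hl : LinGrowth fun x => ∑ k,
        timeOp φ (Symbol.absD * Symbol.riesz k) Set.Iio (b k).val 0 x :=
      .of_bounded (M := ∑ k, (sn (timeOp φ (Symbol.absD * Symbol.riesz k) Set.Iio
        (b k).val 0)).toReal) (Finset.measurable_fun_sum _ fun k _ => (hmb k).measurable 0)
        fun x => (Finset.abs_sum_le_sum_abs _ _).trans
          (Finset.sum_le_sum fun k _ => abs_le_of_sn ((hmb k).sn_ne_top 0) x)
    have h2 : (GradSp.w hW A₁ A₂ A₃ y).val 0 = fun x =>
        (∑ k, timeOp φ (Symbol.absD * Symbol.riesz k) Set.Iio (b k).val 0 x) -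
          timeOp φ Symbol.absD Set.Iio q.val 0 x := funext fun x => GradSp.w_apply hW A₁ A₂ A₃ y 0 x
    rw [h2, sn_congr (cv_sub hl (hmq.growth 0))]
    refine (sn_sub_le _ _).trans (add_le_add_left ?_ _)
    rw [sn_congr (cv_sum (fun k _ => (hmb k).growth 0) _)]
    exact sn_sum_le _ _
  have h2 : ∀ j, pwr r j * sn (cv (sig φ 1 j) ((GradSp.w hW A₁ A₂ A₃ y).val 0)) ≤
      ∑ k, pwr r j * sn (cv (sig φ 1 j)
        (timeOp φ (Symbol.absD * Symbol.riesz k) Set.Iio (b k).val 0)) +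
        pwr r j * sn (cv (sig φ 1 j) (timeOp φ Symbol.absD Set.Iio q.val 0)) := fun j =>
    (mul_le_mul_right (h1 j) _).trans (le_of_eq (by rw [mul_add, Finset.mul_sum]))
  have h3 : ∑' j, pwr r j * sn (cv (sig φ 1 j) ((GradSp.w hW A₁ A₂ A₃ y).val 0)) ≤
      ∑ k, C' k * ∑' j, pwr (1 + r) j * blockInt φ j (b k).val +
        C * ∑' j, pwr (1 + r) j * blockInt φ j q.val := by
    refine (ENNReal.tsum_le_tsum h2).trans ?_
    rw [ENNReal.tsum_add, Summable.tsum_finsetSum fun _ _ => ENNReal.summable]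
    exact add_le_add (Finset.sum_le_sum fun k _ => h' k _ _ hW _ (b k).mem _ measurableSet_mem_Iio 0)
      (h _ _ hW _ q.mem _ measurableSet_mem_Iio 0)
  refine (mul_le_mul_right h3 _).trans ?_
  rw [mul_add, Finset.mul_sum, add_mul, Finset.sum_mul]
  refine add_le_add (Finset.sum_le_sum fun k _ => ?_) ?_
  · rw [mul_left_comm]
    exact mul_le_mul_right ((tsum_pwr_blockInt_le r δ (b k)).trans
      (ENNReal.ofReal_le_ofReal (hb k))) _
  · rw [mul_left_comm]
    exact mul_le_mul_right ((tsum_pwr_blockInt_le r δ q).trans (ENNReal.ofReal_le_ofReal hq)) _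

end DirichletNeumann

end

/-! ### Solution, balance of the weight, and the operator `G`. -/

noncomputable section
namespace DirichletNeumann
variable {d : ℕ} {φ : LittlewoodPaley d}

/-! ### The solution and its bounds -/

variable (φ) in
-- The coefficients are linear in size in the norm of |D|η and the solution in that of |D|f, so the
-- sources `b` and `qa` at the solution are bounded by the product of the two norms.
theorem exists_solution {K : ℝ≥0∞} (hK : K ≠ ⊤) : ∃ c : ℝ, 0 < c ∧ ∃ N : ℝ, 0 < N ∧
    ∀ (W : ℤ → ℝ≥0∞) (hW : IsWeight K W) (u u' : E d → ℝ), LinGrowth u → LinGrowth u' →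
      gradSum φ W u ≤ ENNReal.ofReal c → gradSum φ W u' ≠ ⊤ →
      ∃ (A Y y : GradSp φ W) (A₃ : Sp φ W), IsHeat u A ∧ IsCoeff A A₃ ∧ IsHeat u' Y ∧
        y = Y + GradSp.gradDuhamel hW (GradSp.src hW A.1 A.2 A₃ y) ∧
        (∀ y, ‖GradSp.gradDuhamel hW (GradSp.src hW A.1 A.2 A₃ y)‖ ≤ 1 / 2 * ‖y‖) ∧
        (∀ k, ‖GradSp.b hW A.1 A.2 k y‖ ≤
          N * ((gradSum φ W u).toReal * (gradSum φ W u').toReal)) ∧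
        ‖GradSp.qa hW A.1 A₃ y‖ ≤ N * ((gradSum φ W u).toReal * (gradSum φ W u').toReal) := by
  obtain ⟨M₁, hM₁, h₁⟩ := GradSp.exists_norm_le φ hK
  obtain ⟨M₂, hM₂, h₂⟩ := exists_isHeat φ hK
  obtain ⟨c, hc, -, M₃, hM₃, h₃⟩ := exists_isCoeff φ hK
  have hM₃0 : 0 < M₃ := by linarith
  -- The first bound makes the norm of A at most the threshold for the quotient; the second makes
  -- the linear map a contraction of factor 1/2.
  refine ⟨min (c / M₂) (1 / (2 * (M₁ * (M₃ * M₂)))), by positivity,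
    M₁ * (M₃ * M₂) * (2 * M₂), by positivity, fun W hW u u' hu hu' hs hs' => ?_⟩
  have hsT : gradSum φ W u ≠ ⊤ := ne_top_of_le_ne_top ENNReal.ofReal_ne_top hs
  set a := (gradSum φ W u).toReal with ha
  set b := (gradSum φ W u').toReal with hb
  have ha0 : 0 ≤ a := ENNReal.toReal_nonneg
  have hac := ENNReal.toReal_le_of_le_ofReal (by positivity) hs
  have ha1 : M₂ * a ≤ c := by
    have := hac.trans (min_le_left _ _)
    rwa [le_div_iff₀' hM₂] at this
  have ha2 : M₁ * (M₃ * (M₂ * a)) ≤ 1 / 2 := by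
    have := hac.trans (min_le_right _ _)
    rw [le_div_iff₀' (by positivity)] at this
    linarith
  obtain ⟨A, hA, hAn⟩ := h₂ W hW u hu hsT
  obtain ⟨Y, hY, hYn⟩ := h₂ W hW u' hu' hs'
  obtain ⟨A₃, hA₃, hA₃n⟩ := h₃ W hW A (hAn.trans ha1)
  have hα : ‖A‖ ≤ M₃ * (M₂ * a) := hAn.trans (le_mul_of_one_le_left (by positivity) hM₃)
  obtain ⟨hq, hb', hg⟩ := h₁ W hW A.1 A.2 A₃ (M₃ * (M₂ * a)) (by positivity)
    (fun k => (GradSp.norm_fst_apply_le A k).trans hα) ((norm_snd_le A).trans hα)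
    (hA₃n.trans (by gcongr))
  have hsmall : ∀ y, ‖GradSp.gradDuhamel hW (GradSp.src hW A.1 A.2 A₃ y)‖ ≤ 1 / 2 * ‖y‖ :=
    fun y => (hg y).trans (by gcongr)
  obtain ⟨y, hy, hyn⟩ := exists_eq_add_of_norm_le
    (GradSp.gradDuhamel hW ∘ₗ GradSp.src hW A.1 A.2 A₃) hsmall Y
  have hfin : M₁ * (M₃ * (M₂ * a)) * ‖y‖ ≤ M₁ * (M₃ * M₂) * (2 * M₂) * (a * b) := by
    calc _ ≤ M₁ * (M₃ * (M₂ * a)) * (2 * (M₂ * b)) := by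
          gcongr
          linarith
      _ = _ := by ring
  exact ⟨A, Y, y, A₃, hA, hA₃, hY, hy, hsmall, fun k => (hb' k y).trans hfin, (hq y).trans hfin⟩

theorem IsGradient.congr_add_const {W : ℤ → ℝ≥0∞} {v v' : E d → ℝ → ℝ} {y : GradSp φ W} {k : ℝ}
    (hy : IsGradient v' y) (h : ∀ x z, z < 0 → v x z = v' x z + k) : IsGradient v y := by
  refine ⟨fun x z hz i => ?_, hy.snd.imp fun x z hz h1 => ?_⟩
  · rw [← hy.fst x z hz, gradX, funext fun x => h x z hz]
    simp only [gradX, gradient, fderiv_add_const]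
  · rw [← h1, dz_congr (v := fun x t => v' x t + k) hz fun t ht => h x t ht]
    simp only [dz, deriv_add_const]

theorem besovNorm_absD_ne_top {u : 𝓢'(E d, ℂ)} (hu : IsRealValued u) (h : besovNorm φ 1 1 u < ⊤)
    {s : ℝ} (hs : besovNorm φ 1 (1 + s) u < ⊤) : besovNorm φ Symbol.absD s u ≠ ⊤ := by
  obtain ⟨C, hC, hle⟩ := exists_sn_sig_le φ (Symbol.IsHom.absD (d := d)) .absD
  have hr := (realized_realization hu h).1
  rw [besovNorm_eq hu h .one] at hs
  rw [besovNorm_eq hu h .absD]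
  refine ne_top_of_le_ne_top (ENNReal.mul_ne_top (ENNReal.ofReal_ne_top (r := C)) hs.ne) ?_
  rw [← ENNReal.tsum_mul_left]
  refine ENNReal.tsum_le_tsum fun j => (mul_le_mul_right (hle j _ hr.growth) _).trans (le_of_eq ?_)
  rw [pwr_one_add, mul_one, ENNReal.ofReal_mul hC.le, pw]
  ring

theorem absDf_eq {u : 𝓢'(E d, ℂ)} (hu : IsRealValued u) (h : besovNorm φ 1 1 u < ⊤) (x : E d) :
    absDf φ u x = mult φ Symbol.absD (realization φ u) x := by
  rw [absDf, mult_eq φ .absD]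
  exact tsum_congr fun j => by rw [block_eq_cv_realization hu h .absD, Complex.ofReal_re]

/-- The choice of the weight that balances the two terms of a product estimate. -/
theorem exists_balance {a₀ a b₀ b : ℝ≥0∞} {c : ℝ} (hc : 0 < c) (ha : a ≠ ⊤)
    (ha0 : a = 0 → a₀ = 0) (h : a₀ ≤ ENNReal.ofReal (c / 2)) :
    ∃ δ : ℝ≥0∞, δ ≠ 0 ∧ δ ≠ ⊤ ∧ a₀ + δ * a ≤ ENNReal.ofReal c ∧
      (a₀ + δ * a) * (b₀ + δ * b) ≤ δ * (2 * (a * b₀) + ENNReal.ofReal c * b) := by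
  -- If a vanishes, so does a₀, the left side is zero, and any positive finite δ works.
  by_cases h0 : a = 0
  · refine ⟨1, one_ne_zero, ENNReal.one_ne_top, ?_, ?_⟩ <;> simp [h0, ha0 h0]
  have hc2 : ENNReal.ofReal c = 2 * ENNReal.ofReal (c / 2) := by
    rw [← ENNReal.ofReal_ofNat, ← ENNReal.ofReal_mul zero_le_two]
    congr 1
    ring
  have hc0 : ENNReal.ofReal (c / 2) ≠ 0 := (ENNReal.ofReal_pos.2 (by positivity)).ne'
  have h1 : ENNReal.ofReal (c / 2) / a * a = ENNReal.ofReal (c / 2) := ENNReal.div_mul_cancel h0 ha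
  -- With δa = c/2 the first factor is at most c = 2δa. Written as 2δa against b₀ and as c against
  -- δb, it leaves a common factor δ.
  refine ⟨ENNReal.ofReal (c / 2) / a, ?_, ?_, ?_, ?_⟩
  · exact (ENNReal.div_pos hc0 ha).ne'
  · exact (ENNReal.div_lt_top ENNReal.ofReal_ne_top h0).ne
  · rw [h1, hc2, two_mul]
    gcongr
  · rw [h1]
    calc (a₀ + ENNReal.ofReal (c / 2)) * (b₀ + ENNReal.ofReal (c / 2) / a * b)
        ≤ (2 * ENNReal.ofReal (c / 2)) * (b₀ + ENNReal.ofReal (c / 2) / a * b) := by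
          rw [two_mul]
          gcongr
      _ = 2 * (ENNReal.ofReal (c / 2) / a * a) * b₀ +
          ENNReal.ofReal (c / 2) / a * (2 * ENNReal.ofReal (c / 2) * b) := by
          rw [h1]
          ring
      _ = _ := by
          rw [hc2]
          ring

/-- The definition of `G` selects an unspecified fixed point. By uniqueness it differs from v by a
constant, so it has the same gradient, and `w` depends on the gradient alone. -/
theorem G_eq {η f : 𝓢'(E d, ℂ)} {K : ℝ≥0∞} {W : ℤ → ℝ≥0∞} (hW : IsWeight K W)
    {A y : GradSp φ W} {A₃ : Sp φ W} (hη : Realized φ (realization φ η))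
    (hA : IsHeat (realization φ η) A) (hA₃ : IsCoeff A A₃) (hf : IsRealValued f)
    (hf1 : besovNorm φ 1 1 f < ⊤) {v : E d → ℝ → ℝ} (hv : IsFixedPoint φ η f v)
    (hy : IsGradient v y) (huniq : ∀ v', IsFixedPoint φ η f v' →
      ∃ k : ℝ, ∀ x z, z < 0 → v' x z = v x z + k) (x : E d) :
    G φ η f x = mult φ Symbol.absD (realization φ f) x +
      (GradSp.w hW A.1 A.2 A₃ y).val 0 x := by
  have hex : ∃ v, IsFixedPoint φ η f v := ⟨v, hv⟩
  obtain ⟨k, hk⟩ := huniq _ hex.choose_spec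
  rw [G, dif_pos hex, absDf_eq hf hf1,
    (hy.congr_add_const hk).w_eq hη hA hA₃ hW le_rfl]

end DirichletNeumann

end

/-! ### Assembly of existence, uniqueness and the estimate. -/

noncomputable section
namespace DirichletNeumann
variable {d : ℕ} {φ : LittlewoodPaley d}

theorem besovNorm_G_le {r : ℝ} {u : E d → ℝ} (hu : Realized φ u) {g : E d → ℝ} (hg : LinGrowth g)
    {F : E d → ℝ} (hF : ∀ x, F x = mult φ Symbol.absD u x + g x) :
    besovNorm φ 1 r (pair F) ≤ ∑' j, pwr r j * sn (cv (sig φ Symbol.absD j) u) +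
      ∑' j, pwr r j * sn (cv (sig φ 1 j) g) := by
  rw [besovNorm_pair .one, ← ENNReal.tsum_add]
  refine ENNReal.tsum_le_tsum fun j => ?_
  rw [← mul_add]
  refine mul_le_mul_right ?_ _
  have h1 : ∀ x, cv (sig φ 1 j) F x = cv (sig φ Symbol.absD j) u x + cv (sig φ 1 j) g x := by
    intro x
    rw [funext hF, cv_add (linGrowth_mult .absD hu.growth.1 (hu.tsum_sn_ne_top .absD .absD)) hg,
      hu.cv_mult .absD .absD .one, Symbol.one_mul']
  rw [sn_congr h1]
  exact sn_add_le _ _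

theorem continuous_mult_absD {u : E d → ℝ} (hu : Realized φ u) :
    Continuous (mult φ Symbol.absD u) ∧ ∃ M, ∀ x, |mult φ Symbol.absD u x| ≤ M := by
  have hs := hu.tsum_sn_ne_top (Symbol.IsHom.absD (d := d)) .absD
  rw [funext (mult_eq φ .absD u)]
  refine ⟨continuous_tsum_of_sn (fun j => ?_) hs, _, abs_le_of_sn (ne_top_of_le_ne_top hs
    (sn_tsum_le _))⟩
  rw [funext (cv_sig_eq_sum φ .absD j hu.growth)]
  exact continuous_finsetSum _ fun i _ =>
    continuous_cv _ (measurable_cv _ hu.growth.1) (abs_le_of_sn (hu.ne_top j))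

/-- Existence and uniqueness are settled with the weight 2^j. For each δ the solution in the smaller
weighted space is again a fixed point in 𝒱_*, so uniqueness lets it compute the same `G`; the
constants c and N serve every δ. -/
theorem exists_isFixedPoint_and_G_eq (φ : LittlewoodPaley d) {r : ℝ} (hr : 0 ≤ r) :
    ∃ c : ℝ, 0 < c ∧ ∃ N : ℝ, 0 < N ∧ ∀ η f : 𝓢'(E d, ℂ), IsRealValued η → IsRealValued f →
      besovNorm φ 1 1 η < ⊤ → besovNorm φ 1 1 f < ⊤ →
      gradSum φ pw (realization φ η) ≤ ENNReal.ofReal c →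
      (∃ v, IsFixedPoint φ η f v) ∧
      (∀ v₁ v₂, IsFixedPoint φ η f v₁ → IsFixedPoint φ η f v₂ →
        ∃ k : ℝ, ∀ x z, z < 0 → v₁ x z = v₂ x z + k) ∧
      ∀ δ, gradSum φ (weight r δ) (realization φ η) ≤ ENNReal.ofReal c →
        gradSum φ (weight r δ) (realization φ f) ≠ ⊤ →
        ∃ (A y : GradSp φ (weight r δ)) (A₃ : Sp φ (weight r δ)),
          (∀ k, ‖GradSp.b (isWeight_weight hr δ) A.1 A.2 k y‖ ≤
            N * ((gradSum φ (weight r δ) (realization φ η)).toReal *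
              (gradSum φ (weight r δ) (realization φ f)).toReal)) ∧
          ‖GradSp.qa (isWeight_weight hr δ) A.1 A₃ y‖ ≤
            N * ((gradSum φ (weight r δ) (realization φ η)).toReal *
              (gradSum φ (weight r δ) (realization φ f)).toReal) ∧
          ∀ x, G φ η f x = mult φ Symbol.absD (realization φ f) x +
            (GradSp.w (isWeight_weight hr δ) A.1 A.2 A₃ y).val 0 x := by
  obtain ⟨c, hc, N, hN, h⟩ := exists_solution φ
    (ENNReal.ofReal_ne_top (r := 2 ^ (2 * (1 + r)) * 2))
  have hWp := isWeight_pw ENNReal.ofReal_ne_top (eight_le hr)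
  refine ⟨c, hc, N, hN, fun η f hη hf hη1 hf1 hsm => ?_⟩
  have hRη := (realized_realization hη hη1).1
  have hRf := (realized_realization hf hf1).1
  have hfT : gradSum φ pw (realization φ f) ≠ ⊤ := by
    rw [gradSum_pw]
    exact hRf.tsum_sn_ne_top .absD .absD
  obtain ⟨A, Y, y, A₃, hA, hA₃, hY, hy, hsmall, -, -⟩ :=
    h pw hWp _ _ hRη.growth hRf.growth hsm hfT
  have huniq : ∀ v₁ v₂, IsFixedPoint φ η f v₁ → IsFixedPoint φ η f v₂ →
      ∃ k : ℝ, ∀ x z, z < 0 → v₁ x z = v₂ x z + k := by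
    intro v₁ v₂ hv₁ hv₂
    obtain ⟨k₁, hk₁⟩ := eq_primitive_of_isFixedPoint hRη hA hA₃ hRf hY hWp hy hsmall hv₁
    obtain ⟨k₂, hk₂⟩ := eq_primitive_of_isFixedPoint hRη hA hA₃ hRf hY hWp hy hsmall hv₂
    refine ⟨k₁ - k₂, fun x z hz => ?_⟩
    rw [hk₁ x z hz, hk₂ x z hz]
    ring
  refine ⟨⟨_, (isFixedPoint_primitive hRη hA hA₃ hRf hY hWp hy).2⟩, huniq, fun δ hδ hδf => ?_⟩
  obtain ⟨A', Y', y', A₃', hA', hA₃', hY', hy', -, hb, hq⟩ :=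
    h _ (isWeight_weight hr δ) _ _ hRη.growth hRf.growth hδ hδf
  obtain ⟨hgr, hfix⟩ :=
    isFixedPoint_primitive hRη hA' hA₃' hRf hY' (isWeight_weight hr δ) hy'
  exact ⟨A', y', A₃', hb, hq, G_eq (isWeight_weight hr δ) hRη hA' hA₃' hf hf1 hfix hgr
    fun v' hv' => huniq _ _ hv' hfix⟩

end DirichletNeumann

end

theorem corollary3p4 (d : ℕ) (hd : 1 ≤ d) (φ : DirichletNeumann.LittlewoodPaley d)
    (r : ℝ) (hr : 0 ≤ r) :
    ∃ c : ℝ, 0 < c ∧ ∃ C : ℝ, 0 < C ∧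
      ∀ η f : 𝓢'(DirichletNeumann.E d, ℂ),
        DirichletNeumann.IsRealValued η → DirichletNeumann.IsRealValued f →
        DirichletNeumann.besovNorm φ 1 1 η < ⊤ →
        DirichletNeumann.besovNorm φ 1 (1 + r) η < ⊤ →
        DirichletNeumann.besovNorm φ 1 1 f < ⊤ →
        DirichletNeumann.besovNorm φ 1 (1 + r) f < ⊤ →
        DirichletNeumann.besovNorm φ DirichletNeumann.Symbol.absD 0 η < ENNReal.ofReal c →
        (∃ v, DirichletNeumann.IsFixedPoint φ η f v) ∧
        (∀ v₁ v₂, DirichletNeumann.IsFixedPoint φ η f v₁ →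
          DirichletNeumann.IsFixedPoint φ η f v₂ →
          ∃ k : ℝ, ∀ x z, z < 0 → v₁ x z = v₂ x z + k) ∧
        Continuous (DirichletNeumann.G φ η f) ∧
        (∃ M : ℝ, ∀ x, |DirichletNeumann.G φ η f x| ≤ M) ∧
        DirichletNeumann.besovNorm φ 1 r
            (DirichletNeumann.pair (DirichletNeumann.G φ η f)) ≤
          ENNReal.ofReal C *
              DirichletNeumann.besovNorm φ DirichletNeumann.Symbol.absD r f +
            ENNReal.ofReal C *
              DirichletNeumann.besovNorm φ DirichletNeumann.Symbol.absD r η *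
              DirichletNeumann.besovNorm φ DirichletNeumann.Symbol.absD 0 f := by
  obtain ⟨c, hc, N, hN, h⟩ := DirichletNeumann.exists_isFixedPoint_and_G_eq φ hr
  obtain ⟨L, hL, hw⟩ := DirichletNeumann.exists_tsum_sn_w_le φ hr
  set P : ℝ≥0∞ := L * ENNReal.ofReal N * (2 + ENNReal.ofReal c) with hP
  have hPT : P ≠ ⊤ := by finiteness
  -- Half of the smallness threshold is reserved for the term δa in the weighted norm of η.
  refine ⟨c / 2, by positivity, 1 + P.toReal, by positivity,
    fun η f hη hf hη1 hηr hf1 hfr hsm => ?_⟩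
  have hRη := (DirichletNeumann.realized_realization hη hη1).1
  have hRf := (DirichletNeumann.realized_realization hf hf1).1
  have hηT := DirichletNeumann.besovNorm_absD_ne_top hη hη1 hηr
  have hfT := DirichletNeumann.besovNorm_absD_ne_top hf hf1 hfr
  have h0 := fun {u} hu h => DirichletNeumann.besovNorm_eq (φ := φ) (u := u) hu h
    DirichletNeumann.Symbol.IsReal.absD 0
  simp only [DirichletNeumann.pwr_zero, one_mul] at h0
  rw [h0 hη hη1] at hsm
  rw [h0 hf hf1]
  rw [DirichletNeumann.besovNorm_eq hη hη1 .absD] at hηT ⊢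
  rw [DirichletNeumann.besovNorm_eq hf hf1 .absD] at hfT ⊢
  have hf0T := hRf.tsum_sn_ne_top DirichletNeumann.Symbol.IsHom.absD .absD
  set a₀ := ∑' j, DirichletNeumann.sn (DirichletNeumann.cv
    (DirichletNeumann.sig φ DirichletNeumann.Symbol.absD j) (DirichletNeumann.realization φ η))
    with ha₀
  set a := ∑' j, DirichletNeumann.pwr r j * DirichletNeumann.sn (DirichletNeumann.cv
    (DirichletNeumann.sig φ DirichletNeumann.Symbol.absD j) (DirichletNeumann.realization φ η))
    with ha
  set b₀ := ∑' j, DirichletNeumann.sn (DirichletNeumann.cv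
    (DirichletNeumann.sig φ DirichletNeumann.Symbol.absD j) (DirichletNeumann.realization φ f))
    with hb₀
  set b := ∑' j, DirichletNeumann.pwr r j * DirichletNeumann.sn (DirichletNeumann.cv
    (DirichletNeumann.sig φ DirichletNeumann.Symbol.absD j) (DirichletNeumann.realization φ f))
    with hb
  -- The weights 2^{jr} never vanish, so both norms detect the same blocks.
  have haz : a = 0 → a₀ = 0 := fun hz => ENNReal.tsum_eq_zero.2 fun j =>
    (mul_eq_zero.1 (ENNReal.tsum_eq_zero.1 hz j)).resolve_left (DirichletNeumann.pwr_ne_zero r j)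
  obtain ⟨δ, hδ0, hδT, hδ, hbal⟩ :=
    DirichletNeumann.exists_balance (b₀ := b₀) (b := b) hc hηT haz hsm.le
  have hpw : DirichletNeumann.gradSum φ DirichletNeumann.pw (DirichletNeumann.realization φ η) ≤
      ENNReal.ofReal c := by
    rw [DirichletNeumann.gradSum_pw]
    exact le_self_add.trans hδ
  have haδ : a₀ + δ * a ≠ ⊤ := ne_top_of_le_ne_top ENNReal.ofReal_ne_top hδ
  have hbδ : b₀ + δ * b ≠ ⊤ := by finiteness
  obtain ⟨hex, huniq, hG⟩ := h η f hη hf hη1 hf1 hpw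
  have hgη := DirichletNeumann.gradSum_weight (φ := φ) r δ (DirichletNeumann.realization φ η)
  have hgf := DirichletNeumann.gradSum_weight (φ := φ) r δ (DirichletNeumann.realization φ f)
  rw [← ha₀, ← ha] at hgη
  rw [← hb₀, ← hb] at hgf
  obtain ⟨A, y, A₃, hB, hQ, hGeq⟩ := hG δ (hgη.trans_le hδ) (by rwa [hgf])
  have hw' := hw δ A.1 A.2 A₃ y _ hB hQ
  set g := (DirichletNeumann.GradSp.w (DirichletNeumann.isWeight_weight hr δ) A.1 A.2 A₃ y)
    with hg
  obtain ⟨hc1, M, hM⟩ := DirichletNeumann.continuous_mult_absD hRf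
  refine ⟨hex, huniq, ?_, ⟨M + ‖g‖, fun x => ?_⟩, ?_⟩
  · rw [funext hGeq]
    exact hc1.add (g.mem.cont 0)
  · rw [hGeq]
    exact (abs_add_le _ _).trans (add_le_add (hM x) (g.abs_val_le 0 x))
  · refine (DirichletNeumann.besovNorm_G_le hRf (g.mem.growth 0) hGeq).trans ?_
    rw [← hb]
    have h1 : ∑' j, DirichletNeumann.pwr r j * DirichletNeumann.sn (DirichletNeumann.cv
        (DirichletNeumann.sig φ 1 j) (g.val 0)) ≤
        L * ENNReal.ofReal N * (2 * (a * b₀) + ENNReal.ofReal c * b) := by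
      -- The weighted bound controls δ times the Ḃʳ norm of w(·, 0); the balanced right side carries
      -- the same factor δ, which cancels.
      rw [← ENNReal.mul_le_mul_iff_right hδ0 hδT]
      refine hw'.trans ?_
      rw [hgη, hgf, ENNReal.ofReal_mul hN.le, ← ENNReal.toReal_mul,
        ENNReal.ofReal_toReal (ENNReal.mul_ne_top haδ hbδ)]
      calc L * (ENNReal.ofReal N * ((a₀ + δ * a) * (b₀ + δ * b)))
          ≤ L * (ENNReal.ofReal N * (δ * (2 * (a * b₀) + ENNReal.ofReal c * b))) := by gcongr
        _ = _ := by ring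
    have h2 : ENNReal.ofReal (1 + P.toReal) = 1 + P := by
      rw [ENNReal.ofReal_add zero_le_one ENNReal.toReal_nonneg, ENNReal.ofReal_toReal hPT,
        ENNReal.ofReal_one]
    rw [h2]
    calc _ ≤ b + L * ENNReal.ofReal N * (2 * (a * b₀) + ENNReal.ofReal c * b) := by gcongr
      _ = (1 + L * ENNReal.ofReal N * ENNReal.ofReal c) * b +
          (L * ENNReal.ofReal N * 2) * a * b₀ := by ring
      _ ≤ (1 + P) * b + (1 + P) * a * b₀ := by
          have h3 : L * ENNReal.ofReal N * ENNReal.ofReal c ≤ P := by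
            rw [hP]
            gcongr
            exact le_add_self
          have h4 : L * ENNReal.ofReal N * 2 ≤ 1 + P := by
            refine le_trans ?_ le_add_self
            rw [hP]
            gcongr
            exact le_self_add
          gcongr
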